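/- **Setting.** Let $\Omega$ be a compact $n$-dimensional smooth manifold with (possibly empty) boundary and $(\mathcal M,\mathsf g)$ a connected $(n+1)$-dimensional smooth Riemannian manifold with boundary, written $\mathcal M=\mathcal M_c\cup\Pi$ with $\mathcal M_c$ compact and $\Pi=(0,\infty)\times\Omega$ an open subset that is an end of $\mathcal M$ (the sets $[a,\infty)\times\Omega$, $a>0$, are closed in $\mathcal M$). On $\Pi$ write $\mathsf g=\mathsf g_0\,dx\otimes dx+2\mathsf g_1\otimes dx+\mathsf g_2$ (middle term symmetrized), $\mathsf g_k(x)\in C^\infty T^*\Omega^{\otimes k}$. Let $0<\alpha<\pi/4$. Assume that $x\mapsto\mathsf g_k(x)\in C^\infty T^*\Omega^{\otimes k}$ extend analytically to $\mathbb S_\alpha=\{z\ne0:|\arg z|<\alpha\}$, and that for some Riemannian metric $\mathfrak h$ on $\Omega$ one has $\mathsf g_0(z)\to1$, $\mathsf g_1(z)\to0$, $\mathsf g_2(z)\to\mathfrak h$ in $C^1$ on $\Omega$, uniformly in $z\in\mathbb S_\alpha$ as $|z|\to\infty$. Let $\mathcal O_\alpha=\{\lambda\in\mathbb C:|\lambda|<\sin\alpha\}$,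 let $\mathsf s\in C^\infty(\mathbb R)$ be real with $\mathsf s(x)=0$ for $x\le1$, $0\le\mathsf s'\le1$, and $\mathsf s'(x)=1$ for large $x$, and put $\mathsf s_r(x)=\mathsf s(x-r)$. Let $\mathsf g_\lambda$ be the complex tensor field equal to $\mathsf g$ on $\mathcal M\setminus\Pi$ and, on $\Pi$, $$\mathsf g_\lambda=(1+\lambda\mathsf s_r')^2\,\mathsf g_0(x+\lambda\mathsf s_r)\,dx\otimes dx+2(1+\lambda\mathsf s_r')\,\mathsf g_1(x+\lambda\mathsf s_r)\otimes dx+\mathsf g_2(x+\lambda\mathsf s_r).$$ Denote by $\mathsf g_\lambda[\cdot,\cdot]$ also its sesquilinear extension to complex tangent vectors. For complex covectors let ${}^\lambda\sharp\xi$ be the vector with $\xi(\bar a)=\mathsf g_\lambda[{}^\lambda\sharp\xi,a]$ for all $a$, and $\mathsf g_\lambda[\xi,\eta]=\mathsf g_\lambda[{}^\lambda\sharp\xi,{}^{\bar\lambda}\sharp\eta]$. Let $\mathrm{dvol}_\lambda$ be the analytic continuation in $\lambda\in\mathcal O_\alpha$ of the Riemannian volume of $\mathsf g_\lambda$, $\lambda$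 real. Put $(\xi,\omega)_\lambda=\int_{\mathcal M}\mathsf g_\lambda[\xi,\omega]\,\mathrm{dvol}_\lambda$ for covector fields (and $(u,v)_0=\int u\bar v\,\mathrm{dvol}_0$ for functions), let $\varrho_\lambda\,\mathrm{dvol}_\lambda=\mathrm{dvol}_0$, and for $u,v\in C_c^\infty(\mathcal M)$ (no boundary condition) $$\mathsf q_\lambda[u,v]=(du,d(\varrho_{\bar\lambda}v))_\lambda .$$ Let $L^2(\mathcal M)$ be taken with respect to $\mathrm{dvol}_0$, and let $H^1(\mathcal M)\subset L^2(\mathcal M)$ be the completion of $C_c^\infty(\mathcal M)$ in the norm $\sqrt{(du,du)_0+(u,u)_0}$. **Lemma 1.** There is $r_0>0$ such that for all $\mathsf s$ as above and all $r\ge r_0$ the tensor field $\mathsf g_\lambda$ is non-degenerate for $\lambda\in\mathcal O_\alpha$, the continuation $\mathrm{dvol}_\lambda$ exists and vanishes nowhere, $\varrho_\lambda\in C^\infty(\mathcal M)$, and the following holds. 1. $H^1(\mathcal M)$ is a dense linear subspace of $L^2(\mathcal M)$, and for every $\lambda\in\mathcal O_\alpha$ the form $\mathsf q_\lambda$ extends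 by $H^1$-continuity from $C_c^\infty(\mathcal M)$ to a sesquilinear form $\mathsf q_\lambda$ with domain $H^1(\mathcal M)$, which is closed in $L^2(\mathcal M)$. 2. For every $u\in H^1(\mathcal M)$ the function $\mathcal O_\alpha\ni\lambda\mapsto\mathsf q_\lambda[u,u]$ is analytic. 3. There are $c>0$ and $\vartheta\in[0,\pi/2)$, independent of $\lambda$, such that for all $\lambda\in\mathcal O_\alpha$ the numerical range $\{\mathsf q_\lambda[u,u]:u\in H^1(\mathcal M),\|u\|=1\}$ lies in the sector $\{\mu\in\mathbb C:|\arg(\mu+c)|\le\vartheta\}$ (with $\arg 0=0$). Thus $\lambda\mapsto\mathsf q_\lambda$ is an analytic family of closed densely defined sectorial forms in the sense of Kato. 4. For every $\lambda\in\mathcal O_\alpha$ there is a unique m-sectorial operator ${}^\lambda\Delta$ in $L^2(\mathcal M)$ with domain contained in $H^1(\mathcal M)$ and $({}^\lambda\Delta u,v)_0=\mathsf q_\lambda[u,v]$ for all $u\in\mathcal D({}^\lambda\Delta)$, $v\in H^1(\mathcal M)$; its numerical range $\{({}^\lambda\Delta u,u)_0:\|u\|=1\}$ and its spectrum lie in the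 sector of item 3. (m-sectorial: closed, densely defined, with numerical range and spectrum in some sector $\{|\arg(\mu+c')|\le\vartheta'\}$, $c'>0$, $0\le\vartheta'<\pi/2$.) The family $\lambda\mapsto{}^\lambda\Delta$ is analytic in the sense of Kato: every $\lambda_0\in\mathcal O_\alpha$ has a neighbourhood on which, for some fixed $\mu$, the bounded resolvents $({}^\lambda\Delta-\mu)^{-1}$ exist and are analytic in $\lambda$ in operator norm. -/

import Mathlib

open MeasureTheory Filter Topology Set
open scoped Manifold ContDiff ENNReal ComplexConjugate Matrix

namespace PML

noncomputable section

/-! ### Manifolds, coordinate frames, metrics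

Manifolds are modelled on `EuclideanSpace ℝ (Fin d)` by a model with corners, which covers manifolds
with smooth (possibly empty) boundary. -/

section Manifold

variable {d : ℕ} {H : Type*} [TopologicalSpace H]
  {I : ModelWithCorners ℝ (EuclideanSpace ℝ (Fin d)) H}
  {M : Type*} [TopologicalSpace M] [ChartedSpace H M]

/-- A basis of `T_p M`: the standard basis in the preferred coordinates at `p`. -/
def frame (I : ModelWithCorners ℝ (EuclideanSpace ℝ (Fin d)) H) (p : M) (i : Fin d) :
    TangentSpace I p :=
  (EuclideanSpace.single i (1 : ℝ) : EuclideanSpace ℝ (Fin d))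

/-- The coordinate vector field `∂_i` of the chart at `p₀`, at the point with coordinates `u`. -/
def coordVec (I : ModelWithCorners ℝ (EuclideanSpace ℝ (Fin d)) H) (p₀ : M)
    (u : EuclideanSpace ℝ (Fin d)) (i : Fin d) :
    TangentSpace I ((extChartAt I p₀).symm u) :=
  mfderivWithin 𝓘(ℝ, EuclideanSpace ℝ (Fin d)) I (extChartAt I p₀).symm (range I) u
    (EuclideanSpace.single i (1 : ℝ) : EuclideanSpace ℝ (Fin d))

/-- A smooth Riemannian metric. -/
abbrev Metric (I : ModelWithCorners ℝ (EuclideanSpace ℝ (Fin d)) H) (M : Type*)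
    [TopologicalSpace M] [ChartedSpace H M] [IsManifold I ∞ M] :=
  Bundle.ContMDiffRiemannianMetric I ∞ (EuclideanSpace ℝ (Fin d))
    (fun p : M => TangentSpace I p)

/-! ### Complex symmetric tensor fields on a real manifold

Complex covectors at `p` are real-linear maps `T_p M → ℂ`. Complex tangent vectors are written in
components with respect to `frame I p`. -/

/-- A complex-valued field of (bilinear) forms on the real tangent spaces. -/
abbrev FormField (I : ModelWithCorners ℝ (EuclideanSpace ℝ (Fin d)) H) (M : Type*)
    [TopologicalSpace M] [ChartedSpace H M] :=
  (p : M) → TangentSpace I p → TangentSpace I p → ℂ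

/-- The matrix of `B` at `p`. -/
def gram (B : FormField I M) (p : M) : Matrix (Fin d) (Fin d) ℂ :=
  Matrix.of fun i j => B p (frame I p i) (frame I p j)

/-- `B` extended to complex tangent vectors, linearly in the first and antilinearly in the second
argument. -/
def sesq (B : FormField I M) (p : M) (a b : Fin d → ℂ) : ℂ :=
  ∑ i, ∑ j, gram B p i j * a i * conj (b j)

/-- The complex tangent vector `♯ξ` determined by `ξ(ā) = B[♯ξ, a]` for all complex tangent
vectors `a`, see `sesq_sharp`. -/
def sharp (B : FormField I M) (p : M) (ξ : TangentSpace I p →L[ℝ] ℂ) : Fin d → ℂ :=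
  (gram B p)ᵀ⁻¹ *ᵥ fun i => ξ (frame I p i)

theorem sesq_sharp (B : FormField I M) (p : M) (hB : (gram B p).det ≠ 0)
    (ξ : TangentSpace I p →L[ℝ] ℂ) (a : Fin d → ℂ) :
    sesq B p (sharp B p ξ) a = ∑ i, ξ (frame I p i) * conj (a i) := by
  have h : (gram B p)ᵀ *ᵥ sharp B p ξ = fun i => ξ (frame I p i) := by
    unfold sharp
    rw [Matrix.mulVec_mulVec, Matrix.mul_nonsing_inv _ (by simpa using hB), Matrix.one_mulVec]
  unfold sesq
  rw [Finset.sum_comm]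
  refine Finset.sum_congr rfl fun j _ => ?_
  rw [← congrFun h j, Matrix.mulVec, dotProduct, Finset.sum_mul]
  rfl

/-- The pairing of covectors `B[♯_B ξ, ♯_{B'} η]`. -/
def coInner (B B' : FormField I M) (p : M) (ξ η : TangentSpace I p →L[ℝ] ℂ) : ℂ :=
  sesq B p (sharp B p ξ) (sharp B' p η)

/-- The differential of a complex-valued function. -/
def diff (I : ModelWithCorners ℝ (EuclideanSpace ℝ (Fin d)) H) (u : M → ℂ) (p : M) :
    TangentSpace I p →L[ℝ] ℂ :=
  mfderiv I 𝓘(ℝ, ℂ) u p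

/-! ### The Riemannian volume -/

variable [IsManifold I ∞ M]

/-- A metric as a complex-valued field. -/
def ofMetric (g : Metric I M) : FormField I M := fun p v w => ((g.inner p v w : ℝ) : ℂ)

/-- The Riemannian volume on the domain of the chart at `p₀` (and zero outside it), i.e.
`√(det g_{ij}) du` in coordinates. -/
def chartVolume [MeasurableSpace M] (g : Metric I M) (p₀ : M) : Measure M :=
  Measure.map (extChartAt I p₀).symm
    ((volume.restrict (extChartAt I p₀).target).withDensity fun u =>
      ENNReal.ofReal (Real.sqrt (Matrix.of fun i j =>
        g.inner ((extChartAt I p₀).symm u) (coordVec I p₀ u i) (coordVec I p₀ u j)).det))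

/-- The Riemannian volume measure `dvol_g`. The chart measures agree on overlaps of charts, so the
measure glued from them is the smallest measure that dominates each of them. -/
def riemannianVolume [MeasurableSpace M] (g : Metric I M) : Measure M :=
  ⨆ p₀ : M, chartVolume g p₀

/-! ### The spaces `C_c^∞(M)`, `L²(M)` and `H¹(M)` -/

/-- `u ∈ C_c^∞(M)`; no condition is imposed on the boundary of `M`. -/
def IsTest (I : ModelWithCorners ℝ (EuclideanSpace ℝ (Fin d)) H) (u : M → ℂ) : Prop :=
  ContMDiff I 𝓘(ℝ, ℂ) ∞ u ∧ HasCompactSupport u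

/-- `L²(M)`. -/
abbrev L2 [MeasurableSpace M] (g : Metric I M) : Type _ := Lp ℂ 2 (riemannianVolume g)

/-- The norm `√((du, du) + (u, u))` on `C_c^∞(M)`. -/
def h1norm [MeasurableSpace M] (g : Metric I M) (u : M → ℂ) : ℝ :=
  Real.sqrt ((∫ p, coInner (ofMetric g) (ofMetric g) p (diff I u p) (diff I u p)
      ∂riemannianVolume g).re + (∫ p, u p * conj (u p) ∂riemannianVolume g).re)

/-- `u k ∈ C_c^∞(M)` is a Cauchy sequence in the `H¹`-norm whose limit in `L²(M)` is `f`. -/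
structure H1Approx [MeasurableSpace M] (g : Metric I M) (u : ℕ → M → ℂ) (f : L2 g) : Prop where
  test : ∀ k, IsTest I (u k)
  cauchy : ∀ ε > 0, ∃ N, ∀ j ≥ N, ∀ k ≥ N, h1norm g (u j - u k) < ε
  tendsto : Tendsto (fun k => eLpNorm (fun p => u k p - f p) 2 (riemannianVolume g)) atTop (𝓝 0)

/-- `H¹(M)`, the completion of `C_c^∞(M)` in the `H¹`-norm, as a subset of `L²(M)`. -/
def H1 [MeasurableSpace M] (g : Metric I M) : Set (L2 g) := {f | ∃ u, H1Approx g u f}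

end Manifold

/-! ### Axial analytic quasicylindrical ends -/

/-- The sector `S_α`. -/
def sectorDomain (α : ℝ) : Set ℂ := {z | z ≠ 0 ∧ |z.arg| < α}

section Tensors

variable {n : ℕ} {H' : Type*} [TopologicalSpace H']
  {J : ModelWithCorners ℝ (EuclideanSpace ℝ (Fin n)) H'}
  {Ω : Type*} [TopologicalSpace Ω] [ChartedSpace H' Ω]

/-- The component of index `m` of a covariant tensor field of rank `k`, in the chart at `y₀`. -/
def component {k : ℕ} (T : (y : Ω) → (Fin k → TangentSpace J y) → ℂ) (y₀ : Ω) (m : Fin k → Fin n)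
    (u : EuclideanSpace ℝ (Fin n)) : ℂ :=
  T ((extChartAt J y₀).symm u) fun i => coordVec J y₀ u (m i)

/-- Analyticity on `S_α` of a family of smooth complex tensor fields of rank `k` on a compact `Ω`,
as a map with values in the Fréchet space `C^∞(T^*Ω^{⊗k})`: the components are smooth in `(z, y)`
jointly and holomorphic in `z`. -/
structure AnalyticFamily {k : ℕ} (α : ℝ)
    (T : ℂ → (y : Ω) → MultilinearMap ℝ (fun _ : Fin k => TangentSpace J y) ℂ) : Prop where
  holomorphic : ∀ (y : Ω) (v : Fin k → TangentSpace J y),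
    DifferentiableOn ℂ (fun z => T z y v) (sectorDomain α)
  smooth : ∀ (y₀ : Ω) (m : Fin k → Fin n),
    ContDiffOn ℝ ∞ (fun q : ℂ × EuclideanSpace ℝ (Fin n) =>
      component (fun y v => T q.1 y v) y₀ m q.2) (sectorDomain α ×ˢ (extChartAt J y₀).target)

/-- Convergence `T z → T∞` in `C^1(T^*Ω^{⊗k})`, uniform in `z ∈ S_α` as `|z| → ∞`: near every point
the components in a chart and their first derivatives converge uniformly. As `Ω` is compact, this is
convergence in the norm `max (|·| + |∇ ·|)` of any background Riemannian metric on `Ω`. -/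
def TendstoC1 {k : ℕ} (α : ℝ) (T : ℂ → (y : Ω) → (Fin k → TangentSpace J y) → ℂ)
    (Tinf : (y : Ω) → (Fin k → TangentSpace J y) → ℂ) : Prop :=
  ∀ y₀ : Ω, ∃ U ∈ 𝓝 y₀, U ⊆ (extChartAt J y₀).source ∧
    ∀ ε > 0, ∃ R : ℝ, ∀ z ∈ sectorDomain α, R ≤ ‖z‖ → ∀ y ∈ U, ∀ m : Fin k → Fin n,
      ‖component (T z) y₀ m (extChartAt J y₀ y) - component Tinf y₀ m (extChartAt J y₀ y)‖ < ε ∧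
      ‖fderivWithin ℝ (fun u => component (T z) y₀ m u - component Tinf y₀ m u)
        (extChartAt J y₀).target (extChartAt J y₀ y)‖ < ε

end Tensors

section Ends

variable {n : ℕ} {H : Type*} [TopologicalSpace H]
  {I : ModelWithCorners ℝ (EuclideanSpace ℝ (Fin (n + 1))) H}
  {M : Type*} [TopologicalSpace M] [ChartedSpace H M] [IsManifold I ∞ M]
  {H' : Type*} [TopologicalSpace H']
  {J : ModelWithCorners ℝ (EuclideanSpace ℝ (Fin n)) H'}
  {Ω : Type*} [TopologicalSpace Ω] [ChartedSpace H' Ω] [IsManifold J ∞ Ω]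

/-- An axial analytic quasicylindrical end `(0, ∞) × Ω` of `(M, g)`. -/
structure QuasicylindricalEnd (J : ModelWithCorners ℝ (EuclideanSpace ℝ (Fin n)) H') (Ω : Type*)
    [TopologicalSpace Ω] [ChartedSpace H' Ω] [IsManifold J ∞ Ω] (g : Metric I M) (α : ℝ) where
  angle_pos : 0 < α
  angle_lt : α < Real.pi / 4
  /-- The identification of an open subset of `M` with the semi-cylinder `(0, ∞) × Ω`. -/
  cyl : OpenPartialHomeomorph M (ℝ × Ω)
  target_eq : cyl.target = Ioi 0 ×ˢ univ
  smooth_cyl : ContMDiffOn I (𝓘(ℝ, ℝ).prod J) ∞ cyl cyl.source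
  smooth_symm : ContMDiffOn (𝓘(ℝ, ℝ).prod J) I ∞ cyl.symm cyl.target
  /-- Outside the semi-cylinder `M` is compact. -/
  compact_part : ∃ K : Set M, IsCompact K ∧ K ∪ cyl.source = univ
  /-- The semi-cylinder leaves `M` at infinity. -/
  closed_end : IsClosed (cyl.symm '' (Ici 1 ×ˢ univ))
  /-- The coefficients `g₀, g₁, g₂`, extended to `S_α`. -/
  g0 : ℂ → (y : Ω) → MultilinearMap ℝ (fun _ : Fin 0 => TangentSpace J y) ℂ
  g1 : ℂ → (y : Ω) → MultilinearMap ℝ (fun _ : Fin 1 => TangentSpace J y) ℂ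
  g2 : ℂ → (y : Ω) → MultilinearMap ℝ (fun _ : Fin 2 => TangentSpace J y) ℂ
  /-- `g = g₀ dx ⊗ dx + 2 g₁ ⊗ dx + g₂` (the middle term being symmetrized) for real `x > 0`. -/
  metric_eq : ∀ x : ℝ, 0 < x → ∀ (y : Ω) (a b : ℝ) (v w : TangentSpace J y),
    ((g.inner (cyl.symm (x, y))
        (mfderiv (𝓘(ℝ, ℝ).prod J) I cyl.symm (x, y) ((a, v) : ℝ × EuclideanSpace ℝ (Fin n)))
        (mfderiv (𝓘(ℝ, ℝ).prod J) I cyl.symm (x, y) ((b, w) : ℝ × EuclideanSpace ℝ (Fin n))) : ℝ) : ℂ)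
      = g0 x y ![] * a * b + (g1 x y ![v] * b + g1 x y ![w] * a) + g2 x y ![v, w]
  analytic0 : AnalyticFamily α g0
  analytic1 : AnalyticFamily α g1
  analytic2 : AnalyticFamily α g2
  /-- The limit metric on `Ω`. -/
  limitMetric : Metric J Ω
  tendsto0 : TendstoC1 (J := J) α (fun z y v => g0 z y v) (fun _ _ => 1)
  tendsto1 : TendstoC1 (J := J) α (fun z y v => g1 z y v) (fun _ _ => 0)
  tendsto2 : TendstoC1 (J := J) α (fun z y v => g2 z y v)
    (fun y v => ((limitMetric.inner y (v 0) (v 1) : ℝ) : ℂ))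

/-- The conditions on the scaling function `s`. -/
structure IsScaling (s : ℝ → ℝ) : Prop where
  smooth : ContDiff ℝ ∞ s
  eq_zero : ∀ x ≤ 1, s x = 0
  deriv_nonneg : ∀ x, 0 ≤ deriv s x
  deriv_le_one : ∀ x, deriv s x ≤ 1
  deriv_eventually : ∀ᶠ x in atTop, deriv s x = 1

/-- The disk `O_α`. -/
def disk (α : ℝ) : Set ℂ := Metric.ball 0 (Real.sin α)

/-! ### The complex tensor field `g_lam`, its volume form, and the form `q_lam` -/

variable {g : Metric I M} {α : ℝ}

open Classical in
/-- The tensor field `g_lam`: on the semi-cylinder it is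
`(1 + lam s_r')² g₀ dx ⊗ dx + 2 (1 + lam s_r') g₁ ⊗ dx + g₂`, the coefficients being taken at
`x + lam s_r(x)`, where `s_r(x) = s(x - r)`; elsewhere it is `g`. -/
def pmlField (e : QuasicylindricalEnd J Ω g α) (s : ℝ → ℝ) (r : ℝ) (lam : ℂ) : FormField I M :=
  fun p v w =>
    if p ∈ e.cyl.source then
      let x : ℝ := (e.cyl p).1
      let y : Ω := (e.cyl p).2
      let v' : ℝ × EuclideanSpace ℝ (Fin n) := mfderiv I (𝓘(ℝ, ℝ).prod J) e.cyl p v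
      let w' : ℝ × EuclideanSpace ℝ (Fin n) := mfderiv I (𝓘(ℝ, ℝ).prod J) e.cyl p w
      let z : ℂ := x + lam * s (x - r)
      let c : ℂ := 1 + lam * deriv s (x - r)
      let v2 : TangentSpace J y := v'.2
      let w2 : TangentSpace J y := w'.2
      c ^ 2 * e.g0 z y ![] * v'.1 * w'.1 + c * (e.g1 z y ![v2] * w'.1 + e.g1 z y ![w2] * v'.1)
        + e.g2 z y ![v2, w2]
    else ofMetric g p v w

/-- `det g_lam / det g`. -/
def detRatio (e : QuasicylindricalEnd J Ω g α) (s : ℝ → ℝ) (r : ℝ) (p : M) (lam : ℂ) : ℂ :=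
  (gram (pmlField e s r lam) p).det / (gram (ofMetric g) p).det

/-- `f` is analytic on `O_α`, and for real `lam` it is the density `√(det g_lam / det g)` at `p` of
the Riemannian volume of `g_lam` with respect to that of `g`. -/
def IsDensityExtension (e : QuasicylindricalEnd J Ω g α) (s : ℝ → ℝ) (r : ℝ) (p : M)
    (f : ℂ → ℂ) : Prop :=
  DifferentiableOn ℂ f (disk α) ∧
    ∀ t : ℝ, (t : ℂ) ∈ disk α → f t = ((Real.sqrt (detRatio e s r p t).re : ℝ) : ℂ)

open Classical in
/-- `dvol_lam / dvol_0`, by analytic continuation from real `lam`. -/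
def volDensity (e : QuasicylindricalEnd J Ω g α) (s : ℝ → ℝ) (r : ℝ) (lam : ℂ) (p : M) : ℂ :=
  if h : ∃ f, IsDensityExtension e s r p f then h.choose lam else 1

/-- The function `ϱ_lam` with `ϱ_lam dvol_lam = dvol_0`. -/
def rho (e : QuasicylindricalEnd J Ω g α) (s : ℝ → ℝ) (r : ℝ) (lam : ℂ) (p : M) : ℂ :=
  (volDensity e s r lam p)⁻¹

/-- The deformed global inner product `(ξ, η)_lam` of complex covector fields. -/
def innerLam [MeasurableSpace M] (e : QuasicylindricalEnd J Ω g α) (s : ℝ → ℝ) (r : ℝ) (lam : ℂ)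
    (ξ η : (p : M) → TangentSpace I p →L[ℝ] ℂ) : ℂ :=
  ∫ p, coInner (pmlField e s r lam) (pmlField e s r (conj lam)) p (ξ p) (η p)
    * volDensity e s r lam p ∂riemannianVolume g

/-- `q_lam[u, v] = (du, d(ϱ_{conj lam} v))_lam`. -/
def pmlForm [MeasurableSpace M] (e : QuasicylindricalEnd J Ω g α) (s : ℝ → ℝ) (r : ℝ) (lam : ℂ)
    (u v : M → ℂ) : ℂ :=
  innerLam e s r lam (diff I u) (diff I fun p => rho e s r (conj lam) p * v p)

end Ends

/-! ### Sectorial forms and m-sectorial operators in a Hilbert space -/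

section Forms

variable {X : Type*} [NormedAddCommGroup X] [InnerProductSpace ℂ X]

/-- The sector with vertex `-c` and half-angle `ϑ`. -/
def sector (c ϑ : ℝ) : Set ℂ := {z | |(z + c).arg| ≤ ϑ}

/-- The numerical range of a sesquilinear form with domain `D` lies in the given sector. -/
def FormSectorial {D : Submodule ℂ X} (q : D →ₗ[ℂ] D →ₗ⋆[ℂ] ℂ) (c ϑ : ℝ) : Prop :=
  ∀ u : D, ‖(u : X)‖ = 1 → q u u ∈ sector c ϑ

/-- A (sectorial) form is closed if `u k ∈ D`, `u k → f` and `q[u j - u k] → 0` imply `f ∈ D` and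
`q[u k - f] → 0`. -/
def FormClosed {D : Submodule ℂ X} (q : D →ₗ[ℂ] D →ₗ⋆[ℂ] ℂ) : Prop :=
  ∀ (u : ℕ → D) (f : X), Tendsto (fun k => (u k : X)) atTop (𝓝 f) →
    Tendsto (fun jk : ℕ × ℕ => q (u jk.1 - u jk.2) (u jk.1 - u jk.2)) atTop (𝓝 0) →
    ∃ hf : f ∈ D, Tendsto (fun k => q (u k - ⟨f, hf⟩) (u k - ⟨f, hf⟩)) atTop (𝓝 0)

/-- `R` is the bounded operator `(A - μ)⁻¹`. -/
def IsResolvent (A : X →ₗ.[ℂ] X) (μ : ℂ) (R : X →L[ℂ] X) : Prop :=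
  (∀ f : X, ∃ h : R f ∈ A.domain, A ⟨R f, h⟩ - μ • R f = f) ∧
    ∀ u : A.domain, R (A u - μ • (u : X)) = u

/-- The spectrum of an unbounded operator. -/
def opSpectrum (A : X →ₗ.[ℂ] X) : Set ℂ := {μ | ¬ ∃ R, IsResolvent A μ R}

/-- A closed densely defined operator whose numerical range and spectrum lie in the given sector. -/
structure MSectorial (A : X →ₗ.[ℂ] X) (c ϑ : ℝ) : Prop where
  closed : A.IsClosed
  dense : Dense (A.domain : Set X)
  numericalRange : ∀ u : A.domain, ‖(u : X)‖ = 1 → inner ℂ (u : X) (A u) ∈ sector c ϑ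
  spectrum : opSpectrum A ⊆ sector c ϑ

/-- A closed densely defined operator that is m-sectorial for some sector of half-angle less than
`π / 2`. -/
def IsMSectorial (A : X →ₗ.[ℂ] X) : Prop :=
  ∃ c ϑ : ℝ, 0 < c ∧ 0 ≤ ϑ ∧ ϑ < Real.pi / 2 ∧ MSectorial A c ϑ

/-- The domain of `A` is contained in that of `q`, and `(A u, v) = q[u, v]` for `u` in the domain of
`A` and `v` in that of `q`. -/
def Represents {D : Submodule ℂ X} (A : X →ₗ.[ℂ] X) (q : D →ₗ[ℂ] D →ₗ⋆[ℂ] ℂ) : Prop :=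
  ∀ u : A.domain, ∃ hu : (u : X) ∈ D, ∀ v : D, inner ℂ (v : X) (A u) = q ⟨u, hu⟩ v

/-- An analytic family of operators in the sense of Kato on the open set `O`: near every point of
`O` some fixed `μ` is in the resolvent sets and the resolvent at `μ` is analytic in the parameter. -/
def AnalyticOperatorFamily (O : Set ℂ) (A : ℂ → (X →ₗ.[ℂ] X)) : Prop :=
  (∀ lam ∈ O, (A lam).IsClosed) ∧
  ∀ lam₀ ∈ O, ∃ (μ : ℂ) (R : ℂ → (X →L[ℂ] X)), AnalyticAt ℂ R lam₀ ∧
    ∀ᶠ lam in 𝓝 lam₀, IsResolvent (A lam) μ (R lam)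

end Forms

end

end PML

open PML

namespace PML

noncomputable section

/-! ### Sectors -/

/-! The proof combines an abstract theorem on families of forms with estimates on the deformed
coefficients that are uniform in `lam`.

Abstract side (`exists_analytic_family_of_forms`). Let E be the test functions with the H¹ norm, V
the completion of E, and ι : V → L² the extension of the embedding of E. Suppose that forms on E are
bounded in the H¹ norm, depend holomorphically on `lam`, and satisfy a Gårding inequality δ‖u‖² ≤ Re
Q[u,u] + K|u|², with |u| the L² norm, all with constants independent of `lam`. By Riesz they are
given by bounded operators T on V, and weak holomorphy with a uniform bound makes T analytic in
operator norm. If E → L² is closable, ι is injective and V becomes a subspace of L². Coercivity then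
yields closedness and a common sector. Off this sector T − μι*ι is invertible by Lax–Milgram, and
ι(T − μι*ι)⁻¹ι* is the resolvent of the operator associated with the form. This gives
m-sectoriality, uniqueness and analyticity of the resolvents.

Closability (`toL2_closable`). In charts it is the closability of partial derivatives in L², tested
against functions supported away from the boundary, which is a null set. A sequence whose gradients
are Cauchy has uniformly small gradients outside the support of one of its members, and that support
is compact, so finitely many charts suffice.

Coefficients (`exists_uniform_coefBounds`). For x ≥ r the point z = x + λs_r stays in the sector and
|z| ≥ r, while c = 1 + λs_r' satisfies |c − 1| ≤ sin α < 1/√2, whence Re c² > 0. This is where α <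
π/4 enters: the limit matrix diag(c², h) is accretive. The limit coefficients, over all admissible c
and all points of a compact set in Ω, form a compact set inside the open set `goodCoefs`; for large
r the true coefficients stay in a compact thickening of it. Hence r₀ depends neither on s nor on
`lam`. In the same region det g₂-type ratios stay off the negative axis, so c·√(det A/det B) has a
holomorphic, nonvanishing branch; by the identity theorem it is the continued volume density.

Form estimates. Since conj ϱ at the conjugate parameter is inverse to the density, the integrand is
g_λ[du,dv] plus a first-order term containing dϱ (`Admissible.formIntegrand_eq`). The principal part
is coercive. The gradient of ϱ is bounded uniformly in `lam`, by the chain rule, Cauchy estimates in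
z, C¹ convergence in y and the boundedness of s'', so Young's inequality absorbs the other term. The
integrand is holomorphic in `lam` at each point and dominated by an integrable function, so the form
on test functions is holomorphic. -/

theorem mem_sector_of_im_le {c t : ℝ} {z : ℂ} (h : |z.im| ≤ t * (z.re + c)) (ht : 0 ≤ t)
    (hre : 0 ≤ z.re + c) : z ∈ sector c (Real.arctan t) := by
  have him : (z + c).im = z.im := by simp
  have hre' : (z + c).re = z.re + c := by simp
  have h0 : 0 ≤ (z + (c : ℂ)).re := by rw [hre']; exact hre
  rcases eq_or_lt_of_le h0 with h1 | h1
  -- On the line through the vertex only the vertex itself remains, and its argument is 0 by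
  -- convention.
  · have h2 : (z + (c : ℂ)).im = 0 := by
      rw [him, ← abs_eq_zero]
      rw [← hre', ← h1, mul_zero] at h
      exact le_antisymm h (abs_nonneg _)
    have h3 : z + (c : ℂ) = 0 := Complex.ext h1.symm h2
    simp only [sector, mem_ofPred_eq, h3, Complex.arg_zero, abs_zero]
    exact Real.arctan_nonneg.2 ht
  · simp only [sector, mem_ofPred_eq]
    rw [← hre', ← him] at h
    have h4 : |(z + (c : ℂ)).im / (z + (c : ℂ)).re| ≤ t := by
      rw [abs_div, abs_of_pos h1]
      exact (div_le_iff₀ h1).2 h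
    have harg : (z + (c : ℂ)).arg = Real.arctan ((z + (c : ℂ)).im / (z + (c : ℂ)).re) := by
      have := Complex.tan_arg (z + (c : ℂ))
      rw [← this, Real.arctan_tan]
      · exact (abs_lt.1 (Complex.abs_arg_lt_pi_div_two_iff.2 (Or.inl h1))).1
      · exact (abs_lt.1 (Complex.abs_arg_lt_pi_div_two_iff.2 (Or.inl h1))).2
    rw [harg, abs_le, ← Real.arctan_neg]
    exact ⟨Real.arctan_mono (abs_le.1 h4).1, Real.arctan_mono (abs_le.1 h4).2⟩

/-- Separation of a point from a convex cone: multiplication by `m` puts μ + c in the closed left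
half-plane and the cone in the right one, with margin `κ`. This rotation prepares Lax–Milgram at
points outside the sector. -/
theorem exists_multiplier_of_notMem_sector {c t : ℝ} (ht : 0 ≤ t) {μ : ℂ}
    (h : μ ∉ sector c (Real.arctan t)) :
    ∃ (m : ℂ) (κ : ℝ), 0 < κ ∧ (m * (μ + c)).re ≤ 0 ∧
      ∀ z : ℂ, |z.im| ≤ t * (z.re + c) → 0 ≤ z.re + c → κ * (z.re + c) ≤ (m * (z + c)).re := by
  by_cases h1 : μ.re + c ≤ 0
  · exact ⟨1, 1, one_pos, by simpa using h1, fun z _ _ => by simp⟩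
  push Not at h1
  have h2 : t * (μ.re + c) < |μ.im| := by
    by_contra h3
    push Not at h3
    exact h (mem_sector_of_im_le h3 ht h1.le)
  -- The slope of μ + c. With m = a ± i the real part of m(μ + c) vanishes, and the excess a − t of
  -- the slope over that of the cone is the margin.
  set a := |μ.im| / (μ.re + c) with ha
  have hat : t < a := (lt_div_iff₀ h1).2 h2
  have ha' : a * (μ.re + c) = |μ.im| := by rw [ha]; field_simp
  rcases le_total 0 μ.im with h3 | h3
  · refine ⟨⟨a, 1⟩, a - t, by linarith, ?_, fun z hz hz' => ?_⟩
    · rw [abs_of_nonneg h3] at ha'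
      simp [Complex.mul_re]; linarith
    · have := (abs_le.1 hz).2
      simp [Complex.mul_re]; nlinarith
  · refine ⟨⟨a, -1⟩, a - t, by linarith, ?_, fun z hz hz' => ?_⟩
    · rw [abs_of_nonpos h3] at ha'
      simp [Complex.mul_re]; linarith
    · have := (abs_le.1 hz).1
      simp [Complex.mul_re]; nlinarith

theorem notMem_sector_of_re_lt {c ϑ : ℝ} (hϑ : ϑ < Real.pi / 2) {x : ℝ} (hx : x < -c) :
    (x : ℂ) ∉ sector c ϑ := by
  have : ((x : ℂ) + c).arg = Real.pi := by
    rw [← Complex.ofReal_add]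
    exact Complex.arg_ofReal_of_neg (by linarith)
  simp only [sector, mem_ofPred_eq, this, abs_of_pos Real.pi_pos]
  linarith [Real.pi_pos]

/-! ### Holomorphic families of bounded operators -/

section Holomorphic

variable {V : Type*} [NormedAddCommGroup V] [InnerProductSpace ℂ V]

theorem norm_inner_clm_le {T : V →L[ℂ] V} {C : ℝ} (hT : ‖T‖ ≤ C) (u v : V) :
    ‖inner ℂ v (T u)‖ ≤ C * ‖u‖ * ‖v‖ := by
  calc ‖inner ℂ v (T u)‖ ≤ ‖v‖ * ‖T u‖ := norm_inner_le_norm _ _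
    _ ≤ ‖v‖ * (C * ‖u‖) := by gcongr; exact T.le_of_opNorm_le hT u
    _ = _ := by ring

/-- The Schwarz lemma bounds the increments of all matrix elements between unit vectors by one
Lipschitz constant; the supremum over unit vectors bounds the operator norm. -/
theorem continuousOn_of_weakly_holomorphic {O : Set ℂ} (hO : IsOpen O) {T : ℂ → V →L[ℂ] V} {C : ℝ}
    (hC : ∀ lam ∈ O, ‖T lam‖ ≤ C)
    (hT : ∀ u v : V, DifferentiableOn ℂ (fun lam => inner ℂ v (T lam u)) O) : ContinuousOn T O := by
  intro z₀ hz₀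
  obtain ⟨R, hR, hball⟩ := Metric.isOpen_iff.1 hO z₀ hz₀
  have hC0 : 0 ≤ C := (norm_nonneg _).trans (hC z₀ hz₀)
  have key : ∀ z ∈ Metric.ball z₀ R, ‖T z - T z₀‖ ≤ (2 * C + 1) / R * dist z z₀ := by
    intro z hz
    refine ContinuousLinearMap.opNorm_le_of_unit_norm (𝕜 := ℝ) (f := (T z - T z₀).restrictScalars ℝ)
      (by positivity) fun u hu => ?_
    have : ∀ v : V, ‖v‖ = 1 → ‖inner ℂ v ((T z - T z₀) u)‖ ≤ (2 * C + 1) / R * dist z z₀ := by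
      intro v hv
      have h1 := Complex.dist_le_div_mul_dist_of_mapsTo_ball (f := fun lam => inner ℂ v (T lam u))
        (c := z₀) (R₁ := R) (R₂ := 2 * C + 1) (z := z) ((hT u v).mono hball) ?_ hz
      · rw [dist_eq_norm, ← inner_sub_right] at h1
        exact h1
      · intro w hw
        have h2 : ∀ y ∈ O, ‖inner ℂ v (T y u)‖ ≤ C := fun y hy => by
          simpa [hu, hv] using norm_inner_clm_le (hC y hy) u v
        rw [Metric.mem_closedBall, dist_eq_norm]
        linarith [norm_sub_le (inner ℂ v (T w u)) (inner ℂ v (T z₀ u)), h2 w (hball hw), h2 z₀ hz₀]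
    change ‖(T z - T z₀) u‖ ≤ _
    by_cases h0 : (T z - T z₀) u = 0
    · rw [h0, norm_zero]; positivity
    -- Testing against the normalized image vector recovers its norm.
    · have h3 := this ((‖(T z - T z₀) u‖⁻¹ : ℂ) • (T z - T z₀) u) (by
        rw [norm_smul, norm_inv, Complex.norm_real, norm_norm, inv_mul_cancel₀ (by simpa using h0)])
      rw [inner_smul_left, inner_self_eq_norm_sq_to_K] at h3
      simp only [map_inv₀, Complex.conj_ofReal, norm_mul, norm_inv, Complex.norm_real, norm_norm,
        norm_pow, Complex.coe_algebraMap] at h3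
      have hpos : 0 < ‖(T z - T z₀) u‖ := norm_pos_iff.2 h0
      calc ‖(T z - T z₀) u‖ = ‖(T z - T z₀) u‖⁻¹ * ‖(T z - T z₀) u‖ ^ 2 := by field_simp
        _ ≤ _ := h3
  refine ContinuousAt.continuousWithinAt ?_
  rw [ContinuousAt, tendsto_iff_dist_tendsto_zero]
  refine squeeze_zero' (Eventually.of_forall fun _ => dist_nonneg)
    (g := fun z => (2 * C + 1) / R * dist z z₀) ?_ ?_
  · filter_upwards [Metric.ball_mem_nhds z₀ hR] with z hz
    rw [dist_eq_norm]; exact key z hz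
  · have : Continuous fun z => (2 * C + 1) / R * dist z z₀ := by fun_prop
    simpa using this.tendsto z₀

/-- By norm continuity the operator-valued Cauchy integral exists and has a power series. Its matrix
elements are given by the scalar Cauchy formula, so it equals T. -/
theorem analyticOnNhd_of_weakly_holomorphic [CompleteSpace V] {O : Set ℂ} (hO : IsOpen O)
    {T : ℂ → V →L[ℂ] V} {C : ℝ} (hC : ∀ lam ∈ O, ‖T lam‖ ≤ C)
    (hT : ∀ u v : V, DifferentiableOn ℂ (fun lam => inner ℂ v (T lam u)) O) :
    AnalyticOnNhd ℂ T O := by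
  intro z₀ hz₀
  obtain ⟨R, hR, hball⟩ := Metric.nhds_basis_closedBall.mem_iff.1 (hO.mem_nhds hz₀)
  have hcont := continuousOn_of_weakly_holomorphic hO hC hT
  lift R to NNReal using hR.le
  have hci : CircleIntegrable T z₀ R :=
    (hcont.mono (Metric.sphere_subset_closedBall.trans hball)).circleIntegrable R.2
  have hfs := hasFPowerSeriesOn_cauchy_integral hci (by exact_mod_cast hR)
  refine (hfs.analyticAt).congr ?_
  filter_upwards [Metric.ball_mem_nhds z₀ hR] with w hw
  have hci' : CircleIntegrable (fun z => (z - w)⁻¹ • T z) z₀ R := by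
    refine ContinuousOn.circleIntegrable R.2 (ContinuousOn.smul (ContinuousOn.inv₀
      (continuousOn_id.sub continuousOn_const) ?_)
      (hcont.mono (Metric.sphere_subset_closedBall.trans hball)))
    intro z hz h0
    replace h0 : z = w := sub_eq_zero.1 h0
    rw [h0, mem_sphere_iff_norm, ← dist_eq_norm] at hz
    rw [Metric.mem_ball] at hw
    exact hw.ne hz
  ext u
  refine ext_inner_left ℂ fun v => ?_
  let φ : (V →L[ℂ] V) →L[ℂ] ℂ := (innerSL ℂ v) ∘L (ContinuousLinearMap.apply ℂ V u)
  have hφ : ∀ S : V →L[ℂ] V, φ S = inner ℂ v (S u) := fun S => rfl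
  have h1 := Complex.two_pi_I_inv_smul_circleIntegral_sub_inv_smul_of_differentiable_on_off_countable
    (s := ∅) countable_empty hw
    ((hT u v).continuousOn.mono hball) (fun x hx => (hT u v).differentiableAt
      (hO.mem_nhds (hball (Metric.ball_subset_closedBall hx.1))))
  rw [← hφ, ← hφ, map_smul]
  have h2 : φ (∮ z in C(z₀, R), (z - w)⁻¹ • T z) = ∮ z in C(z₀, R), φ ((z - w)⁻¹ • T z) := by
    simp only [circleIntegral]
    rw [← ContinuousLinearMap.intervalIntegral_comp_comm φ hci'.out]
    simp
  rw [h2]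
  simp only [hφ, _root_.smul_apply, inner_smul_right]
  exact h1

end Holomorphic

/-! ### The operator associated with a bounded form on a densely embedded Hilbert space -/

section Representation

variable {V : Type*} [NormedAddCommGroup V] [InnerProductSpace ℂ V]
  {X : Type*} [NormedAddCommGroup X] [InnerProductSpace ℂ X]

/-- `V` as a subspace of `X`. -/
def embEquiv (ι : V →L[ℂ] X) (hι : Function.Injective ι) : V ≃ₗ[ℂ] LinearMap.range (ι : V →ₗ[ℂ] X) :=
  LinearEquiv.ofInjective (ι : V →ₗ[ℂ] X) hι

theorem coe_embEquiv (ι : V →L[ℂ] X) (hι : Function.Injective ι) (v : V) :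
    (embEquiv ι hι v : X) = ι v := rfl

theorem emb_embEquiv_symm (ι : V →L[ℂ] X) (hι : Function.Injective ι)
    (f : LinearMap.range (ι : V →ₗ[ℂ] X)) : ι ((embEquiv ι hι).symm f) = f := by
  rw [← coe_embEquiv ι hι, LinearEquiv.apply_symm_apply]

/-- The form `⟪v, T u⟫` on `V`, transported to the subspace `V` of `X`. -/
def formOf (ι : V →L[ℂ] X) (hι : Function.Injective ι) (T : V →L[ℂ] V) :
    LinearMap.range (ι : V →ₗ[ℂ] X) →ₗ[ℂ] LinearMap.range (ι : V →ₗ[ℂ] X) →ₗ⋆[ℂ] ℂ :=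
  LinearMap.mk₂'ₛₗ (RingHom.id ℂ) (starRingEnd ℂ)
    (fun f h => inner ℂ ((embEquiv ι hι).symm h) (T ((embEquiv ι hι).symm f)))
    (fun _ _ _ => by simp) (fun _ _ _ => by simp) (fun _ _ _ => by simp)
    (fun _ _ _ => by simp [mul_comm])

theorem formOf_apply (ι : V →L[ℂ] X) (hι : Function.Injective ι) (T : V →L[ℂ] V)
    (f h : LinearMap.range (ι : V →ₗ[ℂ] X)) :
    formOf ι hι T f h = inner ℂ ((embEquiv ι hι).symm h) (T ((embEquiv ι hι).symm f)) := rfl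

variable [CompleteSpace V] [CompleteSpace X]

/-- The kernel of ι* is the orthogonal complement of the range of ι. -/
theorem adjoint_injective {ι : V →L[ℂ] X} (hd : DenseRange ι) : Function.Injective ι.adjoint := by
  rw [injective_iff_map_eq_zero]
  intro f hf
  refine (hd.eq_zero_of_inner_left (𝕜 := ℂ) fun v => ?_)
  rw [← ContinuousLinearMap.adjoint_inner_left, hf, inner_zero_left]

/-- The domain of `operatorOf`, consisting of the `u` in `V` for which `v ↦ ⟪v, T u⟫` extends to a
bounded functional on `X`. -/
def operatorDomain (ι : V →L[ℂ] X) (T : V →L[ℂ] V) : Submodule ℂ X :=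
  ((LinearMap.range (ι.adjoint : X →ₗ[ℂ] V)).comap (T : V →ₗ[ℂ] V)).map (ι : V →ₗ[ℂ] X)

/-- An element of `operatorDomain` as an element of `V`. -/
def operatorDomainEmb (ι : V →L[ℂ] X) (hι : Function.Injective ι) (T : V →L[ℂ] V) :
    operatorDomain ι T →ₗ[ℂ] V :=
  (embEquiv ι hι).symm.toLinearMap ∘ₗ Submodule.inclusion LinearMap.map_le_range

theorem emb_operatorDomainEmb (ι : V →L[ℂ] X) (hι : Function.Injective ι) (T : V →L[ℂ] V)
    (x : operatorDomain ι T) : ι (operatorDomainEmb ι hι T x) = x :=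
  emb_embEquiv_symm ι hι _

theorem operatorDomainEmb_mem (ι : V →L[ℂ] X) (hι : Function.Injective ι) (T : V →L[ℂ] V)
    (x : operatorDomain ι T) :
    ((T : V →ₗ[ℂ] V) ∘ₗ operatorDomainEmb ι hι T) x ∈ LinearMap.range (ι.adjoint : X →ₗ[ℂ] V) := by
  have h := emb_operatorDomainEmb ι hι T x
  obtain ⟨x, u, hu, rfl⟩ := x
  rw [LinearMap.comp_apply, hι h]
  exact hu

/-- The operator associated with the form `formOf ι hι T`. -/
def operatorOf (ι : V →L[ℂ] X) (hι : Function.Injective ι) (hd : DenseRange ι) (T : V →L[ℂ] V) :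
    X →ₗ.[ℂ] X where
  domain := operatorDomain ι T
  toFun := (LinearEquiv.ofInjective (ι.adjoint : X →ₗ[ℂ] V) (adjoint_injective hd)).symm.toLinearMap ∘ₗ
    LinearMap.codRestrict _ ((T : V →ₗ[ℂ] V) ∘ₗ operatorDomainEmb ι hι T)
      (operatorDomainEmb_mem ι hι T)

variable {ι : V →L[ℂ] X} {hι : Function.Injective ι} {hd : DenseRange ι} {T : V →L[ℂ] V}

/-- The defining relation ι*Aιu = Tu. As ι* is injective it determines A, and everything below uses
the operator only through it. -/
theorem adjoint_operatorOf (x : (operatorOf ι hι hd T).domain) :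
    ∃ u : V, ι u = x ∧ ι.adjoint (operatorOf ι hι hd T x) = T u :=
  ⟨operatorDomainEmb ι hι T x, emb_operatorDomainEmb ι hι T x,
    congrArg Subtype.val (LinearEquiv.apply_symm_apply
      (LinearEquiv.ofInjective (ι.adjoint : X →ₗ[ℂ] V) (adjoint_injective hd))
      (LinearMap.codRestrict _ ((T : V →ₗ[ℂ] V) ∘ₗ operatorDomainEmb ι hι T)
        (operatorDomainEmb_mem ι hι T) x))⟩

theorem mem_domain_operatorOf {u : V} {f : X} (h : ι.adjoint f = T u) :
    ι u ∈ (operatorOf ι hι hd T).domain :=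
  ⟨u, ⟨f, h⟩, rfl⟩

theorem operatorOf_apply_eq {u : V} {f : X} (h : ι.adjoint f = T u)
    (hu : ι u ∈ (operatorOf ι hι hd T).domain) : operatorOf ι hι hd T ⟨ι u, hu⟩ = f := by
  obtain ⟨u', h1, h2⟩ := adjoint_operatorOf (⟨ι u, hu⟩ : (operatorOf ι hι hd T).domain)
  refine adjoint_injective hd ?_
  rw [h2, h, hι h1]

theorem represents_operatorOf : Represents (operatorOf ι hι hd T) (formOf ι hι T) := by
  intro x
  obtain ⟨u, h1, h2⟩ := adjoint_operatorOf x
  refine ⟨⟨u, h1⟩, fun v => ?_⟩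
  rw [formOf_apply]
  have h3 : (embEquiv ι hι).symm ⟨x, ⟨u, h1⟩⟩ = u := by
    rw [LinearEquiv.symm_apply_eq]
    exact Subtype.ext h1.symm
  rw [h3, ← h2, ContinuousLinearMap.adjoint_inner_right, emb_embEquiv_symm]

/-- Since ι*(A − μ)ιu = (T − μι*ι)u, inverting T − μι*ι on V inverts A − μ on X. -/
theorem isResolvent_operatorOf {μ : ℂ} {S : V →L[ℂ] V}
    (h1 : (T - μ • (ι.adjoint ∘L ι)) * S = 1) (h2 : S * (T - μ • (ι.adjoint ∘L ι)) = 1) :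
    IsResolvent (operatorOf ι hι hd T) μ (ι ∘L S ∘L ι.adjoint) := by
  constructor
  · intro f
    have h3 : T (S (ι.adjoint f)) - μ • ι.adjoint (ι (S (ι.adjoint f))) = ι.adjoint f := by
      simpa using congrArg (fun L => L (ι.adjoint f)) h1
    -- This exhibits the value of A at ιSι*f, and so shows that this vector lies in the domain.
    have h4 : ι.adjoint (f + μ • ι (S (ι.adjoint f))) = T (S (ι.adjoint f)) := by
      rw [map_add, map_smul]
      exact (sub_eq_iff_eq_add.1 h3).symm
    refine ⟨mem_domain_operatorOf h4, ?_⟩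
    simp only [ContinuousLinearMap.comp_apply]
    rw [operatorOf_apply_eq h4]
    simp
  · intro x
    obtain ⟨u, h3, h4⟩ := adjoint_operatorOf x
    have h5 : S (T u - μ • ι.adjoint (ι u)) = u := by
      simpa using congrArg (fun L => L u) h2
    simp only [ContinuousLinearMap.comp_apply]
    rw [map_sub, map_smul, h4, ← h3, h5]

end Representation

/-! ### Closedness and maximality of m-sectorial operators -/

section MSectorial

variable {X : Type*} [NormedAddCommGroup X] [InnerProductSpace ℂ X]

/-- The graph is the coincidence set of two continuous maps, because y = Ax exactly when R(y − μx) =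
x. -/
theorem IsResolvent.isClosed {A : X →ₗ.[ℂ] X} {μ : ℂ} {R : X →L[ℂ] X} (h : IsResolvent A μ R) :
    A.IsClosed := by
  have : (A.graph : Set (X × X)) = {p | R (p.2 - μ • p.1) = p.1} := by
    ext ⟨x, y⟩
    simp only [SetLike.mem_coe, LinearPMap.mem_graph_iff, mem_ofPred_eq]
    constructor
    · rintro ⟨z, rfl, rfl⟩
      exact h.2 z
    · intro hxy
      obtain ⟨h1, h2⟩ := h.1 (y - μ • x)
      refine ⟨⟨_, h1⟩, hxy, ?_⟩
      simp only [hxy] at h2 ⊢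
      exact sub_left_inj.1 h2
  rw [LinearPMap.IsClosed, this]
  exact isClosed_eq (by fun_prop) (by fun_prop)

/-- A common resolvent point exists far to the left. There B − μ is onto and its extension A − μ is
one-to-one, so the extension cannot be proper. This is the source of uniqueness of the operator. -/
theorem IsMSectorial.eq_of_le {A B : X →ₗ.[ℂ] X} (hA : IsMSectorial A) (hB : IsMSectorial B)
    (hdom : ∀ u : B.domain, ∃ hu : (u : X) ∈ A.domain, A ⟨u, hu⟩ = B u) : B = A := by
  obtain ⟨c, ϑ, hc, _, hϑ, hA⟩ := hA
  obtain ⟨c', ϑ', hc', _, hϑ', hB⟩ := hB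
  -- As c and c' are positive, −(c + c') lies to the left of both vertices.
  have h1 : ((-(c + c') : ℝ) : ℂ) ∉ sector c ϑ := notMem_sector_of_re_lt hϑ (by linarith)
  have h2 : ((-(c + c') : ℝ) : ℂ) ∉ sector c' ϑ' := notMem_sector_of_re_lt hϑ' (by linarith)
  obtain ⟨R, hR⟩ := not_not.1 fun h => h1 (hA.spectrum h)
  obtain ⟨R', hR'⟩ := not_not.1 fun h => h2 (hB.spectrum h)
  set μ : ℂ := ((-(c + c') : ℝ) : ℂ)
  refine LinearPMap.dExt (le_antisymm (fun x hx => (hdom ⟨x, hx⟩).1) fun x hx => ?_) ?_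
  · obtain ⟨k1, k2⟩ := hR'.1 (A ⟨x, hx⟩ - μ • x)
    obtain ⟨k3, k4⟩ := hdom ⟨_, k1⟩
    have k5 := hR.2 ⟨_, k3⟩
    simp only [k4, k2] at k5
    rw [hR.2 ⟨x, hx⟩] at k5
    exact (congrArg (· ∈ B.domain) k5).mpr k1
  · rintro ⟨x, hx⟩ ⟨y, hy⟩ (rfl : x = y)
    exact (hdom ⟨x, hx⟩).2.symm

end MSectorial

/-! ### Coercive operators: sectoriality, closedness, resolvents and their analyticity -/

section Family

variable {V : Type*} [NormedAddCommGroup V] [InnerProductSpace ℂ V]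
  {X : Type*} [NormedAddCommGroup X] [InnerProductSpace ℂ X]
  {ι : V →L[ℂ] X} {hι : Function.Injective ι} {hd : DenseRange ι} {T : V →L[ℂ] V}
  {C δ K : ℝ}

/-- Boundedness controls the imaginary part by C‖u‖² and coercivity controls ‖u‖², which together
confine the form to a cone of slope C/δ. -/
theorem abs_im_inner_le (hδ : 0 < δ) (hT : ‖T‖ ≤ C)
    (hcoer : ∀ u, δ * ‖u‖ ^ 2 ≤ (inner ℂ u (T u)).re + K * ‖ι u‖ ^ 2) (u : V) :
    |(inner ℂ u (T u)).im| ≤ C / δ * ((inner ℂ u (T u)).re + K * ‖ι u‖ ^ 2) := by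
  have hC : 0 ≤ C := (norm_nonneg _).trans hT
  calc |(inner ℂ u (T u)).im| ≤ ‖inner ℂ u (T u)‖ := Complex.abs_im_le_norm _
    _ ≤ C * ‖u‖ * ‖u‖ := norm_inner_clm_le hT u u
    _ = C / δ * (δ * ‖u‖ ^ 2) := by field_simp
    _ ≤ _ := by gcongr; exact hcoer u

/-- The cone estimate on unit vectors. The vertex is moved from −K to −(K + 1) so that the shift is
strictly positive even when K = 0. -/
theorem formSectorial_formOf (hδ : 0 < δ) (hT : ‖T‖ ≤ C)
    (hcoer : ∀ u, δ * ‖u‖ ^ 2 ≤ (inner ℂ u (T u)).re + K * ‖ι u‖ ^ 2) :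
    FormSectorial (formOf ι hι T) (K + 1) (Real.arctan (C / δ)) := by
  intro f hf
  have hC : 0 ≤ C := (norm_nonneg _).trans hT
  rw [formOf_apply]
  have h3 := abs_im_inner_le hδ hT hcoer ((embEquiv ι hι).symm f)
  have h4 := hcoer ((embEquiv ι hι).symm f)
  rw [emb_embEquiv_symm] at h3 h4
  simp only [hf] at h3 h4
  refine mem_sector_of_im_le (h3.trans ?_) (by positivity) ?_
  · gcongr; linarith
  · have := mul_nonneg hδ.le (sq_nonneg ‖(embEquiv ι hι).symm f‖)
    linarith

variable [CompleteSpace V]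

/-- By coercivity a sequence that converges in X and is Cauchy for the form is Cauchy in V; its
limit in V is the required element, since ι is continuous. -/
theorem formClosed_formOf (hδ : 0 < δ)
    (hcoer : ∀ u, δ * ‖u‖ ^ 2 ≤ (inner ℂ u (T u)).re + K * ‖ι u‖ ^ 2) :
    FormClosed (formOf ι hι T) := by
  intro u f huf hq
  set v : ℕ → V := fun k => (embEquiv ι hι).symm (u k) with hv
  have hιv : ∀ k, ι (v k) = u k := fun k => emb_embEquiv_symm ι hι _
  have hcauchy : CauchySeq v := by
    rw [cauchySeq_iff_tendsto_dist_atTop_0]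
    have hX : Tendsto (fun jk : ℕ × ℕ => ‖(u jk.1 : X) - u jk.2‖) atTop (𝓝 0) := by
      have := cauchySeq_iff_tendsto_dist_atTop_0.1 huf.cauchySeq
      simpa only [dist_eq_norm] using this
    have h1 : Tendsto (fun jk : ℕ × ℕ => δ⁻¹ * ((formOf ι hι T (u jk.1 - u jk.2)
        (u jk.1 - u jk.2)).re + K * ‖(u jk.1 : X) - u jk.2‖ ^ 2)) atTop (𝓝 0) := by
      have := ((Complex.continuous_re.tendsto _).comp hq).add ((hX.pow 2).const_mul K)
      simpa using this.const_mul δ⁻¹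
    have h2 : Tendsto (fun jk : ℕ × ℕ => dist (v jk.1) (v jk.2) ^ 2) atTop (𝓝 0) := by
      refine squeeze_zero (fun _ => sq_nonneg _) (fun jk => ?_) h1
      rw [← div_eq_inv_mul, le_div_iff₀ hδ, mul_comm, formOf_apply, map_sub]
      have := hcoer (v jk.1 - v jk.2)
      rw [map_sub ι, hιv, hιv] at this
      rw [dist_eq_norm]
      exact this
    have h3 := (Real.continuous_sqrt.tendsto _).comp h2
    simpa [Function.comp_def, Real.sqrt_sq dist_nonneg] using h3
  obtain ⟨w, hw⟩ := cauchySeq_tendsto_of_complete hcauchy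
  have hf : ι w = f := by
    refine tendsto_nhds_unique ((ι.continuous.tendsto w).comp hw) ?_
    simpa only [Function.comp_def, hιv] using huf
  refine ⟨⟨w, hf⟩, ?_⟩
  have hw' : (embEquiv ι hι).symm ⟨f, ⟨w, hf⟩⟩ = w := by
    rw [LinearEquiv.symm_apply_eq]
    exact Subtype.ext hf.symm
  have h4 : Tendsto (fun k => v k - w) atTop (𝓝 0) := by simpa using hw.sub_const w
  have h5 := h4.inner (𝕜 := ℂ) ((T.continuous.tendsto 0).comp h4)
  rw [map_zero, inner_zero_left] at h5
  refine h5.congr fun k => ?_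
  rw [formOf_apply, map_sub, hw']
  rfl

variable [CompleteSpace X]

/-- Lax–Milgram for the operator rotated by the separating multiplier of μ. -/
theorem isUnit_sub_of_notMem_sector (hδ : 0 < δ) (hT : ‖T‖ ≤ C)
    (hcoer : ∀ u, δ * ‖u‖ ^ 2 ≤ (inner ℂ u (T u)).re + K * ‖ι u‖ ^ 2) {μ : ℂ}
    (hμ : μ ∉ sector (K + 1) (Real.arctan (C / δ))) : IsUnit (T - μ • (ι.adjoint ∘L ι)) := by
  have hC : 0 ≤ C := (norm_nonneg _).trans hT
  obtain ⟨m, κ, hκ, h1, h2⟩ := exists_multiplier_of_notMem_sector (by positivity) hμ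
  refine ContinuousLinearMap.isUnit_of_forall_le_norm_inner_map _
    (c := Real.toNNReal (κ * δ / (‖m‖ + 1))) (Real.toNNReal_pos.2 (by positivity)) fun u => ?_
  rw [norm_inner_symm]
  set z := inner ℂ u (T u) with hz
  have h3 : inner ℂ u ((T - μ • (ι.adjoint ∘L ι)) u) = z - μ * (‖ι u‖ ^ 2 : ℝ) := by
    simp only [_root_.sub_apply, _root_.smul_apply, ContinuousLinearMap.comp_apply,
      inner_sub_right, inner_smul_right, ContinuousLinearMap.adjoint_inner_right, ← hz]
    rw [inner_self_eq_norm_sq_to_K]; simp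
  rw [h3]
  set N := ‖ι u‖ ^ 2 with hN
  have hN0 : 0 ≤ N := by positivity
  -- The separation is stated for the cone with vertex −(K + 1), whereas for a vector of arbitrary
  -- length the natural shift is (K + 1)N. The argument is chosen so that adding K + 1 leaves z + (K
  -- + 1)N.
  have h4 := h2 (z + ((K + 1 : ℝ) : ℂ) * (N : ℂ) - ((K + 1 : ℝ) : ℂ)) (by
    have := abs_im_inner_le hδ hT hcoer u
    rw [← hz] at this
    refine le_trans (le_of_eq ?_) (this.trans ?_)
    · simp
    · rw [← Complex.ofReal_mul]
      simp only [Complex.sub_re, Complex.add_re, Complex.ofReal_re]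
      refine mul_le_mul_of_nonneg_left ?_ (by positivity)
      linarith) (by
    have := hcoer u
    rw [← Complex.ofReal_mul]
    simp only [Complex.sub_re, Complex.add_re, Complex.ofReal_re]
    nlinarith [sq_nonneg ‖u‖, mul_nonneg hδ.le (sq_nonneg ‖u‖)])
  -- z − μN is the difference of z + (K + 1)N and N(μ + K + 1). Multiplied by m, the first has real
  -- part at least κδ‖u‖², the second a nonpositive one.
  have h5 : κ * (δ * ‖u‖ ^ 2) ≤ (m * (z - μ * N)).re := by
    have e1 : m * (z - μ * N) = m * (z + ((K + 1 : ℝ) : ℂ) * (N : ℂ) - ((K + 1 : ℝ) : ℂ)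
        + ((K + 1 : ℝ) : ℂ)) - (N : ℂ) * (m * (μ + ((K + 1 : ℝ) : ℂ))) := by ring
    rw [e1, Complex.sub_re, Complex.re_ofReal_mul]
    refine le_trans ?_ (sub_le_sub h4 (mul_nonpos_of_nonneg_of_nonpos hN0 h1))
    rw [sub_zero]
    gcongr
    rw [← Complex.ofReal_mul]
    simp only [Complex.sub_re, Complex.add_re, Complex.ofReal_re]
    have := hcoer u
    nlinarith
  have h6 : (m * (z - μ * N)).re ≤ (‖m‖ + 1) * ‖z - μ * N‖ := by
    refine (Complex.re_le_norm _).trans ?_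
    rw [norm_mul]
    gcongr
    linarith
  rw [Real.coe_toNNReal _ (by positivity)]
  rw [← mul_div_assoc, div_le_iff₀ (by positivity)]
  linarith

/-- The resolvent exists off the sector, which gives closedness and the location of the spectrum;
the numerical range is part of that of the form. -/
theorem mSectorial_operatorOf (hδ : 0 < δ) (hT : ‖T‖ ≤ C)
    (hcoer : ∀ u, δ * ‖u‖ ^ 2 ≤ (inner ℂ u (T u)).re + K * ‖ι u‖ ^ 2) :
    MSectorial (operatorOf ι hι hd T) (K + 1) (Real.arctan (C / δ)) := by
  have hC : 0 ≤ C := (norm_nonneg _).trans hT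
  have hres : ∀ μ ∉ sector (K + 1) (Real.arctan (C / δ)), ∃ S : V →L[ℂ] V,
      IsResolvent (operatorOf ι hι hd T) μ (ι ∘L S ∘L ι.adjoint) ∧ Function.Surjective S := by
    intro μ hμ
    obtain ⟨S, hS⟩ := isUnit_sub_of_notMem_sector hδ hT hcoer hμ
    refine ⟨↑S⁻¹, isResolvent_operatorOf (by rw [← hS, Units.mul_inv])
      (by rw [← hS, Units.inv_mul]), fun v => ⟨(S : V →L[ℂ] V) v, ?_⟩⟩
    exact congrArg (fun L : V →L[ℂ] V => L v) (Units.inv_mul S)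
  obtain ⟨S, hS, hsurj⟩ := hres ((-(K + 2) : ℝ) : ℂ)
    (notMem_sector_of_re_lt (Real.arctan_lt_pi_div_two _) (by linarith))
  refine ⟨hS.isClosed, ?_, ?_, ?_⟩
  -- The domain contains the range of the resolvent ιSι*. Here ι* has dense range because ι is
  -- injective, S is onto, and ι has dense range.
  · have hadj : DenseRange ι.adjoint := by
      have h1 := ι.adjoint.orthogonal_range
      rw [ContinuousLinearMap.adjoint_adjoint, LinearMap.ker_eq_bot.2 hι] at h1
      have h2 := (Submodule.topologicalClosure_eq_top_iff (K := LinearMap.range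
        (ι.adjoint : X →ₗ[ℂ] V))).2 h1
      exact Submodule.dense_iff_topologicalClosure_eq_top.2 h2
    have h3 : DenseRange (ι ∘L S ∘L ι.adjoint) :=
      hd.comp (hsurj.denseRange.comp hadj S.continuous) ι.continuous
    refine h3.mono ?_
    rintro _ ⟨f, rfl⟩
    exact (hS.1 f).1
  · intro x hx
    obtain ⟨hu, h1⟩ := represents_operatorOf (hι := hι) (hd := hd) x
    have h2 := h1 ⟨x, hu⟩
    rw [formOf_apply] at h2
    simp only at h2
    rw [h2]
    have h3 := abs_im_inner_le hδ hT hcoer ((embEquiv ι hι).symm ⟨x, hu⟩)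
    have h4 := hcoer ((embEquiv ι hι).symm ⟨x, hu⟩)
    rw [emb_embEquiv_symm] at h3 h4
    simp only [hx] at h3 h4
    refine mem_sector_of_im_le (h3.trans ?_) (by positivity) ?_
    · gcongr; linarith
    · have := mul_nonneg hδ.le (sq_nonneg ‖(embEquiv ι hι).symm ⟨x, hu⟩‖)
      linarith
  · intro μ hμ
    by_contra h
    obtain ⟨S, hS, _⟩ := hres μ h
    exact hμ ⟨_, hS⟩

/-- At a real point to the left of the common sector, one μ serves all parameters. The resolvent is
then built from the norm-analytic family T by inversion and composition with fixed bounded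
operators. -/
theorem analyticOperatorFamily_operatorOf {O : Set ℂ} (hO : IsOpen O) {T : ℂ → V →L[ℂ] V}
    (hδ : 0 < δ) (hC : ∀ lam ∈ O, ‖T lam‖ ≤ C)
    (hcoer : ∀ lam ∈ O, ∀ u, δ * ‖u‖ ^ 2 ≤ (inner ℂ u (T lam u)).re + K * ‖ι u‖ ^ 2)
    (hT : ∀ u v : V, DifferentiableOn ℂ (fun lam => inner ℂ v (T lam u)) O) :
    AnalyticOperatorFamily O (fun lam => operatorOf ι hι hd (T lam)) := by
  refine ⟨fun lam hlam => (mSectorial_operatorOf hδ (hC lam hlam) (hcoer lam hlam)).closed,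
    fun lam₀ hlam₀ => ?_⟩
  have hμ : ((-(K + 2) : ℝ) : ℂ) ∉ sector (K + 1) (Real.arctan (C / δ)) :=
    notMem_sector_of_re_lt (Real.arctan_lt_pi_div_two _) (by linarith)
  set μ : ℂ := ((-(K + 2) : ℝ) : ℂ)
  refine ⟨μ, fun lam => ι ∘L Ring.inverse (T lam - μ • (ι.adjoint ∘L ι)) ∘L ι.adjoint, ?_, ?_⟩
  · have h1 : AnalyticAt ℂ (fun lam => T lam - μ • (ι.adjoint ∘L ι)) lam₀ :=
      (analyticOnNhd_of_weakly_holomorphic hO hC hT lam₀ hlam₀).sub analyticAt_const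
    obtain ⟨S, hS⟩ := isUnit_sub_of_notMem_sector hδ (hC lam₀ hlam₀) (hcoer lam₀ hlam₀) hμ
    have h2 : AnalyticAt ℂ Ring.inverse (T lam₀ - μ • (ι.adjoint ∘L ι)) := by
      rw [← hS]; exact analyticAt_inverse S
    have h3 := AnalyticAt.fun_comp (f := fun lam => T lam - μ • (ι.adjoint ∘L ι)) h2 h1
    let Φ : (V →L[ℂ] V) →L[ℂ] (X →L[ℂ] X) :=
      (ContinuousLinearMap.compL ℂ X V X ι) ∘L ((ContinuousLinearMap.compL ℂ X V V).flip ι.adjoint)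
    exact (Φ.analyticAt _).fun_comp h3
  · filter_upwards [hO.mem_nhds hlam₀] with lam hlam
    have hu := isUnit_sub_of_notMem_sector hδ (hC lam hlam) (hcoer lam hlam) hμ
    exact isResolvent_operatorOf (Ring.mul_inverse_cancel _ hu) (Ring.inverse_mul_cancel _ hu)

end Family

/-! ### From forms on a pre-Hilbert space to analytic families of forms and operators -/

section Completion

open UniformSpace (Completion)

variable {E : Type*} [SeminormedAddCommGroup E]

theorem exists_seq_tendsto_coe (x : Completion E) :
    ∃ u : ℕ → E, Tendsto (fun k => (u k : Completion E)) atTop (𝓝 x) := by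
  obtain ⟨y, hy, hlim⟩ := mem_closure_iff_seq_limit.1
    ((Completion.denseRange_coe (α := E)) x)
  choose u hu using hy
  exact ⟨u, by simpa [hu] using hlim⟩

theorem cauchySeq_coe_iff {u : ℕ → E} :
    CauchySeq (fun k => (u k : Completion E)) ↔ CauchySeq u :=
  (Completion.isUniformInducing_coe E).cauchy_map_iff (F := map u atTop)

variable [InnerProductSpace ℂ E]

/-- Riesz representation on the completion. The form is antilinear in its second argument, so the
functional represented is its conjugate. -/
theorem exists_operator_of_form (Q : E →ₗ[ℂ] E →ₗ⋆[ℂ] ℂ) {C : ℝ} (hC : 0 ≤ C)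
    (hQ : ∀ u v, ‖Q u v‖ ≤ C * ‖u‖ * ‖v‖) :
    ∃ T : Completion E →L[ℂ] Completion E, ‖T‖ ≤ C ∧
      ∀ u v : E, inner ℂ (v : Completion E) (T u) = Q u v := by
  let b : E → StrongDual ℂ E := fun u =>
    LinearMap.mkContinuous
      { toFun := fun v => conj (Q u v)
        map_add' := fun _ _ => by simp
        map_smul' := fun _ _ => by simp } (C * ‖u‖) (fun v => by simpa using hQ u v)
  have hb : ∀ u v, b u v = conj (Q u v) := fun _ _ => rfl
  let t : E → Completion E := fun u => (InnerProductSpace.toDual ℂ (Completion E)).symm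
    (b u).fromCompletion
  have ht : ∀ u v : E, inner ℂ (v : Completion E) (t u) = Q u v := by
    intro u v
    rw [← inner_conj_symm, InnerProductSpace.toDual_symm_apply,
      ContinuousLinearMap.fromCompletion_apply_coe, hb, Complex.conj_conj]
  have hdense : DenseRange ((↑) : E → Completion E) := Completion.denseRange_coe
  have hext : ∀ x y : Completion E, (∀ v : E, inner ℂ (v : Completion E) x = inner ℂ (v : Completion E) y)
      → x = y := fun x y h => by
    rw [← sub_eq_zero]
    refine hdense.eq_zero_of_inner_right (𝕜 := ℂ) fun v => ?_
    rw [inner_sub_right, h, sub_self]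
  let t' : E →ₗ[ℂ] Completion E :=
    { toFun := t
      map_add' := fun u u' => hext _ _ fun v => by simp [ht, inner_add_right]
      map_smul' := fun c u => hext _ _ fun v => by simp [ht, inner_smul_right] }
  have hnorm : ∀ u, ‖t' u‖ ≤ C * ‖u‖ := by
    intro u
    change ‖t u‖ ≤ _
    simp only [t]
    rw [LinearIsometryEquiv.norm_map]
    refine ContinuousLinearMap.opNorm_le_bound _ (by positivity) fun x => ?_
    refine Completion.induction_on x (isClosed_le (by fun_prop) (by fun_prop)) fun v => ?_
    rw [ContinuousLinearMap.fromCompletion_apply_coe, hb, Completion.norm_coe, RCLike.norm_conj]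
    exact hQ u v
  refine ⟨(t'.mkContinuous C hnorm).fromCompletion, ?_, fun u v => ?_⟩
  · refine ContinuousLinearMap.opNorm_le_bound _ hC fun x => ?_
    refine Completion.induction_on x (isClosed_le (by fun_prop) (by fun_prop)) fun v => ?_
    rw [ContinuousLinearMap.fromCompletion_apply_coe, Completion.norm_coe]
    exact hnorm v
  · rw [ContinuousLinearMap.fromCompletion_apply_coe]
    exact ht u v

theorem norm_inner_clm_sub_le {V : Type*} [NormedAddCommGroup V] [InnerProductSpace ℂ V]
    {T : V →L[ℂ] V} {C : ℝ} (hT : ‖T‖ ≤ C) (u v x y : V) :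
    ‖inner ℂ y (T x) - inner ℂ v (T u)‖ ≤ C * ‖x‖ * ‖y - v‖ + C * ‖x - u‖ * ‖v‖ := by
  have : inner ℂ y (T x) - inner ℂ v (T u) = inner ℂ (y - v) (T x) + inner ℂ v (T (x - u)) := by
    rw [inner_sub_left, map_sub, inner_sub_right]; ring
  rw [this]
  exact (norm_add_le _ _).trans (add_le_add (norm_inner_clm_le hT _ _) (norm_inner_clm_le hT _ _))

/-- Matrix elements at arbitrary vectors are limits, uniform in the parameter, of matrix elements at
vectors of E; uniform limits of holomorphic functions are holomorphic. -/
theorem differentiableOn_inner_of_dense {O : Set ℂ} (hO : IsOpen O)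
    {T : ℂ → Completion E →L[ℂ] Completion E} {C : ℝ} (hC : ∀ lam ∈ O, ‖T lam‖ ≤ C)
    (hT : ∀ u v : E, DifferentiableOn ℂ (fun lam => inner ℂ (v : Completion E) (T lam u)) O)
    (x y : Completion E) : DifferentiableOn ℂ (fun lam => inner ℂ y (T lam x)) O := by
  obtain ⟨u, hu⟩ := exists_seq_tendsto_coe x
  obtain ⟨v, hv⟩ := exists_seq_tendsto_coe y
  refine TendstoLocallyUniformlyOn.differentiableOn (φ := atTop)
    (F := fun k lam => inner ℂ (v k : Completion E) (T lam (u k))) ?_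
    (Eventually.of_forall fun k => hT _ _) hO
  refine TendstoUniformlyOn.tendstoLocallyUniformlyOn ?_
  rw [Metric.tendstoUniformlyOn_iff]
  intro ε hε
  have h1 : Tendsto (fun k => C * ‖x‖ * ‖y - v k‖ + C * ‖x - u k‖ * ‖(v k : Completion E)‖) atTop
      (𝓝 (C * ‖x‖ * ‖y - y‖ + C * ‖x - x‖ * ‖y‖)) :=
    ((hv.const_sub y).norm.const_mul _).add (((hu.const_sub x).norm.const_mul _).mul hv.norm)
  simp only [sub_self, norm_zero, mul_zero, zero_mul, add_zero] at h1
  filter_upwards [h1.eventually_lt_const hε] with k hk lam hlam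
  rw [dist_eq_norm]
  exact (norm_inner_clm_sub_le (hC lam hlam) _ _ _ _).trans_lt hk

variable {X : Type*} [NormedAddCommGroup X] [InnerProductSpace ℂ X] [CompleteSpace X]

/-- All functional analysis is concentrated here. The closability hypothesis `hclos` says exactly
what is needed for the extension of `j` to the completion to be injective, so that the completion is
a space of vectors of X. -/
theorem exists_analytic_family_of_forms (j : E →L[ℂ] X) (hd : DenseRange j)
    (hclos : ∀ u : ℕ → E, CauchySeq u → Tendsto (fun k => j (u k)) atTop (𝓝 0) →
      Tendsto (fun k => ‖u k‖) atTop (𝓝 0))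
    {O : Set ℂ} (hO : IsOpen O) (Q : ℂ → E →ₗ[ℂ] E →ₗ⋆[ℂ] ℂ) {C δ K : ℝ} (hC : 0 ≤ C) (hδ : 0 < δ)
    (hK : 0 ≤ K) (hQ : ∀ lam ∈ O, ∀ u v, ‖Q lam u v‖ ≤ C * ‖u‖ * ‖v‖)
    (hcoer : ∀ lam ∈ O, ∀ u, δ * ‖u‖ ^ 2 ≤ (Q lam u u).re + K * ‖j u‖ ^ 2)
    (hhol : ∀ u v, DifferentiableOn ℂ (fun lam => Q lam u v) O) :
    ∃ D : Submodule ℂ X,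
      (∀ f, f ∈ D ↔ ∃ u : ℕ → E, CauchySeq u ∧ Tendsto (fun k => j (u k)) atTop (𝓝 f)) ∧
      Dense (D : Set X) ∧
      ∃ q : ℂ → (D →ₗ[ℂ] D →ₗ⋆[ℂ] ℂ),
        (∀ lam ∈ O, ∀ (f h : D) (u v : ℕ → E),
          CauchySeq u → Tendsto (fun k => j (u k)) atTop (𝓝 (f : X)) →
          CauchySeq v → Tendsto (fun k => j (v k)) atTop (𝓝 (h : X)) →
          Tendsto (fun k => Q lam (u k) (v k)) atTop (𝓝 (q lam f h))) ∧
        (∀ lam ∈ O, FormClosed (q lam)) ∧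
        (∀ f : D, AnalyticOnNhd ℂ (fun lam => q lam f f) O) ∧
        ∃ c ϑ : ℝ, 0 < c ∧ 0 ≤ ϑ ∧ ϑ < Real.pi / 2 ∧
          (∀ lam ∈ O, FormSectorial (q lam) c ϑ) ∧
          ∃ A : ℂ → (X →ₗ.[ℂ] X),
            (∀ lam ∈ O, MSectorial (A lam) c ϑ ∧ Represents (A lam) (q lam) ∧
              ∀ B : X →ₗ.[ℂ] X, IsMSectorial B → Represents B (q lam) → B = A lam) ∧
            AnalyticOperatorFamily O A := by
  classical
  have hex : ∀ lam, ∃ T : Completion E →L[ℂ] Completion E, lam ∈ O → ‖T‖ ≤ C ∧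
      ∀ u v : E, inner ℂ (v : Completion E) (T u) = Q lam u v := fun lam => by
    by_cases h : lam ∈ O
    · obtain ⟨T, hT⟩ := exists_operator_of_form (Q lam) hC (hQ lam h)
      exact ⟨T, fun _ => hT⟩
    -- Outside O nothing is assumed about the form; the value 0 there is never used.
    · exact ⟨0, fun h' => absurd h' h⟩
  choose T hT using hex
  have hTC : ∀ lam ∈ O, ‖T lam‖ ≤ C := fun lam h => (hT lam h).1
  have hTQ : ∀ lam ∈ O, ∀ u v : E, inner ℂ (v : Completion E) (T lam u) = Q lam u v :=
    fun lam h => (hT lam h).2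
  set ι : Completion E →L[ℂ] X := j.fromCompletion with hιdef
  have hιj : ∀ u : E, ι (u : Completion E) = j u := fun u =>
    ContinuousLinearMap.fromCompletion_apply_coe j u
  -- An element of the kernel is a limit of vectors of E whose images tend to 0, so by closability
  -- their norms tend to 0 as well.
  have hι : Function.Injective ι := by
    rw [injective_iff_map_eq_zero]
    intro x hx
    obtain ⟨u, hu⟩ := exists_seq_tendsto_coe x
    have h1 : Tendsto (fun k => j (u k)) atTop (𝓝 0) := by
      simpa only [hx, Function.comp_def, hιj] using (ι.continuous.tendsto x).comp hu
    have h2 := hclos u (cauchySeq_coe_iff.1 hu.cauchySeq) h1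
    have h3 : Tendsto (fun k => ‖(u k : Completion E)‖) atTop (𝓝 0) := by
      simpa only [Completion.norm_coe] using h2
    exact tendsto_nhds_unique hu (tendsto_zero_iff_norm_tendsto_zero.2 h3)
  have hdι : DenseRange ι := by
    refine hd.mono ?_
    rintro _ ⟨u, rfl⟩
    exact ⟨u, hιj u⟩
  have hcoer' : ∀ lam ∈ O, ∀ x : Completion E,
      δ * ‖x‖ ^ 2 ≤ (inner ℂ x (T lam x)).re + K * ‖ι x‖ ^ 2 := by
    intro lam h x
    have hc1 : Continuous fun x : Completion E => (inner ℂ x (T lam x)).re :=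
      Complex.continuous_re.comp (continuous_id.inner (T lam).continuous)
    refine Completion.induction_on x (isClosed_le (by fun_prop) (by fun_prop)) fun u => ?_
    rw [hTQ lam h, hιj, Completion.norm_coe]
    exact hcoer lam h u
  have hhol' := differentiableOn_inner_of_dense hO hTC fun u v =>
    (hhol u v).congr fun lam h => hTQ lam h u v
  have hlim : ∀ (f : LinearMap.range (ι : Completion E →ₗ[ℂ] X)) (u : ℕ → E), CauchySeq u →
      Tendsto (fun k => j (u k)) atTop (𝓝 (f : X)) →
      Tendsto (fun k => (u k : Completion E)) atTop (𝓝 ((embEquiv ι hι).symm f)) := by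
    intro f u hu huf
    obtain ⟨x, hx⟩ := cauchySeq_tendsto_of_complete (cauchySeq_coe_iff.2 hu)
    have h1 : ι x = f := by
      refine tendsto_nhds_unique ?_ huf
      simpa only [Function.comp_def, hιj] using (ι.continuous.tendsto x).comp hx
    have h2 : (embEquiv ι hι).symm f = x := by
      rw [LinearEquiv.symm_apply_eq]
      exact Subtype.ext h1.symm
    rwa [h2]
  refine ⟨LinearMap.range (ι : Completion E →ₗ[ℂ] X), fun f => ⟨?_, ?_⟩, hdι,
    fun lam => formOf ι hι (T lam), ?_, fun lam h => formClosed_formOf hδ (hcoer' lam h),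
    fun f => ?_, K + 1, Real.arctan (C / δ), by linarith, Real.arctan_nonneg.2 (by positivity),
    Real.arctan_lt_pi_div_two _, fun lam h => formSectorial_formOf hδ (hTC lam h) (hcoer' lam h),
    fun lam => operatorOf ι hι hdι (T lam), fun lam h =>
      ⟨mSectorial_operatorOf hδ (hTC lam h) (hcoer' lam h), represents_operatorOf, ?_⟩,
    analyticOperatorFamily_operatorOf hO hδ hTC hcoer' fun u v => hhol' u v⟩
  · rintro ⟨x, rfl⟩
    obtain ⟨u, hu⟩ := exists_seq_tendsto_coe x
    refine ⟨u, cauchySeq_coe_iff.1 hu.cauchySeq, ?_⟩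
    rw [ContinuousLinearMap.coe_coe]
    simpa only [Function.comp_def, hιj] using (ι.continuous.tendsto x).comp hu
  · rintro ⟨u, hu, huf⟩
    obtain ⟨x, hx⟩ := cauchySeq_tendsto_of_complete (cauchySeq_coe_iff.2 hu)
    refine ⟨x, tendsto_nhds_unique ?_ huf⟩
    rw [ContinuousLinearMap.coe_coe]
    simpa only [Function.comp_def, hιj] using (ι.continuous.tendsto x).comp hx
  · intro lam hlam f h u v hu huf hv hvh
    rw [formOf_apply]
    simp_rw [← hTQ lam hlam]
    exact (hlim h v hv hvh).inner (((T lam).continuous.tendsto _).comp (hlim f u hu huf))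
  · refine DifferentiableOn.analyticOnNhd ?_ hO
    exact (hhol' _ _).congr fun lam _ => formOf_apply ι hι (T lam) f f
  -- A representing operator B satisfies ι*Bx = Tx on its domain, so it is a restriction of the
  -- constructed one; maximality of m-sectorial operators gives equality.
  · intro B hB hBq
    refine IsMSectorial.eq_of_le (A := operatorOf ι hι hdι (T lam)) ⟨K + 1, Real.arctan (C / δ), by linarith,
      Real.arctan_nonneg.2 (by positivity), Real.arctan_lt_pi_div_two _,
      mSectorial_operatorOf hδ (hTC lam h) (hcoer' lam h)⟩ hB fun x => ?_
    obtain ⟨hx, h1⟩ := hBq x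
    have h2 : ι.adjoint (B x) = T lam ((embEquiv ι hι).symm ⟨x, hx⟩) := by
      refine ext_inner_left ℂ fun v => ?_
      rw [ContinuousLinearMap.adjoint_inner_right]
      have := h1 (embEquiv ι hι v)
      rw [formOf_apply, LinearEquiv.symm_apply_apply, coe_embEquiv] at this
      exact this
    have h3 := emb_embEquiv_symm ι hι ⟨x, hx⟩
    have h4 : (x : X) ∈ (operatorOf ι hι hdι (T lam)).domain := by
      have := mem_domain_operatorOf (hι := hι) (hd := hdι) h2
      rwa [h3] at this
    refine ⟨h4, ?_⟩
    have h5 := operatorOf_apply_eq (hι := hι) (hd := hdι) h2 (by rw [h3]; exact h4)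
    simpa only [h3] using h5

end Completion

/-! ### Tensor fields in arbitrary frames -/

section Frames

variable {d : ℕ} {H : Type*} [TopologicalSpace H]
  {I : ModelWithCorners ℝ (EuclideanSpace ℝ (Fin d)) H}
  {M : Type*} [TopologicalSpace M] [ChartedSpace H M]

/-- `B` is real-bilinear at `p`. -/
def IsBilinAt (B : FormField I M) (p : M) : Prop :=
  ∃ β : TangentSpace I p →ₗ[ℝ] TangentSpace I p →ₗ[ℝ] ℂ, ∀ v w, B p v w = β v w

/-- The matrix of `B` at `p` with respect to the vectors `b`. -/
def gramIn (B : FormField I M) (p : M) (b : Fin d → TangentSpace I p) : Matrix (Fin d) (Fin d) ℂ :=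
  Matrix.of fun i j => B p (b i) (b j)

/-- The components of `b` in the standard frame. -/
def frameMatrix (p : M) (b : Fin d → TangentSpace I p) : Matrix (Fin d) (Fin d) ℝ :=
  Matrix.of fun i k => (show EuclideanSpace ℝ (Fin d) from b i) k

theorem eq_sum_frame (p : M) (v : TangentSpace I p) :
    v = ∑ k, (show EuclideanSpace ℝ (Fin d) from v) k • frame I p k := by
  have := (EuclideanSpace.basisFun (Fin d) ℝ).sum_repr (show EuclideanSpace ℝ (Fin d) from v)
  simp only [EuclideanSpace.basisFun_apply] at this
  exact this.symm

theorem det_frameMatrix_ne_zero {p : M} {b : Fin d → TangentSpace I p}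
    (hb : LinearIndependent ℝ b) : (frameMatrix p b).det ≠ 0 := by
  have h1 : LinearIndependent ℝ (frameMatrix p b).row := by
    have := hb.map' (EuclideanSpace.equiv (Fin d) ℝ).toLinearMap
      (LinearMap.ker_eq_bot.2 (EuclideanSpace.equiv (Fin d) ℝ).injective)
    exact this
  rw [← isUnit_iff_ne_zero, ← Matrix.isUnit_iff_isUnit_det]
  exact Matrix.linearIndependent_rows_iff_isUnit.1 h1

theorem map_frame_eq (p : M) (b : Fin d → TangentSpace I p) (ξ : TangentSpace I p →L[ℝ] ℂ) :
    (fun i => ξ (b i)) = (frameMatrix p b).map ((↑) : ℝ → ℂ) *ᵥ fun k => ξ (frame I p k) := by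
  funext i
  conv_lhs => rw [eq_sum_frame p (b i)]
  simp [map_sum, Matrix.mulVec, dotProduct, frameMatrix]

/-- Change of frame by a real matrix P, in the form PGPᵀ. -/
theorem gramIn_eq {B : FormField I M} {p : M} (hB : IsBilinAt B p) (b : Fin d → TangentSpace I p) :
    gramIn B p b = (frameMatrix p b).map ((↑) : ℝ → ℂ) * gram B p *
      ((frameMatrix p b).map ((↑) : ℝ → ℂ))ᵀ := by
  obtain ⟨β, hβ⟩ := hB
  ext i j
  have h1 : B p (b i) (b j) = ∑ k, ∑ l, ((frameMatrix p b i k : ℝ) : ℂ) *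
      ((frameMatrix p b j l : ℝ) : ℂ) * B p (frame I p k) (frame I p l) := by
    simp only [hβ]
    conv_lhs => rw [eq_sum_frame p (b i), eq_sum_frame p (b j)]
    simp only [map_sum, map_smul, LinearMap.sum_apply, LinearMap.smul_apply, Finset.smul_sum]
    rw [Finset.sum_comm]
    refine Finset.sum_congr rfl fun k _ => Finset.sum_congr rfl fun l _ => ?_
    simp only [frameMatrix, Matrix.of_apply, Complex.real_smul]
    ring
  simp only [gramIn, Matrix.of_apply, h1, Matrix.mul_apply, Finset.sum_mul, gram,
    Matrix.transpose_apply, Matrix.map_apply]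
  rw [Finset.sum_comm]
  refine Finset.sum_congr rfl fun k _ => Finset.sum_congr rfl fun l _ => ?_
  ring

/-- The factor does not depend on the tensor field, so the quotient of the determinants of two
fields may be computed in any frame. -/
theorem det_gramIn {B : FormField I M} {p : M} (hB : IsBilinAt B p) (b : Fin d → TangentSpace I p) :
    (gramIn B p b).det = ((frameMatrix p b).det : ℂ) ^ 2 * (gram B p).det := by
  have : ((frameMatrix p b).map ((↑) : ℝ → ℂ)).det = ((frameMatrix p b).det : ℂ) :=
    (RingHom.map_det Complex.ofRealHom (frameMatrix p b)).symm
  rw [gramIn_eq hB, Matrix.det_mul, Matrix.det_mul, Matrix.det_transpose, this]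
  ring

/-- The pairing `∑ i, x i * conj ((Gᵀ)⁻¹ y) i`. -/
def matrixPairing (G : Matrix (Fin d) (Fin d) ℂ) (x y : Fin d → ℂ) : ℂ :=
  ∑ i, x i * conj ((Gᵀ⁻¹ *ᵥ y) i)

/-- By `sesq_sharp` the first field drops out of the pairing as soon as it is nondegenerate; only
the inverse matrix of the second one remains, and it may be taken in any frame. -/
theorem coInner_eq_matrixPairing {B B' : FormField I M} {p : M} (hB : (gram B p).det ≠ 0)
    (hB' : IsBilinAt B' p) {b : Fin d → TangentSpace I p} (hb : LinearIndependent ℝ b)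
    (ξ η : TangentSpace I p →L[ℝ] ℂ) :
    coInner B B' p ξ η = matrixPairing (gramIn B' p b) (fun i => ξ (b i)) (fun i => η (b i)) := by
  rw [coInner, sesq_sharp B p hB, matrixPairing]
  set P : Matrix (Fin d) (Fin d) ℂ := (frameMatrix p b).map ((↑) : ℝ → ℂ) with hP
  have hPdet : P.det ≠ 0 := by
    have : P.det = ((frameMatrix p b).det : ℂ) :=
      (RingHom.map_det Complex.ofRealHom (frameMatrix p b)).symm
    rw [this]
    exact_mod_cast det_frameMatrix_ne_zero hb
  have hPu : IsUnit P.det := isUnit_iff_ne_zero.2 hPdet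
  have h1 : (gramIn B' p b)ᵀ⁻¹ *ᵥ (fun i => η (b i)) = Pᵀ⁻¹ *ᵥ sharp B' p η := by
    rw [gramIn_eq hB', map_frame_eq p b η, ← hP, sharp, Matrix.mulVec_mulVec, Matrix.mulVec_mulVec]
    congr 1
    rw [Matrix.transpose_mul, Matrix.transpose_mul, Matrix.transpose_transpose, Matrix.mul_inv_rev,
      Matrix.mul_inv_rev, Matrix.mul_assoc, Matrix.mul_assoc, Matrix.nonsing_inv_mul _ hPu,
      Matrix.mul_one]
  rw [h1]
  have h2 : ∀ i, ξ (b i) = ∑ k, P i k * ξ (frame I p k) := fun i => congrFun (map_frame_eq p b ξ) i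
  have h3 : sharp B' p η = Pᵀ *ᵥ (Pᵀ⁻¹ *ᵥ sharp B' p η) := by
    rw [Matrix.mulVec_mulVec, Matrix.mul_nonsing_inv _ (by simpa using hPu), Matrix.one_mulVec]
  set w := Pᵀ⁻¹ *ᵥ sharp B' p η
  rw [h3]
  simp only [h2, Matrix.mulVec, dotProduct, map_sum, map_mul, Finset.mul_sum, Finset.sum_mul,
    Matrix.transpose_apply]
  rw [Finset.sum_comm]
  refine Finset.sum_congr rfl fun k _ => Finset.sum_congr rfl fun l _ => ?_
  -- Frame independence of the sesquilinear expression rests on P being real.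
  have : conj (P k l) = P k l := by simp [hP]
  rw [this]; ring

theorem matrixPairing_add_left (G : Matrix (Fin d) (Fin d) ℂ) (x x' y : Fin d → ℂ) :
    matrixPairing G (x + x') y = matrixPairing G x y + matrixPairing G x' y := by
  simp [matrixPairing, add_mul, Finset.sum_add_distrib]

theorem matrixPairing_smul_left (G : Matrix (Fin d) (Fin d) ℂ) (c : ℂ) (x y : Fin d → ℂ) :
    matrixPairing G (c • x) y = c * matrixPairing G x y := by
  simp [matrixPairing, mul_assoc, Finset.mul_sum]

theorem matrixPairing_add_right (G : Matrix (Fin d) (Fin d) ℂ) (x y y' : Fin d → ℂ) :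
    matrixPairing G x (y + y') = matrixPairing G x y + matrixPairing G x y' := by
  simp [matrixPairing, Matrix.mulVec_add, mul_add, Finset.sum_add_distrib]

theorem matrixPairing_smul_right (G : Matrix (Fin d) (Fin d) ℂ) (c : ℂ) (x y : Fin d → ℂ) :
    matrixPairing G x (c • y) = conj c * matrixPairing G x y := by
  simp only [matrixPairing, Matrix.mulVec_smul, Pi.smul_apply, smul_eq_mul, map_mul, Finset.mul_sum]
  refine Finset.sum_congr rfl fun i _ => by ring

theorem coInner_eq_pairing_gram (B B' : FormField I M) {p : M} (hB : (gram B p).det ≠ 0)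
    (ξ η : TangentSpace I p →L[ℝ] ℂ) :
    coInner B B' p ξ η = matrixPairing (gram B' p) (fun i => ξ (frame I p i))
      (fun i => η (frame I p i)) := by
  rw [coInner, sesq_sharp B p hB]; rfl

theorem coInner_add_left (B B' : FormField I M) {p : M} (hB : (gram B p).det ≠ 0)
    (ξ ξ' η : TangentSpace I p →L[ℝ] ℂ) :
    coInner B B' p (ξ + ξ') η = coInner B B' p ξ η + coInner B B' p ξ' η := by
  simp only [coInner_eq_pairing_gram B B' hB, ← matrixPairing_add_left]; rfl

theorem coInner_smul_left (B B' : FormField I M) {p : M} (hB : (gram B p).det ≠ 0) (c : ℂ)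
    (ξ η : TangentSpace I p →L[ℝ] ℂ) : coInner B B' p (c • ξ) η = c * coInner B B' p ξ η := by
  simp only [coInner_eq_pairing_gram B B' hB, ← matrixPairing_smul_left]; rfl

theorem coInner_add_right (B B' : FormField I M) {p : M} (hB : (gram B p).det ≠ 0)
    (ξ η η' : TangentSpace I p →L[ℝ] ℂ) :
    coInner B B' p ξ (η + η') = coInner B B' p ξ η + coInner B B' p ξ η' := by
  simp only [coInner_eq_pairing_gram B B' hB, ← matrixPairing_add_right]; rfl

theorem coInner_smul_right (B B' : FormField I M) {p : M} (hB : (gram B p).det ≠ 0) (c : ℂ)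
    (ξ η : TangentSpace I p →L[ℝ] ℂ) : coInner B B' p ξ (c • η) = conj c * coInner B B' p ξ η := by
  simp only [coInner_eq_pairing_gram B B' hB, ← matrixPairing_smul_right]; rfl

theorem linearIndependent_frame (p : M) : LinearIndependent ℝ (frame I p) := by
  have := (EuclideanSpace.basisFun (Fin d) ℝ).toBasis.linearIndependent
  have h : ⇑(EuclideanSpace.basisFun (Fin d) ℝ).toBasis = frame I p := by
    funext i; simp [frame]
  rwa [h] at this

end Frames

/-! ### Riemannian metrics on covectors -/

section MetricPairing

variable {d : ℕ} {H : Type*} [TopologicalSpace H]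
  {I : ModelWithCorners ℝ (EuclideanSpace ℝ (Fin d)) H}
  {M : Type*} [TopologicalSpace M] [ChartedSpace H M] [IsManifold I ∞ M]

theorem isBilinAt_ofMetric (g : Metric I M) (p : M) : IsBilinAt (ofMetric g) p :=
  ⟨LinearMap.mk₂ ℝ (fun v w => ((g.inner p v w : ℝ) : ℂ)) (by simp) (by simp) (by simp) (by simp),
    fun _ _ => rfl⟩

/-- The real matrix of a metric with respect to the vectors `b`. -/
def realGram (g : Metric I M) (p : M) (b : Fin d → TangentSpace I p) : Matrix (Fin d) (Fin d) ℝ :=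
  Matrix.of fun i j => g.inner p (b i) (b j)

theorem gramIn_ofMetric (g : Metric I M) (p : M) (b : Fin d → TangentSpace I p) :
    gramIn (ofMetric g) p b = (realGram g p b).map ((↑) : ℝ → ℂ) := rfl

theorem posDef_realGram (g : Metric I M) {p : M} {b : Fin d → TangentSpace I p}
    (hb : LinearIndependent ℝ b) : (realGram g p b).PosDef := by
  refine Matrix.PosDef.of_dotProduct_mulVec_pos ?_ fun x hx => ?_
  · ext i j
    simpa [realGram] using g.symm p (b j) (b i)
  · have h1 : star x ⬝ᵥ realGram g p b *ᵥ x = g.inner p (∑ i, x i • b i) (∑ i, x i • b i) := by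
      simp only [realGram, dotProduct, Matrix.mulVec, Matrix.of_apply, map_sum, map_smul,
        _root_.sum_apply, _root_.smul_apply, Finset.mul_sum, smul_eq_mul,
        Pi.star_apply, star_trivial]
      rw [Finset.sum_comm]
      refine Finset.sum_congr rfl fun i _ => Finset.sum_congr rfl fun j _ => by ring
    rw [h1]
    refine g.pos p _ fun h0 => hx ?_
    exact funext (Fintype.linearIndependent_iff.1 hb x h0)

theorem det_gram_ofMetric_ne_zero (g : Metric I M) (p : M) : (gram (ofMetric g) p).det ≠ 0 := by
  have h1 : gram (ofMetric g) p = (realGram g p (frame I p)).map ((↑) : ℝ → ℂ) := rfl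
  have h2 : (gram (ofMetric g) p).det = ((realGram g p (frame I p)).det : ℂ) := by
    rw [h1]; exact (RingHom.map_det Complex.ofRealHom _).symm
  rw [h2]
  exact_mod_cast (posDef_realGram g (linearIndependent_frame p)).det_pos.ne'

open scoped MatrixOrder in
-- The inverse Gram matrix is positive, hence of the form AᵀA with A real, and ξ ↦ Aξ transports the
-- pairing to the standard inner product. Cauchy–Schwarz for covectors then comes for free.
theorem exists_covector_isometry (g : Metric I M) (p : M) :
    ∃ L : (TangentSpace I p →L[ℝ] ℂ) →ₗ[ℂ] EuclideanSpace ℂ (Fin d), ∀ ξ η,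
      coInner (ofMetric g) (ofMetric g) p ξ η = inner ℂ (L η) (L ξ) := by
  set G := realGram g p (frame I p)
  have hG : G.PosDef := posDef_realGram g (linearIndependent_frame p)
  obtain ⟨A, hA⟩ := CStarAlgebra.nonneg_iff_eq_star_mul_self.1 hG.inv.posSemidef.nonneg
  refine ⟨{ toFun := fun ξ => WithLp.toLp 2 (A.map ((↑) : ℝ → ℂ) *ᵥ fun i => ξ (frame I p i))
            map_add' := fun ξ η => ?_
            map_smul' := fun c ξ => ?_ }, fun ξ η => ?_⟩
  · rw [← WithLp.toLp_add, ← Matrix.mulVec_add]; rfl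
  · rw [RingHom.id_apply, ← WithLp.toLp_smul, ← Matrix.mulVec_smul]; rfl
  · rw [coInner_eq_pairing_gram _ _ (det_gram_ofMetric_ne_zero g p)]
    have h1 : gram (ofMetric g) p = G.map ((↑) : ℝ → ℂ) := rfl
    have h2 : (gram (ofMetric g) p)ᵀ⁻¹ = (A.map ((↑) : ℝ → ℂ))ᵀ * (A.map ((↑) : ℝ → ℂ)) := by
      have h3 : Gᵀ = G := by simpa using hG.isHermitian.eq
      have h4 : (G.map ((↑) : ℝ → ℂ))⁻¹ = (G⁻¹).map ((↑) : ℝ → ℂ) := by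
        refine Matrix.inv_eq_left_inv ?_
        have := congrArg (fun N : Matrix (Fin d) (Fin d) ℝ => N.map Complex.ofRealHom)
          (Matrix.nonsing_inv_mul G (isUnit_iff_ne_zero.2 hG.det_pos.ne'))
        simp only [Matrix.map_mul] at this
        exact this.trans (Matrix.map_one _ (map_zero _) (map_one _))
      rw [h1, ← Matrix.transpose_map, h3, h4, hA, Matrix.star_eq_conjTranspose, Matrix.conjTranspose_eq_transpose_of_trivial,
        ← Matrix.transpose_map]
      exact Matrix.map_mul (f := Complex.ofRealHom)
    rw [matrixPairing, h2, ← Matrix.mulVec_mulVec]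
    set x := fun i => ξ (frame I p i)
    set y := A.map ((↑) : ℝ → ℂ) *ᵥ fun i => η (frame I p i)
    simp only [LinearMap.coe_mk, AddHom.coe_mk, EuclideanSpace.inner_eq_star_dotProduct,
      dotProduct, Matrix.mulVec, Matrix.transpose_apply, Matrix.map_apply, map_sum, map_mul,
      Finset.mul_sum, Finset.sum_mul, Complex.conj_ofReal]
    rw [Finset.sum_comm]
    refine Finset.sum_congr rfl fun i _ => Finset.sum_congr rfl fun j _ => ?_
    simp; ring

/-- A linear map identifying the Hermitian metric on complex covectors at `p` with the standard
one. -/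
def covMap (g : Metric I M) (p : M) :
    (TangentSpace I p →L[ℝ] ℂ) →ₗ[ℂ] EuclideanSpace ℂ (Fin d) :=
  (exists_covector_isometry g p).choose

theorem coInner_ofMetric (g : Metric I M) (p : M) (ξ η : TangentSpace I p →L[ℝ] ℂ) :
    coInner (ofMetric g) (ofMetric g) p ξ η = inner ℂ (covMap g p η) (covMap g p ξ) :=
  (exists_covector_isometry g p).choose_spec ξ η

/-- The length of a complex covector. -/
def covNorm (g : Metric I M) (p : M) (ξ : TangentSpace I p →L[ℝ] ℂ) : ℝ := ‖covMap g p ξ‖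

theorem coInner_ofMetric_self (g : Metric I M) (p : M) (ξ : TangentSpace I p →L[ℝ] ℂ) :
    coInner (ofMetric g) (ofMetric g) p ξ ξ = ((covNorm g p ξ ^ 2 : ℝ) : ℂ) := by
  rw [coInner_ofMetric, inner_self_eq_norm_sq_to_K]; simp [covNorm]

theorem norm_coInner_ofMetric_le (g : Metric I M) (p : M) (ξ η : TangentSpace I p →L[ℝ] ℂ) :
    ‖coInner (ofMetric g) (ofMetric g) p ξ η‖ ≤ covNorm g p ξ * covNorm g p η := by
  rw [coInner_ofMetric, mul_comm]; exact norm_inner_le_norm _ _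

theorem covNorm_nonneg (g : Metric I M) (p : M) (ξ : TangentSpace I p →L[ℝ] ℂ) :
    0 ≤ covNorm g p ξ := norm_nonneg _

theorem covNorm_zero (g : Metric I M) (p : M) : covNorm g p 0 = 0 := by simp [covNorm]

end MetricPairing

/-! ### Coordinate frames -/

section Coordinates

variable {d : ℕ} {H : Type*} [TopologicalSpace H]
  {I : ModelWithCorners ℝ (EuclideanSpace ℝ (Fin d)) H}
  {M : Type*} [TopologicalSpace M] [ChartedSpace H M] [IsManifold I ∞ M]

theorem contMDiffOn_pushforward {F : Type*} [NormedAddCommGroup F] [NormedSpace ℝ F] {ψ : F → M}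
    {S : Set F} (hψ : ContMDiffOn 𝓘(ℝ, F) I ∞ ψ S) (hS : UniqueDiffOn ℝ S) (w : F) :
    ContMDiffOn 𝓘(ℝ, F) I.tangent ∞
      (fun u => (⟨ψ u, mfderivWithin 𝓘(ℝ, F) I ψ S u w⟩ : TangentBundle I M)) S := by
  have h1 := hψ.contMDiffOn_tangentMapWithin (m := ∞) (by simp) hS.uniqueMDiffOn
  have h2 : ContMDiffOn 𝓘(ℝ, F) 𝓘(ℝ, F).tangent ∞
      (fun u => (⟨u, w⟩ : TangentBundle 𝓘(ℝ, F) F)) S :=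
    contMDiffOn_vectorSpace_iff_contDiffOn.2 contDiffOn_const
  exact h1.comp h2 fun u hu => hu

theorem contDiffOn_metric_pushforward (g : Metric I M) {F : Type*} [NormedAddCommGroup F]
    [NormedSpace ℝ F] {ψ : F → M}
    {S : Set F} (hψ : ContMDiffOn 𝓘(ℝ, F) I ∞ ψ S) (hS : UniqueDiffOn ℝ S) (w w' : F) :
    ContDiffOn ℝ ∞ (fun u => g.inner (ψ u) (mfderivWithin 𝓘(ℝ, F) I ψ S u w)
      (mfderivWithin 𝓘(ℝ, F) I ψ S u w')) S := by
  rw [← contMDiffOn_iff_contDiffOn]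
  intro u hu
  have hg : ContMDiffAt I (I.prod 𝓘(ℝ, EuclideanSpace ℝ (Fin d) →L[ℝ] EuclideanSpace ℝ (Fin d) →L[ℝ] ℝ)) ∞
      (fun b => Bundle.TotalSpace.mk' (EuclideanSpace ℝ (Fin d) →L[ℝ] EuclideanSpace ℝ (Fin d) →L[ℝ] ℝ) b
        (g.inner b)) (ψ u) := g.contMDiff.contMDiffAt
  have : ContMDiffWithinAt 𝓘(ℝ, F) (I.prod 𝓘(ℝ)) ∞
      (fun m ↦ Bundle.TotalSpace.mk' ℝ (E := Bundle.Trivial M ℝ) (ψ m)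
        (g.inner (ψ m) (mfderivWithin 𝓘(ℝ, F) I ψ S m w) (mfderivWithin 𝓘(ℝ, F) I ψ S m w'))) S u := by
    apply ContMDiffWithinAt.clm_bundle_apply₂ (F₁ := EuclideanSpace ℝ (Fin d))
      (F₂ := EuclideanSpace ℝ (Fin d))
    · exact ContMDiffAt.comp_contMDiffWithinAt u hg (hψ u hu)
    · exact contMDiffOn_pushforward hψ hS w u hu
    · exact contMDiffOn_pushforward hψ hS w' u hu
  simp only [Bundle.contMDiffWithinAt_totalSpace] at this
  exact this.2

/-- Near such a point the two sets have the same germ, so derivatives within them agree. Coordinate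
vectors are defined within the range of the model, while smoothness is known within the chart image.
-/
theorem target_eventuallyEq_range (p₀ : M) {u : EuclideanSpace ℝ (Fin d)}
    (hu : u ∈ (extChartAt I p₀).target) : (extChartAt I p₀).target =ᶠ[𝓝 u] range I := by
  have h : (extChartAt I p₀).target ∈ 𝓝[range I] u := extChartAt_target_mem_nhdsWithin_of_mem hu
  rw [mem_nhdsWithin] at h
  obtain ⟨U, hU, huU, hsub⟩ := h
  filter_upwards [hU.mem_nhds huU] with x hx
  exact propext ⟨fun h => extChartAt_target_subset_range p₀ h, fun h => hsub ⟨hx, h⟩⟩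

theorem coordVec_eq_target (p₀ : M) {u : EuclideanSpace ℝ (Fin d)}
    (hu : u ∈ (extChartAt I p₀).target) (i : Fin d) :
    coordVec I p₀ u i = mfderivWithin 𝓘(ℝ, EuclideanSpace ℝ (Fin d)) I (extChartAt I p₀).symm
      (extChartAt I p₀).target u (EuclideanSpace.single i (1 : ℝ)) := by
  rw [coordVec, mfderivWithin_congr_set (target_eventuallyEq_range p₀ hu)]

theorem contDiffOn_metric_coordVec (g : Metric I M) (p₀ : M) (i j : Fin d) :
    ContDiffOn ℝ ∞ (fun u => g.inner ((extChartAt I p₀).symm u) (coordVec I p₀ u i)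
      (coordVec I p₀ u j)) (extChartAt I p₀).target := by
  refine (contDiffOn_metric_pushforward g (contMDiffOn_extChartAt_symm p₀)
    (uniqueDiffOn_extChartAt_target p₀) (EuclideanSpace.single i 1)
    (EuclideanSpace.single j 1)).congr fun u hu => ?_
  rw [coordVec_eq_target p₀ hu, coordVec_eq_target p₀ hu]

theorem linearIndependent_coordVec (p₀ : M) {u : EuclideanSpace ℝ (Fin d)}
    (hu : u ∈ (extChartAt I p₀).target) : LinearIndependent ℝ (coordVec I p₀ u) := by
  have h1 := (EuclideanSpace.basisFun (Fin d) ℝ).toBasis.linearIndependent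
  obtain ⟨e, he⟩ := isInvertible_mfderivWithin_extChartAt_symm (I := I) hu
  have h2 := h1.map' e.toLinearMap (LinearMap.ker_eq_bot.2 e.injective)
  have h3 : coordVec I p₀ u = ⇑e.toLinearMap ∘ ⇑(EuclideanSpace.basisFun (Fin d) ℝ).toBasis := ?_
  · rw [h3]; exact h2
  funext i
  have h4 : (EuclideanSpace.basisFun (Fin d) ℝ).toBasis i = EuclideanSpace.single i 1 := by simp
  rw [coordVec, ← he, ← h4]
  rfl

theorem diff_coordVec {u : M → ℂ} (p₀ : M) {q : EuclideanSpace ℝ (Fin d)}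
    (hq : q ∈ (extChartAt I p₀).target)
    (hu : MDifferentiableAt I 𝓘(ℝ, ℂ) u ((extChartAt I p₀).symm q)) (i : Fin d) :
    diff I u ((extChartAt I p₀).symm q) (coordVec I p₀ q i)
      = fderivWithin ℝ (u ∘ (extChartAt I p₀).symm) (extChartAt I p₀).target q
        (EuclideanSpace.single i 1) := by
  have h1 := mfderiv_comp_mfderivWithin q hu (mdifferentiableWithinAt_extChartAt_symm hq)
    (I.uniqueDiffOn.uniqueMDiffOn q (extChartAt_target_subset_range p₀ hq))
  rw [mfderivWithin_eq_fderivWithin] at h1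
  rw [fderivWithin_congr_set (target_eventuallyEq_range p₀ hq)]
  rw [h1]; rfl

end Coordinates

/-! ### The Riemannian volume in charts -/

section Volume

variable {d : ℕ} {H : Type*} [TopologicalSpace H]
  {I : ModelWithCorners ℝ (EuclideanSpace ℝ (Fin d)) H}
  {M : Type*} [TopologicalSpace M] [ChartedSpace H M] [IsManifold I ∞ M]

theorem clm_map_sum_smul {V W ι : Type*} [AddCommGroup V] [Module ℝ V] [TopologicalSpace V]
    [AddCommGroup W] [Module ℝ W] [TopologicalSpace W] [Fintype ι] (L : V →L[ℝ] W) (c : ι → ℝ)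
    (b : ι → V) : L (∑ k, c k • b k) = ∑ k, c k • L (b k) := by
  simp

theorem matrix_of_bilin_comb {V : Type*} [NormedAddCommGroup V] [NormedSpace ℝ V]
    (β : V →L[ℝ] V →L[ℝ] ℝ) {a b : Fin d → V} (Q : Matrix (Fin d) (Fin d) ℝ)
    (h : ∀ i, a i = ∑ k, Q k i • b k) :
    (Matrix.of fun i j => β (a i) (a j)) = Qᵀ * (Matrix.of fun i j => β (b i) (b j)) * Q := by
  ext i j
  simp only [Matrix.of_apply, Matrix.mul_apply, Matrix.transpose_apply, h, map_sum, map_smul,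
    _root_.sum_apply, _root_.smul_apply, smul_eq_mul, Finset.sum_mul, Finset.mul_sum]
  refine Finset.sum_congr rfl fun l _ => Finset.sum_congr rfl fun k _ => by ring

theorem inner_congr_point (g : Metric I M) {p p' : M} (h : p = p') (x y : EuclideanSpace ℝ (Fin d)) :
    g.inner p (show TangentSpace I p from x) (show TangentSpace I p from y)
      = g.inner p' (show TangentSpace I p' from x) (show TangentSpace I p' from y) := by
  subst h; rfl

/-- The density of the Riemannian volume in the chart at `p₀`. -/
def chartDensity (g : Metric I M) (p₀ : M) (u : EuclideanSpace ℝ (Fin d)) : ℝ :=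
  Real.sqrt (realGram g ((extChartAt I p₀).symm u) (coordVec I p₀ u)).det

theorem continuousOn_chartDensity (g : Metric I M) (p₀ : M) :
    ContinuousOn (chartDensity g p₀) (extChartAt I p₀).target := by
  have : ContinuousOn (fun u => realGram g ((extChartAt I p₀).symm u) (coordVec I p₀ u))
      (extChartAt I p₀).target :=
    continuousOn_pi.2 fun i => continuousOn_pi.2 fun j =>
      (contDiffOn_metric_coordVec g p₀ i j).continuousOn
  exact Real.continuous_sqrt.comp_continuousOn (continuous_id.matrix_det.comp_continuousOn this)

theorem chartDensity_pos (g : Metric I M) (p₀ : M) {u : EuclideanSpace ℝ (Fin d)}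
    (hu : u ∈ (extChartAt I p₀).target) : 0 < chartDensity g p₀ u :=
  Real.sqrt_pos.2 (posDef_realGram g (linearIndependent_coordVec p₀ hu)).det_pos

/-- The Jacobian of a change of charts carries one coordinate frame to the other; all derivatives
are within the range of the model, so boundary points are included. -/
theorem fderivWithin_transition (p₀ p₁ : M) {u : EuclideanSpace ℝ (Fin d)}
    (hu : u ∈ (extChartAt I p₁).target) (hu₀ : (extChartAt I p₁).symm u ∈ (extChartAt I p₀).source) :
    DifferentiableWithinAt ℝ (extChartAt I p₀ ∘ (extChartAt I p₁).symm) (range I) u ∧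
    ∀ w, mfderivWithin 𝓘(ℝ, EuclideanSpace ℝ (Fin d)) I (extChartAt I p₀).symm (range I)
        (extChartAt I p₀ ((extChartAt I p₁).symm u))
        (fderivWithin ℝ (extChartAt I p₀ ∘ (extChartAt I p₁).symm) (range I) u w)
      = (mfderivWithin 𝓘(ℝ, EuclideanSpace ℝ (Fin d)) I (extChartAt I p₁).symm (range I) u w :
          EuclideanSpace ℝ (Fin d)) := by
  have hs := mdifferentiableWithinAt_extChartAt_symm (I := I) hu
  have h0 : MDifferentiableAt I 𝓘(ℝ, EuclideanSpace ℝ (Fin d)) (extChartAt I p₀)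
      ((extChartAt I p₁).symm u) :=
    mdifferentiableAt_extChartAt (by rwa [extChartAt_source] at hu₀)
  refine ⟨(h0.comp_mdifferentiableWithinAt u hs).differentiableWithinAt, fun w => ?_⟩
  have h1 := mfderiv_comp_mfderivWithin u h0 hs
    (I.uniqueDiffOn.uniqueMDiffOn u (extChartAt_target_subset_range p₁ hu))
  rw [mfderivWithin_eq_fderivWithin] at h1
  rw [h1]
  have h2 := mfderivWithin_extChartAt_symm_comp_mfderiv_extChartAt' (I := I) hu₀
  exact congrArg (fun L : EuclideanSpace ℝ (Fin d) →L[ℝ] EuclideanSpace ℝ (Fin d) =>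
    L (mfderivWithin 𝓘(ℝ, EuclideanSpace ℝ (Fin d)) I (extChartAt I p₁).symm (range I) u w)) h2

/-- The Gram matrices are related by QᵀGQ with Q the Jacobian matrix, so the square root of the
determinant picks up |det Q|. -/
theorem chartDensity_transition (g : Metric I M) (p₀ p₁ : M) {u : EuclideanSpace ℝ (Fin d)}
    (hu : u ∈ (extChartAt I p₁).target) (hu₀ : (extChartAt I p₁).symm u ∈ (extChartAt I p₀).source) :
    chartDensity g p₁ u
      = |(fderivWithin ℝ (extChartAt I p₀ ∘ (extChartAt I p₁).symm) (range I) u).det| *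
        chartDensity g p₀ (extChartAt I p₀ ((extChartAt I p₁).symm u)) := by
  set τ' := fderivWithin ℝ (extChartAt I p₀ ∘ (extChartAt I p₁).symm) (range I) u with hτ
  set v := extChartAt I p₀ ((extChartAt I p₁).symm u) with hv
  have hp : (extChartAt I p₀).symm v = (extChartAt I p₁).symm u := (extChartAt I p₀).left_inv hu₀
  let Q : Matrix (Fin d) (Fin d) ℝ := LinearMap.toMatrix (EuclideanSpace.basisFun (Fin d) ℝ).toBasis
    (EuclideanSpace.basisFun (Fin d) ℝ).toBasis (τ' : EuclideanSpace ℝ (Fin d) →ₗ[ℝ] _)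
  have hQ : Q.det = τ'.det := LinearMap.det_toMatrix _ _
  have hvec : ∀ i, (coordVec I p₁ u i : EuclideanSpace ℝ (Fin d))
      = ∑ k, Q k i • (coordVec I p₀ v k : EuclideanSpace ℝ (Fin d)) := by
    intro i
    have h1 := (fderivWithin_transition p₀ p₁ hu hu₀).2 (EuclideanSpace.single i 1)
    refine h1.symm.trans ?_
    have h2 : τ' (EuclideanSpace.single i 1) = ∑ k, Q k i • EuclideanSpace.single k (1 : ℝ) := by
      have := (EuclideanSpace.basisFun (Fin d) ℝ).toBasis.sum_repr (τ' (EuclideanSpace.single i 1))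
      rw [← this]
      refine Finset.sum_congr rfl fun k _ => ?_
      simp [Q, LinearMap.toMatrix_apply]
    rw [← hτ, h2]
    exact clm_map_sum_smul (mfderivWithin 𝓘(ℝ, EuclideanSpace ℝ (Fin d)) I (extChartAt I p₀).symm
      (range I) v) (fun k => Q k i) fun k => EuclideanSpace.single k (1 : ℝ)
  have hG : realGram g ((extChartAt I p₁).symm u) (coordVec I p₁ u)
      = Qᵀ * realGram g ((extChartAt I p₀).symm v) (coordVec I p₀ v) * Q := by
    have h1 : realGram g ((extChartAt I p₁).symm u) (coordVec I p₁ u) = Matrix.of fun i j =>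
        g.inner ((extChartAt I p₀).symm v) (coordVec I p₁ u i) (coordVec I p₁ u j) := by
      ext i j
      exact inner_congr_point g hp.symm (coordVec I p₁ u i) (coordVec I p₁ u j)
    let β : EuclideanSpace ℝ (Fin d) →L[ℝ] EuclideanSpace ℝ (Fin d) →L[ℝ] ℝ :=
      g.inner ((extChartAt I p₀).symm v)
    have h2 := matrix_of_bilin_comb (V := EuclideanSpace ℝ (Fin d)) β Q hvec
    exact h1.trans h2
  rw [chartDensity, hG, Matrix.det_mul, Matrix.det_mul, Matrix.det_transpose, hQ, chartDensity]
  rw [show ∀ a b : ℝ, a * b * a = a ^ 2 * b by intros; ring, Real.sqrt_mul (sq_nonneg _),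
    Real.sqrt_sq_eq_abs]

variable [MeasurableSpace M] [BorelSpace M]

theorem measurableSet_extChartAt_target (p₀ : M) : MeasurableSet (extChartAt I p₀).target := by
  rw [extChartAt_target]
  exact ((chartAt H p₀).open_target.preimage I.continuous_symm).measurableSet.inter
    I.isClosed_range.measurableSet

theorem measurableSet_target_inter_preimage (p₀ : M) {A : Set M} (hA : MeasurableSet A) :
    MeasurableSet ((extChartAt I p₀).target ∩ (extChartAt I p₀).symm ⁻¹' A) := by
  have h := (continuousOn_iff_continuous_domRestrict.1
    (continuousOn_extChartAt_symm (I := I) p₀)).measurable hA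
  have := (MeasurableEmbedding.subtype_coe (measurableSet_extChartAt_target (I := I) p₀)).measurableSet_image.2 h
  convert this using 1
  ext x; simp [and_comm]

theorem aemeasurable_extChartAt_symm (p₀ : M) :
    AEMeasurable (extChartAt I p₀).symm (volume.restrict (extChartAt I p₀).target) := by
  have h : Measurable ((extChartAt I p₀).target.domRestrict (extChartAt I p₀).symm) :=
    (continuousOn_iff_continuous_domRestrict.1
    (continuousOn_extChartAt_symm (I := I) p₀)).measurable
  exact (aemeasurable_restrict_iff_comap_subtype (measurableSet_extChartAt_target (I := I) p₀)).2
    h.aemeasurable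

theorem lintegral_chartVolume (g : Metric I M) (p₀ : M) {f : M → ℝ≥0∞} (hf : Measurable f) :
    ∫⁻ p, f p ∂chartVolume g p₀ = ∫⁻ u in (extChartAt I p₀).target,
      ENNReal.ofReal (chartDensity g p₀ u) * f ((extChartAt I p₀).symm u) := by
  have hd : AEMeasurable (fun u => ENNReal.ofReal (chartDensity g p₀ u))
      (volume.restrict (extChartAt I p₀).target) :=
    ((continuousOn_chartDensity g p₀).aemeasurable
      (measurableSet_extChartAt_target p₀)).ennreal_ofReal
  have hψ := aemeasurable_extChartAt_symm (I := I) p₀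
  have : chartVolume g p₀ = Measure.map (extChartAt I p₀).symm
    ((volume.restrict (extChartAt I p₀).target).withDensity fun u =>
      ENNReal.ofReal (chartDensity g p₀ u)) := rfl
  rw [this, lintegral_map' hf.aemeasurable (hψ.mono_ac (withDensity_absolutelyContinuous _ _)),
    lintegral_withDensity_eq_lintegral_mul₀ hd
      (g := fun u => f ((extChartAt I p₀).symm u)) (hf.comp_aemeasurable hψ)]
  rfl

theorem chartVolume_apply (g : Metric I M) (p₀ : M) {A : Set M} (hA : MeasurableSet A) :
    chartVolume g p₀ A = ∫⁻ u in (extChartAt I p₀).target ∩ (extChartAt I p₀).symm ⁻¹' A,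
      ENNReal.ofReal (chartDensity g p₀ u) := by
  have hψ := aemeasurable_extChartAt_symm (I := I) p₀
  have : chartVolume g p₀ = Measure.map (extChartAt I p₀).symm
    ((volume.restrict (extChartAt I p₀).target).withDensity fun u =>
      ENNReal.ofReal (chartDensity g p₀ u)) := rfl
  rw [this, Measure.map_apply_of_aemeasurable (hψ.mono_ac (withDensity_absolutelyContinuous _ _)) hA,
    withDensity_apply', Measure.restrict_restrict' (measurableSet_extChartAt_target p₀), inter_comm]

/-- Change of variables along the chart transition; the Jacobian cancels against the transformation
of the densities. -/
theorem chartVolume_eq_of_subset (g : Metric I M) (p₀ p₁ : M) {A : Set M} (hA : MeasurableSet A)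
    (h₀ : A ⊆ (extChartAt I p₀).source) (h₁ : A ⊆ (extChartAt I p₁).source) :
    chartVolume g p₁ A = chartVolume g p₀ A := by
  rw [chartVolume_apply g p₁ hA, chartVolume_apply g p₀ hA]
  set S := (extChartAt I p₁).target ∩ (extChartAt I p₁).symm ⁻¹' A with hS
  set τ := extChartAt I p₀ ∘ (extChartAt I p₁).symm with hτ
  have himg : (extChartAt I p₀).target ∩ (extChartAt I p₀).symm ⁻¹' A = τ '' S := by
    ext v
    constructor
    · rintro ⟨hv, hvA⟩
      have h2 := h₁ hvA
      refine ⟨extChartAt I p₁ ((extChartAt I p₀).symm v), ⟨(extChartAt I p₁).map_source h2, ?_⟩, ?_⟩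
      · rw [mem_preimage, (extChartAt I p₁).left_inv h2]; exact hvA
      · rw [hτ, Function.comp_apply, (extChartAt I p₁).left_inv h2, (extChartAt I p₀).right_inv hv]
    · rintro ⟨u, ⟨hu, huA⟩, rfl⟩
      refine ⟨(extChartAt I p₀).map_source (h₀ huA), ?_⟩
      rw [mem_preimage, hτ, Function.comp_apply, (extChartAt I p₀).left_inv (h₀ huA)]
      exact huA
  have hSm : MeasurableSet S := measurableSet_target_inter_preimage p₁ hA
  rw [himg, lintegral_image_eq_lintegral_abs_det_fderiv_mul volume hSm
    (f' := fun u => fderivWithin ℝ τ (range I) u)]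
  · refine setLIntegral_congr_fun hSm fun u hu => ?_
    rw [chartDensity_transition g p₀ p₁ hu.1 (h₀ hu.2), ENNReal.ofReal_mul (abs_nonneg _)]
    rfl
  · intro u hu
    exact ((fderivWithin_transition p₀ p₁ hu.1 (h₀ hu.2)).1.hasFDerivWithinAt).mono
      (inter_subset_left.trans (extChartAt_target_subset_range p₁))
  · intro u hu u' hu' h
    have h2 := (extChartAt I p₀).injOn (h₀ hu.2) (h₀ hu'.2) h
    exact (extChartAt I p₁).symm.injOn hu.1 hu'.1 h2

theorem chartVolume_compl_source (g : Metric I M) (p₀ : M) :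
    chartVolume g p₀ (extChartAt I p₀).sourceᶜ = 0 := by
  rw [chartVolume_apply g p₀ (isOpen_extChartAt_source p₀).measurableSet.compl]
  have : (extChartAt I p₀).target ∩ (extChartAt I p₀).symm ⁻¹' (extChartAt I p₀).sourceᶜ = ∅ := by
    ext u
    simp only [mem_inter_iff, mem_preimage, mem_compl_iff, mem_empty_iff_false, iff_false, not_and,
      not_not]
    exact fun hu => (extChartAt I p₀).map_target hu
  rw [this]; simp

/-- The supremum that defines the volume creates no extra mass inside a chart, because chart
measures agree on overlaps and vanish outside their charts. -/
theorem riemannianVolume_restrict_source (g : Metric I M) (p₀ : M) :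
    (riemannianVolume g).restrict (extChartAt I p₀).source = chartVolume g p₀ := by
  have hs : MeasurableSet (extChartAt I p₀).source := (isOpen_extChartAt_source p₀).measurableSet
  -- The right side dominates every chart measure, hence their supremum; restriction to the chart
  -- domain then removes its second term.
  have hle : riemannianVolume g ≤ chartVolume g p₀ +
      (riemannianVolume g).restrict (extChartAt I p₀).sourceᶜ := by
    refine iSup_le fun p₁ => ?_
    refine Measure.le_iff.2 fun A hA => ?_
    rw [← measure_inter_add_sdiff A hs, Measure.add_apply, Measure.restrict_apply hA]
    refine add_le_add ?_ ?_
    · have h2 : chartVolume g p₁ (A ∩ (extChartAt I p₀).source)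
          = chartVolume g p₁ (A ∩ (extChartAt I p₀).source ∩ (extChartAt I p₁).source) := by
        refine le_antisymm ?_ (measure_mono inter_subset_left)
        have := measure_inter_add_sdiff (μ := chartVolume g p₁) (A ∩ (extChartAt I p₀).source)
          (isOpen_extChartAt_source (I := I) p₁).measurableSet
        rw [← this]
        have h3 : chartVolume g p₁ ((A ∩ (extChartAt I p₀).source) \ (extChartAt I p₁).source) = 0 :=
          measure_mono_null (fun x hx => hx.2) (chartVolume_compl_source g p₁)
        rw [h3, add_zero]
      rw [h2, chartVolume_eq_of_subset g p₀ p₁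
        ((hA.inter hs).inter (isOpen_extChartAt_source p₁).measurableSet)
        (inter_subset_left.trans inter_subset_right) inter_subset_right]
      exact measure_mono (inter_subset_left.trans inter_subset_left)
    · rw [← sdiff_eq]
      exact (le_iSup (fun p => chartVolume g p) p₁) _
  refine le_antisymm ?_ ?_
  · have h1 := Measure.restrict_mono_measure hle (extChartAt I p₀).source
    rw [Measure.restrict_add, Measure.restrict_restrict hs, inter_compl_self,
      Measure.restrict_empty, add_zero] at h1
    exact h1.trans Measure.restrict_le_self
  · refine Measure.le_iff.2 fun A hA => ?_
    rw [Measure.restrict_apply hA, ← measure_inter_add_sdiff A hs]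
    have h3 : chartVolume g p₀ (A \ (extChartAt I p₀).source) = 0 :=
      measure_mono_null (fun x hx => hx.2) (chartVolume_compl_source g p₀)
    rw [h3, add_zero]
    exact (le_iSup (fun p => chartVolume g p) p₀) _

/-- The density is continuous, hence bounded near the point, and a coordinate ball has finite
Lebesgue measure. -/
theorem exists_nhds_riemannianVolume_lt_top (g : Metric I M) (p₀ : M) :
    ∃ U ∈ 𝓝 p₀, riemannianVolume g U < ⊤ := by
  have hsrc := extChartAt_source_mem_nhds (I := I) p₀
  have hc := (continuousOn_chartDensity g p₀) (extChartAt I p₀ p₀) (mem_extChartAt_target p₀)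
  have h1 : ∀ᶠ u in 𝓝[(extChartAt I p₀).target] (extChartAt I p₀ p₀),
      chartDensity g p₀ u < chartDensity g p₀ (extChartAt I p₀ p₀) + 1 :=
    hc.eventually_lt_const (lt_add_one _)
  rw [eventually_nhdsWithin_iff] at h1
  obtain ⟨ρ, hρ, hball⟩ := Metric.eventually_nhds_iff_ball.1 h1
  set c := chartDensity g p₀ (extChartAt I p₀ p₀) + 1
  refine ⟨(extChartAt I p₀).source ∩ extChartAt I p₀ ⁻¹' Metric.ball (extChartAt I p₀ p₀) ρ, ?_, ?_⟩
  · exact inter_mem hsrc ((continuousAt_extChartAt p₀).preimage_mem_nhds (Metric.ball_mem_nhds _ hρ))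
  · set U := (extChartAt I p₀).source ∩ extChartAt I p₀ ⁻¹' Metric.ball (extChartAt I p₀ p₀) ρ
    have hU : MeasurableSet U := (isOpen_extChartAt_preimage' p₀ Metric.isOpen_ball).measurableSet
    have h2 : riemannianVolume g U = chartVolume g p₀ U := by
      rw [← riemannianVolume_restrict_source, Measure.restrict_apply hU,
        inter_eq_self_of_subset_left inter_subset_left]
    rw [h2, chartVolume_apply g p₀ hU]
    calc ∫⁻ u in (extChartAt I p₀).target ∩ (extChartAt I p₀).symm ⁻¹' U,
          ENNReal.ofReal (chartDensity g p₀ u)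
        ≤ ∫⁻ u in (extChartAt I p₀).target ∩ (extChartAt I p₀).symm ⁻¹' U, ENNReal.ofReal c := by
          refine setLIntegral_mono' (measurableSet_target_inter_preimage p₀ hU) fun u hu => ?_
          refine ENNReal.ofReal_le_ofReal (hball u ?_ hu.1).le
          have := hu.2.2
          rwa [mem_preimage, (extChartAt I p₀).right_inv hu.1] at this
      _ ≤ ∫⁻ u in Metric.ball (extChartAt I p₀ p₀) ρ, ENNReal.ofReal c := by
          refine lintegral_mono_set fun u hu => ?_
          have := hu.2.2
          rwa [mem_preimage, (extChartAt I p₀).right_inv hu.1] at this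
      _ < ⊤ := by
          rw [setLIntegral_const]
          exact ENNReal.mul_lt_top ENNReal.ofReal_lt_top measure_ball_lt_top

instance isLocallyFiniteMeasure_riemannianVolume (g : Metric I M) :
    IsLocallyFiniteMeasure (riemannianVolume g) :=
  ⟨exists_nhds_riemannianVolume_lt_top g⟩

end Volume

/-! ### Differentials of functions -/

section Differentials

variable {d : ℕ} {H : Type*} [TopologicalSpace H]
  {I : ModelWithCorners ℝ (EuclideanSpace ℝ (Fin d)) H}
  {M : Type*} [TopologicalSpace M] [ChartedSpace H M]

theorem diff_add {u v : M → ℂ} {p : M} (hu : MDifferentiableAt I 𝓘(ℝ, ℂ) u p)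
    (hv : MDifferentiableAt I 𝓘(ℝ, ℂ) v p) : diff I (u + v) p = diff I u p + diff I v p :=
  (hu.hasMFDerivAt.add hv.hasMFDerivAt).mfderiv

theorem diff_mul {u v : M → ℂ} {p : M} (hu : MDifferentiableAt I 𝓘(ℝ, ℂ) u p)
    (hv : MDifferentiableAt I 𝓘(ℝ, ℂ) v p) :
    diff I (fun x => u x * v x) p = u p • diff I v p + v p • diff I u p :=
  (hu.hasMFDerivAt.mul hv.hasMFDerivAt).mfderiv

theorem diff_const (c : ℂ) (p : M) : diff I (fun _ : M => c) p = 0 := mfderiv_const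

theorem diff_smul {u : M → ℂ} {p : M} (hu : MDifferentiableAt I 𝓘(ℝ, ℂ) u p) (c : ℂ) :
    diff I (c • u) p = c • diff I u p := by
  have := diff_mul (mdifferentiableAt_const (c := c)) hu
  rw [diff_const] at this
  exact this.trans ((congrArg _ (smul_zero (u p))).trans (add_zero _))

theorem diff_congr {u v : M → ℂ} {p : M} (h : u =ᶠ[𝓝 p] v) : diff I u p = diff I v p :=
  h.mfderiv_eq

theorem diff_eq_zero_of_notMem_tsupport {u : M → ℂ} {p : M} (h : p ∉ tsupport u) :
    diff I u p = 0 := by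
  rw [diff_congr (notMem_tsupport_iff_eventuallyEq.1 h)]
  exact diff_const 0 p

theorem IsTest.mdifferentiableAt {u : M → ℂ} (hu : IsTest I u) (p : M) :
    MDifferentiableAt I 𝓘(ℝ, ℂ) u p := hu.1.mdifferentiableAt (by simp)

theorem IsTest.add {u v : M → ℂ} (hu : IsTest I u) (hv : IsTest I v) : IsTest I (u + v) :=
  ⟨hu.1.add hv.1, hu.2.add hv.2⟩

theorem contMDiffAt_mul_complex {u v : M → ℂ} {p : M} (hu : ContMDiffAt I 𝓘(ℝ, ℂ) ∞ u p)
    (hv : ContMDiffAt I 𝓘(ℝ, ℂ) ∞ v p) : ContMDiffAt I 𝓘(ℝ, ℂ) ∞ (fun x => u x * v x) p :=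
  ((contDiff_mul (𝕜 := ℝ) (𝔸 := ℂ)).contMDiff.contMDiffAt (x := (u p, v p))).comp p
    (hu.prodMk_space hv)

theorem IsTest.mul_left {u w : M → ℂ} (hu : IsTest I u) (hw : ContMDiff I 𝓘(ℝ, ℂ) ∞ w) :
    IsTest I (fun p => w p * u p) :=
  ⟨fun p => contMDiffAt_mul_complex (hw p) (hu.1 p), hu.2.mul_left⟩

theorem IsTest.smul {u : M → ℂ} (hu : IsTest I u) (c : ℂ) : IsTest I (c • u) :=
  hu.mul_left contMDiff_const

theorem IsTest.zero : IsTest I (0 : M → ℂ) :=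
  ⟨contMDiff_const, HasCompactSupport.zero⟩

end Differentials

/-! ### Continuity of the inverse-matrix pairing -/

section PairingContinuity

variable {d : ℕ}

theorem continuousOn_matrix_inv {Y : Type*} [TopologicalSpace Y] {S : Set Y}
    {G : Y → Matrix (Fin d) (Fin d) ℂ} (hG : ContinuousOn G S) (hdet : ∀ y ∈ S, (G y).det ≠ 0) :
    ContinuousOn (fun y => (G y)⁻¹) S := by
  simp only [Matrix.inv_def, Ring.inverse_eq_inv']
  exact ((continuous_id.matrix_det.comp_continuousOn hG).inv₀ hdet).smul
    (continuous_id.matrix_adjugate.comp_continuousOn hG)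

theorem continuousOn_matrixPairing {Y : Type*} [TopologicalSpace Y] {S : Set Y}
    {G : Y → Matrix (Fin d) (Fin d) ℂ} {x y : Y → Fin d → ℂ} (hG : ContinuousOn G S)
    (hdet : ∀ y ∈ S, (G y).det ≠ 0) (hx : ∀ i, ContinuousOn (fun t => x t i) S)
    (hy : ∀ i, ContinuousOn (fun t => y t i) S) :
    ContinuousOn (fun t => matrixPairing (G t) (x t) (y t)) S := by
  have h1 : ContinuousOn (fun t => (G t)ᵀ⁻¹) S :=
    continuousOn_matrix_inv (continuous_id.matrix_transpose.comp_continuousOn hG)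
      (fun t ht => by simpa using hdet t ht)
  have h2 : ∀ i j, ContinuousOn (fun t => (G t)ᵀ⁻¹ i j) S := fun i j =>
    continuousOn_pi.1 (continuousOn_pi.1 h1 i) j
  refine continuousOn_finsetSum _ fun i _ => (hx i).mul (Complex.continuous_conj.comp_continuousOn ?_)
  simp only [Matrix.mulVec, dotProduct]
  exact continuousOn_finsetSum _ fun j _ => (h2 i j).mul (hy j)

end PairingContinuity

/-! ### The pairing of differentials in charts -/

section ChartFormula

variable {d : ℕ} {H : Type*} [TopologicalSpace H]
  {I : ModelWithCorners ℝ (EuclideanSpace ℝ (Fin d)) H}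
  {M : Type*} [TopologicalSpace M] [ChartedSpace H M]

theorem continuousOn_source_of_chart {Y : Type*} [TopologicalSpace Y] {Φ : M → Y} (p₀ : M)
    (h : ContinuousOn (Φ ∘ (extChartAt I p₀).symm) (extChartAt I p₀).target) :
    ContinuousOn Φ (extChartAt I p₀).source := by
  refine (h.comp (continuousOn_extChartAt p₀) (extChartAt I p₀).mapsTo).congr fun p hp => ?_
  simp only [Function.comp_apply]
  rw [(extChartAt I p₀).left_inv hp]

variable [IsManifold I ∞ M]

/-- The partial derivatives of a function in the chart at `p₀`. -/
def chartDeriv (I : ModelWithCorners ℝ (EuclideanSpace ℝ (Fin d)) H) (p₀ : M) (u : M → ℂ)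
    (q : EuclideanSpace ℝ (Fin d)) (i : Fin d) : ℂ :=
  fderivWithin ℝ (u ∘ (extChartAt I p₀).symm) (extChartAt I p₀).target q (EuclideanSpace.single i 1)

theorem contDiffOn_comp_extChartAt_symm {u : M → ℂ} (hu : ContMDiff I 𝓘(ℝ, ℂ) ∞ u) (p₀ : M) :
    ContDiffOn ℝ ∞ (u ∘ (extChartAt I p₀).symm) (extChartAt I p₀).target :=
  contMDiffOn_iff_contDiffOn.1 (hu.comp_contMDiffOn (contMDiffOn_extChartAt_symm p₀))

theorem continuousOn_chartDeriv {u : M → ℂ} (hu : ContMDiff I 𝓘(ℝ, ℂ) ∞ u) (p₀ : M) (i : Fin d) :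
    ContinuousOn (fun q => chartDeriv I p₀ u q i) (extChartAt I p₀).target :=
  ((contDiffOn_comp_extChartAt_symm hu p₀).continuousOn_fderivWithin
    (uniqueDiffOn_extChartAt_target p₀) (by simp)).clm_apply continuousOn_const

theorem coInner_ofMetric_chart (g : Metric I M) {u v : M → ℂ} (hu : ContMDiff I 𝓘(ℝ, ℂ) ∞ u)
    (hv : ContMDiff I 𝓘(ℝ, ℂ) ∞ v) (p₀ : M) {q : EuclideanSpace ℝ (Fin d)}
    (hq : q ∈ (extChartAt I p₀).target) :
    coInner (ofMetric g) (ofMetric g) ((extChartAt I p₀).symm q)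
        (diff I u ((extChartAt I p₀).symm q)) (diff I v ((extChartAt I p₀).symm q))
      = matrixPairing (gramIn (ofMetric g) ((extChartAt I p₀).symm q) (coordVec I p₀ q))
        (chartDeriv I p₀ u q) (chartDeriv I p₀ v q) := by
  rw [coInner_eq_matrixPairing (det_gram_ofMetric_ne_zero g _) (isBilinAt_ofMetric g _)
    (linearIndependent_coordVec p₀ hq)]
  congr 1
  · funext i
    exact diff_coordVec p₀ hq (hu.mdifferentiableAt (by simp)) i
  · funext i
    exact diff_coordVec p₀ hq (hv.mdifferentiableAt (by simp)) i

theorem continuousOn_gramIn_coordVec (g : Metric I M) (p₀ : M) :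
    ContinuousOn (fun q => gramIn (ofMetric g) ((extChartAt I p₀).symm q) (coordVec I p₀ q))
      (extChartAt I p₀).target :=
  continuousOn_pi.2 fun i => continuousOn_pi.2 fun j =>
    Complex.continuous_ofReal.comp_continuousOn (contDiffOn_metric_coordVec g p₀ i j).continuousOn

theorem det_gramIn_ofMetric_ne_zero (g : Metric I M) {p : M} {b : Fin d → TangentSpace I p}
    (hb : LinearIndependent ℝ b) : (gramIn (ofMetric g) p b).det ≠ 0 := by
  rw [det_gramIn (isBilinAt_ofMetric g p)]
  exact mul_ne_zero (pow_ne_zero _ (by exact_mod_cast det_frameMatrix_ne_zero hb))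
    (det_gram_ofMetric_ne_zero g p)

theorem continuous_coInner_ofMetric (g : Metric I M) {u v : M → ℂ} (hu : ContMDiff I 𝓘(ℝ, ℂ) ∞ u)
    (hv : ContMDiff I 𝓘(ℝ, ℂ) ∞ v) :
    Continuous fun p => coInner (ofMetric g) (ofMetric g) p (diff I u p) (diff I v p) := by
  rw [continuous_iff_continuousAt]
  intro p₀
  refine (continuousOn_source_of_chart (I := I) p₀ ?_).continuousAt (extChartAt_source_mem_nhds p₀)
  refine (continuousOn_matrixPairing (continuousOn_gramIn_coordVec g p₀) (fun q hq => ?_)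
    (continuousOn_chartDeriv hu p₀) (continuousOn_chartDeriv hv p₀)).congr fun q hq =>
      coInner_ofMetric_chart g hu hv p₀ hq
  exact det_gramIn_ofMetric_ne_zero g (linearIndependent_coordVec p₀ hq)

end ChartFormula

/-! ### The pre-Hilbert space of test functions -/

section TestSpace

variable {d : ℕ} {H : Type*} [TopologicalSpace H]
  {I : ModelWithCorners ℝ (EuclideanSpace ℝ (Fin d)) H}
  {M : Type*} [TopologicalSpace M] [ChartedSpace H M]

/-- The space `C_c^∞(M)`. -/
def testSpace (I : ModelWithCorners ℝ (EuclideanSpace ℝ (Fin d)) H) (M : Type*)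
    [TopologicalSpace M] [ChartedSpace H M] : Submodule ℂ (M → ℂ) where
  carrier := {u | IsTest I u}
  add_mem' hu hv := IsTest.add hu hv
  zero_mem' := IsTest.zero
  smul_mem' c _ hu := IsTest.smul hu c

variable [IsManifold I ∞ M] [T2Space M] [MeasurableSpace M] [BorelSpace M]

theorem integrable_of_zero_off_tsupport (g : Metric I M) {u : M → ℂ} (hu : IsTest I u) {f : M → ℂ}
    (hf : Continuous f) (h : ∀ p ∉ tsupport u, f p = 0) : Integrable f (riemannianVolume g) :=
  hf.integrable_of_hasCompactSupport (HasCompactSupport.intro hu.2 h)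

theorem integrable_coInner_ofMetric (g : Metric I M) {u v : M → ℂ} (hu : IsTest I u)
    (hv : IsTest I v) : Integrable
      (fun p => coInner (ofMetric g) (ofMetric g) p (diff I u p) (diff I v p)) (riemannianVolume g) := by
  refine integrable_of_zero_off_tsupport g hu (continuous_coInner_ofMetric g hu.1 hv.1) fun p hp => ?_
  rw [diff_eq_zero_of_notMem_tsupport hp, coInner_ofMetric, map_zero, inner_zero_right]

theorem integrable_mul_conj (g : Metric I M) {u v : M → ℂ} (hu : IsTest I u)
    (hv : IsTest I v) : Integrable (fun p => u p * conj (v p)) (riemannianVolume g) := by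
  refine integrable_of_zero_off_tsupport g hu
    (hu.1.continuous.mul (Complex.continuous_conj.comp hv.1.continuous)) fun p hp => ?_
  rw [image_eq_zero_of_notMem_tsupport hp, zero_mul]

/-- The `H¹` inner product of test functions. -/
def h1inner (g : Metric I M) (u v : M → ℂ) : ℂ :=
  ∫ p, coInner (ofMetric g) (ofMetric g) p (diff I u p) (diff I v p) ∂riemannianVolume g
    + ∫ p, u p * conj (v p) ∂riemannianVolume g

theorem integral_coInner_self (g : Metric I M) (u : M → ℂ) :
    ∫ p, coInner (ofMetric g) (ofMetric g) p (diff I u p) (diff I u p) ∂riemannianVolume g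
      = ((∫ p, covNorm g p (diff I u p) ^ 2 ∂riemannianVolume g : ℝ) : ℂ) := by
  refine Eq.trans (integral_congr_ae (Eventually.of_forall fun p => ?_)) integral_ofReal
  exact coInner_ofMetric_self g p _

theorem integral_mul_conj_self (g : Metric I M) (u : M → ℂ) :
    ∫ p, u p * conj (u p) ∂riemannianVolume g
      = ((∫ p, ‖u p‖ ^ 2 ∂riemannianVolume g : ℝ) : ℂ) := by
  refine Eq.trans (integral_congr_ae (Eventually.of_forall fun p => ?_)) integral_ofReal
  simp [Complex.mul_conj, Complex.normSq_eq_norm_sq]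

theorem h1inner_self (g : Metric I M) (u : M → ℂ) :
    h1inner g u u = ((∫ p, covNorm g p (diff I u p) ^ 2 ∂riemannianVolume g
      + ∫ p, ‖u p‖ ^ 2 ∂riemannianVolume g : ℝ) : ℂ) := by
  rw [h1inner, integral_coInner_self, integral_mul_conj_self, Complex.ofReal_add]

theorem h1inner_conj (g : Metric I M) (u v : M → ℂ) : conj (h1inner g u v) = h1inner g v u := by
  rw [h1inner, map_add, ← integral_conj, ← integral_conj, h1inner]
  congr 1
  · refine integral_congr_ae (Eventually.of_forall fun p => ?_)
    simp only [coInner_ofMetric, inner_conj_symm]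
  · refine integral_congr_ae (Eventually.of_forall fun p => ?_)
    simp [mul_comm]

theorem h1inner_add_left (g : Metric I M) {u v w : M → ℂ} (hu : IsTest I u) (hv : IsTest I v)
    (hw : IsTest I w) : h1inner g (u + v) w = h1inner g u w + h1inner g v w := by
  have h1 : ∀ p, coInner (ofMetric g) (ofMetric g) p (diff I (u + v) p) (diff I w p)
      = coInner (ofMetric g) (ofMetric g) p (diff I u p) (diff I w p)
        + coInner (ofMetric g) (ofMetric g) p (diff I v p) (diff I w p) := fun p => by
    rw [diff_add (hu.mdifferentiableAt p) (hv.mdifferentiableAt p),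
      coInner_add_left _ _ (det_gram_ofMetric_ne_zero g p)]
  simp only [h1inner, h1, Pi.add_apply, add_mul]
  rw [integral_add (integrable_coInner_ofMetric g hu hw) (integrable_coInner_ofMetric g hv hw),
    integral_add (integrable_mul_conj g hu hw) (integrable_mul_conj g hv hw)]
  ring

theorem h1inner_smul_left (g : Metric I M) {u w : M → ℂ} (hu : IsTest I u)  (c : ℂ) :
    h1inner g (c • u) w = c * h1inner g u w := by
  have h1 : ∀ p, coInner (ofMetric g) (ofMetric g) p (diff I (c • u) p) (diff I w p)
      = c * coInner (ofMetric g) (ofMetric g) p (diff I u p) (diff I w p) := fun p => by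
    rw [diff_smul (hu.mdifferentiableAt p),
      coInner_smul_left _ _ (det_gram_ofMetric_ne_zero g p)]
  simp only [h1inner, h1, Pi.smul_apply, smul_eq_mul, mul_assoc]
  rw [integral_const_mul, integral_const_mul]
  ring

/-- The `H¹` inner product on `C_c^∞(M)`. -/
@[reducible]
def testCore (g : Metric I M) : PreInnerProductSpace.Core ℂ (testSpace I M) where
  inner u v := h1inner g v u
  conj_inner_symm u v := h1inner_conj g _ _
  re_inner_nonneg u := by
    rw [h1inner_self]
    simp only [RCLike.re_to_complex, Complex.ofReal_re]
    positivity
  add_left u v w := by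
    rw [← h1inner_conj, ← h1inner_conj g (u : M → ℂ), ← h1inner_conj g (v : M → ℂ), ← map_add]
    exact congrArg _ (h1inner_add_left g u.2 v.2 w.2)
  smul_left u v c := by
    rw [← h1inner_conj, ← h1inner_conj g (u : M → ℂ), ← map_mul]
    exact congrArg _ (h1inner_smul_left g u.2 c)

end TestSpace

/-! ### Closability of partial derivatives in `L²` -/

section Closability

variable {E : Type*} [NormedAddCommGroup E] [InnerProductSpace ℝ E] [FiniteDimensional ℝ E]
  [MeasurableSpace E] [BorelSpace E]

theorem integral_fderiv_eq_zero_of_hasCompactSupport {h : E → ℂ} (hh : ContDiff ℝ 1 h)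
    (hc : HasCompactSupport h) (v : E) : ∫ x, fderiv ℝ h x v = 0 := by
  have hcont : Continuous fun x => fderiv ℝ h x v :=
    (hh.continuous_fderiv (by simp)).clm_apply continuous_const
  have hsupp : HasCompactSupport fun x => fderiv ℝ h x v := by
    refine HasCompactSupport.intro hc fun x hx => ?_
    rw [fderiv_of_notMem_tsupport (𝕜 := ℝ) hx]; rfl
  have h1 := integral_smul_fderiv_eq_neg_fderiv_smul_of_integrable (𝕜 := ℝ) (μ := (volume : Measure E))
    (f := fun _ => (1 : ℝ)) (g := h) (v := v)
    (by simp) (by simpa using hcont.integrable_of_hasCompactSupport hsupp)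
    (by simpa using hh.continuous.integrable_of_hasCompactSupport hc)
    (fun _ _ => differentiableAt_const _) (fun x _ => (hh.differentiable (by simp)) x)
  simpa using h1

/-- Integration by parts for the product φw, which extends by zero to a smooth function with compact
support, so nothing is required of w at the boundary of V. -/
theorem integral_smul_fderiv_eq_neg {V : Set E} (hV : IsOpen V) {w : E → ℂ} (hw : ContDiffOn ℝ ∞ w V)
    {φ : E → ℝ} (hφ : ContDiff ℝ ∞ φ) (hc : HasCompactSupport φ) (hsub : tsupport φ ⊆ V) (v : E) :
    ∫ x in V, φ x • fderiv ℝ w x v = - ∫ x in V, (fderiv ℝ φ x v) • w x := by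
  set h : E → ℂ := fun x => φ x • w x with hh
  have hsupp : tsupport h ⊆ tsupport φ := closure_mono fun x hx hx0 => hx (by simp [hh, hx0])
  have hsm : ContDiff ℝ ∞ h := by
    rw [contDiff_iff_contDiffAt]
    intro x
    by_cases hx : x ∈ V
    · exact hφ.contDiffAt.smul (hw.contDiffAt (hV.mem_nhds hx))
    · have : h =ᶠ[𝓝 x] fun _ => 0 :=
        notMem_tsupport_iff_eventuallyEq.1 fun hx' => hx (hsub (hsupp hx'))
      exact contDiffAt_const.congr_of_eventuallyEq this
  have hcs : HasCompactSupport h := hc.smul_right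
  have h0 := integral_fderiv_eq_zero_of_hasCompactSupport (hsm.of_le (by simp)) hcs v
  have h1 : ∀ x ∈ V, fderiv ℝ h x v = φ x • fderiv ℝ w x v + (fderiv ℝ φ x v) • w x := by
    intro x hx
    have := fderiv_fun_smul (hφ.differentiable (by simp) x)
      ((hw.contDiffAt (hV.mem_nhds hx)).differentiableAt (by simp))
    rw [this]; simp
  have h2 : ∀ x ∉ tsupport φ, fderiv ℝ h x v = 0 := fun x hx => by
    rw [fderiv_of_notMem_tsupport (𝕜 := ℝ) fun hx' => hx (hsupp hx')]; rfl
  have hD : ContinuousOn (fun x => fderiv ℝ w x v) V :=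
    (hw.continuousOn_fderiv_of_isOpen hV (by simp)).clm_apply continuousOn_const
  have hDφ : Continuous fun x => fderiv ℝ φ x v :=
    (hφ.continuous_fderiv (by simp)).clm_apply continuous_const
  have hi : ∀ {F : E → ℂ}, ContinuousOn F V → (∀ x ∉ tsupport φ, F x = 0) → IntegrableOn F V := by
    intro F hF hF0
    have h3 : IntegrableOn F (tsupport φ) := (hF.mono hsub).integrableOn_compact hc
    have h4 : Integrable F :=
      (integrableOn_iff_integrable_of_support_subset fun x hx => by_contra fun h => hx (hF0 x h)).1 h3
    exact h4.integrableOn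
  have hi1 : IntegrableOn (fun x => φ x • fderiv ℝ w x v) V :=
    hi (hφ.continuous.continuousOn.smul hD) fun x hx => by
      rw [image_eq_zero_of_notMem_tsupport hx, zero_smul]
  have hi2 : IntegrableOn (fun x => (fderiv ℝ φ x v) • w x) V :=
    hi (hDφ.continuousOn.smul hw.continuousOn) fun x hx => by
      rw [fderiv_of_notMem_tsupport (𝕜 := ℝ) hx]; simp
  rw [eq_neg_iff_add_eq_zero, ← integral_add hi1 hi2, ← h0]
  rw [← setIntegral_eq_integral_of_forall_compl_eq_zero (s := V)
    fun x hx => h2 x fun hx' => hx (hsub hx')]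
  exact setIntegral_congr_fun hV.measurableSet fun x hx => (h1 x hx).symm

/-- The derivatives converge in L² to some F by completeness. Moving the derivative onto a test
function shows that F pairs to zero with all of them, hence vanishes. -/
theorem tendsto_eLpNorm_fderiv_zero {V : Set E} (hV : IsOpen V) {w : ℕ → E → ℂ}
    (hw : ∀ k, ContDiffOn ℝ ∞ (w k) V) (v : E)
    (hw2 : ∀ k, MemLp (w k) 2 (volume.restrict V))
    (hD2 : ∀ k, MemLp (fun x => fderiv ℝ (w k) x v) 2 (volume.restrict V))
    (hw0 : Tendsto (fun k => eLpNorm (w k) 2 (volume.restrict V)) atTop (𝓝 0))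
    (hcauchy : Tendsto (fun jk : ℕ × ℕ => eLpNorm
      (fun x => fderiv ℝ (w jk.1) x v - fderiv ℝ (w jk.2) x v) 2 (volume.restrict V)) atTop (𝓝 0)) :
    Tendsto (fun k => eLpNorm (fun x => fderiv ℝ (w k) x v) 2 (volume.restrict V)) atTop (𝓝 0) := by
  set μ : Measure E := volume.restrict V
  let W : ℕ → Lp ℂ 2 μ := fun k => (hw2 k).toLp
  let D : ℕ → Lp ℂ 2 μ := fun k => (hD2 k).toLp
  have hnorm : ∀ {f : E → ℂ} (hf : MemLp f 2 μ), ‖hf.toLp‖ = (eLpNorm f 2 μ).toReal :=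
    fun hf => Lp.norm_toLp _ hf
  have hW : Tendsto W atTop (𝓝 0) := by
    rw [tendsto_zero_iff_norm_tendsto_zero]
    simp only [W, hnorm]
    exact (ENNReal.tendsto_toReal ENNReal.zero_ne_top).comp hw0
  have hDc : CauchySeq D := by
    rw [cauchySeq_iff_tendsto_dist_atTop_0]
    have := (ENNReal.tendsto_toReal ENNReal.zero_ne_top).comp hcauchy
    refine this.congr fun jk => ?_
    rw [dist_eq_norm]
    simp only [D, ← MemLp.toLp_sub, hnorm]
    rfl
  obtain ⟨F, hF⟩ := cauchySeq_tendsto_of_complete hDc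
  have key : ∀ φ : E → ℝ, ContDiff ℝ ∞ φ → HasCompactSupport φ → tsupport φ ⊆ V →
      ∫ x, φ x • F x = 0 := by
    intro φ hφ hc hsub
    have hm : ∀ {f : E → ℝ}, Continuous f → HasCompactSupport f →
        MemLp (fun x => (f x : ℂ)) 2 μ := fun hf hfc =>
      ((Complex.continuous_ofReal.comp hf).memLp_of_hasCompactSupport
        (hfc.comp_left (g := ((↑) : ℝ → ℂ)) Complex.ofReal_zero)).restrict V
    have hφ2 := hm hφ.continuous hc
    have hdφ : Continuous fun x => fderiv ℝ φ x v :=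
      (hφ.continuous_fderiv (by simp)).clm_apply continuous_const
    have hdφc : HasCompactSupport fun x => fderiv ℝ φ x v := by
      refine HasCompactSupport.intro hc fun x hx => ?_
      rw [fderiv_of_notMem_tsupport (𝕜 := ℝ) hx]; rfl
    have hdφ2 := hm hdφ hdφc
    have hinner : ∀ {f : E → ℝ} (hf : MemLp (fun x => (f x : ℂ)) 2 μ) (u : Lp ℂ 2 μ),
        inner ℂ hf.toLp u = ∫ x in V, f x • u x := by
      intro f hf u
      rw [L2.inner_def]
      refine integral_congr_ae ?_
      filter_upwards [hf.coeFn_toLp] with x hx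
      rw [hx]; simp [mul_comm]
    have h1 : ∀ k, inner ℂ hφ2.toLp (D k) = - inner ℂ hdφ2.toLp (W k) := by
      intro k
      rw [hinner, hinner]
      have e1 : ∫ x in V, φ x • D k x = ∫ x in V, φ x • fderiv ℝ (w k) x v := by
        refine integral_congr_ae ?_
        filter_upwards [(hD2 k).coeFn_toLp] with x hx
        rw [hx]
      have e2 : ∫ x in V, (fderiv ℝ φ x v) • W k x = ∫ x in V, (fderiv ℝ φ x v) • w k x := by
        refine integral_congr_ae ?_
        filter_upwards [(hw2 k).coeFn_toLp] with x hx
        rw [hx]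
      rw [e1, e2]
      exact integral_smul_fderiv_eq_neg hV (hw k) hφ hc hsub v
    have h2 : Tendsto (fun k => inner ℂ hφ2.toLp (D k)) atTop (𝓝 (inner ℂ hφ2.toLp F)) :=
      tendsto_const_nhds.inner hF
    have h3 : Tendsto (fun k => inner ℂ hφ2.toLp (D k)) atTop (𝓝 0) := by
      simp only [h1]
      simpa using ((tendsto_const_nhds (x := hdφ2.toLp)).inner (𝕜 := ℂ) hW).neg
    have h4 := tendsto_nhds_unique h2 h3
    rw [hinner] at h4
    rw [← h4]
    refine (setIntegral_eq_integral_of_forall_compl_eq_zero fun x hx => ?_).symm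
    rw [image_eq_zero_of_notMem_tsupport fun hx' => hx (hsub hx'), zero_smul]
  have hloc : LocallyIntegrableOn F V := by
    intro x hx
    obtain ⟨K, hKn, hKsub, hK⟩ := local_compact_nhds (hV.mem_nhds hx)
    refine ⟨K, mem_nhdsWithin_of_mem_nhds hKn, ?_⟩
    have h5 : MemLp F 2 ((volume.restrict V).restrict K) := (Lp.memLp F).restrict K
    rw [Measure.restrict_restrict_of_subset hKsub] at h5
    have : IsFiniteMeasure ((volume : Measure E).restrict K) := ⟨by
      rw [Measure.restrict_apply_univ]; exact hK.measure_lt_top⟩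
    exact h5.integrable (by norm_num)
  have hF0 := hV.ae_eq_zero_of_integral_contDiff_smul_eq_zero hloc key
  have hF0' : F = 0 := by
    rw [Lp.eq_zero_iff_ae_eq_zero]
    exact (ae_restrict_iff' hV.measurableSet).2 hF0
  rw [hF0', tendsto_zero_iff_norm_tendsto_zero] at hF
  simp only [D, hnorm] at hF
  rwa [← ENNReal.toReal_zero, ENNReal.tendsto_toReal_iff (fun k => (hD2 k).eLpNorm_ne_top)
    ENNReal.zero_ne_top] at hF

end Closability

/-! ### Closability of the Dirichlet form and density of test functions -/

/-- By homogeneity of degree two it suffices to bound f and 1/f on the compact product of K with the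
unit sphere. -/
theorem exists_bounds_of_homogeneous {Y V : Type*} [TopologicalSpace Y] [NormedAddCommGroup V]
    [NormedSpace ℝ V] [FiniteDimensional ℝ V] {K : Set Y} (hK : IsCompact K) {f : Y → V → ℝ}
    (hf : ContinuousOn (Function.uncurry f) (K ×ˢ univ))
    (hom : ∀ y ∈ K, ∀ (t : ℝ) x, f y (t • x) = t ^ 2 * f y x) (hpos : ∀ y ∈ K, ∀ x ≠ 0, 0 < f y x) :
    ∃ C : ℝ, 1 ≤ C ∧ ∀ y ∈ K, ∀ x, f y x ≤ C * ‖x‖ ^ 2 ∧ ‖x‖ ^ 2 ≤ C * f y x := by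
  have hc : IsCompact (K ×ˢ Metric.sphere (0 : V) 1) := hK.prod (isCompact_sphere _ _)
  have hf' := hf.mono (prod_mono_right (subset_univ (Metric.sphere (0 : V) 1)))
  have hpos' : ∀ q ∈ K ×ˢ Metric.sphere (0 : V) 1, 0 < Function.uncurry f q := by
    rintro ⟨y, x⟩ ⟨hy, hx⟩
    refine hpos y hy x fun h => ?_
    simp [h] at hx
  obtain ⟨C₁, h1⟩ := hc.bddAbove_image hf'
  obtain ⟨C₂, h2⟩ := hc.bddAbove_image (hf'.inv₀ fun q hq => (hpos' q hq).ne')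
  refine ⟨max 1 (max C₁ C₂), le_max_left _ _, fun y hy x => ?_⟩
  rcases eq_or_ne x 0 with rfl | hx
  · have : f y 0 = 0 := by simpa using hom y hy 0 0
    simp [this]
  · have hx' : ‖x‖ ≠ 0 := norm_ne_zero_iff.2 hx
    have hq : (y, ‖x‖⁻¹ • x) ∈ K ×ˢ Metric.sphere (0 : V) 1 := by
      refine ⟨hy, ?_⟩
      simp [norm_smul, hx']
    have e : f y x = ‖x‖ ^ 2 * f y (‖x‖⁻¹ • x) := by
      rw [hom y hy]; field_simp
    have a1 : f y (‖x‖⁻¹ • x) ≤ max 1 (max C₁ C₂) :=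
      (h1 (mem_image_of_mem _ hq)).trans ((le_max_left _ _).trans (le_max_right _ _))
    have a2 : (f y (‖x‖⁻¹ • x))⁻¹ ≤ max 1 (max C₁ C₂) :=
      (h2 (mem_image_of_mem _ hq)).trans ((le_max_right _ _).trans (le_max_right _ _))
    have a0 : 0 < f y (‖x‖⁻¹ • x) := hpos' _ hq
    have a3 : 1 ≤ max 1 (max C₁ C₂) * f y (‖x‖⁻¹ • x) := by
      rwa [inv_le_iff_one_le_mul₀ a0] at a2
    constructor
    · rw [e, mul_comm]; gcongr
    · rw [e]; nlinarith [sq_nonneg ‖x‖]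

theorem tendsto_eLpNorm_two_zero_iff {X F : Type*} [MeasurableSpace X] [NormedAddCommGroup F] {μ : Measure X}
    {ι : Type*} {l : Filter ι} {f : ι → X → F} :
    Tendsto (fun k => eLpNorm (f k) 2 μ) l (𝓝 0) ↔
      Tendsto (fun k => ∫⁻ x, ‖f k x‖ₑ ^ 2 ∂μ) l (𝓝 0) := by
  have h : ∀ k, ∫⁻ x, ‖f k x‖ₑ ^ 2 ∂μ = (eLpNorm (f k) 2 μ) ^ 2 := fun k => by
    have := eLpNorm_nnreal_pow_eq_lintegral (f := f k) (μ := μ) (p := 2) two_ne_zero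
    simpa using this.symm
  constructor
  · intro H
    simp only [h]
    have := ((ENNReal.continuous_pow 2).tendsto 0).comp H
    rwa [zero_pow two_ne_zero] at this
  · intro H
    have h2 : ∀ k, eLpNorm (f k) 2 μ = (∫⁻ x, ‖f k x‖ₑ ^ 2 ∂μ) ^ (1 / 2 : ℝ) := fun k => by
      rw [h, ← ENNReal.rpow_natCast, ← ENNReal.rpow_mul]; norm_num
    simp only [h2]
    have := (ENNReal.continuous_rpow_const (y := (1 / 2 : ℝ))).tendsto 0
    rw [ENNReal.zero_rpow_of_pos (by norm_num)] at this
    exact this.comp H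

/-! ### Comparison of the metric with the Euclidean one in a chart -/

section Comparison

variable {d : ℕ} {H : Type*} [TopologicalSpace H]
  {I : ModelWithCorners ℝ (EuclideanSpace ℝ (Fin d)) H}
  {M : Type*} [TopologicalSpace M] [ChartedSpace H M] [IsManifold I ∞ M]

theorem inv_map_ofReal {G : Matrix (Fin d) (Fin d) ℝ} (hG : G.det ≠ 0) :
    (G.map ((↑) : ℝ → ℂ))⁻¹ = (G⁻¹).map ((↑) : ℝ → ℂ) := by
  refine Matrix.inv_eq_left_inv ?_
  have := congrArg (fun N : Matrix (Fin d) (Fin d) ℝ => N.map Complex.ofRealHom)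
    (Matrix.nonsing_inv_mul G (isUnit_iff_ne_zero.2 hG))
  simp only [Matrix.map_mul] at this
  exact this.trans (Matrix.map_one _ (map_zero _) (map_one _))

/-- For a real matrix the real part of the pairing is the sum of its values at the real and the
imaginary part of the vector. -/
theorem posDef_quadratic_pos {G : Matrix (Fin d) (Fin d) ℝ} (hG : G.PosDef) {x : Fin d → ℂ}
    (hx : x ≠ 0) : 0 < (matrixPairing (G.map ((↑) : ℝ → ℂ)) x x).re := by
  set N := Gᵀ⁻¹ with hN
  have hNp : N.PosDef := hG.transpose.inv
  have e : (matrixPairing (G.map ((↑) : ℝ → ℂ)) x x).re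
      = (fun i => (x i).re) ⬝ᵥ N *ᵥ (fun i => (x i).re)
        + (fun i => (x i).im) ⬝ᵥ N *ᵥ (fun i => (x i).im) := by
    rw [matrixPairing, ← Matrix.transpose_map, inv_map_ofReal (by simpa using hG.det_pos.ne'), ← hN]
    simp only [Matrix.mulVec, dotProduct, Matrix.map_apply, map_sum, map_mul, Complex.conj_ofReal,
      Complex.re_sum, Finset.mul_sum, ← Finset.sum_add_distrib]
    refine Finset.sum_congr rfl fun i _ => Finset.sum_congr rfl fun j _ => ?_
    simp [Complex.mul_re, Complex.mul_im]
  have hn : ∀ y : Fin d → ℝ, 0 ≤ y ⬝ᵥ N *ᵥ y := fun y => by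
    simpa using hNp.posSemidef.dotProduct_mulVec_nonneg y
  have hp : ∀ y : Fin d → ℝ, y ≠ 0 → 0 < y ⬝ᵥ N *ᵥ y := fun y hy => by
    simpa using hNp.dotProduct_mulVec_pos hy
  rw [e]
  by_cases h : (fun i => (x i).re) = 0
  · have h' : (fun i => (x i).im) ≠ 0 := fun h' => hx (funext fun i =>
      Complex.ext (congrFun h i) (congrFun h' i))
    exact add_pos_of_nonneg_of_pos (hn _) (hp _ h')
  · exact add_pos_of_pos_of_nonneg (hp _ h) (hn _)

theorem matrixPairing_real_smul (G : Matrix (Fin d) (Fin d) ℂ) (t : ℝ) (x : Fin d → ℂ) :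
    (matrixPairing G (t • x) (t • x)).re = t ^ 2 * (matrixPairing G x x).re := by
  have e : t • x = (t : ℂ) • x := by ext i; simp
  rw [e, matrixPairing_smul_left, matrixPairing_smul_right, Complex.conj_ofReal, ← mul_assoc,
    ← Complex.ofReal_mul, Complex.re_ofReal_mul, sq]

/-- Volume and covector length are comparable with the Euclidean ones over a compact piece of the
chart. `V` is open in Euclidean space, so that interior calculus applies on it, whereas `W` is a
full neighbourhood of `p₀` and may contain boundary points. -/
theorem exists_chart_comparison [MeasurableSpace M] [BorelSpace M] (g : Metric I M) (p₀ : M) :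
    ∃ (V : Set (EuclideanSpace ℝ (Fin d))) (W : Set M) (C : ℝ), IsOpen V ∧
      V ⊆ (extChartAt I p₀).target ∧ IsOpen W ∧ p₀ ∈ W ∧ 0 ≤ C ∧
      (∀ f : M → ℝ≥0∞, Measurable f →
        ∫⁻ p in W, f p ∂riemannianVolume g
          ≤ ENNReal.ofReal C * ∫⁻ q in V, f ((extChartAt I p₀).symm q) ∧
        ∫⁻ q in V, f ((extChartAt I p₀).symm q) ≤ ENNReal.ofReal C * ∫⁻ p, f p ∂riemannianVolume g) ∧
      ∀ q ∈ V, ∀ u : M → ℂ, ContMDiff I 𝓘(ℝ, ℂ) ∞ u →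
        covNorm g ((extChartAt I p₀).symm q) (diff I u ((extChartAt I p₀).symm q)) ^ 2
          ≤ C * ‖chartDeriv I p₀ u q‖ ^ 2 ∧
        ‖chartDeriv I p₀ u q‖ ^ 2
          ≤ C * covNorm g ((extChartAt I p₀).symm q) (diff I u ((extChartAt I p₀).symm q)) ^ 2 := by
  set ψ := extChartAt I p₀ with hψ
  set q₀ := ψ p₀ with hq₀
  obtain ⟨ρ', hρ', hball⟩ := Metric.mem_nhdsWithin_iff.1 (extChartAt_target_mem_nhdsWithin (I := I) p₀)
  -- Halving the radius keeps a closed, hence compact, piece of the ball inside the chart image.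
  set ρ := ρ' / 2 with hρ
  have hρ0 : 0 < ρ := by positivity
  set K := Metric.closedBall q₀ ρ ∩ range I with hKdef
  have hK : IsCompact K := (isCompact_closedBall _ _).inter_right I.isClosed_range
  have hKt : K ⊆ ψ.target := fun q hq =>
    hball ⟨Metric.closedBall_subset_ball (by linarith) hq.1, hq.2⟩
  have hG := (continuousOn_gramIn_coordVec g p₀).mono hKt
  have hbd := exists_bounds_of_homogeneous (V := Fin d → ℂ) hK
    (f := fun q x => (matrixPairing (gramIn (ofMetric g) (ψ.symm q) (coordVec I p₀ q)) x x).re)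
    (by
      refine Complex.continuous_re.comp_continuousOn ?_
      refine continuousOn_matrixPairing (Y := _ × (Fin d → ℂ))
        (hG.comp continuousOn_fst fun t ht => ht.1)
        (fun t ht => det_gramIn_ofMetric_ne_zero g (linearIndependent_coordVec p₀ (hKt ht.1))) ?_ ?_ <;>
      exact fun i => ((continuous_apply i).comp continuous_snd).continuousOn)
    (fun q _ t x => matrixPairing_real_smul _ t x)
    (fun q hq x hx => by
      rw [gramIn_ofMetric]
      exact posDef_quadratic_pos (posDef_realGram g (linearIndependent_coordVec p₀ (hKt hq))) hx)
  obtain ⟨C₁, hC₁, hC₁'⟩ := hbd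
  have hdc := (continuousOn_chartDensity g p₀).mono hKt
  obtain ⟨C₂, hC₂⟩ := hK.bddAbove_image hdc
  obtain ⟨C₃, hC₃⟩ := hK.bddAbove_image (hdc.inv₀ fun q hq => (chartDensity_pos g p₀ (hKt hq)).ne')
  set C := max C₁ (max C₂ C₃) with hC
  have hC0 : 0 ≤ C := by linarith [le_max_left C₁ (max C₂ C₃)]
  set V := interior (range I) ∩ Metric.ball q₀ ρ with hV
  have hVo : IsOpen V := isOpen_interior.inter Metric.isOpen_ball
  have hVK : V ⊆ K := fun q hq => ⟨Metric.ball_subset_closedBall hq.2, interior_subset hq.1⟩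
  set W := ψ.source ∩ ψ ⁻¹' Metric.ball q₀ ρ with hW
  have hWo : IsOpen W := isOpen_extChartAt_preimage' p₀ Metric.isOpen_ball
  have hden : ∀ q ∈ K, chartDensity g p₀ q ≤ C ∧ 1 ≤ C * chartDensity g p₀ q := fun q hq => by
    have h0 := chartDensity_pos g p₀ (hKt hq)
    have h1 : chartDensity g p₀ q ≤ C₂ := hC₂ (mem_image_of_mem _ hq)
    have h2 : (chartDensity g p₀ q)⁻¹ ≤ C₃ := hC₃ (mem_image_of_mem _ hq)
    refine ⟨h1.trans ((le_max_left _ _).trans (le_max_right _ _)), ?_⟩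
    have := h2.trans ((le_max_right C₂ C₃).trans (le_max_right C₁ _))
    rwa [inv_le_iff_one_le_mul₀ h0] at this
  refine ⟨V, W, C, hVo, hVK.trans hKt, hWo, ⟨mem_extChartAt_source p₀, ?_⟩, hC0, fun f hf => ⟨?_, ?_⟩,
    fun q hq u hu => ?_⟩
  · exact Metric.mem_ball_self hρ0
  · have hrest : (riemannianVolume g).restrict W = (chartVolume g p₀).restrict W := by
      rw [← riemannianVolume_restrict_source, Measure.restrict_restrict hWo.measurableSet,
        inter_eq_self_of_subset_left inter_subset_left]
    rw [hrest, ← lintegral_indicator hWo.measurableSet,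
      lintegral_chartVolume g p₀ (hf.indicator hWo.measurableSet)]
    -- The boundary points missing from `V` have measure zero, the range of the model being convex.
    have hnull : volume (frontier (range I)) = 0 := I.convex_range.addHaar_frontier volume
    calc ∫⁻ q in ψ.target, ENNReal.ofReal (chartDensity g p₀ q) * W.indicator f (ψ.symm q)
        ≤ ∫⁻ q in ψ.target, (Metric.ball q₀ ρ).indicator
            (fun q => ENNReal.ofReal C * f (ψ.symm q)) q := by
          refine setLIntegral_mono' (measurableSet_extChartAt_target p₀) fun q hq => ?_
          by_cases hqb : q ∈ Metric.ball q₀ ρ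
          · rw [indicator_of_mem hqb]
            refine mul_le_mul' (ENNReal.ofReal_le_ofReal (hden q ⟨Metric.ball_subset_closedBall hqb,
              extChartAt_target_subset_range p₀ hq⟩).1) (indicator_le_self _ _ _)
          · have : ψ.symm q ∉ W := fun h => hqb (by
              have := h.2
              rwa [mem_preimage, ψ.right_inv hq] at this)
            rw [indicator_of_notMem this]; simp
      _ = ∫⁻ q in Metric.ball q₀ ρ ∩ ψ.target, ENNReal.ofReal C * f (ψ.symm q) := by
          rw [setLIntegral_indicator measurableSet_ball]
      _ ≤ ∫⁻ q in V ∪ frontier (range I), ENNReal.ofReal C * f (ψ.symm q) := by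
          refine lintegral_mono_set fun q hq => ?_
          by_cases h : q ∈ interior (range I)
          · exact Or.inl ⟨h, hq.1⟩
          · exact Or.inr ⟨subset_closure (extChartAt_target_subset_range p₀ hq.2), h⟩
      _ ≤ _ := lintegral_union_le _ _ _
      _ = ENNReal.ofReal C * ∫⁻ q in V, f (ψ.symm q) := by
          rw [setLIntegral_measure_zero _ _ hnull, add_zero,
            lintegral_const_mul' _ _ ENNReal.ofReal_ne_top]
  · calc ∫⁻ q in V, f (ψ.symm q)
        ≤ ∫⁻ q in V, ENNReal.ofReal C * (ENNReal.ofReal (chartDensity g p₀ q) * f (ψ.symm q)) := by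
          refine setLIntegral_mono' hVo.measurableSet fun q hq => ?_
          rw [← mul_assoc, ← ENNReal.ofReal_mul hC0]
          refine le_mul_of_one_le_left' ?_
          rw [ENNReal.one_le_ofReal]
          exact (hden q (hVK hq)).2
      _ ≤ ∫⁻ q in ψ.target, ENNReal.ofReal C * (ENNReal.ofReal (chartDensity g p₀ q) * f (ψ.symm q)) :=
          lintegral_mono_set (hVK.trans hKt)
      _ = ENNReal.ofReal C * ∫⁻ p, f p ∂chartVolume g p₀ := by
          rw [lintegral_const_mul' _ _ ENNReal.ofReal_ne_top, lintegral_chartVolume g p₀ hf]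
      _ ≤ _ := by
          gcongr
          exact le_iSup (chartVolume g) p₀
  · have e : (covNorm g (ψ.symm q) (diff I u (ψ.symm q))) ^ 2 = (matrixPairing
        (gramIn (ofMetric g) (ψ.symm q) (coordVec I p₀ q)) (chartDeriv I p₀ u q)
          (chartDeriv I p₀ u q)).re := by
      rw [← coInner_ofMetric_chart g hu hu p₀ (hKt (hVK hq)), coInner_ofMetric_self, Complex.ofReal_re]
    obtain ⟨h1, h2⟩ := hC₁' q (hVK hq) (chartDeriv I p₀ u q)
    rw [e]
    have hCC : C₁ ≤ C := le_max_left _ _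
    have h0 : 0 ≤ (matrixPairing (gramIn (ofMetric g) (ψ.symm q) (coordVec I p₀ q))
      (chartDeriv I p₀ u q) (chartDeriv I p₀ u q)).re := by rw [← e]; positivity
    exact ⟨h1.trans (by gcongr), h2.trans (by gcongr)⟩

end Comparison

/-! ### Closability of the Dirichlet form -/

section DirichletClosable

variable {d : ℕ} {H : Type*} [TopologicalSpace H]
  {I : ModelWithCorners ℝ (EuclideanSpace ℝ (Fin d)) H}
  {M : Type*} [TopologicalSpace M] [ChartedSpace H M]

theorem diff_sub {u v : M → ℂ} {p : M} (hu : MDifferentiableAt I 𝓘(ℝ, ℂ) u p)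
    (hv : MDifferentiableAt I 𝓘(ℝ, ℂ) v p) : diff I (u - v) p = diff I u p - diff I v p :=
  (hu.hasMFDerivAt.sub hv.hasMFDerivAt).mfderiv

theorem IsTest.sub {u v : M → ℂ} (hu : IsTest I u) (hv : IsTest I v) : IsTest I (u - v) := by
  have := hu.add (hv.smul (-1))
  simpa [sub_eq_add_neg] using this

variable [IsManifold I ∞ M]

/-- `|du|²`, with values in `ℝ≥0∞`. -/
def gradSq (g : Metric I M) (u : M → ℂ) (p : M) : ℝ≥0∞ := ENNReal.ofReal (covNorm g p (diff I u p) ^ 2)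

theorem continuous_covNorm_sq (g : Metric I M) {u : M → ℂ} (hu : ContMDiff I 𝓘(ℝ, ℂ) ∞ u) :
    Continuous fun p => covNorm g p (diff I u p) ^ 2 := by
  refine (Complex.continuous_re.comp (continuous_coInner_ofMetric g hu hu)).congr fun p => ?_
  simp only [Function.comp_apply, coInner_ofMetric_self, Complex.ofReal_re]

variable [MeasurableSpace M] [BorelSpace M]

theorem measurable_gradSq (g : Metric I M) {u : M → ℂ} (hu : ContMDiff I 𝓘(ℝ, ℂ) ∞ u) :
    Measurable (gradSq g u) :=
  (continuous_covNorm_sq g hu).measurable.ennreal_ofReal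

theorem norm_sq_le_sum {x : Fin d → ℂ} : ‖x‖ ^ 2 ≤ ∑ i, ‖x i‖ ^ 2 := by
  have h : ‖x‖ ≤ Real.sqrt (∑ i, ‖x i‖ ^ 2) := (pi_norm_le_iff_of_nonneg (Real.sqrt_nonneg _)).2
    fun i => Real.le_sqrt_of_sq_le (Finset.single_le_sum (f := fun i => ‖x i‖ ^ 2)
      (fun i _ => by positivity) (Finset.mem_univ i))
  calc ‖x‖ ^ 2 ≤ Real.sqrt (∑ i, ‖x i‖ ^ 2) ^ 2 := by gcongr
    _ = _ := Real.sq_sqrt (by positivity)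

/-- Transported to the open set V of a chart, the assertion becomes closability of each partial
derivative in L². -/
theorem exists_nhds_tendsto_gradSq_zero (g : Metric I M) {u : ℕ → M → ℂ} (hu : ∀ k, IsTest I (u k))
    (h0 : Tendsto (fun k => ∫⁻ p, ‖u k p‖ₑ ^ 2 ∂riemannianVolume g) atTop (𝓝 0))
    (hc : Tendsto (fun jk : ℕ × ℕ => ∫⁻ p, gradSq g (u jk.1 - u jk.2) p ∂riemannianVolume g)
      atTop (𝓝 0))
    (hfin : ∀ v : M → ℂ, IsTest I v → ∫⁻ p, gradSq g v p ∂riemannianVolume g ≠ ⊤ ∧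
      ∫⁻ p, ‖v p‖ₑ ^ 2 ∂riemannianVolume g ≠ ⊤) (p₀ : M) :
    ∃ W ∈ 𝓝 p₀, Tendsto (fun k => ∫⁻ p in W, gradSq g (u k) p ∂riemannianVolume g) atTop (𝓝 0) := by
  obtain ⟨V, W, C, hVo, hVt, hWo, hpW, hC, hint, hpt⟩ := exists_chart_comparison g p₀
  refine ⟨W, hWo.mem_nhds hpW, ?_⟩
  set ψ := extChartAt I p₀
  have hsm : ∀ k, ContDiffOn ℝ ∞ (u k ∘ ψ.symm) V := fun k =>
    (contDiffOn_comp_extChartAt_symm (hu k).1 p₀).mono hVt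
  have hder : ∀ w : M → ℂ, ∀ q ∈ V, ∀ i, chartDeriv I p₀ w q i
      = fderiv ℝ (w ∘ ψ.symm) q (EuclideanSpace.single i 1) := fun w q hq i => by
    rw [chartDeriv, fderivWithin_of_mem_nhds (mem_of_superset (hVo.mem_nhds hq) hVt)]
  have hderle : ∀ w : M → ℂ, IsTest I w → ∀ i, ∫⁻ q in V, ‖fderiv ℝ (w ∘ ψ.symm) q
      (EuclideanSpace.single i 1)‖ₑ ^ 2 ≤ ENNReal.ofReal C * (ENNReal.ofReal C *
        ∫⁻ p, gradSq g w p ∂riemannianVolume g) := by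
    intro w hw i
    refine le_trans ?_ (mul_le_mul_right (hint _ (measurable_gradSq g hw.1)).2 _)
    rw [← lintegral_const_mul' _ _ ENNReal.ofReal_ne_top]
    refine setLIntegral_mono' hVo.measurableSet fun q hq => ?_
    rw [← hder w q hq, gradSq, ← ENNReal.ofReal_mul hC, ← ofReal_norm,
      ← ENNReal.ofReal_pow (norm_nonneg _)]
    refine ENNReal.ofReal_le_ofReal (le_trans ?_ (hpt q hq w hw.1).2)
    gcongr
    exact norm_le_pi_norm (chartDeriv I p₀ w q) i
  have hmem : ∀ {f : EuclideanSpace ℝ (Fin d) → ℂ}, ContinuousOn f V → ∫⁻ q in V, ‖f q‖ₑ ^ 2 ≠ ⊤ →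
      MemLp f 2 (volume.restrict V) := by
    intro f hf hfi
    refine ⟨hf.aestronglyMeasurable hVo.measurableSet, ?_⟩
    refine lt_of_not_ge fun h => hfi ?_
    have := eLpNorm_nnreal_pow_eq_lintegral (f := f) (μ := volume.restrict V) (p := 2) two_ne_zero
    have h2 : ∫⁻ q in V, ‖f q‖ₑ ^ 2 = eLpNorm f 2 (volume.restrict V) ^ 2 := by simpa using this.symm
    rw [h2, top_le_iff.1 h]; simp
  have hcontD : ∀ k i, ContinuousOn (fun q => fderiv ℝ (u k ∘ ψ.symm) q (EuclideanSpace.single i 1)) V :=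
    fun k i => ((hsm k).continuousOn_fderiv_of_isOpen hVo (by simp)).clm_apply continuousOn_const
  have hmeas2 : ∀ k, Measurable fun p => ‖u k p‖ₑ ^ 2 := fun k =>
    ((hu k).1.continuous.measurable.enorm).pow_const 2
  have hfin' : ∀ {a : ℝ≥0∞}, a ≠ ⊤ → ENNReal.ofReal C * a ≠ ⊤ :=
    fun h => ENNReal.mul_ne_top ENNReal.ofReal_ne_top h
  have hlim : ∀ {ι : Type} {l : Filter ι} {F G : ι → ℝ≥0∞}, (∀ k, F k ≤ G k) →
      Tendsto G l (𝓝 0) → Tendsto F l (𝓝 0) := fun hFG hG =>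
    tendsto_of_tendsto_of_tendsto_of_le_of_le tendsto_const_nhds hG (fun _ => zero_le) hFG
  have hmul : ∀ {ι : Type} {l : Filter ι} {G : ι → ℝ≥0∞},
      Tendsto G l (𝓝 0) → Tendsto (fun k => ENNReal.ofReal C * G k) l (𝓝 0) := fun hG => by
    simpa using ENNReal.Tendsto.const_mul hG (Or.inr ENNReal.ofReal_ne_top)
  have hi : ∀ i, Tendsto (fun k => ∫⁻ q in V, ‖fderiv ℝ (u k ∘ ψ.symm) q
      (EuclideanSpace.single i 1)‖ₑ ^ 2) atTop (𝓝 0) := by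
    intro i
    refine tendsto_eLpNorm_two_zero_iff.1 (tendsto_eLpNorm_fderiv_zero hVo hsm _ (fun k => ?_)
      (fun k => ?_) (tendsto_eLpNorm_two_zero_iff.2 ?_) (tendsto_eLpNorm_two_zero_iff.2 ?_))
    · exact hmem (hsm k).continuousOn (ne_top_of_le_ne_top (hfin' (hfin _ (hu k)).2)
        (hint _ (hmeas2 k)).2)
    · exact hmem (hcontD k i) (ne_top_of_le_ne_top (hfin' (hfin' (hfin _ (hu k)).1))
        (hderle _ (hu k) i))
    · exact hlim (fun k => (hint _ (hmeas2 k)).2) (hmul h0)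
    · refine hlim (fun jk => ?_) (hmul (hmul hc))
      refine le_trans (le_of_eq ?_) (hderle _ ((hu jk.1).sub (hu jk.2)) i)
      refine setLIntegral_congr_fun hVo.measurableSet fun q hq => ?_
      have h1 := fderiv_sub (((hsm jk.1).contDiffAt (hVo.mem_nhds hq)).differentiableAt (by simp))
        (((hsm jk.2).contDiffAt (hVo.mem_nhds hq)).differentiableAt (by simp))
      have h2 : (u jk.1 - u jk.2) ∘ ψ.symm = u jk.1 ∘ ψ.symm - u jk.2 ∘ ψ.symm := rfl
      rw [h2, h1]; rfl
  have hsum : Tendsto (fun k => ENNReal.ofReal C * (ENNReal.ofReal C * ∑ i, ∫⁻ q in V,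
      ‖fderiv ℝ (u k ∘ ψ.symm) q (EuclideanSpace.single i 1)‖ₑ ^ 2)) atTop (𝓝 0) := by
    refine hmul (hmul ?_)
    simpa using tendsto_finsetSum Finset.univ fun i _ => hi i
  refine hlim (fun k => ?_) hsum
  refine ((hint _ (measurable_gradSq g (hu k).1)).1).trans (mul_le_mul_right ?_ _)
  rw [← lintegral_finsetSum' _ fun i _ =>
      (((hcontD k i).aestronglyMeasurable hVo.measurableSet).enorm).pow_const 2,
    ← lintegral_const_mul' _ _ ENNReal.ofReal_ne_top]
  refine setLIntegral_mono' hVo.measurableSet fun q hq => ?_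
  simp only [← hder (u k) q hq, ← ofReal_norm, ← ENNReal.ofReal_pow (norm_nonneg _)]
  rw [← ENNReal.ofReal_sum_of_nonneg fun i _ => by positivity, ← ENNReal.ofReal_mul hC, gradSq]
  refine ENNReal.ofReal_le_ofReal ((hpt q hq _ (hu k).1).1.trans ?_)
  gcongr
  exact norm_sq_le_sum

/-- Passage from local to global without any uniformity at infinity. Off the support of a fixed late
member u_N one has du_k = d(u_k − u_N), which is small by the Cauchy property; on that compact
support finitely many local statements suffice. -/
theorem tendsto_lintegral_gradSq_zero (g : Metric I M) {u : ℕ → M → ℂ} (hu : ∀ k, IsTest I (u k))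
    (h0 : Tendsto (fun k => ∫⁻ p, ‖u k p‖ₑ ^ 2 ∂riemannianVolume g) atTop (𝓝 0))
    (hc : Tendsto (fun jk : ℕ × ℕ => ∫⁻ p, gradSq g (u jk.1 - u jk.2) p ∂riemannianVolume g)
      atTop (𝓝 0))
    (hfin : ∀ v : M → ℂ, IsTest I v → ∫⁻ p, gradSq g v p ∂riemannianVolume g ≠ ⊤ ∧
      ∫⁻ p, ‖v p‖ₑ ^ 2 ∂riemannianVolume g ≠ ⊤) :
    Tendsto (fun k => ∫⁻ p, gradSq g (u k) p ∂riemannianVolume g) atTop (𝓝 0) := by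
  choose W hW hlimW using exists_nhds_tendsto_gradSq_zero g hu h0 hc hfin
  rw [ENNReal.tendsto_atTop_zero]
  intro ε hε
  have hε2 : ε / 2 ≠ 0 := (ENNReal.half_pos hε.ne').ne'
  obtain ⟨N, hN⟩ : ∃ N, ∀ j ≥ N, ∀ k ≥ N,
      ∫⁻ p, gradSq g (u j - u k) p ∂riemannianVolume g ≤ ε / 2 := by
    obtain ⟨N, hN⟩ := eventually_atTop_prod_self'.1
      (hc.eventually (ge_mem_nhds (pos_iff_ne_zero.2 hε2)))
    exact ⟨N, hN⟩
  have hKc : IsCompact (tsupport (u N)) := (hu N).2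
  obtain ⟨t, -, ht⟩ := hKc.elim_nhds_subcover W fun x _ => hW x
  set K := tsupport (u N)
  have hKm : MeasurableSet K := (isClosed_tsupport _).measurableSet
  have hsum : Tendsto (fun k => ∑ x ∈ t, ∫⁻ p in W x, gradSq g (u k) p ∂riemannianVolume g)
      atTop (𝓝 0) := by
    simpa using tendsto_finsetSum t fun x _ => hlimW x
  obtain ⟨N', hN'⟩ := ENNReal.tendsto_atTop_zero.1 hsum (ε / 2) (pos_iff_ne_zero.2 hε2)
  refine ⟨max N N', fun k hk => ?_⟩
  rw [← lintegral_add_compl _ hKm, ← ENNReal.add_halves ε]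
  refine add_le_add ?_ ?_
  · refine le_trans ?_ (hN' k ((le_max_right _ _).trans hk))
    refine (lintegral_mono_set ht).trans ?_
    rw [← Finset.sum_coe_sort t fun x => ∫⁻ p in W x, gradSq g (u k) p ∂riemannianVolume g]
    have := lintegral_iUnion_le (μ := riemannianVolume g) (fun x : t => W x) (gradSq g (u k))
    rw [tsum_fintype] at this
    refine le_trans (le_of_eq ?_) this
    rw [← Finset.set_biUnion_coe t W, biUnion_eq_iUnion]
    rfl
  · refine le_trans ?_ (hN k ((le_max_left _ _).trans hk) N le_rfl)
    refine le_trans (le_of_eq ?_) (setLIntegral_le_lintegral Kᶜ _)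
    refine setLIntegral_congr_fun hKm.compl fun p hp => ?_
    have h1 := diff_sub ((hu k).mdifferentiableAt p) ((hu N).mdifferentiableAt p)
    rw [diff_eq_zero_of_notMem_tsupport hp] at h1
    have h2 : diff I (u k - u N) p = diff I (u k) p := h1.trans (sub_zero _)
    simp only [gradSq, h2]

end DirichletClosable

/-! ### The pre-Hilbert space of test functions and its embedding into L² -/

section TestFunSpace

variable {d : ℕ} {H : Type*} [TopologicalSpace H]
  {I : ModelWithCorners ℝ (EuclideanSpace ℝ (Fin d)) H}
  {M : Type*} [TopologicalSpace M] [ChartedSpace H M] [IsManifold I ∞ M]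

/-- The space `C_c^∞(M)` with the `H¹`-norm. -/
def TestFun (_ : Metric I M) : Type _ := testSpace I M

instance (g : Metric I M) : AddCommGroup (TestFun g) := inferInstanceAs (AddCommGroup (testSpace I M))

instance (g : Metric I M) : Module ℂ (TestFun g) := inferInstanceAs (Module ℂ (testSpace I M))

/-- The underlying function. -/
def TestFun.fn {g : Metric I M} (u : TestFun g) : M → ℂ := u.1

theorem TestFun.isTest {g : Metric I M} (u : TestFun g) : IsTest I u.fn := u.2

/-- A test function as an element of `TestFun g`. -/
def TestFun.mk (g : Metric I M) (u : M → ℂ) (hu : IsTest I u) : TestFun g := ⟨u, hu⟩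

theorem TestFun.fn_sub {g : Metric I M} (u v : TestFun g) : (u - v).fn = u.fn - v.fn := rfl

theorem TestFun.fn_add {g : Metric I M} (u v : TestFun g) : (u + v).fn = u.fn + v.fn := rfl

theorem TestFun.fn_smul {g : Metric I M} (c : ℂ) (u : TestFun g) : (c • u).fn = c • u.fn := rfl

variable [MeasurableSpace M] [BorelSpace M]

theorem IsTest.memLp (g : Metric I M) {u : M → ℂ} (hu : IsTest I u) :
    MemLp u 2 (riemannianVolume g) :=
  hu.1.continuous.memLp_of_hasCompactSupport hu.2

variable [T2Space M]

instance (g : Metric I M) : SeminormedAddCommGroup (TestFun g) :=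
  @InnerProductSpace.Core.toSeminormedAddCommGroup ℂ (TestFun g) _ _ _ (testCore g)

instance (g : Metric I M) : InnerProductSpace ℂ (TestFun g) :=
  InnerProductSpace.ofCore (testCore g)

theorem TestFun.norm_sq {g : Metric I M} (u : TestFun g) :
    ‖u‖ ^ 2 = ∫ p, covNorm g p (diff I u.fn p) ^ 2 ∂riemannianVolume g
      + ∫ p, ‖u.fn p‖ ^ 2 ∂riemannianVolume g := by
  have h : (inner ℂ u u : ℂ) = h1inner g u.fn u.fn := rfl
  rw [← inner_self_eq_norm_sq (𝕜 := ℂ) u, h, h1inner_self]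
  exact Complex.ofReal_re _

theorem TestFun.norm_eq_h1norm {g : Metric I M} (u : TestFun g) : ‖u‖ = h1norm g u.fn := by
  rw [h1norm, integral_coInner_self, integral_mul_conj_self, Complex.ofReal_re, Complex.ofReal_re,
    ← TestFun.norm_sq, Real.sqrt_sq (norm_nonneg _)]

theorem integral_norm_sq_eq (g : Metric I M) {u : M → ℂ} (hu : IsTest I u) :
    ‖(hu.memLp g).toLp‖ ^ 2 = ∫ p, ‖u p‖ ^ 2 ∂riemannianVolume g := by
  let w : L2 g := (hu.memLp g).toLp
  change ‖w‖ ^ 2 = _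
  rw [← inner_self_eq_norm_sq (𝕜 := ℂ), L2.inner_def]
  have h1 : ∫ p, inner ℂ (w p) (w p) ∂riemannianVolume g
      = ∫ p, ((‖u p‖ ^ 2 : ℝ) : ℂ) ∂riemannianVolume g := by
    refine integral_congr_ae ?_
    filter_upwards [(hu.memLp g).coeFn_toLp] with p hp
    rw [hp, inner_self_eq_norm_sq_to_K]; simp
  rw [h1]
  exact (congrArg Complex.re (integral_ofReal (𝕜 := ℂ))).trans (Complex.ofReal_re _)

theorem integrable_covNorm_sq (g : Metric I M) {u : M → ℂ} (hu : IsTest I u) :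
    Integrable (fun p => covNorm g p (diff I u p) ^ 2) (riemannianVolume g) :=
  (continuous_covNorm_sq g hu.1).integrable_of_hasCompactSupport
    (HasCompactSupport.intro hu.2 fun p hp => by
      rw [diff_eq_zero_of_notMem_tsupport hp, covNorm_zero, zero_pow two_ne_zero])

/-- The embedding of the test functions into `L²(M)`. -/
def toL2 (g : Metric I M) : TestFun g →L[ℂ] L2 g :=
  LinearMap.mkContinuous
    { toFun := fun u => (u.isTest.memLp g).toLp
      map_add' := fun _ _ => rfl
      map_smul' := fun _ _ => rfl } 1 fun u => by
    refine le_of_sq_le_sq ?_ (by positivity)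
    rw [one_mul, TestFun.norm_sq]
    refine (integral_norm_sq_eq g u.isTest).le.trans ?_
    have : 0 ≤ ∫ p, covNorm g p (diff I u.fn p) ^ 2 ∂riemannianVolume g :=
      integral_nonneg fun p => by positivity
    linarith

theorem toL2_apply {g : Metric I M} (u : TestFun g) : toL2 g u = (u.isTest.memLp g).toLp := rfl

theorem norm_toL2_sq {g : Metric I M} (u : TestFun g) :
    ‖toL2 g u‖ ^ 2 = ∫ p, ‖u.fn p‖ ^ 2 ∂riemannianVolume g := integral_norm_sq_eq g u.isTest

theorem ofReal_norm_toL2_sq {g : Metric I M} (u : TestFun g) :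
    ∫⁻ p, ‖u.fn p‖ₑ ^ 2 ∂riemannianVolume g = ENNReal.ofReal (‖toL2 g u‖ ^ 2) := by
  rw [norm_toL2_sq, ofReal_integral_eq_lintegral_ofReal]
  · refine lintegral_congr fun p => ?_
    rw [ENNReal.ofReal_pow (norm_nonneg _), ofReal_norm]
  · exact (u.isTest.memLp g).integrable_norm_pow (by norm_num)
  · exact Eventually.of_forall fun p => by positivity

theorem lintegral_gradSq (g : Metric I M) {u : M → ℂ} (hu : IsTest I u) :
    ∫⁻ p, gradSq g u p ∂riemannianVolume g
      = ENNReal.ofReal (∫ p, covNorm g p (diff I u p) ^ 2 ∂riemannianVolume g) :=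
  (ofReal_integral_eq_lintegral_ofReal (integrable_covNorm_sq g hu)
    (Eventually.of_forall fun p => by positivity)).symm

theorem lintegral_gradSq_le {g : Metric I M} (u : TestFun g) :
    ∫⁻ p, gradSq g u.fn p ∂riemannianVolume g ≤ ENNReal.ofReal (‖u‖ ^ 2) := by
  rw [lintegral_gradSq g u.isTest, TestFun.norm_sq]
  refine ENNReal.ofReal_le_ofReal ?_
  have : 0 ≤ ∫ p, ‖u.fn p‖ ^ 2 ∂riemannianVolume g := integral_nonneg fun p => by positivity
  linarith

/-- The H¹ norm is the gradient part plus the L² part. The latter tends to zero by hypothesis, the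
former by closability of the Dirichlet form. -/
theorem toL2_closable (g : Metric I M) (u : ℕ → TestFun g) (hu : CauchySeq u)
    (h0 : Tendsto (fun k => toL2 g (u k)) atTop (𝓝 0)) : Tendsto (fun k => ‖u k‖) atTop (𝓝 0) := by
  have hL : Tendsto (fun k => ‖toL2 g (u k)‖ ^ 2) atTop (𝓝 0) := by
    simpa using (tendsto_zero_iff_norm_tendsto_zero.1 h0).pow 2
  have hL' : Tendsto (fun k => ∫⁻ p, ‖(u k).fn p‖ₑ ^ 2 ∂riemannianVolume g) atTop (𝓝 0) := by
    simp only [ofReal_norm_toL2_sq]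
    simpa using ENNReal.tendsto_ofReal hL
  have hc : Tendsto (fun jk : ℕ × ℕ => ∫⁻ p, gradSq g ((u jk.1).fn - (u jk.2).fn) p
      ∂riemannianVolume g) atTop (𝓝 0) := by
    have h1 := cauchySeq_iff_tendsto_dist_atTop_0.1 hu
    have h2 : Tendsto (fun jk : ℕ × ℕ => ENNReal.ofReal (‖u jk.1 - u jk.2‖ ^ 2)) atTop (𝓝 0) := by
      have := ENNReal.tendsto_ofReal (h1.pow 2)
      simpa [dist_eq_norm] using this
    exact tendsto_of_tendsto_of_tendsto_of_le_of_le tendsto_const_nhds h2 (fun _ => zero_le)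
      fun jk => lintegral_gradSq_le (u jk.1 - u jk.2)
  have hg := tendsto_lintegral_gradSq_zero g (fun k => (u k).isTest) hL' hc fun v hv => by
    refine ⟨?_, ?_⟩
    · rw [lintegral_gradSq g hv]; exact ENNReal.ofReal_ne_top
    · rw [show v = (TestFun.mk g v hv).fn from rfl, ofReal_norm_toL2_sq]; exact ENNReal.ofReal_ne_top
  have hg' : Tendsto (fun k => ∫ p, covNorm g p (diff I (u k).fn p) ^ 2 ∂riemannianVolume g)
      atTop (𝓝 0) := by
    have := (ENNReal.tendsto_toReal ENNReal.zero_ne_top).comp hg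
    refine this.congr fun k => ?_
    rw [Function.comp_apply, lintegral_gradSq g (u k).isTest, ENNReal.toReal_ofReal]
    exact integral_nonneg fun p => by positivity
  have hs : Tendsto (fun k => ‖u k‖ ^ 2) atTop (𝓝 0) := by
    simp only [TestFun.norm_sq, ← norm_toL2_sq]
    simpa using hg'.add hL
  have := (Real.continuous_sqrt.tendsto 0).comp hs
  rw [Real.sqrt_zero] at this
  exact this.congr fun k => by simp [Real.sqrt_sq (norm_nonneg _)]

/-- A function orthogonal to all test functions has zero integral against every real smooth function
of compact support, hence vanishes almost everywhere. -/
theorem denseRange_toL2 [SecondCountableTopology M] (g : Metric I M) : DenseRange (toL2 g) := by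
  have := I.locallyCompactSpace
  have := ChartedSpace.locallyCompactSpace H M
  rw [DenseRange, ← ContinuousLinearMap.coe_coe, ← LinearMap.coe_range,
    Submodule.dense_iff_topologicalClosure_eq_top, Submodule.topologicalClosure_eq_top_iff,
    Submodule.eq_bot_iff]
  intro f hf
  rw [Lp.eq_zero_iff_ae_eq_zero]
  refine ae_eq_zero_of_integral_contMDiff_smul_eq_zero I
    ((Lp.memLp f).locallyIntegrable (by norm_num)) fun φ hφ hc => ?_
  have ht : IsTest I fun p => (φ p : ℂ) :=
    ⟨(Complex.ofRealCLM.contDiff.contMDiff).comp hφ, hc.comp_left Complex.ofReal_zero⟩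
  have := Submodule.inner_right_of_mem_orthogonal
    (LinearMap.mem_range_self (toL2 g : TestFun g →ₗ[ℂ] L2 g) (TestFun.mk g _ ht)) hf
  rw [ContinuousLinearMap.coe_coe, toL2_apply, L2.inner_def] at this
  rw [← this]
  refine integral_congr_ae ?_
  filter_upwards [(ht.memLp g).coeFn_toLp] with p hp
  exact ((congrArg (fun z : ℂ => inner ℂ z (f p)) hp).trans (by simp [mul_comm])).symm

theorem h1Approx_iff {g : Metric I M} {u : ℕ → TestFun g} {f : L2 g} :
    H1Approx g (fun k => (u k).fn) f ↔
      CauchySeq u ∧ Tendsto (fun k => toL2 g (u k)) atTop (𝓝 f) := by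
  have h1 : CauchySeq u ↔ ∀ ε > 0, ∃ N, ∀ j ≥ N, ∀ k ≥ N, h1norm g ((u j).fn - (u k).fn) < ε := by
    rw [Metric.cauchySeq_iff]
    simp only [dist_eq_norm, TestFun.norm_eq_h1norm, TestFun.fn_sub]
  have h2 : Tendsto (fun k => toL2 g (u k)) atTop (𝓝 f) ↔
      Tendsto (fun k => eLpNorm (fun p => (u k).fn p - f p) 2 (riemannianVolume g)) atTop (𝓝 0) := by
    rw [Lp.tendsto_Lp_iff_tendsto_eLpNorm']
    refine tendsto_congr fun k => eLpNorm_congr_ae ?_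
    filter_upwards [((u k).isTest.memLp g).coeFn_toLp] with p hp
    exact congrArg (· - f p) hp
  exact ⟨fun h => ⟨h1.2 h.cauchy, h2.2 h.tendsto⟩,
    fun h => ⟨fun k => (u k).isTest, h1.1 h.1, h2.1 h.2⟩⟩

theorem H1Approx.exists_testFun {g : Metric I M} {u : ℕ → M → ℂ} {f : L2 g} (h : H1Approx g u f) :
    ∃ w : ℕ → TestFun g, (∀ k, (w k).fn = u k) ∧ CauchySeq w ∧
      Tendsto (fun k => toL2 g (w k)) atTop (𝓝 f) :=
  ⟨fun k => TestFun.mk g (u k) (h.test k), fun _ => rfl, h1Approx_iff.1 h⟩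

end TestFunSpace

/-! ### The sector and the scaling -/

theorem mem_sectorDomain_of_abs_im {α : ℝ} (h0 : 0 < α) (h1 : α < Real.pi / 2) {z : ℂ}
    (h : |z.im| * Real.cos α < z.re * Real.sin α) : z ∈ sectorDomain α := by
  have hs : 0 < Real.sin α := Real.sin_pos_of_pos_of_lt_pi h0 (by linarith [Real.pi_pos])
  have hc : 0 < Real.cos α := Real.cos_pos_of_mem_Ioo ⟨by linarith [Real.pi_pos], h1⟩
  have hre : 0 < z.re := by
    by_contra hre
    push Not at hre
    nlinarith [abs_nonneg z.im]
  have hz : z ≠ 0 := fun h => by simp [h] at hre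
  refine ⟨hz, ?_⟩
  have hn : 0 < ‖z‖ := norm_pos_iff.2 hz
  rw [Complex.arg_of_re_nonneg hre.le]
  have key : |z.im| < ‖z‖ * Real.sin α := by
    refine lt_of_pow_lt_pow_left₀ 2 (by positivity) ?_
    have e : ‖z‖ ^ 2 = z.re ^ 2 + z.im ^ 2 := by
      rw [← Complex.normSq_eq_norm_sq, Complex.normSq_apply]; ring
    rw [mul_pow, e, sq_abs]
    have h2 : (|z.im| * Real.cos α) ^ 2 < (z.re * Real.sin α) ^ 2 := by gcongr
    rw [mul_pow, mul_pow, sq_abs] at h2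
    nlinarith [Real.sin_sq_add_cos_sq α]
  have hlt : |z.im / ‖z‖| < Real.sin α := by
    rw [abs_div, abs_of_pos hn, div_lt_iff₀ hn]; linarith
  rw [abs_lt] at hlt ⊢
  constructor
  · rw [Real.lt_arcsin_iff_sin_lt' ⟨by linarith, by linarith⟩, Real.sin_neg]; exact hlt.1
  · rw [Real.arcsin_lt_iff_lt_sin' ⟨by linarith, by linarith⟩]; exact hlt.2

/-- The distance from a point x > 0 to the bounding rays of the sector is x sin α. -/
theorem ball_subset_sectorDomain {α : ℝ} (h0 : 0 < α) (h1 : α < Real.pi / 2) (x : ℝ) :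
    Metric.ball (x : ℂ) (x * Real.sin α) ⊆ sectorDomain α := by
  intro z hz
  refine mem_sectorDomain_of_abs_im h0 h1 ?_
  rw [Metric.mem_ball, dist_eq_norm] at hz
  have e : ‖z - x‖ ^ 2 = (z.re - x) ^ 2 + z.im ^ 2 := by
    rw [← Complex.normSq_eq_norm_sq, Complex.normSq_apply]; simp; ring
  -- After reflection to the upper half-plane, the left side is the component of z − x along the
  -- outer unit normal of the bounding ray.
  have h : |z.im| * Real.cos α - (z.re - x) * Real.sin α ≤ ‖z - x‖ := by
    refine le_of_sq_le_sq ?_ (norm_nonneg _)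
    rw [e]
    nlinarith [sq_nonneg (|z.im| * Real.sin α + (z.re - x) * Real.cos α), sq_abs z.im,
      Real.sin_sq_add_cos_sq α]
  nlinarith

/-- For α < π the sector lies in the slit plane, where the argument is continuous. -/
theorem isOpen_sectorDomain {α : ℝ} (h1 : α < Real.pi) : IsOpen (sectorDomain α) := by
  have : sectorDomain α = Complex.slitPlane ∩ (fun z : ℂ => |z.arg|) ⁻¹' Iio α := by
    ext z
    simp only [sectorDomain, Set.mem_ofPred_eq, mem_inter_iff, mem_preimage, mem_Iio]
    constructor
    · rintro ⟨h, h'⟩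
      refine ⟨Complex.mem_slitPlane_iff_arg.2 ⟨fun h2 => ?_, h⟩, h'⟩
      rw [h2, abs_of_pos Real.pi_pos] at h'
      linarith
    · rintro ⟨h, h'⟩
      exact ⟨Complex.slitPlane_ne_zero h, h'⟩
  rw [this]
  refine ContinuousOn.isOpen_inter_preimage (fun z hz => ?_) Complex.isOpen_slitPlane isOpen_Iio
  exact ((Complex.continuousAt_arg hz).abs).continuousWithinAt

section Scaling

variable {s : ℝ → ℝ}

theorem IsScaling.differentiable (hs : IsScaling s) : Differentiable ℝ s :=
  hs.smooth.differentiable (by simp)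

theorem IsScaling.nonneg (hs : IsScaling s) (x : ℝ) : 0 ≤ s x := by
  have hm : Monotone s := monotone_of_deriv_nonneg hs.differentiable hs.deriv_nonneg
  rcases le_total x 1 with h | h
  · rw [hs.eq_zero x h]
  · rw [← hs.eq_zero 1 le_rfl]; exact hm h

theorem IsScaling.le_self (hs : IsScaling s) {x : ℝ} (hx : 0 ≤ x) : s x ≤ x := by
  have hm : Monotone fun x => x - s x := monotone_of_deriv_nonneg
    (differentiable_id.sub hs.differentiable) fun x => by
      rw [deriv_fun_sub differentiableAt_fun_id (hs.differentiable x), deriv_id'']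
      linarith [hs.deriv_le_one x]
  have := hm hx
  simp only [hs.eq_zero 0 (by norm_num)] at this
  linarith

theorem IsScaling.deriv_eq_zero (hs : IsScaling s) {x : ℝ} (hx : x < 1) : deriv s x = 0 := by
  have : s =ᶠ[𝓝 x] fun _ => 0 := by
    filter_upwards [Iio_mem_nhds hx] with y hy using hs.eq_zero y (le_of_lt hy)
  rw [this.deriv_eq, deriv_const]

/-- The first derivative is constant outside a bounded interval, equal to 0 on the left and 1 on the
right, so the second derivative has compact support. -/
theorem IsScaling.exists_deriv2_bound (hs : IsScaling s) : ∃ C, ∀ x, |deriv (deriv s) x| ≤ C := by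
  have hcd : ContDiff ℝ ∞ (deriv s) := (contDiff_infty_iff_deriv.1 hs.smooth).2
  have hc : Continuous (deriv (deriv s)) := (contDiff_infty_iff_deriv.1 hcd).2.continuous
  obtain ⟨a, ha⟩ := eventually_atTop.1 hs.deriv_eventually
  obtain ⟨C, hC⟩ := (isCompact_Icc (a := (0 : ℝ)) (b := a + 1)).exists_bound_of_continuousOn hc.continuousOn
  refine ⟨max C 0, fun x => ?_⟩
  by_cases h1 : x ∈ Icc 0 (a + 1)
  · exact (hC x h1).trans (le_max_left _ _)
  · suffices deriv (deriv s) x = 0 by rw [this, abs_zero]; exact le_max_right _ _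
    rw [mem_Icc, not_and_or] at h1
    push Not at h1
    rcases h1 with h1 | h1
    · have : deriv s =ᶠ[𝓝 x] fun _ => 0 := by
        filter_upwards [Iio_mem_nhds h1] with y hy using hs.deriv_eq_zero (by
          have : y < 0 := hy
          linarith)
      rw [this.deriv_eq, deriv_const]
    · have : deriv s =ᶠ[𝓝 x] fun _ => 1 := by
        filter_upwards [Ioi_mem_nhds h1] with y hy using ha y (by
          have : a + 1 < y := hy
          linarith)
      rw [this.deriv_eq, deriv_const]

/-- The scaled axial variable `x + lam s_r(x)`. -/
def scaledVar (s : ℝ → ℝ) (r : ℝ) (lam : ℂ) (x : ℝ) : ℂ := x + lam * s (x - r)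

/-- Its derivative `1 + lam s_r'(x)`. -/
def scaledDeriv (s : ℝ → ℝ) (r : ℝ) (lam : ℂ) (x : ℝ) : ℂ := 1 + lam * deriv s (x - r)

theorem norm_lt_of_mem_disk {α : ℝ} {lam : ℂ} (h : lam ∈ disk α) : ‖lam‖ < Real.sin α := by
  simpa [disk] using h

/-- The deformation moves x by at most (x − r) sin α, while x is at distance x sin α from the
complement of the sector; r sin α remains to spare. -/
theorem ball_scaledVar_subset (hs : IsScaling s) {α : ℝ} (h0 : 0 < α) (h1 : α < Real.pi / 2)
    {lam : ℂ} (hlam : lam ∈ disk α) {r x : ℝ} (hx : r ≤ x) :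
    Metric.ball (scaledVar s r lam x) (r * Real.sin α) ⊆ sectorDomain α := by
  refine subset_trans (fun z hz => ?_) (ball_subset_sectorDomain h0 h1 x)
  rw [Metric.mem_ball] at hz ⊢
  have hl := norm_lt_of_mem_disk hlam
  have hs0 := hs.nonneg (x - r)
  have hs1 := hs.le_self (x := x - r) (by linarith)
  have h2 : dist (scaledVar s r lam x) x ≤ (x - r) * Real.sin α := by
    rw [dist_eq_norm, scaledVar, add_sub_cancel_left, norm_mul, Complex.norm_real, Real.norm_eq_abs,
      abs_of_nonneg hs0, mul_comm]
    gcongr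
  calc dist z x ≤ dist z (scaledVar s r lam x) + dist (scaledVar s r lam x) x := dist_triangle _ _ _
    _ < r * Real.sin α + (x - r) * Real.sin α := by linarith
    _ = x * Real.sin α := by ring

/-- As |λ| ≤ 1 and s_r ≤ x − r, already the real part is at least r. So large r pushes the deformed
points uniformly to infinity. -/
theorem le_norm_scaledVar (hs : IsScaling s) {α : ℝ} {lam : ℂ} (hlam : lam ∈ disk α) {r x : ℝ}
    (hx : r ≤ x) : r ≤ ‖scaledVar s r lam x‖ := by
  have hl := norm_lt_of_mem_disk hlam
  have hs0 := hs.nonneg (x - r)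
  have hs1 := hs.le_self (x := x - r) (by linarith)
  have hl1 : ‖lam‖ ≤ 1 := hl.le.trans (Real.sin_le_one α)
  have h2 : ‖lam * (s (x - r) : ℂ)‖ ≤ x - r := by
    rw [norm_mul, Complex.norm_real, Real.norm_eq_abs, abs_of_nonneg hs0]
    nlinarith
  have h3 := (Complex.abs_re_le_norm (lam * (s (x - r) : ℂ))).trans h2
  have h4 := Complex.re_le_norm (scaledVar s r lam x)
  simp only [scaledVar, Complex.add_re, Complex.ofReal_re] at h4
  rw [abs_le] at h3
  exact le_trans (by linarith [h3.1]) h4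

theorem norm_scaledDeriv_sub_one_le (hs : IsScaling s) {α : ℝ} {lam : ℂ} (hlam : lam ∈ disk α)
    (r x : ℝ) : ‖scaledDeriv s r lam x - 1‖ ≤ Real.sin α := by
  have hl := norm_lt_of_mem_disk hlam
  have h0 := hs.deriv_nonneg (x - r)
  have h1 := hs.deriv_le_one (x - r)
  rw [scaledDeriv, add_sub_cancel_left, norm_mul, Complex.norm_real, Real.norm_eq_abs,
    abs_of_nonneg h0]
  nlinarith [norm_nonneg lam]

end Scaling

/-! ### Coordinates on the end -/

section Bilinear

theorem update_pair {V : Type*} (w x y : V) : Function.update ![w, x] 1 y = ![w, y] := by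
  ext i; fin_cases i <;> rfl

variable {V T : Type*} [AddCommGroup V] [Module ℝ V] [AddCommGroup T] [Module ℝ T]

theorem map_pair_add (f : MultilinearMap ℝ (fun _ : Fin 2 => V) ℂ) (w a b : V) :
    f ![w, a + b] = f ![w, a] + f ![w, b] := by
  have := f.map_update_add ![w, w] 1 a b
  rwa [update_pair, update_pair, update_pair] at this

theorem map_pair_smul (f : MultilinearMap ℝ (fun _ : Fin 2 => V) ℂ) (t : ℝ) (w a : V) :
    f ![w, t • a] = t • f ![w, a] := by
  have := f.map_update_smul ![w, w] 1 t a
  rwa [update_pair, update_pair] at this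

theorem exists_bilin_comp [TopologicalSpace V]
    [TopologicalSpace T] (L : V →ₗ[ℝ] V →ₗ[ℝ] ℂ) (D : T →L[ℝ] V) :
    ∃ β : T →ₗ[ℝ] T →ₗ[ℝ] ℂ, ∀ v w, β v w = L (D v) (D w) :=
  ⟨L.compl₁₂ (D : T →ₗ[ℝ] V) (D : T →ₗ[ℝ] V), fun _ _ => rfl⟩

end Bilinear

section EndGeometry

variable {n : ℕ} {H : Type*} [TopologicalSpace H]
  {I : ModelWithCorners ℝ (EuclideanSpace ℝ (Fin (n + 1))) H}
  {M : Type*} [TopologicalSpace M] [ChartedSpace H M] [IsManifold I ∞ M]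
  {H' : Type*} [TopologicalSpace H']
  {J : ModelWithCorners ℝ (EuclideanSpace ℝ (Fin n)) H'}
  {Ω : Type*} [TopologicalSpace Ω] [ChartedSpace H' Ω] [IsManifold J ∞ Ω]
  {g : Metric I M} {α : ℝ} (e : QuasicylindricalEnd J Ω g α)

/-- The form `c² g₀(z) dx ⊗ dx + 2 c g₁(z) ⊗ dx + g₂(z)` on `ℝ × T_y Ω`. -/
def endTensor (z : ℂ) (c : ℂ) (y : Ω) (v w : ℝ × EuclideanSpace ℝ (Fin n)) : ℂ :=
  c ^ 2 * e.g0 z y ![] * v.1 * w.1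
    + c * (e.g1 z y ![(show TangentSpace J y from v.2)] * w.1
      + e.g1 z y ![(show TangentSpace J y from w.2)] * v.1)
    + e.g2 z y ![(show TangentSpace J y from v.2), (show TangentSpace J y from w.2)]

/-- The differential of the identification with the semi-cylinder. -/
def dcyl (p : M) : TangentSpace I p →L[ℝ] ℝ × EuclideanSpace ℝ (Fin n) :=
  mfderiv I (𝓘(ℝ, ℝ).prod J) e.cyl p

/-- The differential of the inverse of the identification with the semi-cylinder. -/
def dcylSymm (q : ℝ × Ω) : ℝ × EuclideanSpace ℝ (Fin n) →L[ℝ] TangentSpace I (e.cyl.symm q) :=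
  mfderiv (𝓘(ℝ, ℝ).prod J) I e.cyl.symm q

theorem pmlField_of_mem (s : ℝ → ℝ) (r : ℝ) (lam : ℂ) {p : M} (hp : p ∈ e.cyl.source)
    (v w : TangentSpace I p) : pmlField e s r lam p v w = endTensor e
      (scaledVar s r lam (e.cyl p).1) (scaledDeriv s r lam (e.cyl p).1) (e.cyl p).2
      (dcyl e p v) (dcyl e p w) := by
  rw [pmlField, if_pos hp]; rfl

theorem pmlField_of_notMem (s : ℝ → ℝ) (r : ℝ) (lam : ℂ) {p : M} (hp : p ∉ e.cyl.source)
    (v w : TangentSpace I p) : pmlField e s r lam p v w = ofMetric g p v w := by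
  rw [pmlField, if_neg hp]

theorem cyl_mdifferentiable : e.cyl.MDifferentiable I (𝓘(ℝ, ℝ).prod J) :=
  ⟨e.smooth_cyl.mdifferentiableOn (by simp), e.smooth_symm.mdifferentiableOn (by simp)⟩

theorem cyl_fst_pos {p : M} (hp : p ∈ e.cyl.source) : 0 < (e.cyl p).1 := by
  have := e.cyl.map_source hp
  rw [e.target_eq] at this
  exact this.1

theorem mem_cyl_target {x : ℝ} (hx : 0 < x) (y : Ω) : (x, y) ∈ e.cyl.target := by
  rw [e.target_eq]; exact ⟨hx, mem_univ _⟩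

theorem dcyl_dcylSymm {q : ℝ × Ω} (hq : q ∈ e.cyl.target) (v : ℝ × EuclideanSpace ℝ (Fin n)) :
    dcyl e (e.cyl.symm q) (dcylSymm e q v) = v :=
  DFunLike.congr_fun ((cyl_mdifferentiable e).comp_symm_deriv hq) v

theorem dcylSymm_dcyl {p : M} (hp : p ∈ e.cyl.source) (v : TangentSpace I p) :
    (show EuclideanSpace ℝ (Fin (n + 1)) from dcylSymm e (e.cyl p) (dcyl e p v))
      = (show EuclideanSpace ℝ (Fin (n + 1)) from v) :=
  DFunLike.congr_fun ((cyl_mdifferentiable e).symm_comp_deriv hp) v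

theorem inner_dcylSymm {x : ℝ} (hx : 0 < x) (y : Ω) (v w : ℝ × EuclideanSpace ℝ (Fin n)) :
    ((g.inner (e.cyl.symm (x, y)) (dcylSymm e (x, y) v) (dcylSymm e (x, y) w) : ℝ) : ℂ)
      = endTensor e x 1 y v w := by
  refine (e.metric_eq x hx y v.1 w.1 v.2 w.2).trans ?_
  rw [endTensor, one_pow, one_mul, one_mul]

theorem ofMetric_eq_endTensor {p : M} (hp : p ∈ e.cyl.source) (v w : TangentSpace I p) :
    ofMetric g p v w = endTensor e ((e.cyl p).1 : ℝ) 1 (e.cyl p).2 (dcyl e p v) (dcyl e p w) := by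
  rw [← inner_dcylSymm e (cyl_fst_pos e hp)]
  have h := inner_congr_point g (e.cyl.left_inv hp) (dcylSymm e (e.cyl p) (dcyl e p v))
    (dcylSymm e (e.cyl p) (dcyl e p w))
  refine congrArg Complex.ofReal (Eq.trans ?_ h.symm)
  rw [show (dcylSymm e (e.cyl p) (dcyl e p v) : EuclideanSpace ℝ (Fin (n + 1))) = v from
    dcylSymm_dcyl e hp v, show (dcylSymm e (e.cyl p) (dcyl e p w) : EuclideanSpace ℝ (Fin (n + 1))) = w from
    dcylSymm_dcyl e hp w]

/-- The scaling vanishes for x < r + 1 together with its derivative. The strip between r and r + 1,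
where nothing is deformed yet, provides the overlap used later to glue. -/
theorem pmlField_eq_ofMetric {s : ℝ → ℝ} (hs : IsScaling s) (r : ℝ) (lam : ℂ) {p : M}
    (hp : p ∈ e.cyl.source → (e.cyl p).1 < r + 1) :
    pmlField e s r lam p = ofMetric g p := by
  funext v w
  by_cases hp' : p ∈ e.cyl.source
  · have h := hp hp'
    rw [pmlField_of_mem e s r lam hp', ofMetric_eq_endTensor e hp', scaledVar, scaledDeriv,
      hs.eq_zero _ (by linarith), hs.deriv_eq_zero (by linarith)]
    simp
  · exact pmlField_of_notMem e s r lam hp' v w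

/-- `endTensor` as a bilinear map. -/
def endTensorBilin (z : ℂ) (c : ℂ) (y : Ω) :
    (ℝ × EuclideanSpace ℝ (Fin n)) →ₗ[ℝ] (ℝ × EuclideanSpace ℝ (Fin n)) →ₗ[ℝ] ℂ :=
  have hadd1 : ∀ a b : EuclideanSpace ℝ (Fin n), e.g1 z y ![(show TangentSpace J y from a + b)]
      = e.g1 z y ![(show TangentSpace J y from a)] + e.g1 z y ![(show TangentSpace J y from b)] :=
    fun a b => (e.g1 z y).cons_add (n := 0) ![] a b
  have hsmul1 : ∀ (t : ℝ) (a : EuclideanSpace ℝ (Fin n)), e.g1 z y ![(show TangentSpace J y from t • a)]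
      = t • e.g1 z y ![(show TangentSpace J y from a)] :=
    fun t a => (e.g1 z y).cons_smul (n := 0) ![] t a
  have hadd2 : ∀ a b w : EuclideanSpace ℝ (Fin n), e.g2 z y ![(show TangentSpace J y from a + b), w]
      = e.g2 z y ![(show TangentSpace J y from a), w] + e.g2 z y ![(show TangentSpace J y from b), w] :=
    fun a b w => (e.g2 z y).cons_add (n := 1) ![w] a b
  have hsmul2 : ∀ (t : ℝ) (a w : EuclideanSpace ℝ (Fin n)),
      e.g2 z y ![(show TangentSpace J y from t • a), w] = t • e.g2 z y ![(show TangentSpace J y from a), w] :=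
    fun t a w => (e.g2 z y).cons_smul (n := 1) ![w] t a
  have hadd3 : ∀ w a b : EuclideanSpace ℝ (Fin n), e.g2 z y ![(show TangentSpace J y from w), a + b]
      = e.g2 z y ![(show TangentSpace J y from w), a] + e.g2 z y ![(show TangentSpace J y from w), b] :=
    fun w a b => by
      exact map_pair_add (e.g2 z y) w a b
  have hsmul3 : ∀ (t : ℝ) (w a : EuclideanSpace ℝ (Fin n)),
      e.g2 z y ![(show TangentSpace J y from w), t • a] = t • e.g2 z y ![(show TangentSpace J y from w), a] :=
    fun t w a => by
      exact map_pair_smul (e.g2 z y) t w a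
  LinearMap.mk₂ ℝ (endTensor e z c y)
    (fun v v' w => by
      simp only [endTensor, Prod.fst_add, Prod.snd_add, hadd1, hadd2]; push_cast; ring)
    (fun t v w => by
      simp only [endTensor, Prod.smul_fst, Prod.smul_snd, hsmul1, hsmul2, smul_eq_mul, Complex.real_smul]
      push_cast; ring)
    (fun v w w' => by
      simp only [endTensor, Prod.fst_add, Prod.snd_add, hadd1, hadd3]; push_cast; ring)
    (fun t v w => by
      simp only [endTensor, Prod.smul_fst, Prod.smul_snd, hsmul1, hsmul3, smul_eq_mul, Complex.real_smul]
      push_cast; ring)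

theorem isBilinAt_pmlField (s : ℝ → ℝ) (r : ℝ) (lam : ℂ) (p : M) :
    IsBilinAt (pmlField e s r lam) p := by
  by_cases hp : p ∈ e.cyl.source
  · obtain ⟨β, hβ⟩ := exists_bilin_comp (endTensorBilin e (scaledVar s r lam (e.cyl p).1)
      (scaledDeriv s r lam (e.cyl p).1) (e.cyl p).2) (dcyl e p)
    exact ⟨β, fun v w => (pmlField_of_mem e s r lam hp v w).trans (hβ v w).symm⟩
  · obtain ⟨β, hβ⟩ := isBilinAt_ofMetric g p
    exact ⟨β, fun v w => (pmlField_of_notMem e s r lam hp v w).trans (hβ v w)⟩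

/-- The parametrization of the end by `(0, ∞)` times a chart of `Ω`. -/
def endParam (y₀ : Ω) (q : ℝ × EuclideanSpace ℝ (Fin n)) : M :=
  e.cyl.symm (q.1, (extChartAt J y₀).symm q.2)

/-- The domain `(a, ∞) × U` of the parametrization, for a chart of `Ω` with image `U`. -/
def endDomain (J : ModelWithCorners ℝ (EuclideanSpace ℝ (Fin n)) H') (a : ℝ) (y₀ : Ω) :
    Set (ℝ × EuclideanSpace ℝ (Fin n)) :=
  Ioi a ×ˢ (extChartAt J y₀).target

/-- The vectors `∂_x, ∂_{y_1}, …, ∂_{y_n}` of `ℝ × T_y Ω`. -/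
def cylVec (J : ModelWithCorners ℝ (EuclideanSpace ℝ (Fin n)) H') (y₀ : Ω)
    (u : EuclideanSpace ℝ (Fin n)) : Fin (n + 1) → ℝ × EuclideanSpace ℝ (Fin n) :=
  Fin.cons (1, 0) fun i => (0, coordVec J y₀ u i)

/-- The standard basis of `ℝ × ℝⁿ`. -/
def stdVec (n : ℕ) : Fin (n + 1) → ℝ × EuclideanSpace ℝ (Fin n) :=
  Fin.cons (1, 0) fun i => (0, EuclideanSpace.single i 1)

/-- The coordinate frame of the parametrization of the end. -/
def endFrame (y₀ : Ω) (q : ℝ × EuclideanSpace ℝ (Fin n)) (i : Fin (n + 1)) :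
    TangentSpace I (endParam e y₀ q) :=
  dcylSymm e (q.1, (extChartAt J y₀).symm q.2) (cylVec J y₀ q.2 i)

/-- The matrix of `g₀ dx ⊗ dx + 2 g₁ ⊗ dx + g₂` in coordinates. -/
def endGram (y₀ : Ω) (z : ℂ) (u : EuclideanSpace ℝ (Fin n)) : Matrix (Fin (n + 1)) (Fin (n + 1)) ℂ :=
  Matrix.of fun i j => endTensor e z 1 ((extChartAt J y₀).symm u) (cylVec J y₀ u i) (cylVec J y₀ u j)

/-- The diagonal matrix with entries `c, 1, …, 1`. -/
def axialDiag (n : ℕ) (c : ℂ) : Matrix (Fin (n + 1)) (Fin (n + 1)) ℂ :=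
  Matrix.diagonal (Fin.cons c fun _ => 1)

variable {a : ℝ} {y₀ : Ω} {q : ℝ × EuclideanSpace ℝ (Fin n)}

theorem linearIndependent_cylVec {u : EuclideanSpace ℝ (Fin n)} (hu : u ∈ (extChartAt J y₀).target) :
    LinearIndependent ℝ (cylVec J y₀ u) := by
  have h := linearIndependent_coordVec y₀ hu
  rw [Fintype.linearIndependent_iff] at h ⊢
  intro c hc
  rw [Fin.sum_univ_succ] at hc
  have h1 : c 0 = 0 := by
    have := congrArg Prod.fst hc
    simpa [cylVec, Prod.fst_sum] using this
  have h2 : ∑ i : Fin n, c i.succ • (coordVec J y₀ u i : EuclideanSpace ℝ (Fin n)) = 0 := by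
    have := congrArg Prod.snd hc
    simp [cylVec, Prod.snd_sum] at this
    exact this
  exact Fin.cases h1 (h (fun i => c i.succ) h2)

theorem endParam_target (ha : 0 ≤ a) (hq : q ∈ endDomain J a y₀) :
    (q.1, (extChartAt J y₀).symm q.2) ∈ e.cyl.target :=
  mem_cyl_target e (ha.trans_lt hq.1) _

theorem endParam_mem_source (ha : 0 ≤ a) (hq : q ∈ endDomain J a y₀) : endParam e y₀ q ∈ e.cyl.source :=
  e.cyl.map_target (endParam_target e ha hq)

theorem cyl_endParam (ha : 0 ≤ a) (hq : q ∈ endDomain J a y₀) :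
    e.cyl (endParam e y₀ q) = (q.1, (extChartAt J y₀).symm q.2) :=
  e.cyl.right_inv (endParam_target e ha hq)

theorem dcyl_endFrame (ha : 0 ≤ a) (hq : q ∈ endDomain J a y₀) (i : Fin (n + 1)) :
    dcyl e (endParam e y₀ q) (endFrame e y₀ q i) = cylVec J y₀ q.2 i :=
  dcyl_dcylSymm e (endParam_target e ha hq) _

theorem linearIndependent_endFrame (ha : 0 ≤ a) (hq : q ∈ endDomain J a y₀) :
    LinearIndependent ℝ (endFrame e y₀ q) := by
  have h := linearIndependent_cylVec hq.2
  have h2 : cylVec J y₀ q.2 = (dcyl e (endParam e y₀ q) : TangentSpace I (endParam e y₀ q) →ₗ[ℝ] _)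
      ∘ endFrame e y₀ q := funext fun i => (dcyl_endFrame e ha hq i).symm
  rw [h2] at h
  exact h.of_comp _

/-- Each axial slot of the tensor carries one factor c, which is conjugation of the matrix by
diag(c, 1, …, 1). -/
theorem endTensor_cylVec (z c : ℂ) (u : EuclideanSpace ℝ (Fin n)) (i j : Fin (n + 1)) :
    endTensor e z c ((extChartAt J y₀).symm u) (cylVec J y₀ u i) (cylVec J y₀ u j)
      = (axialDiag n c * endGram e y₀ z u * axialDiag n c) i j := by
  rw [axialDiag, Matrix.mul_diagonal, Matrix.diagonal_mul]
  have h1 : e.g1 z ((extChartAt J y₀).symm u) ![0] = 0 :=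
    (e.g1 z ((extChartAt J y₀).symm u)).map_coord_zero 0 rfl
  have h2 : ∀ v, e.g2 z ((extChartAt J y₀).symm u) ![0, v] = 0 := fun v =>
    (e.g2 z ((extChartAt J y₀).symm u)).map_coord_zero 0 rfl
  have h3 : ∀ v, e.g2 z ((extChartAt J y₀).symm u) ![v, 0] = 0 := fun v =>
    (e.g2 z ((extChartAt J y₀).symm u)).map_coord_zero 1 rfl
  refine Fin.cases ?_ (fun i => ?_) i <;> refine Fin.cases ?_ (fun j => ?_) j <;>
    simp only [endGram, endTensor, cylVec, Matrix.of_apply, Fin.cons_zero, Fin.cons_succ]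
  · erw [h1, h2]; push_cast; ring
  · erw [h1, h2]; push_cast; ring
  · erw [h1, h3]; push_cast; ring
  · push_cast; ring

theorem gramIn_pmlField (s : ℝ → ℝ) (r : ℝ) (lam : ℂ) (ha : 0 ≤ a) (hq : q ∈ endDomain J a y₀) :
    gramIn (pmlField e s r lam) (endParam e y₀ q) (endFrame e y₀ q)
      = axialDiag n (scaledDeriv s r lam q.1) * endGram e y₀ (scaledVar s r lam q.1) q.2
        * axialDiag n (scaledDeriv s r lam q.1) := by
  ext i j
  rw [← endTensor_cylVec, gramIn, Matrix.of_apply,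
    pmlField_of_mem e s r lam (endParam_mem_source e ha hq), dcyl_endFrame e ha hq,
    dcyl_endFrame e ha hq, cyl_endParam e ha hq]

theorem gramIn_ofMetric_endFrame (ha : 0 ≤ a) (hq : q ∈ endDomain J a y₀) :
    gramIn (ofMetric g) (endParam e y₀ q) (endFrame e y₀ q) = endGram e y₀ q.1 q.2 := by
  ext i j
  exact inner_dcylSymm e (ha.trans_lt hq.1) _ _ _

end EndGeometry

/-! ### Calculus in the coordinates of the end -/

section EndCalculus

variable {n : ℕ} {H : Type*} [TopologicalSpace H]
  {I : ModelWithCorners ℝ (EuclideanSpace ℝ (Fin (n + 1))) H}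
  {M : Type*} [TopologicalSpace M] [ChartedSpace H M] [IsManifold I ∞ M]
  {H' : Type*} [TopologicalSpace H']
  {J : ModelWithCorners ℝ (EuclideanSpace ℝ (Fin n)) H'}
  {Ω : Type*} [TopologicalSpace Ω] [ChartedSpace H' Ω] [IsManifold J ∞ Ω]
  {g : Metric I M} {α : ℝ} (e : QuasicylindricalEnd J Ω g α)
  {a : ℝ} {y₀ : Ω} {q : ℝ × EuclideanSpace ℝ (Fin n)}

theorem uniqueDiffOn_endDomain (a : ℝ) (y₀ : Ω) : UniqueDiffOn ℝ (endDomain J a y₀) :=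
  (isOpen_Ioi.uniqueDiffOn).prod (uniqueDiffOn_extChartAt_target y₀)

/-- Needed for the symmetry of second derivatives at boundary points. -/
theorem endDomain_subset_closure_interior (a : ℝ) (y₀ : Ω) :
    endDomain J a y₀ ⊆ closure (interior (endDomain J a y₀)) := by
  rw [endDomain, interior_prod_eq, closure_prod_eq]
  refine prod_mono ?_ extChartAt_target_subset_closure_interior
  rw [interior_Ioi]; exact subset_closure

theorem contMDiffOn_endParam (ha : 0 ≤ a) :
    ContMDiffOn 𝓘(ℝ, ℝ × EuclideanSpace ℝ (Fin n)) I ∞ (endParam e y₀) (endDomain J a y₀) := by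
  refine e.smooth_symm.comp (t := e.cyl.target) ?_ fun q hq => endParam_target e ha hq
  refine ContMDiffOn.prodMk (contDiff_fst.contMDiff.contMDiffOn) ?_
  exact (contMDiffOn_extChartAt_symm y₀).comp (contDiff_snd.contMDiff.contMDiffOn) fun q hq => hq.2

/-- The inverse of the parametrization. -/
def endCoord (y₀ : Ω) (p : M) : ℝ × EuclideanSpace ℝ (Fin n) :=
  ((e.cyl p).1, extChartAt J y₀ (e.cyl p).2)

/-- The points of the end with `x > a` over the chart domain at `y₀`. -/
def endPatch (a : ℝ) (y₀ : Ω) : Set M :=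
  e.cyl.source ∩ e.cyl ⁻¹' (Ioi a ×ˢ (extChartAt J y₀).source)

theorem isOpen_endPatch (a : ℝ) (y₀ : Ω) : IsOpen (endPatch e a y₀) :=
  e.cyl.isOpen_inter_preimage (isOpen_Ioi.prod (isOpen_extChartAt_source y₀))

theorem endCoord_mem {p : M} (hp : p ∈ endPatch e a y₀) : endCoord e y₀ p ∈ endDomain J a y₀ :=
  ⟨hp.2.1, (extChartAt J y₀).map_source hp.2.2⟩

theorem endParam_endCoord {p : M} (hp : p ∈ endPatch e a y₀) : endParam e y₀ (endCoord e y₀ p) = p := by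
  rw [endParam, endCoord]
  simp only [(extChartAt J y₀).left_inv hp.2.2]
  exact e.cyl.left_inv hp.1

theorem contMDiffOn_endCoord (a : ℝ) (y₀ : Ω) : ContMDiffOn I 𝓘(ℝ, ℝ × EuclideanSpace ℝ (Fin n)) ∞
    (endCoord e y₀) (endPatch e a y₀) := by
  have h := e.smooth_cyl.mono (inter_subset_left (s := e.cyl.source)
    (t := e.cyl ⁻¹' (Ioi a ×ˢ (extChartAt J y₀).source)))
  refine ContMDiffOn.prodMk_space (fun p hp => contMDiffAt_fst.comp_contMDiffWithinAt p (h p hp)) ?_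
  refine (contMDiffOn_extChartAt (x := y₀)).comp (t := (chartAt H' y₀).source)
    (fun p hp => contMDiffAt_snd.comp_contMDiffWithinAt p (h p hp)) fun p hp => ?_
  have := hp.2.2
  rwa [extChartAt_source] at this

theorem contMDiffAt_of_endParam {w : M → ℂ} (hw : ContDiffOn ℝ ∞ (w ∘ endParam e y₀) (endDomain J a y₀))
    {p : M} (hp : p ∈ endPatch e a y₀) : ContMDiffAt I 𝓘(ℝ, ℂ) ∞ w p := by
  have h1 := hw.contMDiffOn.comp (contMDiffOn_endCoord e a y₀) fun p hp => endCoord_mem e hp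
  refine ((h1.congr fun p hp => ?_).contMDiffAt ((isOpen_endPatch e a y₀).mem_nhds hp))
  simp only [Function.comp_apply]
  rw [endParam_endCoord e hp]

theorem continuousAt_of_endParam {Y : Type*} [TopologicalSpace Y] {w : M → Y}
    (hw : ContinuousOn (w ∘ endParam e y₀) (endDomain J a y₀))
    {p : M} (hp : p ∈ endPatch e a y₀) : ContinuousAt w p := by
  have h1 := hw.comp (contMDiffOn_endCoord e a y₀).continuousOn fun p hp => endCoord_mem e hp
  refine ((h1.congr fun p hp => ?_).continuousAt ((isOpen_endPatch e a y₀).mem_nhds hp))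
  simp only [Function.comp_apply]
  rw [endParam_endCoord e hp]

theorem contDiffOn_comp_endParam {w : M → ℂ} (ha : 0 ≤ a)
    (hw : ∀ q ∈ endDomain J a y₀, ContMDiffAt I 𝓘(ℝ, ℂ) ∞ w (endParam e y₀ q)) :
    ContDiffOn ℝ ∞ (w ∘ endParam e y₀) (endDomain J a y₀) := by
  rw [← contMDiffOn_iff_contDiffOn]
  exact fun q hq => (hw q hq).comp_contMDiffWithinAt q (contMDiffOn_endParam e ha q hq)

/-- Chain rule: the frame of the end is the image of the standard basis under the derivative of the
parametrization. -/
theorem diff_endFrame {w : M → ℂ} (ha : 0 ≤ a) (hq : q ∈ endDomain J a y₀)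
    (hw : MDifferentiableAt I 𝓘(ℝ, ℂ) w (endParam e y₀ q)) (i : Fin (n + 1)) :
    diff I w (endParam e y₀ q) (endFrame e y₀ q i)
      = fderivWithin ℝ (w ∘ endParam e y₀) (endDomain J a y₀) q (stdVec n i) := by
  have hU : UniqueMDiffWithinAt 𝓘(ℝ, ℝ × EuclideanSpace ℝ (Fin n)) (endDomain J a y₀) q :=
    (uniqueDiffOn_endDomain a y₀).uniqueMDiffOn q hq
  have hψ : MDifferentiableWithinAt 𝓘(ℝ, ℝ × EuclideanSpace ℝ (Fin n)) I (endParam e y₀)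
      (endDomain J a y₀) q := (contMDiffOn_endParam e ha q hq).mdifferentiableWithinAt (by simp)
  have h1 := mfderiv_comp_mfderivWithin q hw hψ hU
  rw [mfderivWithin_eq_fderivWithin] at h1
  rw [h1]
  have hx : HasMFDerivWithinAt 𝓘(ℝ, ℝ × EuclideanSpace ℝ (Fin n)) 𝓘(ℝ, ℝ)
      (fun q : ℝ × EuclideanSpace ℝ (Fin n) => q.1) (endDomain J a y₀) q
      (ContinuousLinearMap.fst ℝ ℝ (EuclideanSpace ℝ (Fin n))) :=
    hasFDerivWithinAt_fst.hasMFDerivWithinAt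
  have hu : HasMFDerivWithinAt 𝓘(ℝ, ℝ × EuclideanSpace ℝ (Fin n)) 𝓘(ℝ, EuclideanSpace ℝ (Fin n))
      (fun q : ℝ × EuclideanSpace ℝ (Fin n) => q.2) (endDomain J a y₀) q
      (ContinuousLinearMap.snd ℝ ℝ (EuclideanSpace ℝ (Fin n))) :=
    hasFDerivWithinAt_snd.hasMFDerivWithinAt
  have hy := (mdifferentiableWithinAt_extChartAt_symm (I := J) hq.2).hasMFDerivWithinAt.comp q hu
    fun q hq => extChartAt_target_subset_range y₀ hq.2
  have hκ := hx.prodMk hy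
  have hcs := ((cyl_mdifferentiable e).mdifferentiableAt_symm
    (endParam_target e ha hq)).hasMFDerivAt.comp_hasMFDerivWithinAt q hκ
  have h2 : mfderivWithin 𝓘(ℝ, ℝ × EuclideanSpace ℝ (Fin n)) I (endParam e y₀) (endDomain J a y₀) q
    = _ := hcs.mfderivWithin hU
  rw [h2]
  have h3 : cylVec J y₀ q.2 i = ((stdVec n i).1, mfderivWithin 𝓘(ℝ, EuclideanSpace ℝ (Fin n)) J
      (extChartAt J y₀).symm (range J) q.2 (stdVec n i).2) := by
    refine Fin.cases ?_ (fun i => ?_) i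
    · simp only [cylVec, stdVec, Fin.cons_zero]
      exact congrArg (Prod.mk (1 : ℝ)) (map_zero _).symm
    · simp only [cylVec, stdVec, Fin.cons_succ]; rfl
  rw [endFrame, h3]
  rfl

theorem exists_endPatch {p : M} (hp : p ∈ e.cyl.source) (ha : a < (e.cyl p).1) :
    p ∈ endPatch e a (e.cyl p).2 :=
  ⟨hp, ha, mem_extChartAt_source _⟩

/-- Closedness in all of M makes the undeformed region open, so that the field and the density are
locally constant in `lam` there. -/
theorem isClosed_end {b : ℝ} (hb : 1 ≤ b) : IsClosed {p | p ∈ e.cyl.source ∧ b ≤ (e.cyl p).1} := by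
  have hsub : e.cyl.symm '' (Ici 1 ×ˢ univ) ⊆ e.cyl.source := by
    rintro _ ⟨⟨x, y⟩, hx, rfl⟩
    exact e.cyl.map_target (mem_cyl_target e (lt_of_lt_of_le one_pos hx.1) y)
  have h := (continuous_fst.comp_continuousOn
    (e.cyl.continuousOn.mono hsub)).preimage_isClosed_of_isClosed e.closed_end (isClosed_Ici (a := b))
  convert h using 1
  ext p
  constructor
  · rintro ⟨hp, hpb⟩
    exact ⟨⟨e.cyl p, ⟨hb.trans hpb, mem_univ _⟩, e.cyl.left_inv hp⟩, hpb⟩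
  · rintro ⟨hp, hpb⟩
    exact ⟨hsub hp, hpb⟩

end EndCalculus

/-! ### Convergence and derivative bounds of the coefficients at infinity -/

section EndCoefficients

variable {n : ℕ} {H : Type*} [TopologicalSpace H]
  {I : ModelWithCorners ℝ (EuclideanSpace ℝ (Fin (n + 1))) H}
  {M : Type*} [TopologicalSpace M] [ChartedSpace H M] [IsManifold I ∞ M]
  {H' : Type*} [TopologicalSpace H']
  {J : ModelWithCorners ℝ (EuclideanSpace ℝ (Fin n)) H'}
  {Ω : Type*} [TopologicalSpace Ω] [ChartedSpace H' Ω] [IsManifold J ∞ Ω]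
  {g : Metric I M} {α : ℝ} (e : QuasicylindricalEnd J Ω g α)

/-- The matrix of `dx ⊗ dx + h` in coordinates, `h` being the limit metric. -/
def limGram (y₀ : Ω) (u : EuclideanSpace ℝ (Fin n)) : Matrix (Fin (n + 1)) (Fin (n + 1)) ℂ :=
  Matrix.of (Fin.cons (Fin.cons 1 fun _ => 0) fun i => Fin.cons 0 fun j =>
    ((e.limitMetric.inner ((extChartAt J y₀).symm u) (coordVec J y₀ u i) (coordVec J y₀ u j) : ℝ) : ℂ))

/-- The properties of the coefficients near `y₀` used below: smoothness, analyticity and convergence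
in `C¹`. -/
structure IsEndCoefficient (J : ModelWithCorners ℝ (EuclideanSpace ℝ (Fin n)) H') (α : ℝ) (y₀ : Ω)
    (G : ℂ → EuclideanSpace ℝ (Fin n) → ℂ) (L : EuclideanSpace ℝ (Fin n) → ℂ) : Prop where
  smooth : ContDiffOn ℝ ∞ (fun q : ℂ × EuclideanSpace ℝ (Fin n) => G q.1 q.2)
    (sectorDomain α ×ˢ (extChartAt J y₀).target)
  holomorphic : ∀ u, DifferentiableOn ℂ (fun z => G z u) (sectorDomain α)
  smooth_lim : ContDiffOn ℝ ∞ L (extChartAt J y₀).target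
  tendsto : ∃ U ∈ 𝓝 y₀, U ⊆ (extChartAt J y₀).source ∧
    ∀ ε > 0, ∃ R : ℝ, ∀ z ∈ sectorDomain α, R ≤ ‖z‖ → ∀ y ∈ U,
      ‖G z (extChartAt J y₀ y) - L (extChartAt J y₀ y)‖ < ε ∧
      ‖fderivWithin ℝ (fun u => G z u - L u) (extChartAt J y₀).target (extChartAt J y₀ y)‖ < ε

theorem isEndCoefficient_component {k : ℕ}
    {T : ℂ → (y : Ω) → MultilinearMap ℝ (fun _ : Fin k => TangentSpace J y) ℂ}
    {Tinf : (y : Ω) → (Fin k → TangentSpace J y) → ℂ} (hT : AnalyticFamily α T)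
    (hlim : TendstoC1 (J := J) α (fun z y v => T z y v) Tinf) (y₀ : Ω) (m : Fin k → Fin n)
    (hsm : ContDiffOn ℝ ∞ (component Tinf y₀ m) (extChartAt J y₀).target) :
    IsEndCoefficient J α y₀ (fun z => component (fun y v => T z y v) y₀ m) (component Tinf y₀ m) where
  smooth := hT.smooth y₀ m
  holomorphic u := hT.holomorphic _ _
  smooth_lim := hsm
  tendsto := by
    obtain ⟨U, hU, hUs, h⟩ := hlim y₀
    refine ⟨U, hU, hUs, fun ε hε => ?_⟩
    obtain ⟨R, hR⟩ := h ε hε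
    exact ⟨R, fun z hz hzR y hy => hR z hz hzR y hy m⟩

theorem isEndCoefficient_endGram (y₀ : Ω) (i j : Fin (n + 1)) :
    IsEndCoefficient J α y₀ (fun z u => endGram e y₀ z u i j) (fun u => limGram e y₀ u i j) := by
  have g1_zero : ∀ z y, e.g1 z y ![0] = 0 := fun z y => (e.g1 z y).map_coord_zero 0 rfl
  have g2_zero : ∀ z y v, e.g2 z y ![0, v] = 0 := fun z y v => (e.g2 z y).map_coord_zero 0 rfl
  have g2_zero' : ∀ z y v, e.g2 z y ![v, 0] = 0 := fun z y v => (e.g2 z y).map_coord_zero 1 rfl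
  have pair1 : ∀ (z : ℂ) (u : EuclideanSpace ℝ (Fin n)) (j : Fin n),
      component (fun y v => e.g1 z y v) y₀ ![j] u
      = e.g1 z ((extChartAt J y₀).symm u) ![coordVec J y₀ u j] := fun z u j => by
    rw [component]; congr 1; funext l; fin_cases l; rfl
  refine Fin.cases ?_ (fun i => ?_) i <;> refine Fin.cases ?_ (fun j => ?_) j
  · have h := isEndCoefficient_component e.analytic0 e.tendsto0 y₀ ![] contDiffOn_const
    convert h using 2 with z
    · funext u
      simp only [endGram, endTensor, cylVec, Matrix.of_apply, Fin.cons_zero]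
      erw [g1_zero, g2_zero]
      simp only [component, one_pow, one_mul, Complex.ofReal_one, mul_one, add_zero]
      congr 1
      exact Subsingleton.elim _ _
    · rfl
  · have h := isEndCoefficient_component e.analytic1 e.tendsto1 y₀ ![j] contDiffOn_const
    convert h using 2 with z
    · funext u
      rw [pair1]
      simp only [endGram, endTensor, cylVec, Matrix.of_apply, Fin.cons_zero, Fin.cons_succ]
      erw [g1_zero, g2_zero]
      simp
    · rfl
  · have h := isEndCoefficient_component e.analytic1 e.tendsto1 y₀ ![i] contDiffOn_const
    convert h using 2 with z
    · funext u
      rw [pair1]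
      simp only [endGram, endTensor, cylVec, Matrix.of_apply, Fin.cons_zero, Fin.cons_succ]
      erw [g1_zero, g2_zero']
      simp
    · rfl
  · have h := isEndCoefficient_component e.analytic2 e.tendsto2 y₀ ![i, j]
      (Complex.ofRealCLM.contDiff.comp_contDiffOn (contDiffOn_metric_coordVec e.limitMetric y₀ i j))
    convert h using 2 with z
    · funext u
      have : component (fun y v => e.g2 z y v) y₀ ![i, j] u
          = e.g2 z ((extChartAt J y₀).symm u) ![coordVec J y₀ u i, coordVec J y₀ u j] := by
        rw [component]; congr 1; funext l; fin_cases l <;> rfl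
      rw [this]
      simp only [endGram, endTensor, cylVec, Matrix.of_apply, Fin.cons_succ]
      simp
    · rfl

/-- The joint derivative splits into partial ones, and the partial derivative in z is multiplication
by the complex derivative. -/
theorem norm_fderivWithin_prod_le {F : Type*} [NormedAddCommGroup F] [NormedSpace ℝ F]
    {G : ℂ → F → ℂ} {S : Set ℂ} {T : Set F} (hS : IsOpen S) (hT : UniqueDiffOn ℝ T) {z : ℂ} {u : F}
    (hz : z ∈ S) (hu : u ∈ T)
    (hG : DifferentiableWithinAt ℝ (fun q : ℂ × F => G q.1 q.2) (S ×ˢ T) (z, u))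
    (hol : DifferentiableAt ℂ (fun z => G z u) z) :
    ‖fderivWithin ℝ (fun q : ℂ × F => G q.1 q.2) (S ×ˢ T) (z, u)‖
      ≤ ‖deriv (fun z => G z u) z‖ + ‖fderivWithin ℝ (G z) T u‖ := by
  set D := fderivWithin ℝ (fun q : ℂ × F => G q.1 q.2) (S ×ˢ T) (z, u)
  have hD := hG.hasFDerivWithinAt
  have h1 : ∀ ζ, D (ζ, 0) = deriv (fun z => G z u) z * ζ := by
    intro ζ
    have hc : HasFDerivWithinAt (fun w : ℂ => (w, u)) (ContinuousLinearMap.inl ℝ ℂ F) S z :=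
      (hasFDerivAt_prodMk_left z u).hasFDerivWithinAt
    have hm : MapsTo (fun w : ℂ => (w, u)) S (S ×ˢ T) := fun w hw => ⟨hw, hu⟩
    have h2 := (HasFDerivWithinAt.comp z hD hc hm).hasFDerivAt (hS.mem_nhds hz)
    have h3 := hol.hasDerivAt.hasFDerivAt.restrictScalars ℝ
    have := DFunLike.congr_fun (h2.unique h3) ζ
    simpa [mul_comm] using this
  have h2 : ∀ w, D (0, w) = fderivWithin ℝ (G z) T u w := by
    intro w
    have hc : HasFDerivWithinAt (fun w : F => (z, w)) (ContinuousLinearMap.inr ℝ ℂ F) T u :=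
      (hasFDerivAt_prodMk_right z u).hasFDerivWithinAt
    have hm : MapsTo (fun w : F => (z, w)) T (S ×ˢ T) := fun w hw => ⟨hz, hw⟩
    have h2 := HasFDerivWithinAt.comp u hD hc hm
    have := DFunLike.congr_fun (h2.fderivWithin (hT u hu)) w
    exact this.symm
  refine D.opNorm_le_bound (by positivity) fun q => ?_
  have e : D q = D (q.1, 0) + D (0, q.2) := by rw [← map_add]; simp
  rw [e, h1, h2, add_mul]
  refine (norm_add_le _ _).trans (add_le_add ?_ ?_)
  · rw [norm_mul]; gcongr; exact norm_fst_le q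
  · refine (ContinuousLinearMap.le_opNorm _ _).trans ?_
    gcongr; exact norm_snd_le q

/-- The z-derivative is not part of the convergence hypothesis. It is bounded by a Cauchy estimate,
for which a unit ball around z must lie in the sector; the y-derivative is bounded by the C¹
convergence. -/
theorem IsEndCoefficient.exists_bound {y₀ : Ω} {G : ℂ → EuclideanSpace ℝ (Fin n) → ℂ}
    {L : EuclideanSpace ℝ (Fin n) → ℂ} (h : IsEndCoefficient J α y₀ G L) (hα : α < Real.pi) :
    ∃ U ∈ 𝓝 y₀, U ⊆ (extChartAt J y₀).source ∧ ∀ K ⊆ U, IsCompact K →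
      (∀ ε > 0, ∃ R : ℝ, ∀ z ∈ sectorDomain α, R ≤ ‖z‖ → ∀ y ∈ K,
        ‖G z (extChartAt J y₀ y) - L (extChartAt J y₀ y)‖ < ε) ∧
      ∃ R C : ℝ, ∀ z, Metric.ball z 1 ⊆ sectorDomain α → R ≤ ‖z‖ → ∀ y ∈ K,
        ‖fderivWithin ℝ (fun q : ℂ × EuclideanSpace ℝ (Fin n) => G q.1 q.2)
          (sectorDomain α ×ˢ (extChartAt J y₀).target) (z, extChartAt J y₀ y)‖ ≤ C := by
  obtain ⟨U, hU, hUs, hlim⟩ := h.tendsto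
  refine ⟨U, hU, hUs, fun K hK hKc => ⟨fun ε hε => ?_, ?_⟩⟩
  · obtain ⟨R, hR⟩ := hlim ε hε
    exact ⟨R, fun z hz hzR y hy => (hR z hz hzR y (hK hy)).1⟩
  · obtain ⟨R, hR⟩ := hlim 1 one_pos
    have huT := uniqueDiffOn_extChartAt_target (I := J) y₀
    have hcont : ContinuousOn (fun y => fderivWithin ℝ L (extChartAt J y₀).target (extChartAt J y₀ y)) K :=
      (h.smooth_lim.continuousOn_fderivWithin huT (by simp)).comp
        ((continuousOn_extChartAt y₀).mono (hK.trans hUs)) fun y hy =>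
          (extChartAt J y₀).map_source (hUs (hK hy))
    obtain ⟨C, hC⟩ := hKc.exists_bound_of_continuousOn hcont
    -- The circle of radius 1/2 about z stays beyond R, and |G − L| ≤ 1 on it bounds the
    -- z-derivative by 2. In the y-direction the derivative is within 1 of that of the limit, which
    -- is at most C.
    refine ⟨R + 1, 2 + (1 + C), fun z hz hzR y hy => ?_⟩
    have hu := (extChartAt J y₀).map_source (hUs (hK hy))
    set u := extChartAt J y₀ y
    have hzs : z ∈ sectorDomain α := hz (Metric.mem_ball_self one_pos)
    have hSo := isOpen_sectorDomain hα
    have hol : DifferentiableAt ℂ (fun z => G z u) z :=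
      (h.holomorphic u).differentiableAt (hSo.mem_nhds hzs)
    refine (norm_fderivWithin_prod_le hSo huT hzs hu
      ((h.smooth (z, u) ⟨hzs, hu⟩).differentiableWithinAt (by simp)) hol).trans (add_le_add ?_ ?_)
    · have hd : DifferentiableOn ℂ (fun z => G z u - L u) (Metric.ball z 1) :=
        ((h.holomorphic u).mono hz).sub (differentiableOn_const _)
      have := Complex.norm_deriv_le_of_forall_mem_sphere_norm_le (c := z) (R := 1 / 2) (C := 1)
        (f := fun z => G z u - L u) (by norm_num)
        ⟨hd.mono (Metric.ball_subset_ball (by norm_num)), by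
          rw [closure_ball _ (by norm_num)]
          exact hd.continuousOn.mono (Metric.closedBall_subset_ball (by norm_num))⟩ fun w hw => ?_
      · rw [deriv_sub_const] at this
        linarith
      · have hw' : ‖w - z‖ = 1 / 2 := by simpa [dist_eq_norm] using hw
        refine (hR w (hz ?_) ?_ y (hK hy)).1.le
        · rw [Metric.mem_ball, dist_eq_norm, hw']; norm_num
        · have := norm_sub_norm_le z w
          rw [norm_sub_rev, hw'] at this
          linarith
    · have hGz : DifferentiableWithinAt ℝ (G z) (extChartAt J y₀).target u := by
        have := (h.smooth (z, u) ⟨hzs, hu⟩).differentiableWithinAt (by simp)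
        exact this.comp u (differentiableWithinAt_const z |>.prodMk differentiableWithinAt_id)
          fun w hw => ⟨hzs, hw⟩
      have hL := (h.smooth_lim u hu).differentiableWithinAt (by simp)
      have h1 := fderivWithin_fun_sub (huT u hu) hGz hL
      have h2 := (hR z hzs (by linarith) y (hK hy)).2
      rw [h1] at h2
      calc ‖fderivWithin ℝ (G z) (extChartAt J y₀).target u‖
          = ‖(fderivWithin ℝ (G z) (extChartAt J y₀).target u
            - fderivWithin ℝ L (extChartAt J y₀).target u)
            + fderivWithin ℝ L (extChartAt J y₀).target u‖ := by rw [sub_add_cancel]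
        _ ≤ _ := norm_add_le _ _
        _ ≤ 1 + C := add_le_add h2.le (hC y hy)

theorem exists_patch_bound [T2Space Ω] [CompactSpace Ω] (y₀ : Ω) :
    ∃ K ∈ 𝓝 y₀, IsCompact K ∧ K ⊆ (extChartAt J y₀).source ∧
      (∀ ε > 0, ∃ R : ℝ, ∀ z ∈ sectorDomain α, R ≤ ‖z‖ → ∀ y ∈ K, ∀ i j,
        ‖endGram e y₀ z (extChartAt J y₀ y) i j - limGram e y₀ (extChartAt J y₀ y) i j‖ < ε) ∧
      ∃ R C : ℝ, ∀ z, Metric.ball z 1 ⊆ sectorDomain α → R ≤ ‖z‖ → ∀ y ∈ K, ∀ i j,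
        ‖fderivWithin ℝ (fun q : ℂ × EuclideanSpace ℝ (Fin n) => endGram e y₀ q.1 q.2 i j)
          (sectorDomain α ×ˢ (extChartAt J y₀).target) (z, extChartAt J y₀ y)‖ ≤ C := by
  have hα : α < Real.pi := by linarith [e.angle_lt, Real.pi_pos]
  have h := fun q : Fin (n + 1) × Fin (n + 1) =>
    (isEndCoefficient_endGram e y₀ q.1 q.2).exists_bound hα
  choose U hU hUs hb using h
  obtain ⟨K, hK, hKs, hKc⟩ := local_compact_nhds (Filter.iInter_mem.2 hU)
  have hKU : ∀ q, K ⊆ U q := fun q => hKs.trans (iInter_subset _ q)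
  refine ⟨K, hK, hKc, (hKU (0, 0)).trans (hUs _), fun ε hε => ?_, ?_⟩
  · choose R hR using fun q => (hb q K (hKU q) hKc).1 ε hε
    obtain ⟨R', hR'⟩ := Finite.bddAbove_range R
    exact ⟨R', fun z hz hzR y hy i j => hR (i, j) z hz
      ((hR' (mem_range_self (i, j))).trans hzR) y hy⟩
  · choose R C hRC using fun q => (hb q K (hKU q) hKc).2
    obtain ⟨R', hR'⟩ := Finite.bddAbove_range R
    obtain ⟨C', hC'⟩ := Finite.bddAbove_range C
    exact ⟨R', C', fun z hz hzR y hy i j => (hRC (i, j) z hz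
      ((hR' (mem_range_self (i, j))).trans hzR) y hy).trans (hC' (mem_range_self (i, j)))⟩

end EndCoefficients

/-! ### Accretive coefficient matrices -/

section Accretive

variable {d n : ℕ}

/-- The sesquilinear form of a matrix on the diagonal. -/
def quadForm (G : Matrix (Fin d) (Fin d) ℂ) (w : Fin d → ℂ) : ℂ := ∑ i, ∑ j, G i j * w i * conj (w j)

theorem quadForm_eq (G : Matrix (Fin d) (Fin d) ℂ) (w : Fin d → ℂ) :
    quadForm G w = ∑ j, (Gᵀ *ᵥ w) j * conj (w j) := by
  rw [quadForm, Finset.sum_comm]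
  refine Finset.sum_congr rfl fun j _ => ?_
  rw [Matrix.mulVec, dotProduct, Finset.sum_mul]
  rfl

theorem det_ne_zero_of_quadForm_pos {G : Matrix (Fin d) (Fin d) ℂ}
    (h : ∀ w ≠ 0, 0 < (quadForm G w).re) : G.det ≠ 0 := by
  intro h0
  rw [← Matrix.det_transpose] at h0
  obtain ⟨v, hv, hGv⟩ := Matrix.exists_mulVec_eq_zero_iff.2 h0
  have := h v hv
  rw [quadForm_eq, hGv] at this
  simp at this

/-- Accretivity passes to the inverse: with w = (Gᵀ)⁻¹x the pairing of x with itself is the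
quadratic form of G at w. -/
theorem matrixPairing_pos_of_quadForm_pos {G : Matrix (Fin d) (Fin d) ℂ}
    (h : ∀ w ≠ 0, 0 < (quadForm G w).re) {x : Fin d → ℂ} (hx : x ≠ 0) :
    0 < (matrixPairing G x x).re := by
  have hdet : IsUnit (Gᵀ).det := by
    rw [Matrix.det_transpose]; exact isUnit_iff_ne_zero.2 (det_ne_zero_of_quadForm_pos h)
  have hw : Gᵀ *ᵥ (Gᵀ⁻¹ *ᵥ x) = x := by
    rw [Matrix.mulVec_mulVec, Matrix.mul_nonsing_inv _ hdet, Matrix.one_mulVec]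
  have hne : Gᵀ⁻¹ *ᵥ x ≠ 0 := fun h0 => hx (by rw [← hw, h0, Matrix.mulVec_zero])
  have := h _ hne
  rw [quadForm_eq, hw] at this
  exact this

theorem quadForm_real_smul (G : Matrix (Fin d) (Fin d) ℂ) (t : ℝ) (w : Fin d → ℂ) :
    quadForm G (t • w) = ((t ^ 2 : ℝ) : ℂ) * quadForm G w := by
  simp only [quadForm, Finset.mul_sum, Pi.smul_apply, Complex.real_smul, map_mul, Complex.conj_ofReal]
  refine Finset.sum_congr rfl fun i _ => Finset.sum_congr rfl fun j _ => by push_cast; ring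

theorem quadForm_pos_of_sphere {G : Matrix (Fin d) (Fin d) ℂ}
    (h : ∀ w ∈ Metric.sphere (0 : Fin d → ℂ) 1, 0 < (quadForm G w).re) {w : Fin d → ℂ} (hw : w ≠ 0) :
    0 < (quadForm G w).re := by
  have hw' : ‖w‖ ≠ 0 := norm_ne_zero_iff.2 hw
  have h1 := h (‖w‖⁻¹ • w) (by simp [norm_smul, hw'])
  rw [quadForm_real_smul, Complex.re_ofReal_mul] at h1
  exact pos_of_mul_pos_right h1 (by positivity)

theorem quadForm_map_pos {G : Matrix (Fin d) (Fin d) ℝ} (hG : G.PosDef) {w : Fin d → ℂ} (hw : w ≠ 0) :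
    0 < (quadForm (G.map ((↑) : ℝ → ℂ)) w).re := by
  have e : (quadForm (G.map ((↑) : ℝ → ℂ)) w).re
      = (fun i => (w i).re) ⬝ᵥ G *ᵥ (fun i => (w i).re)
        + (fun i => (w i).im) ⬝ᵥ G *ᵥ (fun i => (w i).im) := by
    simp only [quadForm, Matrix.mulVec, dotProduct, Matrix.map_apply, Complex.re_sum, Finset.mul_sum,
      ← Finset.sum_add_distrib]
    refine Finset.sum_congr rfl fun i _ => Finset.sum_congr rfl fun j _ => ?_
    simp [Complex.mul_re, Complex.mul_im]
    ring
  have hn : ∀ y : Fin d → ℝ, 0 ≤ y ⬝ᵥ G *ᵥ y := fun y => by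
    simpa using hG.posSemidef.dotProduct_mulVec_nonneg y
  have hp : ∀ y : Fin d → ℝ, y ≠ 0 → 0 < y ⬝ᵥ G *ᵥ y := fun y hy => by
    simpa using hG.dotProduct_mulVec_pos hy
  rw [e]
  by_cases h : (fun i => (w i).re) = 0
  · have h' : (fun i => (w i).im) ≠ 0 := fun h' => hw (funext fun i =>
      Complex.ext (congrFun h i) (congrFun h' i))
    exact add_pos_of_nonneg_of_pos (hn _) (hp _ h')
  · exact add_pos_of_pos_of_nonneg (hp _ h) (hn _)

/-- The matrix `C A C` with `C = diag(c, 1, …, 1)`. -/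
def axialScale (c : ℂ) (A : Matrix (Fin (n + 1)) (Fin (n + 1)) ℂ) : Matrix (Fin (n + 1)) (Fin (n + 1)) ℂ :=
  axialDiag n c * A * axialDiag n c

theorem axialScale_one (A : Matrix (Fin (n + 1)) (Fin (n + 1)) ℂ) : axialScale 1 A = A := by
  have : axialDiag n 1 = 1 := by
    rw [axialDiag, ← Matrix.diagonal_one]
    congr 1
    funext i
    exact Fin.cases rfl (fun _ => rfl) i
  rw [axialScale, this, one_mul, mul_one]

theorem det_axialScale (c : ℂ) (A : Matrix (Fin (n + 1)) (Fin (n + 1)) ℂ) :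
    (axialScale c A).det = c ^ 2 * A.det := by
  have : (axialDiag n c).det = c := by
    rw [axialDiag, Matrix.det_diagonal, Fin.prod_univ_succ]; simp
  rw [axialScale, Matrix.det_mul, Matrix.det_mul, this]; ring

theorem continuous_axialScale {X : Type*} [TopologicalSpace X] {c : X → ℂ}
    {A : X → Matrix (Fin (n + 1)) (Fin (n + 1)) ℂ} (hc : Continuous c) (hA : Continuous A) :
    Continuous fun t => axialScale (c t) (A t) := by
  have h : Continuous fun t => axialDiag n (c t) := by
    refine Continuous.matrix_diagonal (continuous_pi fun i => ?_)
    exact Fin.cases hc (fun _ => continuous_const) i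
  exact (h.mul hA).mul h

theorem continuous_quadForm {X : Type*} [TopologicalSpace X] {F : X → Matrix (Fin d) (Fin d) ℂ}
    {w : X → Fin d → ℂ} (hF : Continuous F) (hw : Continuous w) :
    Continuous fun t => quadForm (F t) (w t) := by
  unfold quadForm
  refine continuous_finsetSum _ fun i _ => continuous_finsetSum _ fun j _ => ?_
  have h2 : ∀ i, Continuous fun t => w t i := fun i => (continuous_apply i).comp hw
  exact ((hF.matrix_elem i j).mul (h2 i)).mul (Complex.continuous_conj.comp (h2 j))

/-- Positivity on the compact unit sphere is stable under perturbation, by the tube lemma. -/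
theorem eventually_quadForm_pos {X : Type*} [TopologicalSpace X] {F : X → Matrix (Fin d) (Fin d) ℂ}
    (hF : Continuous F) {t : X}
    (ht : ∀ w ∈ Metric.sphere (0 : Fin d → ℂ) 1, 0 < (quadForm (F t) w).re) :
    ∀ᶠ t' in 𝓝 t, ∀ w ∈ Metric.sphere (0 : Fin d → ℂ) 1, 0 < (quadForm (F t') w).re := by
  have hc : Continuous fun q : X × (Fin d → ℂ) => (quadForm (F q.1) q.2).re :=
    Complex.continuous_re.comp (continuous_quadForm (hF.comp continuous_fst) continuous_snd)
  have ho : IsOpen {q : X × (Fin d → ℂ) | 0 < (quadForm (F q.1) q.2).re} :=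
    isOpen_lt continuous_const hc
  have h : ∀ w ∈ Metric.sphere (0 : Fin d → ℂ) 1, ∀ᶠ q : X × (Fin d → ℂ) in 𝓝 (t, w),
      0 < (quadForm (F q.1) q.2).re := fun w hw => ho.eventually_mem (x := (t, w)) (ht w hw)
  exact IsCompact.eventually_forall_of_forall_eventually
    (P := fun t' w => 0 < (quadForm (F t') w).re) (isCompact_sphere (0 : Fin d → ℂ) 1) h

theorem exists_matrixPairing_bounds {X : Type*} [TopologicalSpace X] {K : Set X} (hK : IsCompact K)
    {F : X → Matrix (Fin d) (Fin d) ℂ} (hF : Continuous F)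
    (hpos : ∀ t ∈ K, ∀ w ≠ 0, 0 < (quadForm (F t) w).re) : ∃ C : ℝ, 1 ≤ C ∧ ∀ t ∈ K, ∀ x,
      (matrixPairing (F t) x x).re ≤ C * ‖x‖ ^ 2 ∧ ‖x‖ ^ 2 ≤ C * (matrixPairing (F t) x x).re := by
  refine exists_bounds_of_homogeneous hK (f := fun t x => (matrixPairing (F t) x x).re) ?_
    (fun t _ => matrixPairing_real_smul _) fun t ht x hx =>
      matrixPairing_pos_of_quadForm_pos (hpos t ht) hx
  refine Complex.continuous_re.comp_continuousOn ?_
  refine continuousOn_matrixPairing (Y := X × (Fin d → ℂ))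
    (hF.comp continuous_fst).continuousOn
    (fun q hq => det_ne_zero_of_quadForm_pos (hpos _ hq.1)) ?_ ?_ <;>
  exact fun i => ((continuous_apply i).comp continuous_snd).continuousOn

/-- The block matrix `diag(1, G)`. -/
def prependOne (G : Matrix (Fin n) (Fin n) ℂ) : Matrix (Fin (n + 1)) (Fin (n + 1)) ℂ :=
  Matrix.of (Fin.cons (Fin.cons 1 fun _ => 0) fun i => Fin.cons 0 fun j => G i j)

theorem quadForm_axialScale_prependOne (c : ℂ) (G : Matrix (Fin n) (Fin n) ℂ) (w : Fin (n + 1) → ℂ) :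
    quadForm (axialScale c (prependOne G)) w
      = c ^ 2 * ((‖w 0‖ ^ 2 : ℝ) : ℂ) + quadForm G fun i => w i.succ := by
  have h : ∀ i j, axialScale c (prependOne G) i j
      = (Fin.cons c (fun _ => 1) : Fin (n + 1) → ℂ) i * prependOne G i j
        * (Fin.cons c (fun _ => 1) : Fin (n + 1) → ℂ) j := fun i j => by
    rw [axialScale, axialDiag, Matrix.mul_diagonal, Matrix.diagonal_mul]
  have h0 : ((‖w 0‖ ^ 2 : ℝ) : ℂ) = w 0 * conj (w 0) := by
    rw [Complex.mul_conj, Complex.normSq_eq_norm_sq]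
  simp only [quadForm, h]
  simp only [Fin.sum_univ_succ, prependOne, Matrix.of_apply, Fin.cons_zero,
    Fin.cons_succ, h0, mul_zero, zero_mul, Finset.sum_const_zero, add_zero, zero_add, one_mul, mul_one]
  ring

theorem quadForm_axialScale_prependOne_pos {c : ℂ} (hc : 0 < (c ^ 2).re)
    {G : Matrix (Fin n) (Fin n) ℝ} (hG : G.PosDef) {w : Fin (n + 1) → ℂ} (hw : w ≠ 0) :
    0 < (quadForm (axialScale c (prependOne (G.map ((↑) : ℝ → ℂ)))) w).re := by
  rw [quadForm_axialScale_prependOne, Complex.add_re, Complex.re_mul_ofReal]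
  by_cases h : (fun i : Fin n => w i.succ) = 0
  · have h0 : w 0 ≠ 0 := fun h0 => hw (funext fun i => Fin.cases h0 (fun i => congrFun h i) i)
    have : quadForm (G.map ((↑) : ℝ → ℂ)) (fun i => w i.succ) = 0 := by rw [h]; simp [quadForm]
    rw [this, Complex.zero_re, add_zero]
    have := norm_pos_iff.2 h0
    positivity
  · exact add_pos_of_nonneg_of_pos (by positivity) (quadForm_map_pos hG h)

/-- The disc |c − 1| < 1/√2 lies in the cone |arg c| < π/4. Quantitatively, Re c² exceeds (2 Re c −
1)²/2. -/
theorem re_sq_pos {c : ℂ} {t : ℝ} (ht : t ^ 2 < 1 / 2) (hc : ‖c - 1‖ ≤ t) : 0 < (c ^ 2).re := by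
  have h1 : ‖c - 1‖ ^ 2 ≤ t ^ 2 := by gcongr
  have e : ‖c - 1‖ ^ 2 = (c.re - 1) ^ 2 + c.im ^ 2 := by
    rw [← Complex.normSq_eq_norm_sq, Complex.normSq_apply]; simp; ring
  have e2 : (c ^ 2).re = c.re ^ 2 - c.im ^ 2 := by rw [sq, Complex.mul_re]; ring
  rw [e2]
  nlinarith [sq_nonneg (2 * c.re - 1)]

end Accretive

/-! ### The space of coefficient triples and the branch of the volume ratio -/

section CoefficientSpace

variable {n : ℕ}

/-- Triples `(c, A, B)`, where `c` stands for the derivative of the scaling, `A` and `B` for the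
matrices of the coefficients at the scaled and at the original point. -/
abbrev CoefSpace (n : ℕ) : Type :=
  ℂ × (Fin (n + 1) → Fin (n + 1) → ℂ) × (Fin (n + 1) → Fin (n + 1) → ℂ)

/-- The triples with accretive matrices `C A C` and `B` for which the principal branch of
`√(det A / det B)` is analytic. -/
def goodCoefs (n : ℕ) : Set (CoefSpace n) :=
  {t | (∀ w ∈ Metric.sphere (0 : Fin (n + 1) → ℂ) 1,
      0 < (quadForm (axialScale t.1 (Matrix.of t.2.1)) w).re) ∧
    (∀ w ∈ Metric.sphere (0 : Fin (n + 1) → ℂ) 1, 0 < (quadForm (Matrix.of t.2.2) w).re) ∧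
    (Matrix.of t.2.1).det / (Matrix.of t.2.2).det ∈ Complex.slitPlane}

variable {t : CoefSpace n}

theorem det_axialScale_ne_zero_of_good (ht : t ∈ goodCoefs n) :
    (axialScale t.1 (Matrix.of t.2.1)).det ≠ 0 :=
  det_ne_zero_of_quadForm_pos fun _ hw => quadForm_pos_of_sphere ht.1 hw

theorem det_snd_ne_zero_of_good (ht : t ∈ goodCoefs n) : (Matrix.of t.2.2).det ≠ 0 :=
  det_ne_zero_of_quadForm_pos fun _ hw => quadForm_pos_of_sphere ht.2.1 hw

theorem fst_ne_zero_of_good (ht : t ∈ goodCoefs n) : t.1 ≠ 0 := by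
  intro h
  refine det_axialScale_ne_zero_of_good ht ?_
  rw [det_axialScale, h]; simp

/-- Accretivity is open by compactness of the sphere, and it makes the denominator nonzero, so the
quotient of determinants is continuous there. -/
theorem isOpen_goodCoefs : IsOpen (goodCoefs n) := by
  have hd1 : Continuous fun t : CoefSpace n => (Matrix.of t.2.1).det :=
    Continuous.matrix_det (continuous_fst.comp continuous_snd)
  have hd2 : Continuous fun t : CoefSpace n => (Matrix.of t.2.2).det :=
    Continuous.matrix_det (continuous_snd.comp continuous_snd)
  rw [isOpen_iff_mem_nhds]
  intro t ht
  have h1 := eventually_quadForm_pos (continuous_axialScale continuous_fst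
    (continuous_fst.comp continuous_snd)) ht.1
  have h2 := eventually_quadForm_pos (F := fun t : CoefSpace n => Matrix.of t.2.2)
    (continuous_snd.comp continuous_snd) ht.2.1
  have h3 := (hd1.continuousAt.div hd2.continuousAt (det_snd_ne_zero_of_good ht)).eventually
    (Complex.isOpen_slitPlane.mem_nhds ht.2.2)
  filter_upwards [h1, h2, h3] with t' h1 h2 h3 using ⟨h1, h2, h3⟩

/-- The principal branch of `c √(det A / det B)`. -/
def volRatio (t : CoefSpace n) : ℂ :=
  t.1 * Complex.exp (Complex.log ((Matrix.of t.2.1).det / (Matrix.of t.2.2).det) / 2)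

/-- A set on which `volRatio` is analytic and does not vanish. -/
def volDomain (n : ℕ) : Set (CoefSpace n) :=
  {t | t.1 ≠ 0 ∧ (Matrix.of t.2.2).det ≠ 0 ∧
    (Matrix.of t.2.1).det / (Matrix.of t.2.2).det ∈ Complex.slitPlane}

theorem goodCoefs_subset_volDomain : goodCoefs n ⊆ volDomain n := fun _ ht =>
  ⟨fst_ne_zero_of_good ht, det_snd_ne_zero_of_good ht, ht.2.2⟩

theorem volRatio_ne_zero (ht : t ∈ volDomain n) : volRatio t ≠ 0 :=
  mul_ne_zero ht.1 (Complex.exp_ne_zero _)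

theorem contDiff_det_of {d : ℕ} {𝕜 E : Type*} [NontriviallyNormedField 𝕜] [NormedAddCommGroup E] [NormedSpace 𝕜 E]
    [NormedAlgebra 𝕜 ℂ] {A : E → Fin d → Fin d → ℂ} {S : Set E} {k : WithTop ℕ∞}
    (hA : ∀ i j, ContDiffOn 𝕜 k (fun t => A t i j) S) :
    ContDiffOn 𝕜 k (fun t => (Matrix.of (A t)).det) S := by
  simp only [Matrix.det_apply, Matrix.of_apply, Units.smul_def, zsmul_eq_mul]
  exact ContDiffOn.sum fun σ _ => contDiffOn_const.mul (contDiffOn_prod fun i _ => hA _ _)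

/-- The determinant of the scaled matrix contains c², whose root c is taken by hand; only det A/det
B, which is near 1 far out on the end, is left to the logarithm. -/
theorem contDiffOn_volRatio : ContDiffOn ℂ ∞ (volRatio (n := n)) (volDomain n) := by
  have hA : ∀ i j, ContDiff ℂ ∞ fun t : CoefSpace n => t.2.1 i j := fun i j => by fun_prop
  have hB : ∀ i j, ContDiff ℂ ∞ fun t : CoefSpace n => t.2.2 i j := fun i j => by fun_prop
  have hq : ContDiffOn ℂ ∞ (fun t : CoefSpace n => (Matrix.of t.2.1).det / (Matrix.of t.2.2).det)
      (volDomain n) :=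
    (contDiff_det_of fun i j => (hA i j).contDiffOn).div (contDiff_det_of fun i j => (hB i j).contDiffOn)
      fun t ht => ht.2.1
  have hl : ContDiffOn ℂ ∞ (fun t : CoefSpace n =>
      Complex.log ((Matrix.of t.2.1).det / (Matrix.of t.2.2).det)) (volDomain n) := fun t ht =>
    ContDiffAt.comp_contDiffWithinAt (g := Complex.log) t (Complex.contDiffAt_log ht.2.2) (hq t ht)
  exact contDiff_fst.contDiffOn.mul (hl.div_const 2).cexp

theorem contDiffOn_volRatio_inv : ContDiffOn ℂ ∞ (fun t => (volRatio (n := n) t)⁻¹) (volDomain n) :=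
  contDiffOn_volRatio.inv fun _ ht => volRatio_ne_zero ht

theorem norm_matrixPairing_le {d : ℕ} (G : Matrix (Fin d) (Fin d) ℂ) (x y : Fin d → ℂ) :
    ‖matrixPairing G x y‖ ≤ (∑ i, ∑ j, ‖(Gᵀ⁻¹) i j‖) * (‖x‖ * ‖y‖) := by
  rw [matrixPairing, Finset.sum_mul]
  refine (norm_sum_le _ _).trans (Finset.sum_le_sum fun i _ => ?_)
  rw [norm_mul, Complex.norm_conj]
  have h1 : ‖(Gᵀ⁻¹ *ᵥ y) i‖ ≤ (∑ j, ‖(Gᵀ⁻¹) i j‖) * ‖y‖ := by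
    rw [Matrix.mulVec, dotProduct, Finset.sum_mul]
    refine (norm_sum_le _ _).trans (Finset.sum_le_sum fun j _ => ?_)
    rw [norm_mul]
    gcongr
    exact norm_le_pi_norm y j
  have h2 := norm_le_pi_norm x i
  calc ‖x i‖ * ‖(Gᵀ⁻¹ *ᵥ y) i‖ ≤ ‖x‖ * ((∑ j, ‖(Gᵀ⁻¹) i j‖) * ‖y‖) := by gcongr
    _ = _ := by ring

/-- Bounds on a compact set of coefficients. -/
theorem exists_coef_bounds {K : Set (CoefSpace n)} (hK : IsCompact K) (hKg : K ⊆ goodCoefs n) :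
    ∃ C : ℝ, 1 ≤ C ∧ ∀ t ∈ K,
      (∀ x, ‖x‖ ^ 2 ≤ C * (matrixPairing (axialScale t.1 (Matrix.of t.2.1)) x x).re) ∧
      (∀ x y, ‖matrixPairing (axialScale t.1 (Matrix.of t.2.1)) x y‖ ≤ C * (‖x‖ * ‖y‖)) ∧
      (∀ x, (matrixPairing (Matrix.of t.2.2) x x).re ≤ C * ‖x‖ ^ 2 ∧
        ‖x‖ ^ 2 ≤ C * (matrixPairing (Matrix.of t.2.2) x x).re) ∧
      ‖volRatio t‖ ≤ C ∧ ‖fderiv ℝ (fun t => (volRatio t)⁻¹) t‖ ≤ C := by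
  have hcont1 : Continuous fun t : CoefSpace n => axialScale t.1 (Matrix.of t.2.1) :=
    continuous_axialScale continuous_fst (continuous_fst.comp continuous_snd)
  have hcont2 : Continuous fun t : CoefSpace n => Matrix.of t.2.2 := continuous_snd.comp continuous_snd
  obtain ⟨C₁, h1, hC₁⟩ := exists_matrixPairing_bounds hK hcont1 fun t ht w hw => quadForm_pos_of_sphere (hKg ht).1 hw
  obtain ⟨C₂, h2, hC₂⟩ := exists_matrixPairing_bounds hK hcont2 fun t ht w hw => quadForm_pos_of_sphere (hKg ht).2.1 hw
  have hinv : ContinuousOn (fun t : CoefSpace n =>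
      ∑ i, ∑ j, ‖((axialScale t.1 (Matrix.of t.2.1))ᵀ⁻¹) i j‖) K := by
    have h3 : ContinuousOn (fun t : CoefSpace n => (axialScale t.1 (Matrix.of t.2.1))ᵀ⁻¹) K :=
      continuousOn_matrix_inv hcont1.matrix_transpose.continuousOn fun t ht => by
        rw [Matrix.det_transpose]; exact det_axialScale_ne_zero_of_good (hKg ht)
    exact continuousOn_finsetSum _ fun i _ => continuousOn_finsetSum _ fun j _ =>
      (continuousOn_pi.1 (continuousOn_pi.1 h3 i) j).norm
  obtain ⟨C₃, hC₃⟩ := hK.exists_bound_of_continuousOn hinv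
  obtain ⟨C₄, hC₄⟩ := hK.exists_bound_of_continuousOn (contDiffOn_volRatio.continuousOn.mono
    (hKg.trans goodCoefs_subset_volDomain))
  have hR : ContDiffOn ℝ ∞ (fun t => (volRatio (n := n) t)⁻¹) (goodCoefs n) :=
    (contDiffOn_volRatio_inv.restrict_scalars ℝ).mono goodCoefs_subset_volDomain
  obtain ⟨C₅, hC₅⟩ := hK.exists_bound_of_continuousOn
    ((hR.continuousOn_fderiv_of_isOpen isOpen_goodCoefs (by simp)).mono hKg)
  set C := C₁ + C₂ + |C₃| + |C₄| + |C₅| with hC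
  have a3 := abs_nonneg C₃
  have a4 := abs_nonneg C₄
  have a5 := abs_nonneg C₅
  refine ⟨C, by linarith, fun t ht => ⟨fun x => ?_, fun x y => ?_, fun x => ⟨?_, ?_⟩, ?_, ?_⟩⟩
  · have h := (hC₁ t ht x).2
    have : 0 ≤ (matrixPairing (axialScale t.1 (Matrix.of t.2.1)) x x).re := by
      by_contra hneg; push Not at hneg; nlinarith [sq_nonneg ‖x‖]
    exact h.trans (mul_le_mul_of_nonneg_right (by linarith) this)
  · refine (norm_matrixPairing_le _ x y).trans (mul_le_mul_of_nonneg_right ?_ (by positivity))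
    have := (le_abs_self _).trans (hC₃ t ht)
    linarith [le_abs_self C₃]
  · exact (hC₂ t ht x).1.trans (mul_le_mul_of_nonneg_right (by linarith) (by positivity))
  · have h := (hC₂ t ht x).2
    have : 0 ≤ (matrixPairing (Matrix.of t.2.2) x x).re := by
      by_contra hneg; push Not at hneg; nlinarith [sq_nonneg ‖x‖]
    exact h.trans (mul_le_mul_of_nonneg_right (by linarith) this)
  · exact (hC₄ t ht).trans (by linarith [le_abs_self C₄])
  · exact (hC₅ t ht).trans (by linarith [le_abs_self C₅])

end CoefficientSpace

/-! ### Uniform ellipticity far out on the end -/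

section UniformBounds

variable {n : ℕ} {H : Type*} [TopologicalSpace H]
  {I : ModelWithCorners ℝ (EuclideanSpace ℝ (Fin (n + 1))) H}
  {M : Type*} [TopologicalSpace M] [ChartedSpace H M] [IsManifold I ∞ M]
  {H' : Type*} [TopologicalSpace H']
  {J : ModelWithCorners ℝ (EuclideanSpace ℝ (Fin n)) H'}
  {Ω : Type*} [TopologicalSpace Ω] [ChartedSpace H' Ω] [IsManifold J ∞ Ω]
  {g : Metric I M} {α : ℝ} (e : QuasicylindricalEnd J Ω g α)

/-- The coefficients of `g_lam` and `g` at a point of the end. -/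
def coefAt (y₀ : Ω) (s : ℝ → ℝ) (r : ℝ) (lam : ℂ) (q : ℝ × EuclideanSpace ℝ (Fin n)) : CoefSpace n :=
  (scaledDeriv s r lam q.1, endGram e y₀ (scaledVar s r lam q.1) q.2, endGram e y₀ q.1 q.2)

/-- The bounds on the coefficients at a point of `goodCoefs`. -/
structure CoefBounds (C : ℝ) (t : CoefSpace n) : Prop where
  good : t ∈ goodCoefs n
  coercive : ∀ x, ‖x‖ ^ 2 ≤ C * (matrixPairing (axialScale t.1 (Matrix.of t.2.1)) x x).re
  bounded : ∀ x y, ‖matrixPairing (axialScale t.1 (Matrix.of t.2.1)) x y‖ ≤ C * (‖x‖ * ‖y‖)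
  metric_le : ∀ x, (matrixPairing (Matrix.of t.2.2) x x).re ≤ C * ‖x‖ ^ 2
  le_metric : ∀ x, ‖x‖ ^ 2 ≤ C * (matrixPairing (Matrix.of t.2.2) x x).re
  volRatio_le : ‖volRatio t‖ ≤ C
  deriv_le : ‖fderiv ℝ (fun t => (volRatio t)⁻¹) t‖ ≤ C

theorem CoefBounds.mono {C C' : ℝ} {t : CoefSpace n} (h : CoefBounds C t) (hC : C ≤ C') :
    CoefBounds C' t where
  good := h.good
  coercive x := (h.coercive x).trans (mul_le_mul_of_nonneg_right hC (by
    by_cases hx : x = 0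
    · subst hx; simp [matrixPairing]
    · exact (matrixPairing_pos_of_quadForm_pos (fun _ hw => quadForm_pos_of_sphere h.good.1 hw) hx).le))
  bounded x y := (h.bounded x y).trans (by gcongr)
  metric_le x := (h.metric_le x).trans (by gcongr)
  le_metric x := (h.le_metric x).trans (mul_le_mul_of_nonneg_right hC (by
    by_cases hx : x = 0
    · subst hx; simp [matrixPairing]
    · exact (matrixPairing_pos_of_quadForm_pos (fun _ hw => quadForm_pos_of_sphere h.good.2.1 hw) hx).le))
  volRatio_le := h.volRatio_le.trans hC
  deriv_le := h.deriv_le.trans hC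

theorem limGram_eq (y₀ : Ω) (u : EuclideanSpace ℝ (Fin n)) : limGram e y₀ u = prependOne
    ((realGram e.limitMetric ((extChartAt J y₀).symm u) (coordVec J y₀ u)).map ((↑) : ℝ → ℂ)) := rfl

/-- Here α < π/4 is used: sin² α < 1/2 gives Re c² > 0, so diag(c², h) is accretive; the quotient of
determinants at infinity is 1. -/
theorem limGram_good (hα0 : 0 < α) (hα : α < Real.pi / 4) {y₀ : Ω} {u : EuclideanSpace ℝ (Fin n)}
    (hu : u ∈ (extChartAt J y₀).target) {c : ℂ} (hc : ‖c - 1‖ ≤ Real.sin α) :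
    ((c, limGram e y₀ u, limGram e y₀ u) : CoefSpace n) ∈ goodCoefs n := by
  have hsin : Real.sin α ^ 2 < 1 / 2 := by
    have h1 : Real.sin α < Real.sin (Real.pi / 4) :=
      Real.sin_lt_sin_of_lt_of_le_pi_div_two (by linarith) (by linarith [Real.pi_pos]) hα
    have h0 : 0 < Real.sin α := Real.sin_pos_of_pos_of_lt_pi hα0 (by linarith [Real.pi_pos])
    rw [Real.sin_pi_div_four] at h1
    have h2 : Real.sin α ^ 2 < (√2 / 2) ^ 2 := by gcongr
    rw [div_pow, Real.sq_sqrt (by norm_num)] at h2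
    linarith
  have hG := posDef_realGram e.limitMetric (linearIndependent_coordVec y₀ hu)
  have h1 : ∀ w ≠ 0, 0 < (quadForm (axialScale c (limGram e y₀ u)) w).re := fun w hw => by
    rw [limGram_eq]
    exact quadForm_axialScale_prependOne_pos (re_sq_pos hsin hc) hG hw
  have h2 : ∀ w ≠ 0, 0 < (quadForm (limGram e y₀ u) w).re := fun w hw => by
    rw [← axialScale_one (limGram e y₀ u), limGram_eq]
    exact quadForm_axialScale_prependOne_pos (by simp) hG hw
  have hsph : ∀ w ∈ Metric.sphere (0 : Fin (n + 1) → ℂ) 1, w ≠ 0 := fun w hw h => by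
    simp [h] at hw
  refine ⟨fun w hw => h1 w (hsph w hw), fun w hw => h2 w (hsph w hw), ?_⟩
  have h3 : (limGram e y₀ u).det ≠ 0 := det_ne_zero_of_quadForm_pos h2
  change (limGram e y₀ u).det / (limGram e y₀ u).det ∈ Complex.slitPlane
  rw [div_self h3]
  exact Complex.one_mem_slitPlane

/-- Only the range of c enters, never s itself. The triples with both matrices at infinity form a
compact part of the open good set, and for large r the actual triples are uniformly close to it. -/
theorem exists_patch_coefBounds [T2Space Ω] [CompactSpace Ω] (y₀ : Ω) :
    ∃ K ∈ 𝓝 y₀, K ⊆ (extChartAt J y₀).source ∧ ∃ R C : ℝ, ∀ s, IsScaling s → ∀ r, R ≤ r →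
      ∀ lam ∈ disk α, ∀ x, r ≤ x → ∀ y ∈ K,
        CoefBounds C (coefAt e y₀ s r lam (x, extChartAt J y₀ y)) ∧
        ∀ z ∈ ({scaledVar s r lam x, (x : ℂ)} : Set ℂ), z ∈ sectorDomain α ∧ ∀ i j,
          ‖fderivWithin ℝ (fun q : ℂ × EuclideanSpace ℝ (Fin n) => endGram e y₀ q.1 q.2 i j)
            (sectorDomain α ×ˢ (extChartAt J y₀).target) (z, extChartAt J y₀ y)‖ ≤ C := by
  obtain ⟨K, hK, hKc, hKs, hlim, R₁, C₁, hbd⟩ := exists_patch_bound e y₀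
  have hα0 := e.angle_pos
  have hα := e.angle_lt
  have hsin : 0 < Real.sin α := Real.sin_pos_of_pos_of_lt_pi hα0 (by linarith [Real.pi_pos])
  let Φ : ℂ × Ω → CoefSpace n := fun q =>
    (q.1, limGram e y₀ (extChartAt J y₀ q.2), limGram e y₀ (extChartAt J y₀ q.2))
  have hL : ContinuousOn (fun y => (limGram e y₀ (extChartAt J y₀ y) : Fin (n + 1) → Fin (n + 1) → ℂ)) K :=
    continuousOn_pi.2 fun i => continuousOn_pi.2 fun j =>
      (isEndCoefficient_endGram e y₀ i j).smooth_lim.continuousOn.comp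
        ((continuousOn_extChartAt y₀).mono hKs) fun y hy => (extChartAt J y₀).map_source (hKs hy)
  have hB : IsCompact (Metric.closedBall (1 : ℂ) (Real.sin α) ×ˢ K) := (isCompact_closedBall _ _).prod hKc
  have hΦ : ContinuousOn Φ (Metric.closedBall (1 : ℂ) (Real.sin α) ×ˢ K) :=
    continuousOn_fst.prodMk ((hL.comp continuousOn_snd fun q hq => hq.2).prodMk
      (hL.comp continuousOn_snd fun q hq => hq.2))
  have hKc₀ := hB.image_of_continuousOn hΦ
  have hsub : Φ '' (Metric.closedBall (1 : ℂ) (Real.sin α) ×ˢ K) ⊆ goodCoefs n := by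
    rintro _ ⟨⟨c, y⟩, ⟨hc, hy⟩, rfl⟩
    exact limGram_good e hα0 hα ((extChartAt J y₀).map_source (hKs hy)) (by
      simpa [dist_eq_norm] using hc)
  -- The closed thickening is again compact and good, so one constant bounds all quantities on it.
  obtain ⟨ε, hε, hεsub⟩ := hKc₀.exists_cthickening_subset_open isOpen_goodCoefs hsub
  obtain ⟨C₂, -, hC₂⟩ := exists_coef_bounds hKc₀.cthickening hεsub
  obtain ⟨R₂, hR₂⟩ := hlim ε hε
  -- The term 1/sin α makes r sin α ≥ 1, so that unit balls around the deformed points lie in the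
  -- sector, as the derivative bounds require.
  refine ⟨K, hK, hKs, max (max R₁ R₂) (1 / Real.sin α), max C₁ C₂, ?_⟩
  intro s hs r hr lam hlam x hx y hy
  have hrs : 1 ≤ r * Real.sin α := by
    rw [← div_le_iff₀ hsin]; exact (le_max_right _ _).trans hr
  have hr1 : R₁ ≤ r := (le_max_left _ _).trans ((le_max_left _ _).trans hr)
  have hr2 : R₂ ≤ r := (le_max_right _ _).trans ((le_max_left _ _).trans hr)
  have hr0 : 0 < r := by by_contra h; push Not at h; nlinarith
  have hz1 : Metric.ball (scaledVar s r lam x) 1 ⊆ sectorDomain α :=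
    (Metric.ball_subset_ball hrs).trans
      (ball_scaledVar_subset hs hα0 (by linarith [Real.pi_pos]) hlam hx)
  have hx1 : Metric.ball (x : ℂ) 1 ⊆ sectorDomain α :=
    (Metric.ball_subset_ball (hrs.trans (by gcongr))).trans
      (ball_subset_sectorDomain hα0 (by linarith [Real.pi_pos]) x)
  have hnz : r ≤ ‖scaledVar s r lam x‖ := le_norm_scaledVar hs hlam hx
  have hnx : r ≤ ‖(x : ℂ)‖ := by rw [Complex.norm_real]; exact hx.trans (le_abs_self x)
  have hzs := hz1 (Metric.mem_ball_self one_pos)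
  have hxs := hx1 (Metric.mem_ball_self one_pos)
  refine ⟨?_, ?_⟩
  · have hmem : coefAt e y₀ s r lam (x, extChartAt J y₀ y) ∈
        Metric.cthickening ε (Φ '' (Metric.closedBall (1 : ℂ) (Real.sin α) ×ˢ K)) := by
      have hc : scaledDeriv s r lam x ∈ Metric.closedBall (1 : ℂ) (Real.sin α) := by
        rw [Metric.mem_closedBall, dist_eq_norm]; exact norm_scaledDeriv_sub_one_le hs hlam r x
      refine Metric.mem_cthickening_of_dist_le _ (Φ (scaledDeriv s r lam x, y)) _ _
        (mem_image_of_mem _ ⟨hc, hy⟩) ?_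
      refine max_le ?_ (max_le ?_ ?_)
      · simp [coefAt, Φ, hε.le]
      · exact (dist_pi_le_iff hε.le).2 fun i => (dist_pi_le_iff hε.le).2 fun j => by
          rw [dist_eq_norm]; exact (hR₂ _ hzs (hr2.trans hnz) y hy i j).le
      · exact (dist_pi_le_iff hε.le).2 fun i => (dist_pi_le_iff hε.le).2 fun j => by
          rw [dist_eq_norm]; exact (hR₂ _ hxs (hr2.trans hnx) y hy i j).le
    obtain ⟨h1, h2, h3, h4, h5⟩ := hC₂ _ hmem
    exact CoefBounds.mono ⟨hεsub hmem, h1, h2, fun x => (h3 x).1, fun x => (h3 x).2, h4, h5⟩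
      (le_max_right _ _)
  · rintro z (rfl | rfl)
    · exact ⟨hzs, fun i j => (hbd _ hz1 (hr1.trans hnz) y hy i j).trans (le_max_left _ _)⟩
    · exact ⟨hxs, fun i j => (hbd _ hx1 (hr1.trans hnx) y hy i j).trans (le_max_left _ _)⟩

/-- Uniform bounds on the coefficients at the points with `x > r`, in a suitable chart of `Ω`. -/
theorem exists_uniform_coefBounds [T2Space Ω] [CompactSpace Ω] :
    ∃ r₀ C : ℝ, 0 < r₀ ∧ 1 ≤ C ∧ ∀ s, IsScaling s → ∀ r, r₀ ≤ r → ∀ lam ∈ disk α,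
      ∀ p ∈ e.cyl.source, r < (e.cyl p).1 → ∃ y₀ : Ω, ∃ q ∈ endDomain J r y₀, endParam e y₀ q = p ∧
        CoefBounds C (coefAt e y₀ s r lam q) ∧
        ∀ z ∈ ({scaledVar s r lam q.1, (q.1 : ℂ)} : Set ℂ), z ∈ sectorDomain α ∧ ∀ i j,
          ‖fderivWithin ℝ (fun q : ℂ × EuclideanSpace ℝ (Fin n) => endGram e y₀ q.1 q.2 i j)
            (sectorDomain α ×ˢ (extChartAt J y₀).target) (z, q.2)‖ ≤ C := by
  choose K hK hKs R C h using exists_patch_coefBounds e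
  obtain ⟨t, -, ht⟩ := (isCompact_univ (X := Ω)).elim_nhds_subcover K fun y _ => hK y
  obtain ⟨R', hR'⟩ := (t.image R).exists_le
  obtain ⟨C', hC'⟩ := (t.image C).exists_le
  refine ⟨max R' 1, max C' 1, by positivity, le_max_right _ _, ?_⟩
  intro s hs r hr lam hlam p hp hpr
  obtain ⟨y₀, hy₀, hy⟩ := mem_iUnion₂.1 (ht (mem_univ (e.cyl p).2))
  have hR := (hR' _ (Finset.mem_image_of_mem R hy₀)).trans ((le_max_left _ _).trans hr)
  have hC := (hC' _ (Finset.mem_image_of_mem C hy₀)).trans (le_max_left C' 1)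
  obtain ⟨h1, h2⟩ := h y₀ s hs r hR lam hlam (e.cyl p).1 hpr.le (e.cyl p).2 hy
  have hpe : p ∈ endPatch e r y₀ := ⟨hp, hpr, hKs y₀ hy⟩
  exact ⟨y₀, endCoord e y₀ p, endCoord_mem e hpe, endParam_endCoord e hpe, h1.mono hC,
    fun z hz => ⟨(h2 z hz).1, fun i j => ((h2 z hz).2 i j).trans hC⟩⟩

end UniformBounds

/-! ### The complex volume density -/

section VolumeDensity

variable {n : ℕ} {H : Type*} [TopologicalSpace H]
  {I : ModelWithCorners ℝ (EuclideanSpace ℝ (Fin (n + 1))) H}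
  {M : Type*} [TopologicalSpace M] [ChartedSpace H M] [IsManifold I ∞ M]
  {H' : Type*} [TopologicalSpace H']
  {J : ModelWithCorners ℝ (EuclideanSpace ℝ (Fin n)) H'}
  {Ω : Type*} [TopologicalSpace Ω] [ChartedSpace H' Ω] [IsManifold J ∞ Ω]
  {g : Metric I M} {α : ℝ} (e : QuasicylindricalEnd J Ω g α)

/-- `s` is a scaling, and for `x > r` the coefficients satisfy uniform bounds. -/
structure Admissible (s : ℝ → ℝ) (r C : ℝ) : Prop where
  scaling : IsScaling s
  pos : 0 < r
  one_le : 1 ≤ C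
  bounds : ∀ lam ∈ disk α,
    ∀ p ∈ e.cyl.source, r < (e.cyl p).1 → ∃ y₀ : Ω, ∃ q ∈ endDomain J r y₀, endParam e y₀ q = p ∧
      CoefBounds C (coefAt e y₀ s r lam q) ∧
      ∀ z ∈ ({scaledVar s r lam q.1, (q.1 : ℂ)} : Set ℂ), z ∈ sectorDomain α ∧ ∀ i j,
        ‖fderivWithin ℝ (fun q : ℂ × EuclideanSpace ℝ (Fin n) => endGram e y₀ q.1 q.2 i j)
          (sectorDomain α ×ˢ (extChartAt J y₀).target) (z, q.2)‖ ≤ C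

variable {e} {s : ℝ → ℝ} {r C : ℝ} {lam : ℂ} {y₀ : Ω}
  {q : ℝ × EuclideanSpace ℝ (Fin n)} {p : M}

theorem sin_pos_of_end (e : QuasicylindricalEnd J Ω g α) : 0 < Real.sin α :=
  Real.sin_pos_of_pos_of_lt_pi e.angle_pos (by linarith [e.angle_lt, Real.pi_pos])

theorem Admissible.scaledVar_mem (h : Admissible e s r C) (hlam : lam ∈ disk α) {x : ℝ} (hx : r ≤ x) :
    scaledVar s r lam x ∈ sectorDomain α :=
  ball_scaledVar_subset h.scaling e.angle_pos (by linarith [e.angle_lt, Real.pi_pos]) hlam hx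
    (Metric.mem_ball_self (mul_pos h.pos (sin_pos_of_end e)))

theorem zero_mem_disk (e : QuasicylindricalEnd J Ω g α) : (0 : ℂ) ∈ disk α :=
  Metric.mem_ball_self (sin_pos_of_end e)

theorem conj_mem_disk (hlam : lam ∈ disk α) : conj lam ∈ disk α := by
  simpa [disk] using hlam

theorem scaledVar_zero (s : ℝ → ℝ) (r x : ℝ) : scaledVar s r 0 x = x := by simp [scaledVar]

theorem scaledDeriv_zero (s : ℝ → ℝ) (r x : ℝ) : scaledDeriv s r 0 x = 1 := by simp [scaledDeriv]

theorem gramIn_pmlField_eq (hr : 0 ≤ r) (hq : q ∈ endDomain J r y₀) :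
    gramIn (pmlField e s r lam) (endParam e y₀ q) (endFrame e y₀ q)
      = axialScale (coefAt e y₀ s r lam q).1 (Matrix.of (coefAt e y₀ s r lam q).2.1) :=
  gramIn_pmlField e s r lam hr hq

theorem gramIn_ofMetric_eq (hr : 0 ≤ r) (hq : q ∈ endDomain J r y₀) :
    gramIn (ofMetric g) (endParam e y₀ q) (endFrame e y₀ q)
      = Matrix.of (coefAt e y₀ s r lam q).2.2 :=
  gramIn_ofMetric_endFrame e hr hq

theorem Admissible.det_gram_ne_zero (h : Admissible e s r C) (hlam : lam ∈ disk α) (p : M) :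
    (gram (pmlField e s r lam) p).det ≠ 0 := by
  by_cases hp : p ∈ e.cyl.source ∧ r < (e.cyl p).1
  · obtain ⟨y₀, q, hq, rfl, hb, -⟩ := h.bounds lam hlam p hp.1 hp.2
    have h1 := det_gramIn (isBilinAt_pmlField e s r lam (endParam e y₀ q)) (endFrame e y₀ q)
    rw [gramIn_pmlField_eq h.pos.le hq] at h1
    intro h0
    rw [h0, mul_zero] at h1
    exact det_axialScale_ne_zero_of_good hb.good h1
  · have h1 : pmlField e s r lam p = ofMetric g p := pmlField_eq_ofMetric e h.scaling r lam fun hp' => by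
      by_contra hx
      exact hp ⟨hp', by linarith⟩
    have h2 : gram (pmlField e s r lam) p = gram (ofMetric g) p := by
      ext i j; simp only [gram, Matrix.of_apply, h1]
    rw [h2]
    exact det_gram_ofMetric_ne_zero g p

/-- Both determinants acquire the same factor under the change to the frame of the end, and it
cancels. -/
theorem detRatio_endParam (hr : 0 ≤ r) (hq : q ∈ endDomain J r y₀) :
    detRatio e s r (endParam e y₀ q) lam = scaledDeriv s r lam q.1 ^ 2 *
      ((endGram e y₀ (scaledVar s r lam q.1) q.2).det / (endGram e y₀ q.1 q.2).det) := by
  have h1 := det_gramIn (isBilinAt_pmlField e s r lam (endParam e y₀ q)) (endFrame e y₀ q)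
  have h2 := det_gramIn (isBilinAt_ofMetric g (endParam e y₀ q)) (endFrame e y₀ q)
  rw [gramIn_pmlField e s r lam hr hq] at h1
  rw [gramIn_ofMetric_endFrame e hr hq] at h2
  have h3 := det_axialScale (scaledDeriv s r lam q.1) (endGram e y₀ (scaledVar s r lam q.1) q.2)
  rw [axialScale, h1] at h3
  have h4 : (((frameMatrix (endParam e y₀ q) (endFrame e y₀ q)).det : ℝ) : ℂ) ≠ 0 := by
    exact_mod_cast det_frameMatrix_ne_zero (linearIndependent_endFrame e hr hq)
  rw [detRatio, ← mul_div_assoc, ← h3, h2, mul_div_mul_left _ _ (pow_ne_zero 2 h4)]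

theorem fst_endParam (hr : 0 ≤ r) (hq : q ∈ endDomain J r y₀) : (e.cyl (endParam e y₀ q)).1 = q.1 := by
  rw [cyl_endParam e hr hq]

/-- The bounds hold only in one chosen chart over each point. The conditions defining `volDomain`,
unlike those of `goodCoefs`, can be transferred to any chart because the quotient of determinants is
frame independent. -/
theorem Admissible.coefAt_mem_volDomain (h : Admissible e s r C) (hlam : lam ∈ disk α)
    (hq : q ∈ endDomain J r y₀) : coefAt e y₀ s r lam q ∈ volDomain n := by
  have hr := h.pos.le
  obtain ⟨y₁, q₁, hq₁, hp, hb, -⟩ := h.bounds lam hlam (endParam e y₀ q) (endParam_mem_source e hr hq)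
    (by rw [fst_endParam hr hq]; exact hq.1)
  have hx : q₁.1 = q.1 := by rw [← fst_endParam (e := e) hr hq, ← fst_endParam (e := e) hr hq₁, hp]
  obtain ⟨h1, h2, h3⟩ := goodCoefs_subset_volDomain hb.good
  have h4 := detRatio_endParam (e := e) (s := s) (lam := lam) hr hq₁
  rw [hp, detRatio_endParam hr hq, hx] at h4
  have hc : scaledDeriv s r lam q.1 ≠ 0 := by rw [← hx]; exact h1
  refine ⟨hc, ?_, ?_⟩
  · have := det_gramIn_ofMetric_ne_zero g (linearIndependent_endFrame e hr hq)
    rwa [gramIn_ofMetric_endFrame e hr hq] at this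
  · have h5 := mul_left_cancel₀ (pow_ne_zero 2 hc) h4
    rw [← hx] at h5
    change (endGram e y₀ (scaledVar s r lam q.1) q.2).det / (endGram e y₀ q.1 q.2).det ∈ _
    rw [← hx, h5]
    exact h3

open Classical in
/-- The density of the complex volume, by means of the principal branch of the square root. -/
def explicitDensity (e : QuasicylindricalEnd J Ω g α) (s : ℝ → ℝ) (r : ℝ) (lam : ℂ) (p : M) : ℂ :=
  if p ∈ e.cyl.source ∧ r < (e.cyl p).1 then
    scaledDeriv s r lam (e.cyl p).1 * Complex.exp (Complex.log
      (detRatio e s r p lam / scaledDeriv s r lam (e.cyl p).1 ^ 2) / 2)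
  else 1

theorem Admissible.explicitDensity_endParam (h : Admissible e s r C) (hlam : lam ∈ disk α)
    (hq : q ∈ endDomain J r y₀) :
    explicitDensity e s r lam (endParam e y₀ q) = volRatio (coefAt e y₀ s r lam q) := by
  have hr := h.pos.le
  have hc : scaledDeriv s r lam q.1 ≠ 0 := (h.coefAt_mem_volDomain hlam hq).1
  rw [explicitDensity, if_pos ⟨endParam_mem_source e hr hq, by rw [fst_endParam hr hq]; exact hq.1⟩,
    detRatio_endParam hr hq, fst_endParam hr hq, mul_div_cancel_left₀ _ (pow_ne_zero 2 hc)]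
  rfl

theorem detRatio_eq_one (hs : IsScaling s) (hp : p ∈ e.cyl.source → (e.cyl p).1 < r + 1) :
    detRatio e s r p lam = 1 := by
  have h1 : pmlField e s r lam p = ofMetric g p := pmlField_eq_ofMetric e hs r lam hp
  have h2 : gram (pmlField e s r lam) p = gram (ofMetric g) p := by
    ext i j; simp only [gram, Matrix.of_apply, h1]
  rw [detRatio, h2, div_self (det_gram_ofMetric_ne_zero g p)]

theorem explicitDensity_eq_one (hs : IsScaling s) (hp : p ∈ e.cyl.source → (e.cyl p).1 < r + 1) :
    explicitDensity e s r lam p = 1 := by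
  rw [explicitDensity]
  split_ifs with h
  · have : scaledDeriv s r lam (e.cyl p).1 = 1 := by
      rw [scaledDeriv, hs.deriv_eq_zero (by linarith [hp h.1])]; simp
    rw [detRatio_eq_one hs hp, this]; simp
  · rfl

theorem exists_endParam_of_mem (hp : p ∈ e.cyl.source) (hx : r < (e.cyl p).1) :
    ∃ y₀ : Ω, ∃ q ∈ endDomain J r y₀, endParam e y₀ q = p :=
  ⟨_, _, endCoord_mem e (exists_endPatch e hp hx), endParam_endCoord e (exists_endPatch e hp hx)⟩

theorem Admissible.differentiableOn_coefAt (h : Admissible e s r C) (hq : q ∈ endDomain J r y₀) :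
    DifferentiableOn ℂ (fun lam => coefAt e y₀ s r lam q) (disk α) := by
  have hz : DifferentiableOn ℂ (fun lam => scaledVar s r lam q.1) (disk α) := by
    unfold scaledVar; fun_prop
  have hc : DifferentiableOn ℂ (fun lam => scaledDeriv s r lam q.1) (disk α) := by
    unfold scaledDeriv; fun_prop
  refine hc.prodMk (DifferentiableOn.prodMk ?_ (differentiableOn_const _))
  exact differentiableOn_pi.2 fun i => differentiableOn_pi.2 fun j =>
    ((isEndCoefficient_endGram e y₀ i j).holomorphic q.2).comp hz fun lam hlam =>
      h.scaledVar_mem hlam (le_of_lt hq.1)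

theorem ofReal_sqrt_eq {w : ℝ} (hw : 0 < w) :
    Complex.exp (Complex.log (w : ℂ) / 2) = ((Real.sqrt w : ℝ) : ℂ) := by
  rw [← Complex.ofReal_log hw.le, ← Complex.ofReal_ofNat, ← Complex.ofReal_div, ← Complex.ofReal_exp]
  congr 1
  symm
  rw [Real.sqrt_eq_iff_mul_self_eq hw.le (Real.exp_pos _).le, ← Real.exp_add, add_halves,
    Real.exp_log hw]

/-- At real points the coefficients are those of the Riemannian metric `g`, whose Gram determinants
are positive. -/
theorem endGram_real {x : ℝ} (hx : 0 < x) {u : EuclideanSpace ℝ (Fin n)}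
    (hu : u ∈ (extChartAt J y₀).target) :
    ∃ D : ℝ, 0 < D ∧ (endGram e y₀ x u).det = D := by
  have hq : ((x, u) : ℝ × EuclideanSpace ℝ (Fin n)) ∈ endDomain J 0 y₀ := ⟨hx, hu⟩
  refine ⟨(realGram g (endParam e y₀ (x, u)) (endFrame e y₀ (x, u))).det,
    (posDef_realGram g (linearIndependent_endFrame e le_rfl hq)).det_pos, ?_⟩
  have := gramIn_ofMetric_endFrame e le_rfl hq
  rw [← this, gramIn_ofMetric]
  exact (RingHom.map_det Complex.ofRealHom _).symm

/-- The explicit branch is holomorphic in the parameter. For real parameters the scaled variable is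
real and positive, so both determinants are positive and exp(log/2) is the ordinary square root. -/
theorem Admissible.isDensityExtension (h : Admissible e s r C) (p : M) :
    IsDensityExtension e s r p fun lam => explicitDensity e s r lam p := by
  by_cases hp : p ∈ e.cyl.source ∧ r < (e.cyl p).1
  · obtain ⟨y₀, q, hq, rfl⟩ := exists_endParam_of_mem hp.1 hp.2
    have hE : ∀ lam ∈ disk α, explicitDensity e s r lam (endParam e y₀ q)
      = volRatio (coefAt e y₀ s r lam q) := fun lam hlam => h.explicitDensity_endParam hlam hq
    refine ⟨DifferentiableOn.congr ?_ hE, fun t ht => ?_⟩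
    · exact (contDiffOn_volRatio.differentiableOn (by simp)).comp (h.differentiableOn_coefAt hq)
        fun lam hlam => h.coefAt_mem_volDomain hlam hq
    · have hx : r < q.1 := hq.1
      have hs0 := h.scaling.nonneg (q.1 - r)
      have hs1 := h.scaling.le_self (x := q.1 - r) (by linarith)
      have hd0 := h.scaling.deriv_nonneg (q.1 - r)
      have hd1 := h.scaling.deriv_le_one (q.1 - r)
      have ht1 : |t| < 1 := by
        have := norm_lt_of_mem_disk ht
        rw [Complex.norm_real] at this
        exact this.trans_le (Real.sin_le_one α)
      rw [abs_lt] at ht1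
      have hr := h.pos
      -- Since t > −1, the deformed variable exceeds x − s_r(x) ≥ r.
      have hxt : 0 < q.1 + t * s (q.1 - r) := by nlinarith
      have hct : 0 < 1 + t * deriv s (q.1 - r) := by nlinarith
      have e1 : scaledVar s r t q.1 = ((q.1 + t * s (q.1 - r) : ℝ) : ℂ) := by
        rw [scaledVar]; push_cast; ring
      have e2 : scaledDeriv s r t q.1 = ((1 + t * deriv s (q.1 - r) : ℝ) : ℂ) := by
        rw [scaledDeriv]; push_cast; ring
      obtain ⟨D₁, hD₁, hD₁'⟩ := endGram_real (e := e) (y₀ := y₀) hxt hq.2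
      obtain ⟨D₂, hD₂, hD₂'⟩ := endGram_real (e := e) (y₀ := y₀) (hr.trans hx) hq.2
      have hV : volRatio (coefAt e y₀ s r t q) = scaledDeriv s r t q.1 * Complex.exp (Complex.log
        ((endGram e y₀ (scaledVar s r t q.1) q.2).det / (endGram e y₀ q.1 q.2).det) / 2) := rfl
      simp only
      rw [hE t ht, hV, detRatio_endParam hr.le hq, e1, e2, hD₁', hD₂', ← Complex.ofReal_div,
        ofReal_sqrt_eq (div_pos hD₁ hD₂), ← Complex.ofReal_mul, ← Complex.ofReal_pow,
        ← Complex.ofReal_mul, Complex.ofReal_re, Real.sqrt_mul (sq_nonneg _), Real.sqrt_sq hct.le]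
  · have hp' : p ∈ e.cyl.source → (e.cyl p).1 < r + 1 := fun hp' => by
      by_contra hx
      exact hp ⟨hp', by linarith⟩
    refine ⟨(differentiableOn_const 1).congr fun lam _ => explicitDensity_eq_one h.scaling hp',
      fun t _ => ?_⟩
    simp only
    rw [explicitDensity_eq_one h.scaling hp', detRatio_eq_one h.scaling hp']
    simp

theorem isOpen_disk (α : ℝ) : IsOpen (disk α) := Metric.isOpen_ball

/-- Identity theorem: two extensions agree at the real points, which accumulate at 0. Thus the
density picked by choice equals the explicit one. -/
theorem IsDensityExtension.eqOn (e : QuasicylindricalEnd J Ω g α) {f f' : ℂ → ℂ}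
    (hf : IsDensityExtension e s r p f) (hf' : IsDensityExtension e s r p f') :
    EqOn f f' (disk α) := by
  have hd : IsPreconnected (disk α) := (convex_ball _ _).isPreconnected
  refine AnalyticOnNhd.eqOn_of_preconnected_of_frequently_eq
    (hf.1.analyticOnNhd (isOpen_disk α)) (hf'.1.analyticOnNhd (isOpen_disk α)) hd
    (zero_mem_disk e) ?_
  have ht : Tendsto (fun t : ℝ => (t : ℂ)) (𝓝[≠] 0) (𝓝[≠] 0) := by
    refine tendsto_nhdsWithin_of_tendsto_nhds_of_eventually_within _ ?_ ?_
    · have := (Complex.continuous_ofReal.tendsto 0).mono_left (nhdsWithin_le_nhds (s := {0}ᶜ))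
      simpa using this
    · filter_upwards [self_mem_nhdsWithin] with t ht
      simpa using ht
  refine ht.frequently (Eventually.frequently ?_)
  have h0 : ∀ᶠ t : ℝ in 𝓝 0, (t : ℂ) ∈ disk α := by
    refine Complex.continuous_ofReal.continuousAt.eventually ((isOpen_disk α).mem_nhds ?_)
    simpa using zero_mem_disk e
  filter_upwards [nhdsWithin_le_nhds h0] with t ht
  rw [hf.2 t ht, hf'.2 t ht]

theorem Admissible.volDensity_eq (h : Admissible e s r C) (hlam : lam ∈ disk α) (p : M) :
    volDensity e s r lam p = explicitDensity e s r lam p := by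
  have hex : ∃ f, IsDensityExtension e s r p f := ⟨_, h.isDensityExtension p⟩
  rw [volDensity, dif_pos hex]
  exact hex.choose_spec.eqOn e (h.isDensityExtension p) hlam

/-- Reflection principle: the conjugate of the density at the conjugate parameter is also an
extension, so uniqueness applies. -/
theorem Admissible.explicitDensity_conj (h : Admissible e s r C) (hlam : lam ∈ disk α) (p : M) :
    explicitDensity e s r (conj lam) p = conj (explicitDensity e s r lam p) := by
  have hf := h.isDensityExtension p
  have hf' : IsDensityExtension e s r p fun lam => conj (explicitDensity e s r (conj lam) p) := by
    refine ⟨fun lam hlam => ?_, fun t ht => ?_⟩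
    · have := (hf.1.differentiableAt ((isOpen_disk α).mem_nhds (conj_mem_disk hlam)))
      have h2 := this.conj_conj
      rw [Complex.conj_conj] at h2
      exact h2.differentiableWithinAt
    · simp only [Complex.conj_ofReal]
      exact (congrArg conj (hf.2 t ht)).trans (Complex.conj_ofReal _)
  have := hf.eqOn e hf' (conj_mem_disk hlam)
  simpa using this

theorem Admissible.explicitDensity_ne_zero (h : Admissible e s r C) (hlam : lam ∈ disk α) (p : M) :
    explicitDensity e s r lam p ≠ 0 := by
  by_cases hp : p ∈ e.cyl.source ∧ r < (e.cyl p).1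
  · obtain ⟨y₀, q, hq, rfl⟩ := exists_endParam_of_mem hp.1 hp.2
    rw [h.explicitDensity_endParam hlam hq]
    exact volRatio_ne_zero (h.coefAt_mem_volDomain hlam hq)
  · rw [explicitDensity, if_neg hp]; exact one_ne_zero

/-- The joint smoothness of the coefficients in the parameter and the coordinates. -/
theorem Admissible.contDiffOn_coefAt (h : Admissible e s r C) (y₀ : Ω) :
    ContDiffOn ℝ ∞ (fun t : ℂ × (ℝ × EuclideanSpace ℝ (Fin n)) => coefAt e y₀ s r t.1 t.2)
      (disk α ×ˢ endDomain J r y₀) := by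
  have hs := h.scaling.smooth
  have hds : ContDiff ℝ ∞ (deriv s) := (contDiff_infty_iff_deriv.1 hs).2
  have hx : ContDiff ℝ ∞ fun t : ℂ × (ℝ × EuclideanSpace ℝ (Fin n)) => t.2.1 := by fun_prop
  have hof : ContDiff ℝ ∞ (fun x : ℝ => (x : ℂ)) := Complex.ofRealCLM.contDiff
  have hxr : ContDiff ℝ ∞ fun t : ℂ × (ℝ × EuclideanSpace ℝ (Fin n)) => t.2.1 - r :=
    hx.sub contDiff_const
  have hz : ContDiff ℝ ∞ fun t : ℂ × (ℝ × EuclideanSpace ℝ (Fin n)) => scaledVar s r t.1 t.2.1 :=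
    (hof.comp hx).add (contDiff_fst.mul (hof.comp (hs.comp hxr)))
  have hc : ContDiff ℝ ∞ fun t : ℂ × (ℝ × EuclideanSpace ℝ (Fin n)) => scaledDeriv s r t.1 t.2.1 :=
    contDiff_const.add (contDiff_fst.mul (hof.comp (hds.comp hxr)))
  have hu : ContDiff ℝ ∞ fun t : ℂ × (ℝ × EuclideanSpace ℝ (Fin n)) => t.2.2 := by fun_prop
  have hG : ∀ i j, ∀ Z : ℂ × (ℝ × EuclideanSpace ℝ (Fin n)) → ℂ, ContDiff ℝ ∞ Z →
      (∀ t ∈ disk α ×ˢ endDomain J r y₀, Z t ∈ sectorDomain α) →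
      ContDiffOn ℝ ∞ (fun t => endGram e y₀ (Z t) t.2.2 i j) (disk α ×ˢ endDomain J r y₀) := by
    intro i j Z hZ hZm
    have hm : MapsTo (fun t => (Z t, t.2.2)) (disk α ×ˢ endDomain J r y₀)
        (sectorDomain α ×ˢ (extChartAt J y₀).target) := fun t ht => ⟨hZm t ht, ht.2.2⟩
    have hsm := (isEndCoefficient_endGram e y₀ i j).smooth
    obtain ⟨G, hG⟩ : ∃ G : ℂ × EuclideanSpace ℝ (Fin n) → ℂ,
      G = fun q => endGram e y₀ q.1 q.2 i j := ⟨_, rfl⟩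
    have h1 : ContDiffOn ℝ ∞ (fun t => G (Z t, t.2.2)) (disk α ×ˢ endDomain J r y₀) :=
      ContDiffOn.comp (f := fun t : ℂ × (ℝ × EuclideanSpace ℝ (Fin n)) => (Z t, t.2.2))
        (hG ▸ hsm) (hZ.prodMk hu).contDiffOn hm
    rw [hG] at h1
    exact h1
  refine hc.contDiffOn.prodMk (ContDiffOn.prodMk ?_ ?_)
  · exact contDiffOn_pi.2 fun i => contDiffOn_pi.2 fun j => hG i j _ hz fun t ht =>
      h.scaledVar_mem ht.1 (le_of_lt ht.2.1)
  · exact contDiffOn_pi.2 fun i => contDiffOn_pi.2 fun j => hG i j _ (hof.comp hx) fun t ht => by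
      have := h.scaledVar_mem (zero_mem_disk e) (le_of_lt ht.2.1)
      rwa [scaledVar_zero] at this

/-- `1 / √(det g_lam / det g)` in coordinates. -/
def chartRho (e : QuasicylindricalEnd J Ω g α) (y₀ : Ω) (s : ℝ → ℝ) (r : ℝ) (lam : ℂ)
    (q : ℝ × EuclideanSpace ℝ (Fin n)) : ℂ := (volRatio (coefAt e y₀ s r lam q))⁻¹

theorem Admissible.contDiffOn_chartRho (h : Admissible e s r C) (y₀ : Ω) :
    ContDiffOn ℝ ∞ (fun t : ℂ × (ℝ × EuclideanSpace ℝ (Fin n)) => chartRho e y₀ s r t.1 t.2)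
      (disk α ×ˢ endDomain J r y₀) :=
  (contDiffOn_volRatio_inv.restrict_scalars ℝ).comp (h.contDiffOn_coefAt y₀) fun _ ht =>
    h.coefAt_mem_volDomain ht.1 ht.2

theorem Admissible.contDiffOn_chartRho_apply (h : Admissible e s r C) (hlam : lam ∈ disk α) (y₀ : Ω) :
    ContDiffOn ℝ ∞ (chartRho e y₀ s r lam) (endDomain J r y₀) := by
  have h1 := h.contDiffOn_chartRho y₀
  have hm : MapsTo (fun q : ℝ × EuclideanSpace ℝ (Fin n) => (lam, q)) (endDomain J r y₀)
      (disk α ×ˢ endDomain J r y₀) := fun q hq => ⟨hlam, hq⟩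
  generalize chartRho e y₀ s r = F at h1 ⊢
  exact ContDiffOn.comp (g := fun t : ℂ × (ℝ × EuclideanSpace ℝ (Fin n)) => F t.1 t.2)
    (f := fun q : ℝ × EuclideanSpace ℝ (Fin n) => (lam, q)) h1
    (contDiff_const.prodMk contDiff_id).contDiffOn hm

theorem Admissible.rho_endParam (h : Admissible e s r C) (hlam : lam ∈ disk α)
    (hq : q ∈ endDomain J r y₀) : rho e s r lam (endParam e y₀ q) = chartRho e y₀ s r lam q := by
  rw [rho, h.volDensity_eq hlam, h.explicitDensity_endParam hlam hq, chartRho]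

/-- The region where the metric is not deformed. -/
def coreRegion (e : QuasicylindricalEnd J Ω g α) (r : ℝ) : Set M :=
  {p | p ∈ e.cyl.source ∧ r + 1 ≤ (e.cyl p).1}ᶜ

theorem isOpen_coreRegion (e : QuasicylindricalEnd J Ω g α) (hr : 0 ≤ r) : IsOpen (coreRegion e r) :=
  (isClosed_end e (by linarith)).isOpen_compl

theorem mem_coreRegion_iff : p ∈ coreRegion e r ↔ (p ∈ e.cyl.source → (e.cyl p).1 < r + 1) := by
  simp [coreRegion]

theorem mem_coreRegion_or (p : M) :
    p ∈ coreRegion e r ∨ (p ∈ e.cyl.source ∧ r < (e.cyl p).1) := by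
  rw [mem_coreRegion_iff]
  by_cases hp : p ∈ e.cyl.source ∧ r < (e.cyl p).1
  · exact Or.inr hp
  · refine Or.inl fun hp' => ?_
    by_contra hx
    exact hp ⟨hp', by linarith⟩

theorem Admissible.rho_eq_one (h : Admissible e s r C) (hlam : lam ∈ disk α) (hp : p ∈ coreRegion e r) :
    rho e s r lam p = 1 := by
  rw [rho, h.volDensity_eq hlam, explicitDensity_eq_one h.scaling (mem_coreRegion_iff.1 hp), inv_one]

/-- M is covered by the open region where the function is identically 1 and by coordinate patches of
the end, where it is given by the smooth branch. -/
theorem Admissible.contMDiff_rho (h : Admissible e s r C) (hlam : lam ∈ disk α) :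
    ContMDiff I 𝓘(ℝ, ℂ) ∞ (rho e s r lam) := by
  intro p
  rcases mem_coreRegion_or (e := e) (r := r) p with hp | hp
  · refine (contMDiffAt_const (c := (1 : ℂ))).congr_of_eventuallyEq ?_
    filter_upwards [(isOpen_coreRegion e h.pos.le).mem_nhds hp] with p' hp'
      using h.rho_eq_one hlam hp'
  · refine contMDiffAt_of_endParam e (a := r) (y₀ := (e.cyl p).2) ?_ (exists_endPatch e hp.1 hp.2)
    refine ContDiffOn.congr ?_ fun q hq => h.rho_endParam hlam hq
    exact h.contDiffOn_chartRho_apply hlam _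

end VolumeDensity

/-! ### Uniform bounds on the integrands -/

section IntegrandBounds

variable {n : ℕ} {H : Type*} [TopologicalSpace H]
  {I : ModelWithCorners ℝ (EuclideanSpace ℝ (Fin (n + 1))) H}
  {M : Type*} [TopologicalSpace M] [ChartedSpace H M] [IsManifold I ∞ M]
  {H' : Type*} [TopologicalSpace H']
  {J : ModelWithCorners ℝ (EuclideanSpace ℝ (Fin n)) H'}
  {Ω : Type*} [TopologicalSpace Ω] [ChartedSpace H' Ω] [IsManifold J ∞ Ω]
  {g : Metric I M} {α : ℝ} {e : QuasicylindricalEnd J Ω g α}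
  {s : ℝ → ℝ} {r C : ℝ} {lam : ℂ} {y₀ : Ω}
  {q : ℝ × EuclideanSpace ℝ (Fin n)} {p : M}

/-- The pairing `g_lam[ξ, η]` of covectors. -/
def lamPairing (e : QuasicylindricalEnd J Ω g α) (s : ℝ → ℝ) (r : ℝ) (lam : ℂ) (p : M)
    (ξ η : TangentSpace I p →L[ℝ] ℂ) : ℂ :=
  coInner (pmlField e s r lam) (pmlField e s r (conj lam)) p ξ η

theorem coInner_congr {d : ℕ} {H : Type*} [TopologicalSpace H]
    {I : ModelWithCorners ℝ (EuclideanSpace ℝ (Fin d)) H} {M : Type*} [TopologicalSpace M]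
    [ChartedSpace H M] {B B' D D' : FormField I M} {p : M} (h : B p = D p) (h' : B' p = D' p)
    (ξ η : TangentSpace I p →L[ℝ] ℂ) : coInner B B' p ξ η = coInner D D' p ξ η := by
  simp only [coInner, sesq, sharp, gram, h, h']

theorem Admissible.lamPairing_core (h : Admissible e s r C) (lam : ℂ) (hp : p ∈ coreRegion e r)
    (ξ η : TangentSpace I p →L[ℝ] ℂ) :
    lamPairing e s r lam p ξ η = coInner (ofMetric g) (ofMetric g) p ξ η :=
  coInner_congr (pmlField_eq_ofMetric e h.scaling r _ (mem_coreRegion_iff.1 hp))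
    (pmlField_eq_ofMetric e h.scaling r _ (mem_coreRegion_iff.1 hp)) ξ η

theorem Admissible.lamPairing_endParam (h : Admissible e s r C) (hlam : lam ∈ disk α)
    (hq : q ∈ endDomain J r y₀) (ξ η : TangentSpace I (endParam e y₀ q) →L[ℝ] ℂ) :
    lamPairing e s r lam (endParam e y₀ q) ξ η
      = matrixPairing (axialScale (coefAt e y₀ s r (conj lam) q).1
          (Matrix.of (coefAt e y₀ s r (conj lam) q).2.1))
        (fun i => ξ (endFrame e y₀ q i)) (fun i => η (endFrame e y₀ q i)) := by
  rw [lamPairing, coInner_eq_matrixPairing (h.det_gram_ne_zero hlam _) (isBilinAt_pmlField e s r _ _)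
    (linearIndependent_endFrame e h.pos.le hq), gramIn_pmlField_eq h.pos.le hq]

theorem covNorm_sq_endParam (hr : 0 ≤ r) (hq : q ∈ endDomain J r y₀)
    (ξ : TangentSpace I (endParam e y₀ q) →L[ℝ] ℂ) :
    covNorm g (endParam e y₀ q) ξ ^ 2 = (matrixPairing (Matrix.of (coefAt e y₀ s r lam q).2.2)
        (fun i => ξ (endFrame e y₀ q i)) (fun i => ξ (endFrame e y₀ q i))).re := by
  rw [← gramIn_ofMetric_eq hr hq, ← coInner_eq_matrixPairing (det_gram_ofMetric_ne_zero g _)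
    (isBilinAt_ofMetric g _) (linearIndependent_endFrame e hr hq), coInner_ofMetric_self,
    Complex.ofReal_re]

/-- Both lengths are compared with the Euclidean norm in the frame of the end, each at the cost of a
factor C. -/
theorem Admissible.covNorm_sq_le (h : Admissible e s r C) (hlam : lam ∈ disk α) (p : M)
    (ξ : TangentSpace I p →L[ℝ] ℂ) :
    covNorm g p ξ ^ 2 ≤ C ^ 2 * (lamPairing e s r lam p ξ ξ).re := by
  have hC := h.one_le
  rcases mem_coreRegion_or (e := e) (r := r) p with hp | hp
  · rw [h.lamPairing_core lam hp, coInner_ofMetric_self, Complex.ofReal_re]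
    exact le_mul_of_one_le_left (sq_nonneg _) (one_le_pow₀ hC)
  -- The conjugate parameter occurs because the pairing reduces to the inverse matrix of the second
  -- field, which sits at that parameter.
  · obtain ⟨y₀, q, hq, rfl, hb, -⟩ := h.bounds _ (conj_mem_disk hlam) p hp.1 hp.2
    rw [h.lamPairing_endParam hlam hq, covNorm_sq_endParam (s := s) (lam := conj lam) h.pos.le hq]
    refine (hb.metric_le _).trans ?_
    rw [sq C, mul_assoc]
    exact mul_le_mul_of_nonneg_left (hb.coercive _) (by linarith)

theorem Admissible.norm_lamPairing_le (h : Admissible e s r C) (hlam : lam ∈ disk α) (p : M)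
    (ξ η : TangentSpace I p →L[ℝ] ℂ) :
    ‖lamPairing e s r lam p ξ η‖ ≤ C ^ 2 * (covNorm g p ξ * covNorm g p η) := by
  have hC := h.one_le
  have h0 := mul_nonneg (covNorm_nonneg g p ξ) (covNorm_nonneg g p η)
  rcases mem_coreRegion_or (e := e) (r := r) p with hp | hp
  · rw [h.lamPairing_core lam hp]
    exact (norm_coInner_ofMetric_le g p ξ η).trans (le_mul_of_one_le_left h0 (one_le_pow₀ hC))
  · obtain ⟨y₀, q, hq, rfl, hb, -⟩ := h.bounds _ (conj_mem_disk hlam) p hp.1 hp.2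
    rw [h.lamPairing_endParam hlam hq]
    refine (hb.bounded _ _).trans ?_
    rw [sq, mul_assoc]
    refine mul_le_mul_of_nonneg_left ?_ (by linarith)
    have hξ := hb.le_metric fun i => ξ (endFrame e y₀ q i)
    have hη := hb.le_metric fun i => η (endFrame e y₀ q i)
    rw [← covNorm_sq_endParam h.pos.le hq] at hξ hη
    refine le_of_sq_le_sq ?_ (by positivity)
    calc _ = ‖fun i => ξ (endFrame e y₀ q i)‖ ^ 2 * ‖fun i => η (endFrame e y₀ q i)‖ ^ 2 := by ring
      _ ≤ (C * covNorm g (endParam e y₀ q) ξ ^ 2) * (C * covNorm g (endParam e y₀ q) η ^ 2) := by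
        gcongr
      _ = _ := by ring

theorem Admissible.norm_volDensity_le (h : Admissible e s r C) (hlam : lam ∈ disk α) (p : M) :
    ‖volDensity e s r lam p‖ ≤ C := by
  rw [h.volDensity_eq hlam]
  rcases mem_coreRegion_or (e := e) (r := r) p with hp | hp
  · rw [explicitDensity_eq_one h.scaling (mem_coreRegion_iff.1 hp), norm_one]
    exact h.one_le
  · obtain ⟨y₀, q, hq, rfl, hb, -⟩ := h.bounds _ hlam p hp.1 hp.2
    rw [h.explicitDensity_endParam hlam hq]
    exact hb.volRatio_le

theorem hasFDerivAt_scaledVar (hs : IsScaling s) (r : ℝ) (lam : ℂ)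
    (q : ℝ × EuclideanSpace ℝ (Fin n)) :
    HasFDerivAt (fun q : ℝ × EuclideanSpace ℝ (Fin n) => scaledVar s r lam q.1)
      ((ContinuousLinearMap.fst ℝ ℝ (EuclideanSpace ℝ (Fin n))).smulRight (scaledDeriv s r lam q.1))
      q := by
  have h1 : HasDerivAt (fun x => s (x - r)) (deriv s (q.1 - r)) q.1 :=
    (hs.differentiable (q.1 - r)).hasDerivAt.comp_sub_const q.1 r
  have h2 : HasDerivAt (fun x : ℝ => scaledVar s r lam x) (scaledDeriv s r lam q.1) q.1 := by
    have h3 : HasDerivAt (fun x : ℝ => (x : ℂ)) 1 q.1 := by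
      simpa using (hasDerivAt_id q.1).ofReal_comp
    exact h3.add (h1.ofReal_comp.const_mul lam)
  exact h2.hasFDerivAt.comp (f := fun q : ℝ × EuclideanSpace ℝ (Fin n) => q.1) q hasFDerivAt_fst

theorem hasFDerivAt_scaledDeriv (hs : IsScaling s) (r : ℝ) (lam : ℂ)
    (q : ℝ × EuclideanSpace ℝ (Fin n)) :
    HasFDerivAt (fun q : ℝ × EuclideanSpace ℝ (Fin n) => scaledDeriv s r lam q.1)
      ((ContinuousLinearMap.fst ℝ ℝ (EuclideanSpace ℝ (Fin n))).smulRight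
        (lam * deriv (deriv s) (q.1 - r))) q := by
  have hcd : ContDiff ℝ ∞ (deriv s) := (contDiff_infty_iff_deriv.1 hs.smooth).2
  have h1 : HasDerivAt (fun x => deriv s (x - r)) (deriv (deriv s) (q.1 - r)) q.1 :=
    (hcd.differentiable (by simp) (q.1 - r)).hasDerivAt.comp_sub_const q.1 r
  have h2 : HasDerivAt (fun x : ℝ => scaledDeriv s r lam x) (lam * deriv (deriv s) (q.1 - r)) q.1 :=
    (h1.ofReal_comp.const_mul lam).const_add 1
  exact h2.hasFDerivAt.comp (f := fun q : ℝ × EuclideanSpace ℝ (Fin n) => q.1) q hasFDerivAt_fst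

/-- The chain rule for the coefficients along a path of parameters. -/
theorem hasFDerivWithinAt_endGram_comp {Z : ℝ × EuclideanSpace ℝ (Fin n) → ℂ} {c : ℂ} {a : ℝ}
    (hZ : HasFDerivAt Z ((ContinuousLinearMap.fst ℝ ℝ (EuclideanSpace ℝ (Fin n))).smulRight c) q)
    (hq : q ∈ endDomain J a y₀) (hm : ∀ q ∈ endDomain J a y₀, Z q ∈ sectorDomain α)
    (hc : ‖c‖ ≤ 2) (i j : Fin (n + 1)) (hC : 0 ≤ C)
    (hb : ‖fderivWithin ℝ (fun q : ℂ × EuclideanSpace ℝ (Fin n) => endGram e y₀ q.1 q.2 i j)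
          (sectorDomain α ×ˢ (extChartAt J y₀).target) (Z q, q.2)‖ ≤ C) :
    ∃ L : ℝ × EuclideanSpace ℝ (Fin n) →L[ℝ] ℂ,
      HasFDerivWithinAt (fun q => endGram e y₀ (Z q) q.2 i j) L (endDomain J a y₀) q ∧
      ∀ w, ‖L w‖ ≤ 2 * C * ‖w‖ := by
  have hsm := (isEndCoefficient_endGram e y₀ i j).smooth
  obtain ⟨G, hG⟩ : ∃ G : ℂ × EuclideanSpace ℝ (Fin n) → ℂ,
    G = fun q => endGram e y₀ q.1 q.2 i j := ⟨_, rfl⟩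
  rw [← hG] at hsm hb
  have hmt : MapsTo (fun q : ℝ × EuclideanSpace ℝ (Fin n) => (Z q, q.2)) (endDomain J a y₀)
      (sectorDomain α ×ˢ (extChartAt J y₀).target) := fun q hq => ⟨hm q hq, hq.2⟩
  have h1 := (hsm.differentiableOn (by simp) (Z q, q.2) (hmt hq)).hasFDerivWithinAt
  have h2 : HasFDerivWithinAt (fun q : ℝ × EuclideanSpace ℝ (Fin n) => (Z q, q.2)) _
      (endDomain J a y₀) q := (hZ.prodMk hasFDerivAt_snd).hasFDerivWithinAt
  have h3 := h1.comp q h2 hmt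
  refine ⟨_, by rw [hG] at h3; exact h3, fun w => ?_⟩
  rw [ContinuousLinearMap.comp_apply, ← hG]
  refine (ContinuousLinearMap.le_opNorm _ _).trans ?_
  rw [mul_comm (2 : ℝ), mul_assoc]
  refine mul_le_mul hb ?_ (norm_nonneg _) hC
  refine norm_prod_le_iff.2 ⟨?_, ?_⟩
  · change ‖w.1 • c‖ ≤ _
    rw [norm_smul, mul_comm]
    exact mul_le_mul hc (norm_fst_le w) (norm_nonneg _) (by norm_num)
  · change ‖w.2‖ ≤ _
    linarith [norm_snd_le w, norm_nonneg w]

theorem norm_fderivWithin_comp_apply_le {E X : Type*} [NormedAddCommGroup E] [NormedSpace ℝ E]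
    [NormedAddCommGroup X] [NormedSpace ℝ X] {F : X → ℂ} {κ : E → X} {L : E →L[ℝ] X} {S : Set E}
    {x w : E} {A B : ℝ} (hF : DifferentiableAt ℝ F (κ x)) (hκ : HasFDerivWithinAt κ L S x)
    (hS : UniqueDiffWithinAt ℝ S x) (hA : 0 ≤ A) (hb : ‖fderiv ℝ F (κ x)‖ ≤ A) (hw : ‖L w‖ ≤ B) :
    ‖fderivWithin ℝ (fun y => F (κ y)) S x w‖ ≤ A * B := by
  have hcomp : HasFDerivWithinAt (fun y => F (κ y)) _ S x :=
    hF.hasFDerivAt.comp_hasFDerivWithinAt x hκ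
  rw [hcomp.fderivWithin hS, ContinuousLinearMap.comp_apply]
  exact (ContinuousLinearMap.le_opNorm _ _).trans (mul_le_mul hb hw (norm_nonneg _) hA)

theorem norm_prod_apply_le {E X Y : Type*} [NormedAddCommGroup E] [NormedSpace ℝ E]
    [NormedAddCommGroup X] [NormedSpace ℝ X] [NormedAddCommGroup Y] [NormedSpace ℝ Y]
    {A : E →L[ℝ] X} {B : E →L[ℝ] Y} {w : E} {b : ℝ} (hA : ‖A w‖ ≤ b) (hB : ‖B w‖ ≤ b) :
    ‖(A.prod B) w‖ ≤ b := norm_prod_le_iff.2 ⟨hA, hB⟩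

theorem norm_pi_pi_apply_le {E ι κ : Type*} [Fintype ι] [Fintype κ] [NormedAddCommGroup E]
    [NormedSpace ℝ E] {A : ι → κ → E →L[ℝ] ℂ} {w : E} {b : ℝ} (hb : 0 ≤ b)
    (hA : ∀ i j, ‖A i j w‖ ≤ b) :
    ‖(ContinuousLinearMap.pi fun i => ContinuousLinearMap.pi (A i)) w‖ ≤ b :=
  (pi_norm_le_iff_of_nonneg hb).2 fun i => (pi_norm_le_iff_of_nonneg hb).2 fun j => hA i j

/-- Chain rule through the coefficient triple: the derivative of c is λs'', bounded by S, and the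
derivatives of the matrix entries are bounded by 2C. -/
theorem Admissible.norm_fderivWithin_chartRho_le (h : Admissible e s r C) (hlam : lam ∈ disk α)
    (hq : q ∈ endDomain J r y₀) (hb : CoefBounds C (coefAt e y₀ s r lam q))
    (hz : ∀ z ∈ ({scaledVar s r lam q.1, (q.1 : ℂ)} : Set ℂ), z ∈ sectorDomain α ∧ ∀ i j,
        ‖fderivWithin ℝ (fun q : ℂ × EuclideanSpace ℝ (Fin n) => endGram e y₀ q.1 q.2 i j)
          (sectorDomain α ×ˢ (extChartAt J y₀).target) (z, q.2)‖ ≤ C)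
    {S : ℝ} (hS : ∀ x, |deriv (deriv s) x| ≤ S) (w : ℝ × EuclideanSpace ℝ (Fin n)) :
    ‖fderivWithin ℝ (chartRho e y₀ s r lam) (endDomain J r y₀) q w‖ ≤ C * ((S + 2 * C) * ‖w‖) := by
  have hC := h.one_le
  have hS0 : 0 ≤ S := (abs_nonneg _).trans (hS 0)
  have hsin := Real.sin_le_one α
  have hc2 : ‖scaledDeriv s r lam q.1‖ ≤ 2 := by
    have h1 := norm_scaledDeriv_sub_one_le h.scaling hlam r q.1
    have h2 := norm_add_le (scaledDeriv s r lam q.1 - 1) 1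
    rw [sub_add_cancel, norm_one] at h2
    linarith
  have hm1 : ∀ q ∈ endDomain J r y₀, scaledVar s r lam q.1 ∈ sectorDomain α := fun q hq =>
    h.scaledVar_mem hlam (le_of_lt hq.1)
  have hm2 : ∀ q ∈ endDomain J r y₀, ((q.1 : ℝ) : ℂ) ∈ sectorDomain α := fun q hq => by
    have := h.scaledVar_mem (zero_mem_disk e) (le_of_lt hq.1)
    rwa [scaledVar_zero] at this
  have hof : HasFDerivAt (fun q : ℝ × EuclideanSpace ℝ (Fin n) => ((q.1 : ℝ) : ℂ))
      ((ContinuousLinearMap.fst ℝ ℝ (EuclideanSpace ℝ (Fin n))).smulRight (1 : ℂ)) q := by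
    have := hasFDerivAt_scaledVar h.scaling r 0 q
    simpa only [scaledVar_zero, scaledDeriv_zero] using this
  choose L₁ hL₁ hL₁' using fun i j => hasFDerivWithinAt_endGram_comp (e := e)
    (hasFDerivAt_scaledVar h.scaling r lam q) hq hm1 hc2 i j (by linarith) ((hz _ (by simp)).2 i j)
  choose L₂ hL₂ hL₂' using fun i j => hasFDerivWithinAt_endGram_comp (e := e)
    hof hq hm2 (by norm_num) i j (by linarith) ((hz _ (by simp)).2 i j)
  have hcoef : HasFDerivWithinAt (coefAt e y₀ s r lam)
      (((ContinuousLinearMap.fst ℝ ℝ (EuclideanSpace ℝ (Fin n))).smulRight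
        (lam * deriv (deriv s) (q.1 - r))).prod
        ((ContinuousLinearMap.pi fun i => ContinuousLinearMap.pi (L₁ i)).prod
          (ContinuousLinearMap.pi fun i => ContinuousLinearMap.pi (L₂ i)))) (endDomain J r y₀) q :=
    (hasFDerivAt_scaledDeriv h.scaling r lam q).hasFDerivWithinAt.prodMk
      ((hasFDerivWithinAt_pi.2 fun i => hasFDerivWithinAt_pi.2 (hL₁ i)).prodMk
        (hasFDerivWithinAt_pi.2 fun i => hasFDerivWithinAt_pi.2 (hL₂ i)))
  have hopen : IsOpen (goodCoefs n) := isOpen_goodCoefs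
  have hR : DifferentiableAt ℝ (fun t : CoefSpace n => (volRatio t)⁻¹) (coefAt e y₀ s r lam q) :=
    (((contDiffOn_volRatio_inv.mono goodCoefs_subset_volDomain).contDiffAt
      (hopen.mem_nhds hb.good)).restrict_scalars ℝ).differentiableAt (by simp)
  refine norm_fderivWithin_comp_apply_le (F := fun t : CoefSpace n => (volRatio t)⁻¹)
    (κ := coefAt e y₀ s r lam) hR hcoef (uniqueDiffOn_endDomain r y₀ q hq) (by linarith)
    hb.deriv_le ?_
  have hw := norm_nonneg w
  have hle : 2 * C * ‖w‖ ≤ (S + 2 * C) * ‖w‖ := by nlinarith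
  have hb0 : 0 ≤ (S + 2 * C) * ‖w‖ := by positivity
  refine norm_prod_apply_le ?_ (norm_prod_apply_le
    (norm_pi_pi_apply_le hb0 fun i j => (hL₁' i j w).trans hle)
    (norm_pi_pi_apply_le hb0 fun i j => (hL₂' i j w).trans hle))
  rw [ContinuousLinearMap.smulRight_apply, ContinuousLinearMap.coe_fst', norm_smul, norm_mul]
  have h1 : ‖lam‖ ≤ 1 := (norm_lt_of_mem_disk hlam).le.trans hsin
  have h2 : ‖((deriv (deriv s) (q.1 - r) : ℝ) : ℂ)‖ ≤ S := by rw [Complex.norm_real]; exact hS _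
  calc ‖w.1‖ * (‖lam‖ * ‖((deriv (deriv s) (q.1 - r) : ℝ) : ℂ)‖) ≤ ‖w‖ * (1 * S) := by
        gcongr
        exact norm_fst_le w
    _ ≤ _ := by nlinarith

theorem norm_stdVec_le (n : ℕ) (i : Fin (n + 1)) : ‖stdVec n i‖ ≤ 1 := by
  refine Fin.cases ?_ (fun i => ?_) i <;> simp [stdVec, Prod.norm_def]

theorem Admissible.diff_rho_endFrame (h : Admissible e s r C) (hlam : lam ∈ disk α)
    (hq : q ∈ endDomain J r y₀) (i : Fin (n + 1)) :
    diff I (rho e s r lam) (endParam e y₀ q) (endFrame e y₀ q i)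
      = fderivWithin ℝ (chartRho e y₀ s r lam) (endDomain J r y₀) q (stdVec n i) := by
  rw [diff_endFrame e h.pos.le hq ((h.contMDiff_rho hlam).mdifferentiableAt (by simp))]
  congr 1
  exact fderivWithin_congr (fun q hq => h.rho_endParam hlam hq) (h.rho_endParam hlam hq)

theorem Admissible.diff_rho_core (h : Admissible e s r C) (hlam : lam ∈ disk α)
    (hp : p ∈ coreRegion e r) : diff I (rho e s r lam) p = 0 := by
  have : rho e s r lam =ᶠ[𝓝 p] fun _ => 1 := by
    filter_upwards [(isOpen_coreRegion e h.pos.le).mem_nhds hp] with p' hp'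
      using h.rho_eq_one hlam hp'
  rw [diff, this.mfderiv_eq, mfderiv_const]
  rfl

/-- The only constant that depends on s beyond the bounds on s'. It is uniform in the parameter and
the point, and r₀ is not affected by it. -/
theorem Admissible.exists_covNorm_diff_rho_le (h : Admissible e s r C) :
    ∃ K, 0 ≤ K ∧ ∀ lam ∈ disk α, ∀ p, covNorm g p (diff I (rho e s r lam) p) ≤ K := by
  obtain ⟨S, hS⟩ := h.scaling.exists_deriv2_bound
  have hS0 : 0 ≤ S := (abs_nonneg _).trans (hS 0)
  have hC := h.one_le
  refine ⟨C * (C * (S + 2 * C)), by positivity, fun lam hlam p => ?_⟩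
  rcases mem_coreRegion_or (e := e) (r := r) p with hp | hp
  · rw [h.diff_rho_core hlam hp, covNorm_zero]; positivity
  · obtain ⟨y₀, q, hq, rfl, hb, hz⟩ := h.bounds _ hlam p hp.1 hp.2
    refine le_of_sq_le_sq ?_ (by positivity)
    rw [covNorm_sq_endParam (s := s) (lam := lam) h.pos.le hq]
    refine (hb.metric_le _).trans ?_
    have h1 : ‖fun i => diff I (rho e s r lam) (endParam e y₀ q) (endFrame e y₀ q i)‖
        ≤ C * (S + 2 * C) := by
      refine (pi_norm_le_iff_of_nonneg (by positivity)).2 fun i => ?_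
      rw [h.diff_rho_endFrame hlam hq]
      refine (h.norm_fderivWithin_chartRho_le hlam hq hb hz hS _).trans ?_
      have := norm_stdVec_le n i
      gcongr
      exact mul_le_of_le_one_right (by positivity) this
    rw [mul_pow]
    gcongr
    nlinarith

end IntegrandBounds

/-! ### Holomorphic dependence on parameters -/

section Holomorphy

theorem differentiableOn_conj_conj {O : Set ℂ} (hO : IsOpen O) (hc : ∀ z ∈ O, conj z ∈ O) {f : ℂ → ℂ}
    (hf : DifferentiableOn ℂ f O) : DifferentiableOn ℂ (fun z => conj (f (conj z))) O := by
  intro z hz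
  have h2 := (hf.differentiableAt (hO.mem_nhds (hc z hz))).conj_conj
  rw [Complex.conj_conj] at h2
  exact h2.differentiableWithinAt

theorem contDiffOn_matrix_inv_apply {d : ℕ} {𝕜 E : Type*} [NontriviallyNormedField 𝕜]
    [NormedAddCommGroup E] [NormedSpace 𝕜 E] [NormedAlgebra 𝕜 ℂ] {A : E → Matrix (Fin d) (Fin d) ℂ}
    {S : Set E} {k : WithTop ℕ∞} (hA : ∀ i j, ContDiffOn 𝕜 k (fun t => A t i j) S)
    (hdet : ∀ t ∈ S, (A t).det ≠ 0) (i j : Fin d) : ContDiffOn 𝕜 k (fun t => (A t)⁻¹ i j) S := by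
  simp only [Matrix.inv_def, Ring.inverse_eq_inv', Matrix.smul_apply, smul_eq_mul]
  refine ((contDiff_det_of hA).inv hdet).mul ?_
  simp only [Matrix.adjugate_apply]
  refine contDiff_det_of (A := fun t => (A t).updateRow j (Pi.single i 1)) fun k l => ?_
  by_cases hk : k = j
  · subst hk
    simp only [Matrix.updateRow_self]
    exact contDiffOn_const
  · simp only [Matrix.updateRow_ne hk]
    exact hA k l

/-- The directional derivatives within `U` of a jointly smooth function that is holomorphic in a
parameter are holomorphic in this parameter. -/
theorem differentiableOn_fderivWithin_apply {E : Type*} [NormedAddCommGroup E] [NormedSpace ℝ E]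
    {Φ : ℂ → E → ℂ} {O : Set ℂ} {U : Set E} (hO : IsOpen O) (hU : UniqueDiffOn ℝ U)
    (hU' : U ⊆ closure (interior U)) (hΦ : ContDiffOn ℝ ∞ (fun x : ℂ × E => Φ x.1 x.2) (O ×ˢ U))
    (hhol : ∀ q ∈ U, DifferentiableOn ℂ (fun z => Φ z q) O) {q : E} (hq : q ∈ U) (w : E) :
    DifferentiableOn ℂ (fun z => fderivWithin ℝ (Φ z) U q w) O := by
  set Ψ : ℂ × E → ℂ := fun x => Φ x.1 x.2 with hΨ
  set A := O ×ˢ U with hA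
  have hAu : UniqueDiffOn ℝ A := hO.uniqueDiffOn.prod hU
  have hAc : A ⊆ closure (interior A) := by
    rw [hA, interior_prod_eq, closure_prod_eq, hO.interior_eq]
    exact prod_mono subset_closure hU'
  set D := fderivWithin ℝ Ψ A with hD
  have hDs : ContDiffOn ℝ ∞ D A := hΦ.fderivWithin hAu (by simp)
  have hΨd : ∀ x ∈ A, HasFDerivWithinAt Ψ (D x) A x := fun x hx =>
    (hΦ.differentiableOn (by simp) x hx).hasFDerivWithinAt
  have hDd : ∀ x ∈ A, HasFDerivWithinAt D (fderivWithin ℝ D A x) A x := fun x hx =>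
    (hDs.differentiableOn (by simp) x hx).hasFDerivWithinAt
  have hin : ∀ z (q : E), HasFDerivAt (fun z : ℂ => (z, q)) (ContinuousLinearMap.inl ℝ ℂ E) z :=
    fun z q => (hasFDerivAt_id z).prodMk (hasFDerivAt_const q z)
  have hinr : ∀ z (q : E), HasFDerivAt (fun q : E => (z, q)) (ContinuousLinearMap.inr ℝ ℂ E) q :=
    fun z q => (hasFDerivAt_const z q).prodMk (hasFDerivAt_id q)
  have hmaps : ∀ q ∈ U, MapsTo (fun z : ℂ => (z, q)) O A := fun q hq z hz => ⟨hz, hq⟩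
  have hslice : ∀ z ∈ O, ∀ q ∈ U, HasFDerivAt (fun z => Φ z q)
      ((D (z, q)).comp (ContinuousLinearMap.inl ℝ ℂ E)) z := fun z hz q hq =>
    (HasFDerivWithinAt.comp (f := fun z => (z, q)) (s := O) z (hΨd (z, q) ⟨hz, hq⟩)
      (hin z q).hasFDerivWithinAt (hmaps q hq)).hasFDerivAt (hO.mem_nhds hz)
  have hslice2 : ∀ z ∈ O, fderivWithin ℝ (Φ z) U q w = D (z, q) (0, w) := fun z hz => by
    have h1 : HasFDerivWithinAt (Φ z) ((D (z, q)).comp (ContinuousLinearMap.inr ℝ ℂ E)) U q :=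
      (hΨd (z, q) ⟨hz, hq⟩).comp (s := U) q (hinr z q).hasFDerivWithinAt fun q' hq' => ⟨hz, hq'⟩
    rw [h1.fderivWithin (hU q hq)]
    rfl
  -- The Cauchy–Riemann equation in z, which holds at every point of the product and may therefore
  -- be differentiated in the direction w.
  have hCR : ∀ x ∈ A, D x (Complex.I, 0) = Complex.I * D x (1, 0) := fun x hx => by
    have h1 := hslice x.1 hx.1 x.2 hx.2
    have h2 := ((hhol x.2 hx.2).differentiableAt (hO.mem_nhds hx.1)).hasFDerivAt.restrictScalars ℝ
    have h3 := h1.unique h2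
    have h4 : ∀ c : ℂ, D x (c, 0) = c * D x (1, 0) := fun c => by
      have e1 : D x (c, 0) = fderiv ℂ (fun z => Φ z x.2) x.1 c := DFunLike.congr_fun h3 c
      have e2 : D x (1, 0) = fderiv ℂ (fun z => Φ z x.2) x.1 1 := DFunLike.congr_fun h3 1
      rw [e1, e2, ← smul_eq_mul, ← map_smul, smul_eq_mul, mul_one]
    exact h4 _
  refine DifferentiableOn.congr (fun z hz => ?_) hslice2
  have hx : (z, q) ∈ A := ⟨hz, hq⟩
  set D2 := fderivWithin ℝ D A (z, q) with hD2
  -- Symmetry of the second derivative turns the differentiated Cauchy–Riemann equation into the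
  -- Cauchy–Riemann equation for the derivative in direction w.
  have hsymm : ∀ v v', D2 v v' = D2 v' v :=
    (hΦ (z, q) hx).isSymmSndFDerivWithinAt (by
      rw [minSmoothness_of_isRCLikeNormedField]; exact ENat.LEInfty.out) hAu (hAc hx) hx
  have happ : ∀ v, HasFDerivWithinAt (fun x => D x v) ((ContinuousLinearMap.apply ℝ ℂ v).comp D2) A
      (z, q) := fun v =>
    (ContinuousLinearMap.apply ℝ ℂ v).hasFDerivAt.comp_hasFDerivWithinAt (z, q) (hDd _ hx)
  have hmix : D2 (0, w) (Complex.I, 0) = Complex.I * D2 (0, w) (1, 0) := by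
    have h1 := (happ (1, 0)).const_smul Complex.I
    have h2 := (happ (Complex.I, 0)).congr (f₁ := fun x => Complex.I • D x (1, 0))
      (fun x hx => (hCR x hx).symm) (hCR _ hx).symm
    exact DFunLike.congr_fun ((hAu _ hx).eq h2 h1) (0, w)
  have hF : HasFDerivAt (fun z => D (z, q) (0, w))
      (((ContinuousLinearMap.apply ℝ ℂ ((0, w) : ℂ × E)).comp D2).comp
        (ContinuousLinearMap.inl ℝ ℂ E)) z :=
    (HasFDerivWithinAt.comp (f := fun z => (z, q)) (s := O) z (happ (0, w))
      (hin z q).hasFDerivWithinAt (hmaps q hq)).hasFDerivAt (hO.mem_nhds hz)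
  refine (hF.hasFDerivWithinAt.complexOfReal (s := O) ?_).differentiableWithinAt
  change D2 (Complex.I, 0) (0, w) = Complex.I • D2 (1, 0) (0, w)
  rw [hsymm, hmix, hsymm (1, 0), smul_eq_mul]

/-- Integrals of functions which are holomorphic in a parameter and have an integrable bound. -/
theorem differentiableOn_integral_of_bounded {X : Type*} [MeasurableSpace X] {μ : Measure X}
    {F : ℂ → X → ℂ} {O : Set ℂ} (hO : IsOpen O) {b : X → ℝ} (hb : Integrable b μ)
    (hm : ∀ z ∈ O, AEStronglyMeasurable (F z) μ) (hF : ∀ z ∈ O, ∀ p, ‖F z p‖ ≤ b p)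
    (hhol : ∀ p, DifferentiableOn ℂ (fun z => F z p) O) :
    DifferentiableOn ℂ (fun z => ∫ p, F z p ∂μ) O := by
  intro z₀ hz₀
  obtain ⟨ε, hε, hsub⟩ := Metric.isOpen_iff.1 hO z₀ hz₀
  have hd : ∀ p, ∀ z ∈ O, HasDerivAt (fun z => F z p) (deriv (fun z => F z p) z) z := fun p z hz =>
    ((hhol p).differentiableAt (hO.mem_nhds hz)).hasDerivAt
  -- On these closed balls Cauchy's estimate dominates the derivative in z by b/(ε/4), which is
  -- integrable.
  have hcb : ∀ z ∈ Metric.ball z₀ (ε / 2), Metric.closedBall z (ε / 4) ⊆ O := fun z hz x hx => by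
    refine hsub ?_
    rw [Metric.mem_ball] at hz ⊢
    rw [Metric.mem_closedBall] at hx
    linarith [dist_triangle x z z₀]
  -- The derivative is a limit of difference quotients along a sequence, each of them measurable.
  have hmeas : AEStronglyMeasurable (fun p => deriv (fun z => F z p) z₀) μ := by
    obtain ⟨t, ht⟩ := (𝓝[≠] (0 : ℂ)).exists_seq_tendsto
    have ht0 : Tendsto t atTop (𝓝 0) := ht.mono_right nhdsWithin_le_nhds
    have hev : ∀ᶠ k in atTop, z₀ + t k ∈ O := by
      have : Tendsto (fun k => z₀ + t k) atTop (𝓝 z₀) := by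
        simpa using (tendsto_const_nhds (x := z₀)).add ht0
      exact this.eventually (hO.mem_nhds hz₀)
    obtain ⟨N, hN⟩ := eventually_atTop.1 hev
    refine aestronglyMeasurable_of_tendsto_ae atTop
      (f := fun k p => (t (k + N))⁻¹ • (F (z₀ + t (k + N)) p - F z₀ p)) (fun k => ?_)
      (Eventually.of_forall fun p => ?_)
    · have h1 : AEStronglyMeasurable (fun p => F (z₀ + t (k + N)) p - F z₀ p) μ :=
        (hm _ (hN (k + N) (by omega))).sub (hm z₀ hz₀)
      exact h1.const_smul ((t (k + N))⁻¹)
    · exact (hasDerivAt_iff_tendsto_slope_zero.1 (hd p z₀ hz₀)).comp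
        ((tendsto_add_atTop_iff_nat N).2 ht)
  refine (hasDerivAt_integral_of_dominated_loc_of_deriv_le (bound := fun p => b p / (ε / 4))
    (F' := fun z p => deriv (fun z => F z p) z) (Metric.ball_mem_nhds z₀ (half_pos hε)) ?_
    (hb.mono' (hm z₀ hz₀) (Eventually.of_forall (hF z₀ hz₀))) hmeas ?_ (hb.div_const _)
    ?_).2.differentiableAt.differentiableWithinAt
  · filter_upwards [hO.mem_nhds hz₀] with z hz using hm z hz
  · refine Eventually.of_forall fun p z hz => ?_
    refine Complex.norm_deriv_le_of_forall_mem_sphere_norm_le (by linarith) ?_ fun x hx =>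
      hF x (hcb z hz (Metric.sphere_subset_closedBall hx)) p
    exact ((hhol p).mono (hcb z hz)).diffContOnCl_ball subset_rfl
  · exact Eventually.of_forall fun p z hz => hd p z
      (hcb z hz (Metric.mem_closedBall_self (by linarith)))

end Holomorphy

/-! ### The form on test functions -/

section Integrand

variable {n : ℕ} {H : Type*} [TopologicalSpace H]
  {I : ModelWithCorners ℝ (EuclideanSpace ℝ (Fin (n + 1))) H}
  {M : Type*} [TopologicalSpace M] [ChartedSpace H M] [IsManifold I ∞ M]
  {H' : Type*} [TopologicalSpace H']
  {J : ModelWithCorners ℝ (EuclideanSpace ℝ (Fin n)) H'}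
  {Ω : Type*} [TopologicalSpace Ω] [ChartedSpace H' Ω] [IsManifold J ∞ Ω]
  {g : Metric I M} {α : ℝ} {e : QuasicylindricalEnd J Ω g α}
  {s : ℝ → ℝ} {r C : ℝ} {lam : ℂ} {y₀ : Ω}
  {q : ℝ × EuclideanSpace ℝ (Fin n)} {p : M}

/-- The integrand of the form `q_lam`. -/
def formIntegrand (e : QuasicylindricalEnd J Ω g α) (s : ℝ → ℝ) (r : ℝ) (lam : ℂ) (u v : M → ℂ)
    (p : M) : ℂ :=
  lamPairing e s r lam p (diff I u p) (diff I (fun p => rho e s r (conj lam) p * v p) p)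
    * volDensity e s r lam p

theorem pmlForm_eq [MeasurableSpace M] (u v : M → ℂ) :
    pmlForm e s r lam u v = ∫ p, formIntegrand e s r lam u v p ∂riemannianVolume g := rfl

theorem axialScale_apply (c : ℂ) (A : Matrix (Fin (n + 1)) (Fin (n + 1)) ℂ) (i j : Fin (n + 1)) :
    axialScale c A i j = (Fin.cons c (fun _ => 1) : Fin (n + 1) → ℂ) i * A i j
      * (Fin.cons c (fun _ => 1) : Fin (n + 1) → ℂ) j := by
  rw [axialScale, axialDiag, Matrix.mul_diagonal, Matrix.diagonal_mul]

theorem differentiableOn_axialScale_apply {O : Set ℂ} {c : ℂ → ℂ}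
    {A : ℂ → Matrix (Fin (n + 1)) (Fin (n + 1)) ℂ} (hc : DifferentiableOn ℂ c O)
    (hA : ∀ i j, DifferentiableOn ℂ (fun z => A z i j) O) (i j : Fin (n + 1)) :
    DifferentiableOn ℂ (fun z => axialScale (c z) (A z) i j) O := by
  simp only [axialScale_apply]
  have h : ∀ i, DifferentiableOn ℂ (fun z => (Fin.cons (c z) (fun _ => 1) : Fin (n + 1) → ℂ) i) O :=
    fun i => Fin.cases (by simpa using hc) (fun i => by simp) i
  exact ((h i).mul (hA i j)).mul (h j)

/-- The pairing conjugates its second entry, and the data there are evaluated at the conjugate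
parameter; the two conjugations compose to a holomorphic function. -/
theorem differentiableOn_matrixPairing_conj {d : ℕ} {O : Set ℂ} (hO : IsOpen O)
    (hconj : ∀ z ∈ O, conj z ∈ O) {A : ℂ → Matrix (Fin d) (Fin d) ℂ}
    (hA : ∀ i j, DifferentiableOn ℂ (fun z => A z i j) O) (hdet : ∀ z ∈ O, (A z).det ≠ 0)
    (x : Fin d → ℂ) {y : ℂ → Fin d → ℂ} (hy : ∀ j, DifferentiableOn ℂ (fun z => y z j) O) :
    DifferentiableOn ℂ (fun z => matrixPairing (A (conj z)) x (y (conj z))) O := by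
  have hinv : ∀ i j, DifferentiableOn ℂ (fun z => ((A z)ᵀ⁻¹) i j) O := fun i j =>
    (contDiffOn_matrix_inv_apply (A := fun z => (A z)ᵀ) (k := 1) (fun i j => (hA j i).contDiffOn hO)
      (fun z hz => by rw [Matrix.det_transpose]; exact hdet z hz) i j).differentiableOn (by simp)
  unfold matrixPairing
  refine DifferentiableOn.fun_sum fun i _ => (differentiableOn_const _).mul ?_
  refine differentiableOn_conj_conj hO hconj (f := fun z => ((A z)ᵀ⁻¹ *ᵥ y z) i) ?_
  simp only [Matrix.mulVec, dotProduct]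
  exact DifferentiableOn.fun_sum fun j _ => (hinv i j).mul (hy j)

theorem det_axialScale_ne_zero_of_mem_volDomain {t : CoefSpace n} (ht : t ∈ volDomain n) :
    (axialScale t.1 (Matrix.of t.2.1)).det ≠ 0 := by
  rw [det_axialScale]
  refine mul_ne_zero (pow_ne_zero 2 ht.1) fun h0 => ?_
  have h1 := ht.2.2
  rw [h0, zero_div] at h1
  exact Complex.zero_notMem_slitPlane h1

theorem differentiableOn_matrixPairing_coef {O : Set ℂ} (hO : IsOpen O)
    (hconj : ∀ z ∈ O, conj z ∈ O) {f : ℂ → CoefSpace n} (hf : DifferentiableOn ℂ f O)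
    (hfv : ∀ z ∈ O, f z ∈ volDomain n) (x : Fin (n + 1) → ℂ) {y : ℂ → Fin (n + 1) → ℂ}
    (hy : ∀ j, DifferentiableOn ℂ (fun z => y z j) O) :
    DifferentiableOn ℂ (fun z => matrixPairing
      (axialScale (f (conj z)).1 (Matrix.of (f (conj z)).2.1)) x (y (conj z))) O := by
  have h1 : DifferentiableOn ℂ (fun z => (f z).1) O := hf.fst
  have h2 : DifferentiableOn ℂ (fun z => (f z).2.1) O := hf.snd.fst
  have h3 : ∀ i j, DifferentiableOn ℂ (fun z => Matrix.of (f z).2.1 i j) O :=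
    fun i j => differentiableOn_pi.1 (differentiableOn_pi.1 h2 i) j
  exact differentiableOn_matrixPairing_conj hO hconj
    (A := fun z => axialScale (f z).1 (Matrix.of (f z).2.1))
    (differentiableOn_axialScale_apply h1 h3)
    (fun z hz => det_axialScale_ne_zero_of_mem_volDomain (hfv z hz)) x hy

theorem Admissible.differentiableOn_lamPairing (h : Admissible e s r C) (hq : q ∈ endDomain J r y₀)
    (ξ : TangentSpace I (endParam e y₀ q) →L[ℝ] ℂ)
    {η : ℂ → TangentSpace I (endParam e y₀ q) →L[ℝ] ℂ}
    (hη : ∀ j, DifferentiableOn ℂ (fun z => η z (endFrame e y₀ q j)) (disk α)) :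
    DifferentiableOn ℂ (fun lam => lamPairing e s r lam (endParam e y₀ q) ξ (η (conj lam)))
      (disk α) := by
  refine DifferentiableOn.congr ?_ fun lam hlam => h.lamPairing_endParam hlam hq ξ _
  exact differentiableOn_matrixPairing_coef (isOpen_disk α) (fun z hz => conj_mem_disk hz)
    (h.differentiableOn_coefAt hq) (fun z hz => h.coefAt_mem_volDomain hz hq) _
    (y := fun z i => η z (endFrame e y₀ q i)) hη

theorem Admissible.differentiableOn_volDensity (h : Admissible e s r C) (p : M) :
    DifferentiableOn ℂ (fun lam => volDensity e s r lam p) (disk α) :=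
  (h.isDensityExtension p).1.congr fun _ hlam => h.volDensity_eq hlam p

theorem Admissible.differentiableOn_diff_rho (h : Admissible e s r C) (hq : q ∈ endDomain J r y₀)
    (i : Fin (n + 1)) : DifferentiableOn ℂ
      (fun lam => diff I (rho e s r lam) (endParam e y₀ q) (endFrame e y₀ q i)) (disk α) := by
  refine DifferentiableOn.congr ?_ fun lam hlam => h.diff_rho_endFrame hlam hq i
  refine differentiableOn_fderivWithin_apply (isOpen_disk α) (uniqueDiffOn_endDomain r y₀)
    (endDomain_subset_closure_interior r y₀) (h.contDiffOn_chartRho y₀) (fun q hq => ?_) hq _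
  exact (contDiffOn_volRatio_inv.differentiableOn (by simp)).comp (h.differentiableOn_coefAt hq)
    fun lam hlam => h.coefAt_mem_volDomain hlam hq

theorem Admissible.volDensity_ne_zero (h : Admissible e s r C) (hlam : lam ∈ disk α) (p : M) :
    volDensity e s r lam p ≠ 0 := by
  rw [h.volDensity_eq hlam]; exact h.explicitDensity_ne_zero hlam p

theorem Admissible.conj_rho_mul_volDensity (h : Admissible e s r C) (hlam : lam ∈ disk α) (p : M) :
    conj (rho e s r (conj lam) p) * volDensity e s r lam p = 1 := by
  rw [rho, h.volDensity_eq (conj_mem_disk hlam), h.explicitDensity_conj hlam, map_inv₀,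
    Complex.conj_conj, ← h.volDensity_eq hlam, inv_mul_cancel₀ (h.volDensity_ne_zero hlam p)]

/-- Product rule for ϱv. In the term with dv the conjugate of ϱ cancels the density, leaving the
principal part without weight; the other term contains v undifferentiated and is of lower order. -/
theorem Admissible.formIntegrand_eq (h : Admissible e s r C) (hlam : lam ∈ disk α) (u : M → ℂ)
    {v : M → ℂ} (hv : IsTest I v) (p : M) :
    formIntegrand e s r lam u v p = lamPairing e s r lam p (diff I u p) (diff I v p)
      + conj (v p) * (volDensity e s r lam p
        * lamPairing e s r lam p (diff I u p) (diff I (rho e s r (conj lam)) p)) := by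
  have hd := h.det_gram_ne_zero hlam p
  have h1 := h.conj_rho_mul_volDensity hlam p
  rw [formIntegrand, diff_mul (((h.contMDiff_rho (conj_mem_disk hlam)).mdifferentiableAt (by simp)))
    (hv.mdifferentiableAt p)]
  simp only [lamPairing]
  rw [coInner_add_right _ _ hd, coInner_smul_right _ _ hd, coInner_smul_right _ _ hd]
  linear_combination coInner (pmlField e s r lam) (pmlField e s r (conj lam)) p (diff I u p)
    (diff I v p) * h1

/-- In the undeformed region the integrand does not depend on the parameter. On the end every factor
is holomorphic, including the gradient of ϱ by the exchange of derivatives in z and in space. -/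
theorem Admissible.differentiableOn_formIntegrand (h : Admissible e s r C) {u v : M → ℂ}
    (hv : IsTest I v) (p : M) :
    DifferentiableOn ℂ (fun lam => formIntegrand e s r lam u v p) (disk α) := by
  refine DifferentiableOn.congr ?_ fun lam hlam => h.formIntegrand_eq hlam u hv p
  rcases mem_coreRegion_or (e := e) (r := r) p with hp | hp
  · refine (differentiableOn_const (coInner (ofMetric g) (ofMetric g) p (diff I u p)
      (diff I v p))).congr fun lam hlam => ?_
    rw [h.lamPairing_core lam hp, h.lamPairing_core lam hp, h.diff_rho_core (conj_mem_disk hlam) hp,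
      coInner_ofMetric g p _ 0, map_zero, inner_zero_left, mul_zero, mul_zero, add_zero]
  · obtain ⟨y₀, q, hq, rfl⟩ := exists_endParam_of_mem hp.1 hp.2
    exact (h.differentiableOn_lamPairing hq _ (η := fun _ => diff I v (endParam e y₀ q))
      fun j => differentiableOn_const _).add ((differentiableOn_const _).mul
        ((h.differentiableOn_volDensity _).mul (h.differentiableOn_lamPairing hq _
          (η := fun z => diff I (rho e s r z) (endParam e y₀ q)) (h.differentiableOn_diff_rho hq))))

/-- `diff` in the coordinates of the end is continuous. -/
theorem continuousOn_diff_endFrame (hr : 0 ≤ r) {w : M → ℂ} (hw : ContMDiff I 𝓘(ℝ, ℂ) ∞ w)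
    (i : Fin (n + 1)) : ContinuousOn
      (fun q => diff I w (endParam e y₀ q) (endFrame e y₀ q i)) (endDomain J r y₀) := by
  have h1 : ContDiffOn ℝ ∞ (w ∘ endParam e y₀) (endDomain J r y₀) :=
    contDiffOn_comp_endParam e hr fun q _ => hw _
  refine ContinuousOn.congr ?_ fun q hq => diff_endFrame e hr hq (hw.mdifferentiableAt (by simp)) i
  exact (h1.continuousOn_fderivWithin (uniqueDiffOn_endDomain r y₀) (by simp)).clm_apply
    continuousOn_const

theorem Admissible.continuousOn_coefAt (h : Admissible e s r C) (hlam : lam ∈ disk α) (y₀ : Ω) :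
    ContinuousOn (coefAt e y₀ s r lam) (endDomain J r y₀) := by
  have h1 := (h.contDiffOn_coefAt y₀).continuousOn
  have hm : MapsTo (fun q : ℝ × EuclideanSpace ℝ (Fin n) => (lam, q)) (endDomain J r y₀)
      (disk α ×ˢ endDomain J r y₀) := fun q hq => ⟨hlam, hq⟩
  generalize coefAt e y₀ s r = F at h1 ⊢
  exact ContinuousOn.comp (g := fun t : ℂ × (ℝ × EuclideanSpace ℝ (Fin n)) => F t.1 t.2)
    (f := fun q : ℝ × EuclideanSpace ℝ (Fin n) => (lam, q)) h1
    (continuous_const.prodMk continuous_id).continuousOn hm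

theorem Admissible.continuous_lamPairing (h : Admissible e s r C) (hlam : lam ∈ disk α) {u w : M → ℂ}
    (hu : ContMDiff I 𝓘(ℝ, ℂ) ∞ u) (hw : ContMDiff I 𝓘(ℝ, ℂ) ∞ w) :
    Continuous fun p => lamPairing e s r lam p (diff I u p) (diff I w p) := by
  rw [continuous_iff_continuousAt]
  intro p
  rcases mem_coreRegion_or (e := e) (r := r) p with hp | hp
  · refine (continuous_coInner_ofMetric g hu hw).continuousAt.congr ?_
    filter_upwards [(isOpen_coreRegion e h.pos.le).mem_nhds hp] with p' hp'
      using (h.lamPairing_core lam hp' _ _).symm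
  · refine continuousAt_of_endParam e (a := r) (y₀ := (e.cyl p).2) ?_ (exists_endPatch e hp.1 hp.2)
    refine ContinuousOn.congr ?_ fun q hq => h.lamPairing_endParam hlam hq _ _
    have hc := h.continuousOn_coefAt (conj_mem_disk hlam) (e.cyl p).2
    refine continuousOn_matrixPairing
      (G := fun q => axialScale (coefAt e (e.cyl p).2 s r (conj lam) q).1
        (Matrix.of (coefAt e (e.cyl p).2 s r (conj lam) q).2.1)) ?_ (fun q hq => ?_)
      (continuousOn_diff_endFrame h.pos.le hu) (continuousOn_diff_endFrame h.pos.le hw)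
    · have h1 : Continuous fun t : CoefSpace n => axialScale t.1 (Matrix.of t.2.1) :=
        continuous_axialScale continuous_fst (continuous_fst.comp continuous_snd)
      exact h1.comp_continuousOn hc
    · exact det_axialScale_ne_zero_of_mem_volDomain (h.coefAt_mem_volDomain (conj_mem_disk hlam) hq)

theorem Admissible.continuous_volDensity (h : Admissible e s r C) (hlam : lam ∈ disk α) :
    Continuous (volDensity e s r lam) := by
  have h1 : volDensity e s r lam = fun p => (rho e s r lam p)⁻¹ := by
    funext p; rw [rho, inv_inv]
  rw [h1]
  exact (h.contMDiff_rho hlam).continuous.inv₀ fun p => inv_ne_zero (h.volDensity_ne_zero hlam p)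

theorem Admissible.continuous_formIntegrand (h : Admissible e s r C) (hlam : lam ∈ disk α)
    {u v : M → ℂ} (hu : IsTest I u) (hv : IsTest I v) : Continuous (formIntegrand e s r lam u v) :=
  (h.continuous_lamPairing hlam hu.1 (hv.mul_left (h.contMDiff_rho (conj_mem_disk hlam))).1).mul
    (h.continuous_volDensity hlam)

theorem Admissible.formIntegrand_eq_zero (h : Admissible e s r C) (hlam : lam ∈ disk α) {u : M → ℂ}
    (v : M → ℂ) (hp : p ∉ tsupport u) : formIntegrand e s r lam u v p = 0 := by
  rw [formIntegrand, diff_eq_zero_of_notMem_tsupport hp]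
  have := norm_le_zero_iff.1 ((h.norm_lamPairing_le hlam p 0
    (diff I (fun p => rho e s r (conj lam) p * v p) p)).trans (by
      rw [covNorm_zero, zero_mul, mul_zero]))
  rw [this, zero_mul]

variable [T2Space M] [MeasurableSpace M] [BorelSpace M]

theorem Admissible.integrable_formIntegrand (h : Admissible e s r C) (hlam : lam ∈ disk α)
    {u v : M → ℂ} (hu : IsTest I u) (hv : IsTest I v) :
    Integrable (formIntegrand e s r lam u v) (riemannianVolume g) :=
  integrable_of_zero_off_tsupport g hu (h.continuous_formIntegrand hlam hu hv) fun _ hp =>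
    h.formIntegrand_eq_zero hlam v hp

end Integrand

/-! ### Boundedness, Gårding inequality and holomorphy of the form on test functions -/

section FormEstimates

variable {n : ℕ} {H : Type*} [TopologicalSpace H]
  {I : ModelWithCorners ℝ (EuclideanSpace ℝ (Fin (n + 1))) H}
  {M : Type*} [TopologicalSpace M] [ChartedSpace H M] [IsManifold I ∞ M]
  {H' : Type*} [TopologicalSpace H']
  {J : ModelWithCorners ℝ (EuclideanSpace ℝ (Fin n)) H'}
  {Ω : Type*} [TopologicalSpace Ω] [ChartedSpace H' Ω] [IsManifold J ∞ Ω]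
  {g : Metric I M} {α : ℝ} {e : QuasicylindricalEnd J Ω g α}
  {s : ℝ → ℝ} {r C K : ℝ} {lam : ℂ} {p : M}

/-- Cauchy–Schwarz from the discriminant of the nonnegative polynomial t ↦ ∫(a − tb)². -/
theorem sq_integral_mul_le {X : Type*} [MeasurableSpace X] {μ : Measure X} {a b : X → ℝ}
    (ha : Integrable (fun x => a x ^ 2) μ) (hb : Integrable (fun x => b x ^ 2) μ)
    (hab : Integrable (fun x => a x * b x) μ) :
    (∫ x, a x * b x ∂μ) ^ 2 ≤ (∫ x, a x ^ 2 ∂μ) * ∫ x, b x ^ 2 ∂μ := by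
  have h := discrim_le_zero (a := ∫ x, b x ^ 2 ∂μ) (b := -2 * ∫ x, a x * b x ∂μ)
    (c := ∫ x, a x ^ 2 ∂μ) fun t => by
    have h1 : 0 ≤ ∫ x, (a x - t * b x) ^ 2 ∂μ := integral_nonneg fun x => sq_nonneg _
    have h2 : ∫ x, (a x - t * b x) ^ 2 ∂μ
        = ∫ x, (a x ^ 2 - (2 * t) * (a x * b x)) + t ^ 2 * b x ^ 2 ∂μ :=
      integral_congr_ae (Eventually.of_forall fun x => by ring)
    have h3 : Integrable (fun x => a x ^ 2 - (2 * t) * (a x * b x)) μ := ha.sub (hab.const_mul _)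
    rw [h2, integral_add h3 (hb.const_mul _),
      integral_sub ha (hab.const_mul _), integral_const_mul, integral_const_mul] at h1
    linarith
  rw [discrim] at h
  nlinarith

/-- A majorant of `|du| + |u|`. -/
def jetNorm (g : Metric I M) (u : M → ℂ) (p : M) : ℝ := covNorm g p (diff I u p) + ‖u p‖

theorem continuous_jetNorm (g : Metric I M) {u : M → ℂ} (hu : IsTest I u) :
    Continuous (jetNorm g u) := by
  have h1 : Continuous fun p => covNorm g p (diff I u p) := by
    have h2 := (continuous_covNorm_sq g hu.1).sqrt
    simpa only [Real.sqrt_sq (covNorm_nonneg g _ _)] using h2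
  exact h1.add hu.1.continuous.norm

theorem jetNorm_eq_zero (g : Metric I M) {u : M → ℂ} (hp : p ∉ tsupport u) : jetNorm g u p = 0 := by
  rw [jetNorm, diff_eq_zero_of_notMem_tsupport hp, image_eq_zero_of_notMem_tsupport hp, covNorm_zero,
    norm_zero, add_zero]

theorem Admissible.norm_formIntegrand_le (h : Admissible e s r C)
    (hρ : ∀ lam ∈ disk α, ∀ p, covNorm g p (diff I (rho e s r lam) p) ≤ K) (hlam : lam ∈ disk α)
    (u : M → ℂ) {v : M → ℂ} (hv : IsTest I v) (p : M) :
    ‖formIntegrand e s r lam u v p‖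
      ≤ (C ^ 2 + C * (C ^ 2 * K)) * (jetNorm g u p * jetNorm g v p) := by
  have hC := h.one_le
  have hu0 := covNorm_nonneg g p (diff I u p)
  have hv0 := covNorm_nonneg g p (diff I v p)
  have hu1 : covNorm g p (diff I u p) ≤ jetNorm g u p := by
    rw [jetNorm]; linarith [norm_nonneg (u p)]
  have hv1 : covNorm g p (diff I v p) ≤ jetNorm g v p := by
    rw [jetNorm]; linarith [norm_nonneg (v p)]
  have hv2 : ‖v p‖ ≤ jetNorm g v p := by rw [jetNorm]; linarith
  rw [h.formIntegrand_eq hlam u hv]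
  refine (norm_add_le _ _).trans ?_
  rw [add_mul]
  refine add_le_add ((h.norm_lamPairing_le hlam p _ _).trans ?_) ?_
  · gcongr
    exact hu0.trans hu1
  · rw [norm_mul, norm_mul, Complex.norm_conj]
    calc _ ≤ jetNorm g v p * (C * (C ^ 2 * (jetNorm g u p * K))) := by
          gcongr
          · exact hv0.trans hv1
          · exact h.norm_volDensity_le hlam p
          · refine (h.norm_lamPairing_le hlam p _ _).trans ?_
            gcongr
            · exact covNorm_nonneg g p _
            · exact hu0.trans hu1
            · exact hρ _ (conj_mem_disk hlam) p
      _ = _ := by ring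

/-- Pointwise Gårding inequality: half of the coercive principal part absorbs the term linear in
|du|, at the price of a multiple of |u|². -/
theorem Admissible.le_re_formIntegrand (h : Admissible e s r C)
    (hρ : ∀ lam ∈ disk α, ∀ p, covNorm g p (diff I (rho e s r lam) p) ≤ K) (hlam : lam ∈ disk α)
    {u : M → ℂ} (hu : IsTest I u) (p : M) :
    (C ^ 2)⁻¹ / 2 * covNorm g p (diff I u p) ^ 2
      ≤ (formIntegrand e s r lam u u p).re + C ^ 2 / 2 * (C * (C ^ 2 * K)) ^ 2 * ‖u p‖ ^ 2 := by
  have hC := h.one_le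
  have hC2 : 0 < C ^ 2 := by positivity
  set a := covNorm g p (diff I u p) with ha
  have ha0 : 0 ≤ a := covNorm_nonneg g p _
  rw [h.formIntegrand_eq hlam u hu, Complex.add_re]
  have h1 : (C ^ 2)⁻¹ * a ^ 2 ≤ (lamPairing e s r lam p (diff I u p) (diff I u p)).re := by
    rw [inv_mul_le_iff₀ hC2]
    exact h.covNorm_sq_le hlam p _
  have h2 : ‖conj (u p) * (volDensity e s r lam p
        * lamPairing e s r lam p (diff I u p) (diff I (rho e s r (conj lam)) p))‖
      ≤ (C * (C ^ 2 * K)) * (a * ‖u p‖) := by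
    rw [norm_mul, norm_mul, Complex.norm_conj]
    calc _ ≤ ‖u p‖ * (C * (C ^ 2 * (a * K))) := by
          gcongr
          · exact h.norm_volDensity_le hlam p
          · refine (h.norm_lamPairing_le hlam p _ _).trans ?_
            gcongr
            exact hρ _ (conj_mem_disk hlam) p
      _ = _ := by ring
  have h3 := (abs_le.1 ((Complex.abs_re_le_norm _).trans h2)).1
  set B := C * (C ^ 2 * K)
  -- Young's inequality, weighted so that exactly half of (C²)⁻¹a² is used up.
  have h4 : B * (a * ‖u p‖) ≤ (C ^ 2)⁻¹ / 2 * a ^ 2 + C ^ 2 / 2 * B ^ 2 * ‖u p‖ ^ 2 := by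
    have h5 : 0 ≤ (C ^ 2)⁻¹ / 2 * (a - C ^ 2 * B * ‖u p‖) ^ 2 := by positivity
    have h6 : (C ^ 2)⁻¹ / 2 * (a - C ^ 2 * B * ‖u p‖) ^ 2
        = (C ^ 2)⁻¹ / 2 * a ^ 2 - B * (a * ‖u p‖) + C ^ 2 / 2 * B ^ 2 * ‖u p‖ ^ 2 := by
      field_simp
      ring
    linarith
  linarith

variable [T2Space M] [MeasurableSpace M] [BorelSpace M]

theorem integrable_jetNorm_mul (g : Metric I M) {u v : M → ℂ} (hu : IsTest I u) (hv : IsTest I v) :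
    Integrable (fun p => jetNorm g u p * jetNorm g v p) (riemannianVolume g) :=
  ((continuous_jetNorm g hu).mul (continuous_jetNorm g hv)).integrable_of_hasCompactSupport
    (HasCompactSupport.intro hu.2 fun p hp => by
      rw [Pi.mul_apply, jetNorm_eq_zero g hp, zero_mul])

theorem integral_jetNorm_sq_le {g : Metric I M} (u : TestFun g) :
    ∫ p, jetNorm g u.fn p ^ 2 ∂riemannianVolume g ≤ 2 * ‖u‖ ^ 2 := by
  have h1 := integrable_covNorm_sq g u.isTest
  have h2 : Integrable (fun p => ‖u.fn p‖ ^ 2) (riemannianVolume g) :=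
    (u.isTest.memLp g).integrable_norm_pow (by norm_num)
  rw [u.norm_sq, ← integral_add h1 h2, ← integral_const_mul]
  refine integral_mono ?_ ((h1.add h2).const_mul 2) fun p => ?_
  · simpa only [sq] using integrable_jetNorm_mul g u.isTest u.isTest
  · simp only [jetNorm]
    nlinarith [sq_nonneg (covNorm g p (diff I u.fn p) - ‖u.fn p‖)]

theorem integral_jetNorm_mul_le {g : Metric I M} (u v : TestFun g) :
    ∫ p, jetNorm g u.fn p * jetNorm g v.fn p ∂riemannianVolume g ≤ 2 * ‖u‖ * ‖v‖ := by
  have hu : Integrable (fun p => jetNorm g u.fn p ^ 2) (riemannianVolume g) := by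
    simpa only [sq] using integrable_jetNorm_mul g u.isTest u.isTest
  have hv : Integrable (fun p => jetNorm g v.fn p ^ 2) (riemannianVolume g) := by
    simpa only [sq] using integrable_jetNorm_mul g v.isTest v.isTest
  refine le_of_sq_le_sq ?_ (by positivity)
  refine (sq_integral_mul_le hu hv (integrable_jetNorm_mul g u.isTest v.isTest)).trans ?_
  calc _ ≤ (2 * ‖u‖ ^ 2) * (2 * ‖v‖ ^ 2) :=
        mul_le_mul (integral_jetNorm_sq_le u) (integral_jetNorm_sq_le v)
          (integral_nonneg fun p => sq_nonneg _) (by positivity)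
    _ = _ := by ring

theorem Admissible.norm_pmlForm_le (h : Admissible e s r C) (hK : 0 ≤ K)
    (hρ : ∀ lam ∈ disk α, ∀ p, covNorm g p (diff I (rho e s r lam) p) ≤ K) (hlam : lam ∈ disk α)
    (u v : TestFun g) :
    ‖pmlForm e s r lam u.fn v.fn‖ ≤ (C ^ 2 + C * (C ^ 2 * K)) * 2 * ‖u‖ * ‖v‖ := by
  have hC := h.one_le
  rw [pmlForm_eq]
  refine (norm_integral_le_of_norm_le ((integrable_jetNorm_mul g u.isTest v.isTest).const_mul _)
    (Eventually.of_forall (h.norm_formIntegrand_le hρ hlam u.fn v.isTest))).trans ?_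
  rw [integral_const_mul, mul_assoc, mul_assoc, ← mul_assoc 2]
  exact mul_le_mul_of_nonneg_left (integral_jetNorm_mul_le u v) (by positivity)

/-- Integral of the pointwise inequality. The extra summand (C²)⁻¹/2 accounts for the L² part
contained in ‖u‖². -/
theorem Admissible.le_re_pmlForm (h : Admissible e s r C)
    (hρ : ∀ lam ∈ disk α, ∀ p, covNorm g p (diff I (rho e s r lam) p) ≤ K) (hlam : lam ∈ disk α)
    (u : TestFun g) :
    (C ^ 2)⁻¹ / 2 * ‖u‖ ^ 2 ≤ (pmlForm e s r lam u.fn u.fn).re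
      + (C ^ 2 / 2 * (C * (C ^ 2 * K)) ^ 2 + (C ^ 2)⁻¹ / 2) * ‖toL2 g u‖ ^ 2 := by
  have h1 := integrable_covNorm_sq g u.isTest
  have h2 : Integrable (fun p => ‖u.fn p‖ ^ 2) (riemannianVolume g) :=
    (u.isTest.memLp g).integrable_norm_pow (by norm_num)
  have h3 := h.integrable_formIntegrand hlam u.isTest u.isTest
  have h4 := integral_mono (h1.const_mul ((C ^ 2)⁻¹ / 2)) (h3.re.add
    (h2.const_mul (C ^ 2 / 2 * (C * (C ^ 2 * K)) ^ 2))) fun p => h.le_re_formIntegrand hρ hlam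
      u.isTest p
  have h5 : ∫ p, (formIntegrand e s r lam u.fn u.fn p).re ∂riemannianVolume g
      = (pmlForm e s r lam u.fn u.fn).re := integral_re h3
  have h6 := integral_add h3.re (h2.const_mul (C ^ 2 / 2 * (C * (C ^ 2 * K)) ^ 2))
  rw [integral_const_mul] at h4 h6
  change _ ≤ ∫ p, RCLike.re (formIntegrand e s r lam u.fn u.fn p)
    + C ^ 2 / 2 * (C * (C ^ 2 * K)) ^ 2 * ‖u.fn p‖ ^ 2 ∂riemannianVolume g at h4
  rw [h6] at h4
  change _ ≤ ∫ p, (formIntegrand e s r lam u.fn u.fn p).re ∂riemannianVolume g + _ at h4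
  rw [h5] at h4
  rw [u.norm_sq, norm_toL2_sq]
  linarith

theorem Admissible.differentiableOn_pmlForm (h : Admissible e s r C)
    (hρ : ∀ lam ∈ disk α, ∀ p, covNorm g p (diff I (rho e s r lam) p) ≤ K) (u v : TestFun g) :
    DifferentiableOn ℂ (fun lam => pmlForm e s r lam u.fn v.fn) (disk α) :=
  differentiableOn_integral_of_bounded (isOpen_disk α)
    ((integrable_jetNorm_mul g u.isTest v.isTest).const_mul _)
    (fun _ hlam => (h.integrable_formIntegrand hlam u.isTest v.isTest).aestronglyMeasurable)
    (fun _ hlam p => h.norm_formIntegrand_le hρ hlam u.fn v.isTest p)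
    fun p => h.differentiableOn_formIntegrand v.isTest p

/-- The form on test functions as a sesquilinear map. -/
def Admissible.sesqForm (h : Admissible e s r C) (hlam : lam ∈ disk α) :
    TestFun g →ₗ[ℂ] TestFun g →ₗ⋆[ℂ] ℂ :=
  LinearMap.mk₂'ₛₗ (RingHom.id ℂ) (starRingEnd ℂ) (fun u v => pmlForm e s r lam u.fn v.fn)
    (fun u u' v => by
      rw [pmlForm_eq, pmlForm_eq, pmlForm_eq,
        ← integral_add (h.integrable_formIntegrand hlam u.isTest v.isTest)
          (h.integrable_formIntegrand hlam u'.isTest v.isTest)]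
      refine integral_congr_ae (Eventually.of_forall fun p => ?_)
      simp only [formIntegrand, TestFun.fn_add, lamPairing]
      rw [diff_add (u.isTest.mdifferentiableAt p) (u'.isTest.mdifferentiableAt p),
        coInner_add_left _ _ (h.det_gram_ne_zero hlam p), add_mul])
    (fun c u v => by
      rw [pmlForm_eq, pmlForm_eq, RingHom.id_apply, smul_eq_mul, ← integral_const_mul]
      refine integral_congr_ae (Eventually.of_forall fun p => ?_)
      simp only [formIntegrand, TestFun.fn_smul, lamPairing]
      rw [diff_smul (u.isTest.mdifferentiableAt p),
        coInner_smul_left _ _ (h.det_gram_ne_zero hlam p), mul_assoc])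
    (fun u v v' => by
      rw [pmlForm_eq, pmlForm_eq, pmlForm_eq,
        ← integral_add (h.integrable_formIntegrand hlam u.isTest v.isTest)
          (h.integrable_formIntegrand hlam u.isTest v'.isTest)]
      refine integral_congr_ae (Eventually.of_forall fun p => ?_)
      simp only
      rw [h.formIntegrand_eq hlam _ (v + v').isTest, h.formIntegrand_eq hlam _ v.isTest,
        h.formIntegrand_eq hlam _ v'.isTest]
      simp only [TestFun.fn_add, lamPairing, Pi.add_apply, map_add]
      rw [diff_add (v.isTest.mdifferentiableAt p) (v'.isTest.mdifferentiableAt p),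
        coInner_add_right _ _ (h.det_gram_ne_zero hlam p)]
      ring)
    fun c u v => by
      rw [pmlForm_eq, pmlForm_eq, smul_eq_mul, ← integral_const_mul]
      refine integral_congr_ae (Eventually.of_forall fun p => ?_)
      simp only
      rw [h.formIntegrand_eq hlam _ (c • v).isTest, h.formIntegrand_eq hlam _ v.isTest]
      simp only [TestFun.fn_smul, lamPairing, Pi.smul_apply, smul_eq_mul, map_mul]
      rw [diff_smul (v.isTest.mdifferentiableAt p),
        coInner_smul_right _ _ (h.det_gram_ne_zero hlam p)]
      ring

end FormEstimates

end

end PML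

theorem lemma1 {n : ℕ}
    {H : Type*} [TopologicalSpace H]
    (I : ModelWithCorners ℝ (EuclideanSpace ℝ (Fin (n + 1))) H)
    {M : Type*} [TopologicalSpace M] [T2Space M] [SecondCountableTopology M] [ConnectedSpace M]
    [ChartedSpace H M] [IsManifold I ∞ M] [MeasurableSpace M] [BorelSpace M]
    {H' : Type*} [TopologicalSpace H']
    (J : ModelWithCorners ℝ (EuclideanSpace ℝ (Fin n)) H')
    {Ω : Type*} [TopologicalSpace Ω] [T2Space Ω] [CompactSpace Ω]
    [ChartedSpace H' Ω] [IsManifold J ∞ Ω]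
    (g : PML.Metric I M) (α : ℝ) (e : QuasicylindricalEnd J Ω g α) :
    ∃ r₀ : ℝ, 0 < r₀ ∧ ∀ s : ℝ → ℝ, IsScaling s → ∀ r : ℝ, r₀ ≤ r →
      -- the objects entering the form are well defined
      (∀ lam ∈ disk α, ∀ p : M, (gram (pmlField e s r lam) p).det ≠ 0) ∧
      (∀ p : M, ∃ f, IsDensityExtension e s r p f) ∧
      (∀ lam ∈ disk α, (∀ p : M, volDensity e s r lam p ≠ 0) ∧
        ContMDiff I 𝓘(ℝ, ℂ) ∞ (rho e s r lam)) ∧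
      -- the forms in `L²(M)` with the dense domain `H¹(M)`
      ∃ D : Submodule ℂ (L2 g), (D : Set (L2 g)) = H1 g ∧ Dense (D : Set (L2 g)) ∧
      ∃ q : ℂ → (D →ₗ[ℂ] D →ₗ⋆[ℂ] ℂ),
        -- `q lam` is the continuous extension of the form given on `C_c^∞(M)`
        (∀ lam ∈ disk α, ∀ (f h : D) (u v : ℕ → M → ℂ),
          H1Approx g u (f : L2 g) → H1Approx g v (h : L2 g) →
          Tendsto (fun k => pmlForm e s r lam (u k) (v k)) atTop (𝓝 (q lam f h))) ∧
        (∀ lam ∈ disk α, FormClosed (q lam)) ∧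
        (∀ f : D, AnalyticOnNhd ℂ (fun lam => q lam f f) (disk α)) ∧
        -- a sector independent of `lam`, and the operators
        ∃ c ϑ : ℝ, 0 < c ∧ 0 ≤ ϑ ∧ ϑ < Real.pi / 2 ∧
          (∀ lam ∈ disk α, FormSectorial (q lam) c ϑ) ∧
          ∃ A : ℂ → (L2 g →ₗ.[ℂ] L2 g),
            (∀ lam ∈ disk α, MSectorial (A lam) c ϑ ∧ Represents (A lam) (q lam) ∧
              ∀ B : L2 g →ₗ.[ℂ] L2 g, IsMSectorial B → Represents B (q lam) → B = A lam) ∧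
            AnalyticOperatorFamily (disk α) A := by
  -- r₀ and C are fixed before the scaling function is given.
  obtain ⟨r₀, C, hr₀, hC, hbd⟩ := exists_uniform_coefBounds e
  refine ⟨r₀, hr₀, fun s hs r hr => ?_⟩
  have h : Admissible e s r C := ⟨hs, hr₀.trans_le hr, hC, hbd s hs r hr⟩
  refine ⟨fun lam hlam p => h.det_gram_ne_zero hlam p, fun p => ⟨_, h.isDensityExtension p⟩,
    fun lam hlam => ⟨h.volDensity_ne_zero hlam, h.contMDiff_rho hlam⟩, ?_⟩
  obtain ⟨K, hK, hρ⟩ := h.exists_covNorm_diff_rho_le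
  classical
  -- Sesquilinearity is known only for parameters in the disk; the value 0 elsewhere is irrelevant.
  let Q : ℂ → TestFun g →ₗ[ℂ] TestFun g →ₗ⋆[ℂ] ℂ := fun lam =>
    if hlam : lam ∈ disk α then h.sesqForm hlam else 0
  have hQ : ∀ lam ∈ disk α, ∀ u v, Q lam u v = pmlForm e s r lam u.fn v.fn := fun lam hlam u v => by
    simp only [Q, dif_pos hlam]
    rfl
  obtain ⟨D, hD, hDd, q, hq, hrest⟩ := exists_analytic_family_of_forms (toL2 g) (denseRange_toL2 g)
    (toL2_closable g) (isOpen_disk α) Q (C := (C ^ 2 + C * (C ^ 2 * K)) * 2) (δ := (C ^ 2)⁻¹ / 2)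
    (K := C ^ 2 / 2 * (C * (C ^ 2 * K)) ^ 2 + (C ^ 2)⁻¹ / 2) (by positivity) (by positivity)
    (by positivity) (fun lam hlam u v =>
      (congrArg norm (hQ lam hlam u v)).le.trans (h.norm_pmlForm_le hK hρ hlam u v))
    (fun lam hlam u => (h.le_re_pmlForm hρ hlam u).trans_eq
      (congrArg (· + _) (congrArg Complex.re (hQ lam hlam u u)).symm))
    (fun u v => (h.differentiableOn_pmlForm hρ u v).congr fun lam hlam => hQ lam hlam u v)
  refine ⟨D, ?_, hDd, q, fun lam hlam f k u v hu hv => ?_, hrest⟩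
  · ext f
    rw [SetLike.mem_coe, hD]
    constructor
    · rintro ⟨u, hu, huf⟩
      exact ⟨_, h1Approx_iff.2 ⟨hu, huf⟩⟩
    · rintro ⟨u, hu⟩
      obtain ⟨w, -, hw⟩ := hu.exists_testFun
      exact ⟨w, hw⟩
  · obtain ⟨u', hu', hu⟩ := hu.exists_testFun
    obtain ⟨v', hv', hv⟩ := hv.exists_testFun
    refine (hq lam hlam f k u' v' hu.1 hu.2 hv.1 hv.2).congr fun k => ?_
    rw [← hu', ← hv']
    exact hQ lam hlam _ _
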